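/- Fix a dimension $d\ge 1$. For $T>0$ we consider functions $u$ on $[0,T]\times\mathbb R^d$ and, more generally, weakly measurable families $u=(u(t))_{t\in[0,T]}$ of tempered distributions on $\mathbb R^d$. **Notation.** Let $\phi$ be a smooth real function on $\mathbb R^d$ with $\phi(\xi)=1$ for $|\xi|\le 1$ and $\phi(\xi)=0$ for $|\xi|\ge 2$, and let $1=\sum_{j\ge 0}S_j$ be the inhomogeneous Littlewood–Paley decomposition in the space variable: $S_0$ is the Fourier multiplier with symbol $\phi(\xi)$, and $S_j$, $j\ge1$, the one with symbol $\phi(2^{-j}\xi)-\phi(2^{-(j-1)}\xi)$; put $S_{\le N}=\sum_{j\le N}S_j$. For $j\ge 0$ let $\mathcal Q_j$ be the partition of $\mathbb R^d$ into the cubes $Q=2^j(k+[0,1)^d)$, $k\in\mathbb Z^d$, and let $\chi_Q(x)=\chi(2^{-j}x-k)$ be the associated partition of unity, where $\chi\ge0$ is smooth and compactly supported with $\sum_{k\in\mathbb Z^d}\chi(x-k)=1$. Set $$\|f\|_X=\sup_{l\ge 0}\ \sup_{Q\in\mathcal Q_l}2^{-l/2}\|f\|_{L^2([0,T]\times Q)},\qquad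 \|f\|_{X_j}=2^{j/2}\|f\|_X+\|f\|_{L^\infty([0,T];L^2(\mathbb R^d))},$$ $$\|f\|_{l^1_jX_j}=\sum_{Q\in\mathcal Q_j}\|\chi_Qf\|_{X_j},\qquad \|u\|_{l^1X^s}^2=\sum_{j\ge0}2^{2js}\|S_ju\|_{l^1_jX_j}^2 ,$$ and let $l^1X^s$ be the space of those $u$ with $\|u\|_{l^1X^s}<\infty$; for $s<0$ its elements may be distributions in $x$. The product $uv$ is the limit, in the sense of distributions in $x$ for almost every $t$, of $S_{\le N}u\,S_{\le N}v$ as $N\to\infty$; it is the pointwise product when $u$ and $v$ are functions that are square integrable in $x$ for almost every $t$. Finally $\|u\|_{L^\infty}$ is the norm of $L^\infty([0,T]\times\mathbb R^d)$. **Proposition.** Let $s>\frac d2$. a) For every $\sigma\ge d-s$ there is a constant $C$ such that for all $T>0$ and all complex valued $u,v\in l^1X^s\cap l^1X^\sigma$ the product $uv$ exists and $$\|uv\|_{l^1X^\sigma}\le C\big(\|u\|_{l^1X^\sigma}\|v\|_{l^1X^s}+\|u\|_{l^1X^s}\|v\|_{l^1X^\sigma}\big).$$ If $d-s\le\sigma\le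 s$, there is a constant $C$ such that for all $T>0$, all complex valued $u\in l^1X^\sigma$ and $v\in l^1X^s$ the product $uv$ exists and $$\|uv\|_{l^1X^\sigma}\le C\,\|u\|_{l^1X^\sigma}\|v\|_{l^1X^s}.$$ b) Let $F:\mathbb C^m\to\mathbb C^n$ be smooth (in the real sense, so that $F$ may depend on both $u$ and $\bar u$), with $F$ and all its derivatives of order one and two vanishing at $0$. For every $\sigma\ge d-s$ there is a nondecreasing function $c:[0,\infty)\to[0,\infty)$ such that for all $T>0$ and all $\mathbb C^m$ valued $u\in l^1X^s\cap l^1X^\sigma$ $$\|F(u)\|_{l^1X^\sigma}\le \|u\|_{l^1X^\sigma}\|u\|_{l^1X^s}^2\,c(\|u\|_{L^\infty}).$$ If $d-s\le\sigma\le s$, there is a function $c:[0,\infty)^2\to[0,\infty)$, nondecreasing in each variable, such that for all $T>0$ and all $\mathbb C^m$ valued $u,v\in l^1X^s$ $$\|F(u)-F(v)\|_{l^1X^\sigma}\le\|u-v\|_{l^1X^\sigma}\big(\|u\|_{l^1X^s}+\|v\|_{l^1X^s}\big)^2\,c(\|u\|_{L^\infty},\|v\|_{L^\infty}).$$ The constants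 $C$ and the functions $c$ do not depend on $T$, $u$, $v$. -/

import Mathlib

open MeasureTheory Filter Topology
open scoped ENNReal NNReal SchwartzMap ContDiff FourierTransform

noncomputable section

namespace L1X

/-- `ℝ^d` with its Euclidean structure. -/
abbrev Space (d : ℕ) : Type := EuclideanSpace ℝ (Fin d)

/-! ### The spatial Littlewood–Paley decomposition -/

/-- The profile `φ` of an inhomogeneous Littlewood–Paley decomposition: a smooth function which is
`1` on the unit ball and vanishes outside the ball of radius `2`. -/
structure LPCutoff (d : ℕ) where
  toFun : Space d → ℝ
  smooth : ContDiff ℝ ∞ toFun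
  eq_one : ∀ ξ, ‖ξ‖ ≤ 1 → toFun ξ = 1
  eq_zero : ∀ ξ, 2 ≤ ‖ξ‖ → toFun ξ = 0

namespace LPCutoff

variable {d : ℕ}

/-- `ξ ↦ φ(2^{-j} ξ)`, the symbol of `S_{≤ j}`. -/
def lowSymbolFun (φ : LPCutoff d) (j : ℕ) (ξ : Space d) : ℂ :=
  ((φ.toFun (((2 : ℝ) ^ j)⁻¹ • ξ) : ℝ) : ℂ)

theorem hasCompactSupport_lowSymbolFun (φ : LPCutoff d) (j : ℕ) :
    HasCompactSupport (φ.lowSymbolFun j) := by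
  have hφ : HasCompactSupport φ.toFun := by
    refine HasCompactSupport.of_support_subset_isCompact
      (isCompact_closedBall (0 : Space d) 2) ?_
    intro ξ hξ
    by_contra h
    apply hξ
    apply φ.eq_zero
    simp only [Metric.mem_closedBall, dist_zero_right, not_le] at h
    exact h.le
  have h1 : HasCompactSupport fun ξ : Space d => φ.toFun (((2 : ℝ) ^ j)⁻¹ • ξ) :=
    hφ.comp_smul (by positivity)
  exact h1.comp_left (g := fun r : ℝ => (r : ℂ)) Complex.ofReal_zero

theorem contDiff_lowSymbolFun (φ : LPCutoff d) (j : ℕ) :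
    ContDiff ℝ ∞ (φ.lowSymbolFun j) :=
  Complex.ofRealCLM.contDiff.comp (φ.smooth.comp (contDiff_const_smul _))

/-- The symbol of `S_{≤ j}` as a Schwartz function. -/
def lowSymbol (φ : LPCutoff d) (j : ℕ) : 𝓢(Space d, ℂ) :=
  (φ.hasCompactSupport_lowSymbolFun j).toSchwartzMap (φ.contDiff_lowSymbolFun j)

/-- The symbol of `S_j`: `φ(ξ)` for `j = 0`, and `φ(2^{-j} ξ) - φ(2^{-(j-1)} ξ)` for `j ≥ 1`. -/
def symbol (φ : LPCutoff d) : ℕ → 𝓢(Space d, ℂ)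
  | 0 => φ.lowSymbol 0
  | j + 1 => φ.lowSymbol (j + 1) - φ.lowSymbol j

/-- The test function `y ↦ K_j(x - y)`, where `K_j` is the convolution kernel of `S_j`, i.e. the
inverse Fourier transform of its symbol (see `kernelAt_apply`). -/
def kernelAt (φ : LPCutoff d) (j : ℕ) (x : Space d) : 𝓢(Space d, ℂ) :=
  (𝓕 (φ.symbol j)).compSubConstCLM ℂ x

theorem kernelAt_apply (φ : LPCutoff d) (j : ℕ) (x y : Space d) :
    φ.kernelAt j x y = (𝓕⁻ (φ.symbol j)) (x - y) := by
  simp [kernelAt, SchwartzMap.fourier_coe, SchwartzMap.fourierInv_coe,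
    Real.fourierInv_eq_fourier_neg]

/-- The Littlewood–Paley piece `S_j u = K_j * u` of a tempered distribution, which is a (smooth)
function. -/
def piece (φ : LPCutoff d) {E : Type*} [NormedAddCommGroup E] [NormedSpace ℂ E]
    (j : ℕ) (u : 𝓢'(Space d, E)) (x : Space d) : E :=
  u (φ.kernelAt j x)

/-- `S_{≤ N} u = ∑_{j ≤ N} S_j u`. -/
def lowPiece (φ : LPCutoff d) {E : Type*} [NormedAddCommGroup E] [NormedSpace ℂ E]
    (N : ℕ) (u : 𝓢'(Space d, E)) (x : Space d) : E :=
  ∑ j ∈ Finset.range (N + 1), φ.piece j u x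

end LPCutoff

/-! ### Dyadic cubes and the associated smooth partitions of unity -/

/-- The profile of the smooth partitions of unity: a smooth, compactly supported, nonnegative
function on `ℝ^d` whose integer translates sum to `1`. -/
structure CubeCutoff (d : ℕ) where
  toFun : Space d → ℝ
  smooth : ContDiff ℝ ∞ toFun
  hasCompactSupport : HasCompactSupport toFun
  nonneg : ∀ x, 0 ≤ toFun x
  sum_eq_one : ∀ x, ∑' k : Fin d → ℤ, toFun (x - WithLp.toLp 2 (fun i => (k i : ℝ))) = 1

/-- The cutoff `χ_Q`, where `Q = 2^j (k + [0,1)^d)`. -/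
def CubeCutoff.bump {d : ℕ} (χ : CubeCutoff d) (j : ℕ) (k : Fin d → ℤ) (x : Space d) : ℝ :=
  χ.toFun (((2 : ℝ) ^ j)⁻¹ • x - WithLp.toLp 2 (fun i => (k i : ℝ)))

/-- The cube `2^l (k + [0,1)^d)` of side length `2^l`. -/
def cube {d : ℕ} (l : ℕ) (k : Fin d → ℤ) : Set (Space d) :=
  {x | ∀ i, (2 : ℝ) ^ l * k i ≤ x i ∧ x i < (2 : ℝ) ^ l * (k i + 1)}

/-! ### The space-time norms on `[0,T] × ℝ^d` -/

/-- Lebesgue measure on the time interval `[0,T]`. -/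
abbrev timeMeasure (T : ℝ) : Measure ℝ := volume.restrict (Set.Icc 0 T)

section Norms

variable {d : ℕ} {E : Type*} [NormedAddCommGroup E]

/-- The local energy norm
`‖f‖_X = sup_{l ≥ 0} sup_{Q ∈ 𝒬_l} 2^{-l/2} ‖f‖_{L²([0,T] × Q)}`. -/
def normX (T : ℝ) (f : ℝ → Space d → E) : ℝ≥0∞ :=
  ⨆ (l : ℕ) (k : Fin d → ℤ), (2 : ℝ≥0∞) ^ (-(l : ℝ) / 2) *
    eLpNorm (Function.uncurry f) 2 ((timeMeasure T).prod (volume.restrict (cube l k)))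

/-- The norm of `L^∞([0,T]; L²(ℝ^d))`. -/
def normLinftyL2 (T : ℝ) (f : ℝ → Space d → E) : ℝ≥0∞ :=
  essSup (fun t => eLpNorm (f t) 2 volume) (timeMeasure T)

/-- The norm of `X_j = 2^{-j/2} X ∩ L^∞ L²`. -/
def normXj (T : ℝ) (j : ℕ) (f : ℝ → Space d → E) : ℝ≥0∞ :=
  (2 : ℝ≥0∞) ^ ((j : ℝ) / 2) * normX T f + normLinftyL2 T f

/-- The norm of `l^1_j X_j`: `∑_{Q ∈ 𝒬_j} ‖χ_Q f‖_{X_j}`. -/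
def normL1Xj [NormedSpace ℝ E] (χ : CubeCutoff d) (T : ℝ) (j : ℕ) (f : ℝ → Space d → E) : ℝ≥0∞ :=
  ∑' k : Fin d → ℤ, normXj T j (fun t x => χ.bump j k x • f t x)

/-- The norm of `L^∞([0,T] × ℝ^d)`. -/
def normSup (T : ℝ) (f : ℝ → Space d → E) : ℝ≥0∞ :=
  eLpNorm (Function.uncurry f) ⊤ ((timeMeasure T).prod volume)

end Norms

section Spaces

variable {d : ℕ} {E : Type*} [NormedAddCommGroup E] [NormedSpace ℂ E]

/-- The norm of `l^1 X^s`: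
`‖u‖² = ∑_j 2^{2js} ‖S_j u‖²_{l^1_j X_j}`, for a time dependent tempered distribution `u`. -/
def normL1X (φ : LPCutoff d) (χ : CubeCutoff d) (T s : ℝ) (u : ℝ → 𝓢'(Space d, E)) : ℝ≥0∞ :=
  (∑' j : ℕ, (2 : ℝ≥0∞) ^ (2 * (j : ℝ) * s) *
    normL1Xj χ T j (fun t x => φ.piece j (u t) x) ^ 2) ^ (1 / 2 : ℝ)

/-- `u ∈ l^1 X^s` on the time interval `[0,T]`: `u` is a (weakly) measurable family of tempered
distributions with finite norm. For negative `s` the elements need not be functions. -/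
structure MemL1X (φ : LPCutoff d) (χ : CubeCutoff d) (T s : ℝ) (u : ℝ → 𝓢'(Space d, E)) :
    Prop where
  measurable : ∀ θ : 𝓢(Space d, ℂ), AEStronglyMeasurable (fun t => u t θ) (timeMeasure T)
  norm_lt_top : normL1X φ χ T s u < ⊤

/-- The time dependent distribution `U` is given on `[0,T]` by the measurable function `u`. -/
structure IsGivenBy (T : ℝ) (U : ℝ → 𝓢'(Space d, E)) (u : ℝ → Space d → E) : Prop where
  measurable : AEStronglyMeasurable (Function.uncurry u) ((timeMeasure T).prod volume)
  eq_integral : ∀ᵐ t ∂(timeMeasure T), ∀ θ : 𝓢(Space d, ℂ),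
    Integrable (fun x => θ x • u t x) ∧ U t θ = ∫ x, θ x • u t x

end Spaces

/-- `W` is the product `U V` on `[0,T]`: for almost every `t`, `W(t)` is the limit in the sense of
distributions of the products of smooth functions `S_{≤ N} U(t) · S_{≤ N} V(t)`; and when `U` and
`V` are given by functions that are square integrable in space, `W` is given by their pointwise
product. -/
structure IsProduct {d : ℕ} (φ : LPCutoff d) (T : ℝ) (U V W : ℝ → 𝓢'(Space d, ℂ)) : Prop where
  tendsto : ∀ᵐ t ∂(timeMeasure T), ∀ θ : 𝓢(Space d, ℂ),
    Tendsto (fun N : ℕ => ∫ x, θ x * (φ.lowPiece N (U t) x * φ.lowPiece N (V t) x))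
      atTop (𝓝 (W t θ))
  pointwise : ∀ u v : ℝ → Space d → ℂ, IsGivenBy T U u → IsGivenBy T V v →
    (∀ᵐ t ∂(timeMeasure T), MemLp (u t) 2 volume) →
    (∀ᵐ t ∂(timeMeasure T), MemLp (v t) 2 volume) →
    IsGivenBy T W (fun t x => u t x * v t x)

end L1X

end

/-! Every norm involved depends only on |f|, so the analysis takes place on functions with values in
[0,∞]: `eX`, `eI`, `eN`, `eY` are the norms of X, L^∞L², X_j and l¹_jX_j, with sharp instead of
smooth cutoffs to cubes (`exists_normL1Xj_comparison`). A Littlewood–Paley piece reproduces itself,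
|S_j u| ≤ C w_j * |S_j u| with w_j = `wt j` an integrable kernel of scale 2^(-j) ≤ 1. Convolution
with integrable kernels respects sums over cubes (`IsConvNorm.cubeSum_conv_le`), and the kernels w_j
give Bernstein's inequalities L¹ → L² and L² → L^∞ cube by cube, each at the price 2^(jd/2).

Products. The product is Σ S_i u S_j v, and S_k sees the pair (i, j) only if k is close to the
larger index, or if i and j are close and k is not much larger (`Compat.cases`). For i ≤ j ≈ k the
low factor is put in L^∞ and carries the sum over cubes; the cost 2^(id/2) is beaten by s > d/2. For
i ≈ j ≳ k, Bernstein at scale 2^(-k) costs 2^(kd/2), and refining cubes of side 2^i to cubes of side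
2^k costs 2^((i-k)d). With the weight 2^(kσ) the total is at most a constant times 2^(i(σ+s))
2^(-k(s-d/2)) because σ + s ≥ d. Schur's test sums the interactions (`exists_wl2_product_le`). At
almost every time the double series defines a distribution (`exists_product_at`): far from the
diagonal only the high frequencies of the test function contribute, near it L² times L² and σ + s ≥
0 suffice.

Nonlinear functions. As in Meyer's argument, G(u) is the telescoping sum of G(a + b) - G(a), where a
is the sum of S_i u over i < j and b = S_j u. If G and G' vanish at 0, Hadamard's lemma applied
twice writes the increment as K(a,b)(a,b)b. Its derivatives of order n cost 2^(jn) with constants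
depending on ‖u‖_∞ only, so its frequencies 2^k > 2^j decay like 2^(-(k-j)n). This gives ‖G(u)‖_σ ≤
C ‖u‖_s ‖u‖_σ for σ ≥ s (`exists_normL1X_comp_le`).

The remaining range of σ is reached through the product estimates: F(u) - F(v) is a sum of
components of u - v, or their conjugates, times coefficients `diffCoeff` of (u, v). These vanish at
0 together with their first derivatives because F' and F'' do, so the previous bound places them in
l¹X^max(σ,s), quadratically in (u, v), and the bilinear estimates conclude
(`exists_normL1X_difference_le`). The Moser estimate is the case v = 0. -/

noncomputable section

namespace L1X

/-! ### Convolution, dyadic cubes and norms of nonnegative space-time functions -/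

section

/-! ### The `L²` functional for `ℝ≥0∞`-valued functions -/

section LTwo

variable {α : Type*} {mα : MeasurableSpace α} {μ : Measure α}

/-- The `L²` norm of an `ℝ≥0∞`-valued function. -/
def l2 (μ : Measure α) (h : α → ℝ≥0∞) : ℝ≥0∞ := (∫⁻ a, h a ^ 2 ∂μ) ^ (1 / 2 : ℝ)

theorem l2_sq (μ : Measure α) (h : α → ℝ≥0∞) : l2 μ h ^ 2 = ∫⁻ a, h a ^ 2 ∂μ := by
  rw [l2, ← ENNReal.rpow_natCast, ← ENNReal.rpow_mul]; norm_num

theorem pow_two_le_pow_two_iff {a b : ℝ≥0∞} : a ^ 2 ≤ b ^ 2 ↔ a ≤ b :=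
  ENNReal.pow_le_pow_left_iff two_ne_zero

theorem l2_le_iff {h : α → ℝ≥0∞} {c : ℝ≥0∞} : l2 μ h ≤ c ↔ ∫⁻ a, h a ^ 2 ∂μ ≤ c ^ 2 := by
  rw [← l2_sq, pow_two_le_pow_two_iff]

theorem l2_mono {h h' : α → ℝ≥0∞} (H : ∀ a, h a ≤ h' a) : l2 μ h ≤ l2 μ h' := by
  rw [l2_le_iff, l2_sq]; exact lintegral_mono fun a => by gcongr; exact H a

theorem l2_mono_ae {h h' : α → ℝ≥0∞} (H : ∀ᵐ a ∂μ, h a ≤ h' a) : l2 μ h ≤ l2 μ h' := by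
  rw [l2_le_iff, l2_sq]
  exact lintegral_mono_ae (H.mono fun a ha => by gcongr)

theorem l2_congr_ae {h h' : α → ℝ≥0∞} (H : h =ᵐ[μ] h') : l2 μ h = l2 μ h' := by
  rw [l2, l2]; congr 1; exact lintegral_congr_ae (H.fun_comp (· ^ 2))

theorem lintegral_mul_le_l2 {f g : α → ℝ≥0∞} (hf : AEMeasurable f μ) (hg : AEMeasurable g μ) :
    ∫⁻ a, f a * g a ∂μ ≤ l2 μ f * l2 μ g := by
  have := ENNReal.lintegral_mul_le_Lp_mul_Lq μ Real.HolderConjugate.two_two hf hg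
  simpa [l2] using this

/-- Minkowski's inequality: expand the square into a double sum and apply Cauchy–Schwarz to each
pair of terms. Nothing has to be finite. -/
theorem l2_tsum_le {ι : Type*} [Countable ι] {h : ι → α → ℝ≥0∞} (hm : ∀ i, Measurable (h i)) :
    l2 μ (fun a => ∑' i, h i a) ≤ ∑' i, l2 μ (h i) := by
  rw [l2_le_iff]
  calc ∫⁻ a, (∑' i, h i a) ^ 2 ∂μ = ∫⁻ a, ∑' i, ∑' j, h i a * h j a ∂μ := by
        refine lintegral_congr fun a => ?_
        rw [sq, ← ENNReal.tsum_mul_right]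
        exact tsum_congr fun i => by rw [ENNReal.tsum_mul_left]
    _ = ∑' i, ∑' j, ∫⁻ a, h i a * h j a ∂μ := by
        rw [lintegral_tsum fun i => ?_]
        · exact tsum_congr fun i => lintegral_tsum fun j => ((hm i).mul (hm j)).aemeasurable
        · exact (Measurable.tsum fun j => (hm i).mul (hm j)).aemeasurable
    _ ≤ ∑' i, ∑' j, l2 μ (h i) * l2 μ (h j) :=
        ENNReal.tsum_le_tsum fun i => ENNReal.tsum_le_tsum fun j =>
          lintegral_mul_le_l2 (hm i).aemeasurable (hm j).aemeasurable
    _ = (∑' i, l2 μ (h i)) ^ 2 := by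
        rw [sq, ← ENNReal.tsum_mul_right]
        exact tsum_congr fun i => by rw [ENNReal.tsum_mul_left]

theorem l2_const_mul (c : ℝ≥0∞) {h : α → ℝ≥0∞} (hm : Measurable h) :
    l2 μ (fun a => c * h a) = c * l2 μ h := by
  simp only [l2, mul_pow]
  rw [lintegral_const_mul _ (hm.pow_const 2), ENNReal.mul_rpow_of_nonneg _ _ (by norm_num),
    ← ENNReal.rpow_natCast, ← ENNReal.rpow_mul]
  norm_num

theorem eLpNorm_two_eq {E : Type*} [NormedAddCommGroup E] (f : α → E) :
    eLpNorm f 2 μ = l2 μ (fun a => ‖f a‖ₑ) := by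
  rw [eLpNorm_eq_lintegral_rpow_enorm_toReal (by norm_num) (by norm_num)]
  simp [l2]

end LTwo

variable {d : ℕ}

/-! ### Convolution in the space variable -/

/-- Convolution of nonnegative functions. -/
def conv (ρ h : Space d → ℝ≥0∞) (x : Space d) : ℝ≥0∞ := ∫⁻ y, ρ y * h (x - y)

theorem conv_mono {ρ ρ' h h' : Space d → ℝ≥0∞} (H : ∀ x, ρ x ≤ ρ' x) (H' : ∀ x, h x ≤ h' x)
    (x : Space d) : conv ρ h x ≤ conv ρ' h' x :=
  lintegral_mono fun y => mul_le_mul' (H y) (H' _)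

theorem conv_comm (ρ h : Space d → ℝ≥0∞) : conv ρ h = conv h ρ := by
  ext x
  unfold conv
  rw [← lintegral_sub_left_eq_self _ x]
  refine lintegral_congr fun y => ?_
  rw [sub_sub_cancel, mul_comm]

theorem conv_const_mul (c : ℝ≥0∞) (hc : c ≠ ⊤) (ρ h : Space d → ℝ≥0∞) (x : Space d) :
    conv ρ (fun y => c * h y) x = c * conv ρ h x := by
  unfold conv
  rw [← lintegral_const_mul' _ _ hc]
  exact lintegral_congr fun y => by ring

theorem const_mul_conv (c : ℝ≥0∞) (hc : c ≠ ⊤) (ρ h : Space d → ℝ≥0∞) (x : Space d) :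
    conv (fun y => c * ρ y) h x = c * conv ρ h x := by
  unfold conv
  rw [← lintegral_const_mul' _ _ hc]
  exact lintegral_congr fun y => by ring

theorem measurable_conv {ρ h : Space d → ℝ≥0∞} (hρ : Measurable ρ) (hh : Measurable h) :
    Measurable (conv ρ h) := by
  unfold conv
  have : Measurable fun p : Space d × Space d => ρ p.2 * h (p.1 - p.2) := by fun_prop
  exact this.lintegral_prod_right

theorem measurable_uncurry_conv {ρ : Space d → ℝ≥0∞} {h : ℝ → Space d → ℝ≥0∞} (hρ : Measurable ρ)
    (hh : Measurable (Function.uncurry h)) :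
    Measurable (Function.uncurry fun t => conv ρ (h t)) := by
  have : Measurable fun p : (ℝ × Space d) × Space d =>
      ρ p.2 * Function.uncurry h (p.1.1, p.1.2 - p.2) := by fun_prop
  exact Measurable.lintegral_prod_right this

theorem conv_tsum {ι : Type*} [Countable ι] {ρ : Space d → ℝ≥0∞} {h : ι → Space d → ℝ≥0∞}
    (hρ : Measurable ρ) (hh : ∀ i, Measurable (h i)) (x : Space d) :
    conv ρ (fun y => ∑' i, h i y) x = ∑' i, conv ρ (h i) x := by
  unfold conv
  rw [← lintegral_tsum fun i => by
    exact (hρ.mul ((hh i).comp (measurable_const.sub measurable_id))).aemeasurable]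
  exact lintegral_congr fun y => by rw [ENNReal.tsum_mul_left]

theorem tsum_conv {ι : Type*} [Countable ι] {ρ : ι → Space d → ℝ≥0∞} {h : Space d → ℝ≥0∞}
    (hρ : ∀ i, Measurable (ρ i)) (hh : Measurable h) (x : Space d) :
    conv (fun y => ∑' i, ρ i y) h x = ∑' i, conv (ρ i) h x := by
  rw [conv_comm, conv_tsum hh hρ]
  exact tsum_congr fun i => by rw [conv_comm]

theorem conv_assoc {ρ σ h : Space d → ℝ≥0∞} (hρ : Measurable ρ) (hσ : Measurable σ)
    (hh : Measurable h) (x : Space d) : conv (conv ρ σ) h x = conv ρ (conv σ h) x := by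
  unfold conv
  calc ∫⁻ y, (∫⁻ z, ρ z * σ (y - z)) * h (x - y)
      = ∫⁻ y, ∫⁻ z, ρ z * σ (y - z) * h (x - y) := by
        refine lintegral_congr fun y => ?_
        rw [lintegral_mul_const]
        fun_prop
    _ = ∫⁻ z, ∫⁻ y, ρ z * σ (y - z) * h (x - y) := by
        rw [lintegral_lintegral_swap]
        fun_prop
    _ = ∫⁻ z, ρ z * ∫⁻ y, σ y * h (x - z - y) := by
        refine lintegral_congr fun z => ?_
        rw [← lintegral_const_mul _ (by fun_prop), ← lintegral_add_right_eq_self _ z]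
        refine lintegral_congr fun y => ?_
        rw [add_sub_cancel_right, mul_assoc, sub_sub, add_comm z y]

/-- Jensen's inequality for the convolution with an integrable weight. -/
theorem conv_sq_le {ρ h : Space d → ℝ≥0∞} (hρ : Measurable ρ) (hh : Measurable h) (x : Space d) :
    conv ρ h x ^ 2 ≤ (∫⁻ y, ρ y) * conv ρ (fun y => h y ^ 2) x := by
  have e : ∀ a : ℝ≥0∞, a ^ (1 / 2 : ℝ) ^ 1 * a ^ (1 / 2 : ℝ) ^ 1 = a := fun a => by
    rw [← ENNReal.rpow_add_of_nonneg _ _ (by norm_num) (by norm_num)]; norm_num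
  have e2 : ∀ a : ℝ≥0∞, (a ^ (1 / 2 : ℝ)) ^ 2 = a := fun a => by
    rw [← ENNReal.rpow_natCast, ← ENNReal.rpow_mul]; norm_num
  have h1 := lintegral_mul_le_l2 (μ := (volume : Measure (Space d)))
    (f := fun y => ρ y ^ (1 / 2 : ℝ)) (g := fun y => ρ y ^ (1 / 2 : ℝ) * h (x - y))
    (by fun_prop) (by fun_prop)
  have h2 : conv ρ h x = ∫⁻ y, ρ y ^ (1 / 2 : ℝ) * (ρ y ^ (1 / 2 : ℝ) * h (x - y)) := by
    unfold conv
    refine lintegral_congr fun y => ?_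
    have := e (ρ y)
    rw [pow_one] at this
    rw [← mul_assoc, this]
  rw [h2]
  refine (pow_le_pow_left' h1 2).trans ?_
  rw [mul_pow, l2_sq, l2_sq]
  simp only [mul_pow, e2]
  exact le_rfl

/-- The estimate `L¹ * L² ⊆ L²` in the form needed for Bernstein's inequality. -/
theorem lintegral_conv_sq_le {ρ h : Space d → ℝ≥0∞} (hρ : Measurable ρ) (hh : Measurable h) :
    ∫⁻ x, conv ρ h x ^ 2 ≤ (∫⁻ y, ρ y ^ 2) * (∫⁻ y, h y) ^ 2 := by
  calc ∫⁻ x, conv ρ h x ^ 2 ≤ ∫⁻ x, (∫⁻ y, h y) * conv h (fun y => ρ y ^ 2) x :=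
        lintegral_mono fun x => by rw [conv_comm]; exact conv_sq_le hh hρ x
    _ = (∫⁻ y, h y) * ∫⁻ x, ∫⁻ y, h y * ρ (x - y) ^ 2 := by
        rw [lintegral_const_mul _ (measurable_conv hh (hρ.pow_const 2))]; rfl
    _ = (∫⁻ y, h y) * ∫⁻ y, h y * ∫⁻ x, ρ x ^ 2 := by
        rw [lintegral_lintegral_swap (by fun_prop)]
        congr 1
        refine lintegral_congr fun y => ?_
        rw [lintegral_const_mul _ (by fun_prop), lintegral_sub_right_eq_self (fun x => ρ x ^ 2)]
    _ = _ := by rw [lintegral_mul_const _ hh]; ring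

/-- Cauchy–Schwarz; with a normalized ball of radius 2^(-k) as `ρ` this is Bernstein's inequality
from L² to L^∞. -/
theorem conv_le_l2 {ρ h : Space d → ℝ≥0∞} (hρ : Measurable ρ) (hh : Measurable h) (x : Space d) :
    conv ρ h x ≤ l2 volume ρ * l2 volume h := by
  have e : l2 volume (fun y => h (x - y)) = l2 volume h := by
    rw [l2, l2, lintegral_sub_left_eq_self (fun y => h y ^ 2) x]
  rw [← e]
  exact lintegral_mul_le_l2 hρ.aemeasurable
    (hh.comp (measurable_const.sub measurable_id)).aemeasurable

end

section

variable {d : ℕ}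

/-! ### Dyadic cubes -/

theorem mem_cube_iff {l : ℕ} {k : Fin d → ℤ} {x : Space d} :
    x ∈ cube l k ↔ k = fun i => ⌊x i / 2 ^ l⌋ := by
  have h2 : (0 : ℝ) < 2 ^ l := by positivity
  rw [funext_iff]
  refine forall_congr' fun i => ?_
  rw [eq_comm, Int.floor_eq_iff, le_div_iff₀ h2, div_lt_iff₀ h2, mul_comm, mul_comm (_ + 1)]

theorem measurableSet_cube (l : ℕ) (k : Fin d → ℤ) : MeasurableSet (cube l k : Set (Space d)) := by
  have : (cube l k : Set (Space d)) =
      ⋂ i, {x | (2 : ℝ) ^ l * k i ≤ x i ∧ x i < (2 : ℝ) ^ l * (k i + 1)} := by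
    ext x; simp [cube]
  rw [this]
  refine MeasurableSet.iInter fun i => ?_
  have hi : Measurable fun x : Space d => x i := by fun_prop
  exact (measurableSet_le measurable_const hi).inter (measurableSet_lt hi measurable_const)

/-- The index of the cube of level `l` containing `x`. -/
def cubeIdx (l : ℕ) (x : Space d) : Fin d → ℤ := fun i => ⌊x i / 2 ^ l⌋

theorem mem_cube_cubeIdx (l : ℕ) (x : Space d) : x ∈ cube l (cubeIdx l x) := mem_cube_iff.2 rfl

theorem mem_cube_iff_eq {l : ℕ} {k : Fin d → ℤ} {x : Space d} :
    x ∈ cube l k ↔ k = cubeIdx l x := mem_cube_iff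

/-- The restriction of a space-time function to a cube. -/
def cut (l : ℕ) (k : Fin d → ℤ) (h : ℝ → Space d → ℝ≥0∞) : ℝ → Space d → ℝ≥0∞ :=
  fun t => (cube l k).indicator (h t)

theorem cut_apply_of_mem {l : ℕ} {k : Fin d → ℤ} {h : ℝ → Space d → ℝ≥0∞} {t : ℝ} {x : Space d}
    (hx : x ∈ cube l k) : cut l k h t x = h t x := Set.indicator_of_mem hx _

theorem cut_apply_of_notMem {l : ℕ} {k : Fin d → ℤ} {h : ℝ → Space d → ℝ≥0∞} {t : ℝ} {x : Space d}
    (hx : x ∉ cube l k) : cut l k h t x = 0 := Set.indicator_of_notMem hx _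

theorem cut_mono {h h' : ℝ → Space d → ℝ≥0∞} (H : ∀ t x, h t x ≤ h' t x) (l : ℕ) (k : Fin d → ℤ)
    (t : ℝ) (x : Space d) : cut l k h t x ≤ cut l k h' t x :=
  Set.indicator_le_indicator (H t x)

theorem measurable_cut {h : ℝ → Space d → ℝ≥0∞} (hm : Measurable (Function.uncurry h)) (l : ℕ)
    (k : Fin d → ℤ) : Measurable (Function.uncurry (cut l k h)) := by
  have : Function.uncurry (cut l k h) =
      (Prod.snd ⁻¹' (cube l k : Set (Space d))).indicator (Function.uncurry h) := by
    ext ⟨t, x⟩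
    by_cases hx : x ∈ cube l k
    · rw [Set.indicator_of_mem (by exact hx)]; exact cut_apply_of_mem hx
    · rw [Set.indicator_of_notMem (by exact hx)]; exact cut_apply_of_notMem hx
  rw [this]
  exact hm.indicator (measurable_snd (measurableSet_cube l k))

theorem tsum_cut (l : ℕ) (h : ℝ → Space d → ℝ≥0∞) (t : ℝ) (x : Space d) :
    ∑' k, cut l k h t x = h t x := by
  rw [tsum_eq_single (cubeIdx l x), cut_apply_of_mem (mem_cube_cubeIdx l x)]
  intro k hk
  exact cut_apply_of_notMem fun hx => hk (mem_cube_iff_eq.1 hx)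

/-- The box of integer offsets with entries in `[-R, R]`. -/
def box (d R : ℕ) : Finset (Fin d → ℤ) := Fintype.piFinset fun _ => Finset.Icc (-(R : ℤ)) R

theorem mem_box {R : ℕ} {m : Fin d → ℤ} : m ∈ box d R ↔ ∀ i, |m i| ≤ R := by
  simp [box, abs_le]

/-- Summing over all cubes a sum over neighbouring cubes costs a constant only. -/
theorem tsum_sum_shift (s : Finset (Fin d → ℤ)) (a : (Fin d → ℤ) → ℝ≥0∞) (n : Fin d → ℤ) :
    ∑' k, ∑ m ∈ s, a (k + n + m) = s.card * ∑' k, a k := by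
  rw [Summable.tsum_finsetSum fun _ _ => ENNReal.summable, Finset.sum_congr rfl (fun m _ => ?_),
    Finset.sum_const, nsmul_eq_mul]
  simp_rw [add_assoc]
  exact (Equiv.addRight (n + m)).tsum_eq a

/-- The part of the offset of a translate of a cube of level `l`. -/
def shiftIdx (l : ℕ) (y : Space d) : Fin d → ℤ := fun i => ⌊-(y i) / 2 ^ l⌋

theorem measurable_shiftIdx (l : ℕ) : Measurable (shiftIdx l : Space d → Fin d → ℤ) := by
  unfold shiftIdx
  fun_prop

/-- The floor function is additive up to one. Hence translation by an arbitrary `y` acts on cubes as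
an integer shift up to the 3^d neighbours, so that kernels with unbounded support can be handled
without loss. -/
theorem cubeIdx_sub_mem {l : ℕ} {k : Fin d → ℤ} {x : Space d} (y : Space d) (hx : x ∈ cube l k) :
    cubeIdx l (x - y) - (k + shiftIdx l y) ∈ box d 1 := by
  rw [mem_cube_iff_eq] at hx
  subst hx
  rw [mem_box]
  intro i
  simp only [cubeIdx, shiftIdx, Pi.sub_apply, Pi.add_apply, PiLp.sub_apply]
  have e : (x i - y i) / 2 ^ l = x i / 2 ^ l + -(y i) / 2 ^ l := by ring
  rw [e]
  have h1 := Int.le_floor_add (x i / 2 ^ l) (-(y i) / 2 ^ l)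
  have h2 := Int.le_floor_add_floor (x i / 2 ^ l) (-(y i) / 2 ^ l)
  rw [abs_le]
  push_cast
  constructor <;> linarith

theorem cubeIdx_sub_mem_of_norm_le {l : ℕ} {x y : Space d} (hy : ‖y‖ ≤ 1) :
    cubeIdx l (x - y) - cubeIdx l x ∈ box d 1 := by
  rw [mem_box]
  intro i
  have hyi : |y i| ≤ 1 := (PiLp.norm_apply_le y i).trans hy
  have h2 : (1 : ℝ) ≤ 2 ^ l := one_le_pow₀ (by norm_num)
  have h3 : |y i / 2 ^ l| ≤ 1 := by
    rw [abs_div, abs_of_pos (by positivity : (0 : ℝ) < 2 ^ l)]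
    exact div_le_one_of_le₀ (hyi.trans h2) (by positivity)
  rw [abs_le] at h3
  simp only [cubeIdx, Pi.sub_apply, PiLp.sub_apply, sub_div]
  have a1 := Int.floor_le (x i / 2 ^ l)
  have a2 := Int.lt_floor_add_one (x i / 2 ^ l)
  have a3 := Int.floor_le (x i / 2 ^ l - y i / 2 ^ l)
  have a4 := Int.lt_floor_add_one (x i / 2 ^ l - y i / 2 ^ l)
  have b1 : (⌊x i / 2 ^ l - y i / 2 ^ l⌋ : ℝ) < ⌊x i / 2 ^ l⌋ + 2 := by linarith [h3.1]
  have b2 : (⌊x i / 2 ^ l⌋ : ℝ) < ⌊x i / 2 ^ l - y i / 2 ^ l⌋ + 2 := by linarith [h3.2]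
  have b1' : ⌊x i / 2 ^ l - y i / 2 ^ l⌋ < ⌊x i / 2 ^ l⌋ + 2 := by exact_mod_cast b1
  have b2' : ⌊x i / 2 ^ l⌋ < ⌊x i / 2 ^ l - y i / 2 ^ l⌋ + 2 := by exact_mod_cast b2
  rw [abs_le]
  push_cast
  constructor <;> linarith

/-- The index of the parent, `m` levels up. -/
def parentIdx (m : ℕ) (k : Fin d → ℤ) : Fin d → ℤ := fun i => k i / 2 ^ m

theorem cubeIdx_add (l m : ℕ) (x : Space d) : cubeIdx (l + m) x = parentIdx m (cubeIdx l x) := by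
  ext i
  simp only [cubeIdx, parentIdx]
  rw [pow_add, ← div_div]
  have := Int.floor_div_natCast (k := ℝ) (x i / 2 ^ l) (2 ^ m)
  push_cast at this
  exact this

/-- Integer division by 2^m has fibres of 2^m elements in each coordinate. -/
theorem ncard_parentIdx_fiber (m : ℕ) (k : Fin d → ℤ) :
    ∑' k' : Fin d → ℤ, (if parentIdx m k' = k then 1 else 0 : ℝ≥0∞) = 2 ^ (m * d) := by
  have hs : ∀ k', parentIdx m k' = k ↔
      k' ∈ Fintype.piFinset fun i => Finset.Ico (2 ^ m * k i) (2 ^ m * k i + 2 ^ m) := by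
    intro k'
    rw [Fintype.mem_piFinset, funext_iff]
    refine forall_congr' fun i => ?_
    have h2 : (0 : ℤ) < 2 ^ m := by positivity
    rw [Finset.mem_Ico, parentIdx, Int.ediv_eq_iff_of_pos h2, mul_comm]
  simp only [hs]
  rw [tsum_eq_sum (s := Fintype.piFinset fun i => Finset.Ico (2 ^ m * k i) (2 ^ m * k i + 2 ^ m))
    (fun b hb => by simp [hb])]
  rw [Finset.sum_congr rfl (fun b hb => if_pos hb)]
  have h2 : ((2 : ℤ) ^ m).toNat = 2 ^ m := by exact_mod_cast Int.toNat_natCast (2 ^ m)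
  simp [Fintype.card_piFinset, pow_mul, h2]

theorem cut_cut_of_parent {j m : ℕ} {k : Fin d → ℤ} (h : ℝ → Space d → ℝ≥0∞) (t : ℝ) (x : Space d) :
    cut (j + m) k h t x =
      ∑' k', (if parentIdx m k' = k then 1 else 0) * cut j k' h t x := by
  rw [tsum_eq_single (cubeIdx j x)]
  · rw [cut_apply_of_mem (mem_cube_cubeIdx j x), ← cubeIdx_add]
    split_ifs with H
    · rw [cut_apply_of_mem (mem_cube_iff_eq.2 H.symm), one_mul]
    · rw [cut_apply_of_notMem (fun h => H (mem_cube_iff_eq.1 h).symm), zero_mul]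
  · intro k' hk'
    rw [cut_apply_of_notMem fun hx => hk' (mem_cube_iff_eq.1 hx), mul_zero]

end

section

variable {d : ℕ}

/-! ### Norms of nonnegative space-time functions -/

/-- Monotone, countably subadditive functionals on space-time functions which are stable under
convolution in space with integrable weights. -/
structure IsConvNorm (N : (ℝ → Space d → ℝ≥0∞) → ℝ≥0∞) : Prop where
  mono : ∀ {h h' : ℝ → Space d → ℝ≥0∞}, (∀ t x, h t x ≤ h' t x) → N h ≤ N h'
  tsum_le : ∀ {ι : Type} [Countable ι] {h : ι → ℝ → Space d → ℝ≥0∞},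
    (∀ i, Measurable (Function.uncurry (h i))) →
      N (fun t x => ∑' i, h i t x) ≤ ∑' i, N (h i)
  conv_le : ∀ {ρ : Space d → ℝ≥0∞} {h : ℝ → Space d → ℝ≥0∞}, Measurable ρ →
    Measurable (Function.uncurry h) →
      N (fun t => conv ρ (h t)) ≤ (box d 1).card * (∫⁻ y, ρ y) * N h

theorem IsConvNorm.sum_le {N : (ℝ → Space d → ℝ≥0∞) → ℝ≥0∞} (hN : IsConvNorm N) {ι : Type}
    (s : Finset ι) {h : ι → ℝ → Space d → ℝ≥0∞} (hm : ∀ i, Measurable (Function.uncurry (h i))) :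
    N (fun t x => ∑ i ∈ s, h i t x) ≤ ∑ i ∈ s, N (h i) := by
  have := hN.tsum_le (ι := s) (h := fun i => h i) (fun i => hm i)
  simpa only [tsum_fintype, Finset.sum_coe_sort s (fun i => N (h i)),
    fun t x => Finset.sum_coe_sort s (fun i => h i t x)] using this

theorem one_le_card_box (d R : ℕ) : (1 : ℝ≥0∞) ≤ (box d R).card := by
  have : (0 : Fin d → ℤ) ∈ box d R := by simp [mem_box]
  exact_mod_cast Finset.card_pos.2 ⟨_, this⟩

/-- The norm of `X` for nonnegative functions. -/
def eX (T : ℝ) (h : ℝ → Space d → ℝ≥0∞) : ℝ≥0∞ :=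
  ⨆ (l : ℕ) (k : Fin d → ℤ), (2 : ℝ≥0∞) ^ (-(l : ℝ) / 2) *
    l2 ((timeMeasure T).prod (volume.restrict (cube l k))) (Function.uncurry h)

/-- The norm of `L^∞ L²` for nonnegative functions. -/
def eI (T : ℝ) (h : ℝ → Space d → ℝ≥0∞) : ℝ≥0∞ :=
  essSup (fun t => l2 volume (h t)) (timeMeasure T)

/-- The norm of `L^∞` in time and space (everywhere in space) for nonnegative functions. -/
def eS (T : ℝ) (h : ℝ → Space d → ℝ≥0∞) : ℝ≥0∞ :=
  essSup (fun t => ⨆ x, h t x) (timeMeasure T)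

/-- The norm of `X_j` for nonnegative functions. -/
def eN (T : ℝ) (j : ℕ) (h : ℝ → Space d → ℝ≥0∞) : ℝ≥0∞ :=
  (2 : ℝ≥0∞) ^ ((j : ℝ) / 2) * eX T h + eI T h

theorem le_eX (T : ℝ) (h : ℝ → Space d → ℝ≥0∞) (l : ℕ) (k : Fin d → ℤ) :
    (2 : ℝ≥0∞) ^ (-(l : ℝ) / 2) *
      l2 ((timeMeasure T).prod (volume.restrict (cube l k))) (Function.uncurry h) ≤ eX T h :=
  le_iSup₂_of_le l k le_rfl

theorem ae_le_eI (T : ℝ) (h : ℝ → Space d → ℝ≥0∞) :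
    ∀ᵐ t ∂timeMeasure T, l2 volume (h t) ≤ eI T h := ENNReal.ae_le_essSup _

theorem ae_le_eS (T : ℝ) (h : ℝ → Space d → ℝ≥0∞) :
    ∀ᵐ t ∂timeMeasure T, ∀ x, h t x ≤ eS T h :=
  (ENNReal.ae_le_essSup _).mono fun t ht x => (le_iSup (h t) x).trans ht

theorem measurable_slice {h : ℝ → Space d → ℝ≥0∞} (hm : Measurable (Function.uncurry h)) (t : ℝ) :
    Measurable (h t) := hm.comp measurable_prodMk_left

/-- The translated cube is covered by the neighbours of one shifted cube. -/
theorem lintegral_sub_cube_le {l : ℕ} {k : Fin d → ℤ} (T : ℝ) {h : ℝ → Space d → ℝ≥0∞}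
    (hm : Measurable (Function.uncurry h)) (y : Space d) :
    ∫⁻ t, (∫⁻ x in cube l k, h t (x - y)) ∂(timeMeasure T) ≤
      ∑ m ∈ box d 1, ∫⁻ t, (∫⁻ x in cube l (k + shiftIdx l y + m), h t x) ∂(timeMeasure T) := by
  rw [← lintegral_finsetSum]
  swap
  · intro m _
    exact hm.lintegral_prod_right'
  refine lintegral_mono fun t => ?_
  calc ∫⁻ x in cube l k, h t (x - y)
      ≤ ∫⁻ x in cube l k, ∑ m ∈ box d 1, cut l (k + shiftIdx l y + m) h t (x - y) := by
        refine setLIntegral_mono_ae' (measurableSet_cube l k) (Eventually.of_forall fun x hx => ?_)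
        have hmem := cubeIdx_sub_mem y hx
        rw [← cut_apply_of_mem (h := h) (t := t) (mem_cube_cubeIdx l (x - y))]
        refine le_trans ?_ (Finset.single_le_sum
          (f := fun m => cut l (k + shiftIdx l y + m) h t (x - y)) (fun _ _ => zero_le) hmem)
        simp
    _ ≤ ∫⁻ x, ∑ m ∈ box d 1, cut l (k + shiftIdx l y + m) h t (x - y) :=
        setLIntegral_le_lintegral _ _
    _ = ∫⁻ x, ∑ m ∈ box d 1, cut l (k + shiftIdx l y + m) h t x :=
        lintegral_sub_right_eq_self
          (fun x => ∑ m ∈ box d 1, cut l (k + shiftIdx l y + m) h t x) y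
    _ = ∑ m ∈ box d 1, ∫⁻ x, cut l (k + shiftIdx l y + m) h t x :=
        lintegral_finsetSum _ fun m _ => measurable_slice (measurable_cut hm _ _) t
    _ = _ := Finset.sum_congr rfl fun m _ => lintegral_indicator (measurableSet_cube _ _) _

theorem l2_prod_sq {T : ℝ} {h : ℝ → Space d → ℝ≥0∞} (hm : Measurable (Function.uncurry h))
    (s : Set (Space d)) :
    l2 ((timeMeasure T).prod (volume.restrict s)) (Function.uncurry h) ^ 2 =
      ∫⁻ t, (∫⁻ x in s, h t x ^ 2) ∂(timeMeasure T) := by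
  rw [l2_sq, lintegral_prod _ (hm.pow_const 2).aemeasurable]
  rfl

/-- Jensen's inequality turns the square of a convolution into an average of translates. The norm of
X is invariant under translations only up to a constant, because a translate of a dyadic cube is
covered by neighbouring dyadic cubes; this is the origin of the factor `(box d 1).card` in
`IsConvNorm`. -/
theorem isConvNorm_eX (T : ℝ) : IsConvNorm (d := d) (eX T) where
  mono H := iSup₂_mono fun l k => by
    gcongr
    exact l2_mono fun p => H _ _
  tsum_le {ι} _ {h} hm := by
    refine iSup₂_le fun l k => ?_
    calc _ ≤ (2 : ℝ≥0∞) ^ (-(l : ℝ) / 2) * ∑' i,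
          l2 ((timeMeasure T).prod (volume.restrict (cube l k))) (Function.uncurry (h i)) := by
          gcongr
          exact l2_tsum_le hm
      _ = ∑' i, (2 : ℝ≥0∞) ^ (-(l : ℝ) / 2) *
          l2 ((timeMeasure T).prod (volume.restrict (cube l k))) (Function.uncurry (h i)) := by
          rw [ENNReal.tsum_mul_left]
      _ ≤ _ := ENNReal.tsum_le_tsum fun i => le_eX _ _ _ _
  conv_le {ρ h} hρ hm := by
    refine iSup₂_le fun l k => ?_
    rw [← pow_two_le_pow_two_iff, mul_pow, l2_prod_sq (measurable_uncurry_conv hρ hm)]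
    set w : ℝ≥0∞ := (2 : ℝ≥0∞) ^ (-(l : ℝ) / 2)
    have hm2 : Measurable (Function.uncurry fun t x => h t x ^ 2) := hm.pow_const 2
    calc w ^ 2 * ∫⁻ t, (∫⁻ x in cube l k, conv ρ (h t) x ^ 2) ∂(timeMeasure T)
        ≤ w ^ 2 * ∫⁻ t, (∫⁻ x in cube l k, (∫⁻ y, ρ y) * conv ρ (fun y => h t y ^ 2) x)
            ∂(timeMeasure T) := by
          gcongr with t x
          exact conv_sq_le hρ (measurable_slice hm t) x
      _ = w ^ 2 * ((∫⁻ y, ρ y) * ∫⁻ t, (∫⁻ x in cube l k, ∫⁻ y, ρ y * h t (x - y) ^ 2)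
            ∂(timeMeasure T)) := by
          have hc := measurable_uncurry_conv hρ hm2
          rw [← lintegral_const_mul _ (show Measurable fun t =>
            ∫⁻ x in cube l k, ∫⁻ y, ρ y * h t (x - y) ^ 2 from hc.lintegral_prod_right')]
          congr 1
          refine lintegral_congr fun t => ?_
          rw [lintegral_const_mul _ (measurable_slice hc t)]
          rfl
      _ = w ^ 2 * ((∫⁻ y, ρ y) * ∫⁻ y, ρ y * ∫⁻ t, (∫⁻ x in cube l k, h t (x - y) ^ 2)
            ∂(timeMeasure T)) := by
          congr 2
          have h3 : Measurable fun p : (ℝ × Space d) × Space d =>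
              ρ p.2 * Function.uncurry h (p.1.1, p.1.2 - p.2) ^ 2 := by fun_prop
          have e1 : ∀ t, ∫⁻ x in cube l k, ∫⁻ y, ρ y * h t (x - y) ^ 2 =
              ∫⁻ y, ∫⁻ x in cube l k, ρ y * h t (x - y) ^ 2 := fun t => by
            refine lintegral_lintegral_swap ?_
            exact (h3.comp (f := fun p : Space d × Space d => ((t, p.1), p.2))
              (by fun_prop)).aemeasurable
          simp_rw [e1]
          rw [lintegral_lintegral_swap]
          · refine lintegral_congr fun y => ?_
            rw [← lintegral_const_mul]
            · refine lintegral_congr fun t => ?_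
              rw [lintegral_const_mul]
              exact ((measurable_slice hm t).comp (by fun_prop)).pow_const 2
            · have h4 : Measurable fun p : ℝ × Space d =>
                  Function.uncurry h (p.1, p.2 - y) ^ 2 := by fun_prop
              exact h4.lintegral_prod_right'
          · have h5 : Measurable fun p : (ℝ × Space d) × Space d =>
                ρ p.1.2 * Function.uncurry h (p.1.1, p.2 - p.1.2) ^ 2 := by fun_prop
            exact h5.lintegral_prod_right'.aemeasurable
      _ ≤ w ^ 2 * ((∫⁻ y, ρ y) * ∫⁻ y, ρ y * ∑ m ∈ box d 1,
            l2 ((timeMeasure T).prod (volume.restrict (cube l (k + shiftIdx l y + m))))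
              (Function.uncurry h) ^ 2) := by
          gcongr with y
          refine (lintegral_sub_cube_le T hm2 y).trans_eq ?_
          exact Finset.sum_congr rfl fun m _ => (l2_prod_sq hm _).symm
      _ = (∫⁻ y, ρ y) * ∫⁻ y, ρ y * ∑ m ∈ box d 1,
            (w * l2 ((timeMeasure T).prod (volume.restrict (cube l (k + shiftIdx l y + m))))
              (Function.uncurry h)) ^ 2 := by
          have hw : w ^ 2 ≠ ⊤ := ENNReal.pow_ne_top (ENNReal.rpow_ne_top_of_ne_zero
            (by norm_num) (by norm_num))
          rw [mul_left_comm, ← lintegral_const_mul' _ _ hw]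
          congr 1
          refine lintegral_congr fun y => ?_
          rw [mul_left_comm, Finset.mul_sum]
          simp_rw [mul_pow]
      _ ≤ (∫⁻ y, ρ y) * ∫⁻ y, ρ y * ((box d 1).card * eX T h ^ 2) := by
          gcongr with y
          rw [← nsmul_eq_mul]
          refine Finset.sum_le_card_nsmul _ _ _ fun m _ => ?_
          gcongr
          exact le_eX _ _ _ _
      _ = (∫⁻ y, ρ y) ^ 2 * ((box d 1).card * eX T h ^ 2) := by
          rw [lintegral_mul_const _ hρ]; ring
      -- One cardinality would do; the second one makes the bound a perfect square.
      _ ≤ (∫⁻ y, ρ y) ^ 2 * (((box d 1).card * (box d 1).card) * eX T h ^ 2) := by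
          gcongr
          exact le_mul_of_one_le_right' (one_le_card_box d 1)
      _ = _ := by ring

theorem essSup_tsum_le {ι α : Type*} [Countable ι] {mα : MeasurableSpace α} {μ : Measure α}
    (f : ι → α → ℝ≥0∞) : essSup (fun a => ∑' i, f i a) μ ≤ ∑' i, essSup (f i) μ := by
  refine essSup_le_of_ae_le _ ?_
  have : ∀ᵐ a ∂μ, ∀ i, f i a ≤ essSup (f i) μ :=
    ae_all_iff.2 fun i => ENNReal.ae_le_essSup _
  exact this.mono fun a ha => ENNReal.tsum_le_tsum ha

theorem l2_conv_le {ρ h : Space d → ℝ≥0∞} (hρ : Measurable ρ) (hh : Measurable h) :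
    l2 volume (conv ρ h) ≤ (∫⁻ y, ρ y) * l2 volume h := by
  rw [l2_le_iff]
  calc ∫⁻ x, conv ρ h x ^ 2 ≤ ∫⁻ x, (∫⁻ y, ρ y) * conv ρ (fun y => h y ^ 2) x :=
        lintegral_mono fun x => conv_sq_le hρ hh x
    _ = (∫⁻ y, ρ y) * ∫⁻ x, ∫⁻ y, ρ y * h (x - y) ^ 2 := by
        rw [lintegral_const_mul _ (measurable_conv hρ (hh.pow_const 2))]; rfl
    _ = (∫⁻ y, ρ y) * ∫⁻ y, ρ y * ∫⁻ x, h x ^ 2 := by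
        rw [lintegral_lintegral_swap (by fun_prop)]
        congr 1
        refine lintegral_congr fun y => ?_
        rw [lintegral_const_mul _ (by fun_prop), lintegral_sub_right_eq_self (fun x => h x ^ 2)]
    _ = ((∫⁻ y, ρ y) * l2 volume h) ^ 2 := by
        rw [lintegral_mul_const _ hρ, mul_pow, l2_sq]; ring

theorem isConvNorm_eI (T : ℝ) : IsConvNorm (d := d) (eI T) where
  mono H := essSup_mono_ae (Eventually.of_forall fun t => l2_mono (H t))
  tsum_le {ι} _ {h} hm := by
    refine le_trans ?_ (essSup_tsum_le _)
    exact essSup_mono_ae (Eventually.of_forall fun t => l2_tsum_le fun i => measurable_slice (hm i) t)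
  conv_le {ρ h} hρ hm := by
    refine essSup_le_of_ae_le _ ((ae_le_eI T h).mono fun t ht => ?_)
    have hmt := measurable_slice hm t
    refine le_trans ?_ (mul_le_mul' (le_mul_of_one_le_left' (one_le_card_box d 1)) ht)
    exact l2_conv_le hρ hmt

theorem isConvNorm_eS (T : ℝ) : IsConvNorm (d := d) (eS T) where
  mono H := essSup_mono_ae (Eventually.of_forall fun t => iSup_mono (H t))
  tsum_le {ι} _ {h} hm := by
    refine le_trans ?_ (essSup_tsum_le _)
    exact essSup_mono_ae (Eventually.of_forall fun t => iSup_le fun x =>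
      ENNReal.tsum_le_tsum fun i => le_iSup (h i t) x)
  conv_le {ρ h} hρ hm := by
    refine essSup_le_of_ae_le _ ((ae_le_eS T h).mono fun t ht => ?_)
    refine le_trans ?_ (mul_le_mul' (le_mul_of_one_le_left' (one_le_card_box d 1)) le_rfl)
    refine iSup_le fun x => ?_
    rw [← lintegral_mul_const _ hρ]
    exact lintegral_mono fun y => mul_le_mul' le_rfl (ht _)

theorem isConvNorm_eN (T : ℝ) (j : ℕ) : IsConvNorm (d := d) (eN T j) where
  mono H := by
    unfold eN
    gcongr
    · exact (isConvNorm_eX T).mono H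
    · exact (isConvNorm_eI T).mono H
  tsum_le {ι} _ {h} hm := by
    unfold eN
    rw [ENNReal.tsum_add, ENNReal.tsum_mul_left]
    gcongr
    · exact (isConvNorm_eX T).tsum_le hm
    · exact (isConvNorm_eI T).tsum_le hm
  conv_le {ρ h} hρ hm := by
    unfold eN
    rw [mul_add, mul_left_comm]
    gcongr
    · exact (isConvNorm_eX T).conv_le hρ hm
    · exact (isConvNorm_eI T).conv_le hρ hm

theorem eI_le_eN (T : ℝ) (j : ℕ) (h : ℝ → Space d → ℝ≥0∞) : eI T h ≤ eN T j h := le_add_self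

theorem eN_mono_level (T : ℝ) {j k : ℕ} (hjk : j ≤ k) (h : ℝ → Space d → ℝ≥0∞) :
    eN T j h ≤ eN T k h := by
  exact add_le_add (mul_le_mul' (ENNReal.rpow_le_rpow_of_exponent_le (by norm_num) (by gcongr))
    le_rfl) le_rfl

theorem eN_add_le (T : ℝ) (j m : ℕ) (h : ℝ → Space d → ℝ≥0∞) :
    eN T (j + m) h ≤ (2 : ℝ≥0∞) ^ ((m : ℝ) / 2) * eN T j h := by
  unfold eN
  rw [mul_add, ← mul_assoc, ← ENNReal.rpow_add _ _ (by norm_num) (by norm_num)]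
  have e : (m : ℝ) / 2 + j / 2 = ((j + m : ℕ) : ℝ) / 2 := by push_cast; ring
  rw [e]
  gcongr
  refine le_mul_of_one_le_left' ?_
  rw [← ENNReal.rpow_zero (x := 2)]
  exact ENNReal.rpow_le_rpow_of_exponent_le (by norm_num) (by positivity)

end

section

variable {d : ℕ}

/-! ### Sums over cubes -/

/-- The sum over all cubes of level `j` of the norms of the restrictions. -/
def cubeSum (N : (ℝ → Space d → ℝ≥0∞) → ℝ≥0∞) (j : ℕ) (h : ℝ → Space d → ℝ≥0∞) : ℝ≥0∞ :=
  ∑' k, N (cut j k h)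

namespace IsConvNorm

variable {N : (ℝ → Space d → ℝ≥0∞) → ℝ≥0∞}

theorem cubeSum_mono (hN : IsConvNorm N) {h h' : ℝ → Space d → ℝ≥0∞} (H : ∀ t x, h t x ≤ h' t x)
    (j : ℕ) : cubeSum N j h ≤ cubeSum N j h' :=
  ENNReal.tsum_le_tsum fun k => hN.mono (cut_mono H j k)

theorem le_cubeSum (hN : IsConvNorm N) {h : ℝ → Space d → ℝ≥0∞}
    (hm : Measurable (Function.uncurry h)) (j : ℕ) : N h ≤ cubeSum N j h := by
  refine le_trans (hN.mono fun t x => (tsum_cut j h t x).ge) (hN.tsum_le fun k => ?_)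
  exact measurable_cut hm j k

theorem cubeSum_tsum_le (hN : IsConvNorm N) {ι : Type} [Countable ι]
    {h : ι → ℝ → Space d → ℝ≥0∞} (hm : ∀ i, Measurable (Function.uncurry (h i))) (j : ℕ) :
    cubeSum N j (fun t x => ∑' i, h i t x) ≤ ∑' i, cubeSum N j (h i) := by
  unfold cubeSum
  rw [ENNReal.tsum_comm]
  refine ENNReal.tsum_le_tsum fun k => ?_
  refine le_trans (hN.mono fun t x => ?_) (hN.tsum_le fun i => measurable_cut (hm i) j k)
  by_cases hx : x ∈ cube j k
  · simp only [cut_apply_of_mem hx]; exact le_rfl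
  · rw [cut_apply_of_notMem hx]; exact zero_le

/-- Finite overlap: each `G k` is used by boundedly many cubes. -/
theorem cubeSum_le_of_near (hN : IsConvNorm N) {j R : ℕ} {H : ℝ → Space d → ℝ≥0∞}
    {G : (Fin d → ℤ) → ℝ → Space d → ℝ≥0∞} (hG : ∀ k, Measurable (Function.uncurry (G k)))
    (h : ∀ k t x, cut j k H t x ≤ ∑ m ∈ box d R, G (k + m) t x) :
    cubeSum N j H ≤ (box d R).card * ∑' k, N (G k) := by
  rw [← tsum_sum_shift (box d R) (fun k => N (G k)) 0]
  refine ENNReal.tsum_le_tsum fun k => ?_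
  refine le_trans (hN.mono (h k)) (le_trans (hN.sum_le _ fun m => hG _) ?_)
  simp

/-- The kernel is split into the parts `r n` on which the induced shift of cubes is constant. Each
part sends the cube `k` to the neighbours of `k + n`, the sum over all cubes does not feel the shift
by `n`, and the masses of the parts add up to the mass of the kernel. No decay beyond integrability
is needed. -/
theorem cubeSum_conv_le (hN : IsConvNorm N) {ρ : Space d → ℝ≥0∞} {h : ℝ → Space d → ℝ≥0∞}
    (hρ : Measurable ρ) (hm : Measurable (Function.uncurry h)) (j : ℕ) :
    cubeSum N j (fun t => conv ρ (h t)) ≤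
      (box d 1).card * (box d 1).card * (∫⁻ y, ρ y) * cubeSum N j h := by
  set r : (Fin d → ℤ) → Space d → ℝ≥0∞ := fun n => (shiftIdx j ⁻¹' {n}).indicator ρ
  have hS : ∀ n, MeasurableSet (shiftIdx j ⁻¹' {n} : Set (Space d)) := fun n =>
    measurable_shiftIdx j (measurableSet_singleton n)
  have hr : ∀ n, Measurable (r n) := fun n => hρ.indicator (hS n)
  have hr_sum : ∀ y, ∑' n, r n y = ρ y := fun y => by
    rw [tsum_eq_single (shiftIdx j y)]
    · exact Set.indicator_of_mem (by simp) _
    · intro n hn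
      exact Set.indicator_of_notMem (fun H => hn (by simpa using Eq.symm H)) _
  have key : ∀ k t x, cut j k (fun t => conv ρ (h t)) t x ≤
      ∑' n, ∑ m ∈ box d 1, conv (r n) (cut j (k + n + m) h t) x := by
    intro k t x
    by_cases hx : x ∈ cube j k
    swap
    · rw [cut_apply_of_notMem hx]; exact zero_le
    rw [cut_apply_of_mem hx]
    have e1 : conv ρ (h t) x = ∑' n, conv (r n) (h t) x := by
      rw [← tsum_conv hr (measurable_slice hm t)]
      simp_rw [hr_sum]
    rw [e1]
    refine ENNReal.tsum_le_tsum fun n => ?_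
    unfold conv
    rw [← lintegral_finsetSum]
    swap
    · intro m _
      have := measurable_slice (measurable_cut hm j (k + n + m)) t
      have := hr n
      fun_prop
    refine lintegral_mono fun y => ?_
    by_cases hy : shiftIdx j y = n
    swap
    · have : r n y = 0 := Set.indicator_of_notMem (fun H => hy (by simpa using H)) _
      simp [this]
    rw [← Finset.mul_sum]
    gcongr
    have hmem := cubeIdx_sub_mem y hx
    rw [← cut_apply_of_mem (h := h) (t := t) (mem_cube_cubeIdx j (x - y))]
    refine le_trans ?_ (Finset.single_le_sum
      (f := fun m => cut j (k + n + m) h t (x - y)) (fun _ _ => zero_le) hmem)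
    simp [hy]
  have hmc : ∀ n k, Measurable (Function.uncurry fun t => conv (r n) (cut j k h t)) := fun n k =>
    measurable_uncurry_conv (hr n) (measurable_cut hm j k)
  calc cubeSum N j (fun t => conv ρ (h t))
      ≤ ∑' k, ∑' n, ∑ m ∈ box d 1, N (fun t => conv (r n) (cut j (k + n + m) h t)) := by
        refine ENNReal.tsum_le_tsum fun k => ?_
        refine le_trans (hN.mono (key k)) (le_trans (hN.tsum_le fun n => ?_) ?_)
        · have : (Function.uncurry fun t x => ∑ m ∈ box d 1,
              conv (r n) (cut j (k + n + m) h t) x) = fun p => ∑ m ∈ box d 1,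
              Function.uncurry (fun t => conv (r n) (cut j (k + n + m) h t)) p := rfl
          rw [this]
          exact Finset.measurable_fun_sum _ fun m _ => hmc n _
        · exact ENNReal.tsum_le_tsum fun n => hN.sum_le _ fun m => hmc n _
    _ ≤ ∑' k, ∑' n, ∑ m ∈ box d 1,
          (box d 1).card * (∫⁻ y, r n y) * N (cut j (k + n + m) h) :=
        ENNReal.tsum_le_tsum fun k => ENNReal.tsum_le_tsum fun n => Finset.sum_le_sum fun m _ =>
          hN.conv_le (hr n) (measurable_cut hm _ _)
    _ = ∑' n, (box d 1).card * (∫⁻ y, r n y) * ((box d 1).card * cubeSum N j h) := by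
        rw [ENNReal.tsum_comm]
        refine tsum_congr fun n => ?_
        simp_rw [← Finset.mul_sum]
        rw [ENNReal.tsum_mul_left, tsum_sum_shift (box d 1) (fun k => N (cut j k h)) n]
        rfl
    _ = (box d 1).card * (∑' n, ∫⁻ y, r n y) * ((box d 1).card * cubeSum N j h) := by
        rw [ENNReal.tsum_mul_right, ENNReal.tsum_mul_left]
    _ = _ := by
        rw [← lintegral_tsum fun n => (hr n).aemeasurable]
        simp_rw [hr_sum]
        ring

theorem cubeSum_add_le (hN : IsConvNorm N) {h : ℝ → Space d → ℝ≥0∞}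
    (hm : Measurable (Function.uncurry h)) (j m : ℕ) :
    cubeSum N (j + m) h ≤ cubeSum N j h := by
  -- Subadditivity over the empty family gives the value at zero.
  have hN0 : N (fun _ _ => 0) = 0 := by
    have := hN.tsum_le (ι := Empty) (h := fun i => nomatch i) (fun i => nomatch i)
    simpa using this
  calc cubeSum N (j + m) h
      ≤ ∑' k, ∑' k', N (fun t x => (if parentIdx m k' = k then 1 else 0) * cut j k' h t x) := by
        refine ENNReal.tsum_le_tsum fun k => ?_
        refine le_trans (hN.mono fun t x => (cut_cut_of_parent h t x).le) (hN.tsum_le fun k' => ?_)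
        exact (measurable_cut hm j k').const_mul _
    _ = ∑' k, ∑' k', (if parentIdx m k' = k then 1 else 0) * N (cut j k' h) := by
        refine tsum_congr fun k => tsum_congr fun k' => ?_
        split_ifs
        · simp only [one_mul]
        · simp only [zero_mul, hN0]
    _ = cubeSum N j h := by
        rw [ENNReal.tsum_comm]
        refine tsum_congr fun k' => ?_
        rw [ENNReal.tsum_mul_right, tsum_eq_single (parentIdx m k')]
        · simp
        · intro k hk
          rw [if_neg (Ne.symm hk)]

/-- Each coarse cube is counted once for each of its 2^(md) children. This loss is the factor
2^((i-k)d) in the interaction of two high frequencies. -/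
theorem cubeSum_le_add (hN : IsConvNorm N) (h : ℝ → Space d → ℝ≥0∞) (j m : ℕ) :
    cubeSum N j h ≤ 2 ^ (m * d) * cubeSum N (j + m) h := by
  calc cubeSum N j h ≤ ∑' k', N (cut (j + m) (parentIdx m k') h) := by
        refine ENNReal.tsum_le_tsum fun k' => hN.mono fun t x => ?_
        by_cases hx : x ∈ cube j k'
        · rw [cut_apply_of_mem hx, cut_apply_of_mem]
          rw [mem_cube_iff_eq] at hx ⊢
          rw [cubeIdx_add, hx]
        · rw [cut_apply_of_notMem hx]; exact zero_le
    _ = ∑' k', ∑' k, (if parentIdx m k' = k then 1 else 0) * N (cut (j + m) k h) := by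
        refine tsum_congr fun k' => ?_
        rw [tsum_eq_single (parentIdx m k')]
        · simp
        · intro k hk
          rw [if_neg (Ne.symm hk), zero_mul]
    _ = 2 ^ (m * d) * cubeSum N (j + m) h := by
        rw [ENNReal.tsum_comm]
        simp_rw [ENNReal.tsum_mul_right, ncard_parentIdx_fiber, ENNReal.tsum_mul_left]
        rfl

end IsConvNorm

/-! ### The norm of `l¹_j X_j` with sharp cutoffs -/

/-- The norm of `l¹_j X_j`, with sharp cutoffs. -/
def eY (T : ℝ) (j : ℕ) (h : ℝ → Space d → ℝ≥0∞) : ℝ≥0∞ := cubeSum (eN T j) j h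

theorem eY_mono (T : ℝ) (j : ℕ) {h h' : ℝ → Space d → ℝ≥0∞} (H : ∀ t x, h t x ≤ h' t x) :
    eY T j h ≤ eY T j h' := (isConvNorm_eN T j).cubeSum_mono H j

theorem eI_le_eY (T : ℝ) (j : ℕ) {h : ℝ → Space d → ℝ≥0∞} (hm : Measurable (Function.uncurry h)) :
    eI T h ≤ eY T j h :=
  (eI_le_eN T j h).trans ((isConvNorm_eN T j).le_cubeSum hm j)

/-- Merging cubes costs nothing by subadditivity; only the weight 2^(j/2) in front of the norm of X
grows. -/
theorem eY_add_le (T : ℝ) {h : ℝ → Space d → ℝ≥0∞} (hm : Measurable (Function.uncurry h))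
    (j m : ℕ) : eY T (j + m) h ≤ (2 : ℝ≥0∞) ^ ((m : ℝ) / 2) * eY T j h := by
  refine le_trans ((isConvNorm_eN T (j + m)).cubeSum_add_le hm j m) ?_
  unfold eY cubeSum
  rw [← ENNReal.tsum_mul_left]
  exact ENNReal.tsum_le_tsum fun k => eN_add_le _ _ _ _

theorem eY_le_add (T : ℝ) (h : ℝ → Space d → ℝ≥0∞) (j m : ℕ) :
    eY T j h ≤ 2 ^ (m * d) * eY T (j + m) h := by
  refine le_trans ((isConvNorm_eN T j).cubeSum_le_add h j m) ?_
  unfold eY cubeSum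
  gcongr with k
  exact eN_mono_level _ (by omega) _

theorem eY_conv_le (T : ℝ) (j : ℕ) {ρ : Space d → ℝ≥0∞} {h : ℝ → Space d → ℝ≥0∞}
    (hρ : Measurable ρ) (hm : Measurable (Function.uncurry h)) :
    eY T j (fun t => conv ρ (h t)) ≤
      (box d 1).card * (box d 1).card * (∫⁻ y, ρ y) * eY T j h :=
  (isConvNorm_eN T j).cubeSum_conv_le hρ hm j

theorem eY_tsum_le (T : ℝ) (j : ℕ) {ι : Type} [Countable ι]
    {h : ι → ℝ → Space d → ℝ≥0∞} (hm : ∀ i, Measurable (Function.uncurry (h i))) :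
    eY T j (fun t x => ∑' i, h i t x) ≤ ∑' i, eY T j (h i) :=
  (isConvNorm_eN T j).cubeSum_tsum_le hm j

end

/-! ### Bernstein and Hölder estimates cube by cube -/

section

variable {d : ℕ}

/-! ### Bernstein type estimates -/

theorem sum_sq_le_card_mul {ι : Type*} (s : Finset ι) (f : ι → ℝ≥0∞) :
    (∑ i ∈ s, f i) ^ 2 ≤ s.card * ∑ i ∈ s, f i ^ 2 := by
  have := ENNReal.rpow_sum_le_const_mul_sum_rpow s f (p := 2) (by norm_num)
  norm_num at this
  exact this

/-- The inequality L² * L¹ ⊆ L², localized: as the kernel lives in the unit ball and cubes have side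
at least one, only neighbouring cubes matter. -/
theorem conv_sq_restrict_le {l : ℕ} {k : Fin d → ℤ} {β F : Space d → ℝ≥0∞} (hβ : Measurable β)
    (hF : Measurable F) (hs : ∀ y, β y ≠ 0 → ‖y‖ ≤ 1) :
    ∫⁻ x in cube l k, conv β F x ^ 2 ≤
      (∫⁻ y, β y ^ 2) * (∑ m ∈ box d 1, ∫⁻ y in cube l (k + m), F y) ^ 2 := by
  set G : Space d → ℝ≥0∞ := fun x => ∑ m ∈ box d 1, (cube l (k + m)).indicator F x
  have hG : Measurable G := Finset.measurable_fun_sum _ fun m _ =>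
    hF.indicator (measurableSet_cube _ _)
  calc ∫⁻ x in cube l k, conv β F x ^ 2 ≤ ∫⁻ x in cube l k, conv β G x ^ 2 := by
        refine setLIntegral_mono_ae' (measurableSet_cube l k) (Eventually.of_forall fun x hx => ?_)
        gcongr
        refine lintegral_mono fun y => ?_
        by_cases hy : β y = 0
        · simp [hy]
        gcongr
        have hmem := cubeIdx_sub_mem_of_norm_le (l := l) (x := x) (hs y hy)
        rw [← mem_cube_iff_eq.1 hx] at hmem
        refine le_trans ?_ (Finset.single_le_sum
          (f := fun m => (cube l (k + m)).indicator F (x - y)) (fun _ _ => zero_le) hmem)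
        rw [Set.indicator_of_mem]
        simpa using mem_cube_cubeIdx l (x - y)
    _ ≤ ∫⁻ x, conv β G x ^ 2 := setLIntegral_le_lintegral _ _
    _ ≤ (∫⁻ y, β y ^ 2) * (∫⁻ y, G y) ^ 2 := lintegral_conv_sq_le hβ hG
    _ = _ := by
        rw [lintegral_finsetSum _ fun m _ => hF.indicator (measurableSet_cube _ _)]
        simp_rw [lintegral_indicator (measurableSet_cube _ _)]

theorem eI_conv_mul_le (T : ℝ) {β : Space d → ℝ≥0∞} {f g : ℝ → Space d → ℝ≥0∞}
    (hβ : Measurable β) (hf : Measurable (Function.uncurry f))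
    (hg : Measurable (Function.uncurry g)) :
    eI T (fun t => conv β (fun x => f t x * g t x)) ≤ l2 volume β * eI T f * eI T g := by
  refine essSup_le_of_ae_le _ ?_
  filter_upwards [ae_le_eI T f, ae_le_eI T g] with t hft hgt
  have hft' := measurable_slice hf t
  have hgt' := measurable_slice hg t
  refine le_trans ?_ (mul_le_mul' (mul_le_mul' le_rfl hft) hgt)
  rw [l2_le_iff, mul_assoc, mul_pow, l2_sq]
  refine (lintegral_conv_sq_le hβ (hft'.mul hgt')).trans ?_
  gcongr
  exact lintegral_mul_le_l2 hft'.aemeasurable hgt'.aemeasurable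

/-- On a cube Q, Cauchy–Schwarz in space bounds the L¹ norm of the product by ‖f‖_{L²(Q)} ‖g‖_{L²}.
The second factor is bounded uniformly in time, so the L² norm in time falls on `f` alone, which is
what the norm of X controls. -/
theorem eX_conv_mul_le (T : ℝ) {β : Space d → ℝ≥0∞} {f g : ℝ → Space d → ℝ≥0∞}
    (hβ : Measurable β) (hf : Measurable (Function.uncurry f))
    (hg : Measurable (Function.uncurry g)) (hs : ∀ y, β y ≠ 0 → ‖y‖ ≤ 1) :
    eX T (fun t => conv β (fun x => f t x * g t x)) ≤
      (box d 1).card * l2 volume β * eX T f * eI T g := by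
  have hfg : Measurable (Function.uncurry fun t x => f t x * g t x) := hf.mul hg
  refine iSup₂_le fun l k => ?_
  rw [← pow_two_le_pow_two_iff, mul_pow, l2_prod_sq (measurable_uncurry_conv hβ hfg)]
  set w : ℝ≥0∞ := (2 : ℝ≥0∞) ^ (-(l : ℝ) / 2)
  have hw : w ^ 2 ≠ ⊤ := ENNReal.pow_ne_top (ENNReal.rpow_ne_top_of_ne_zero
    (by norm_num) (by norm_num))
  have hsl : ∀ t, ∀ m, (∫⁻ y in cube l (k + m), f t y * g t y) ≤
      l2 (volume.restrict (cube l (k + m))) (f t) * l2 volume (g t) := fun t m => by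
    refine (lintegral_mul_le_l2 (measurable_slice hf t).aemeasurable
      (measurable_slice hg t).aemeasurable).trans ?_
    gcongr
    rw [l2_le_iff, l2_sq]
    exact setLIntegral_le_lintegral _ _
  calc w ^ 2 * ∫⁻ t, (∫⁻ x in cube l k, conv β (fun x => f t x * g t x) x ^ 2) ∂(timeMeasure T)
      ≤ w ^ 2 * ∫⁻ t, l2 volume β ^ 2 * eI T g ^ 2 * ((box d 1).card *
          ∑ m ∈ box d 1, ∫⁻ y in cube l (k + m), f t y ^ 2) ∂(timeMeasure T) := by
        refine mul_le_mul' le_rfl ?_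
        refine lintegral_mono_ae ((ae_le_eI T g).mono fun t hgt => ?_)
        refine (conv_sq_restrict_le hβ (measurable_slice hfg t) hs).trans ?_
        rw [l2_sq, mul_assoc]
        refine mul_le_mul' le_rfl ?_
        calc (∑ m ∈ box d 1, ∫⁻ y in cube l (k + m), f t y * g t y) ^ 2
            ≤ (∑ m ∈ box d 1, l2 (volume.restrict (cube l (k + m))) (f t) * eI T g) ^ 2 := by
              gcongr with m _
              exact (hsl t m).trans (by gcongr)
          _ = eI T g ^ 2 * (∑ m ∈ box d 1, l2 (volume.restrict (cube l (k + m))) (f t)) ^ 2 := by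
              rw [← Finset.sum_mul]; ring
          _ ≤ eI T g ^ 2 * ((box d 1).card *
                ∑ m ∈ box d 1, l2 (volume.restrict (cube l (k + m))) (f t) ^ 2) := by
              gcongr
              exact sum_sq_le_card_mul _ _
          _ = _ := by simp_rw [l2_sq]
    _ = w ^ 2 * (l2 volume β ^ 2 * eI T g ^ 2 * ((box d 1).card *
          ∑ m ∈ box d 1, l2 ((timeMeasure T).prod (volume.restrict (cube l (k + m))))
            (Function.uncurry f) ^ 2)) := by
        have hm2 : ∀ m, Measurable fun t => ∫⁻ y in cube l (k + m), f t y ^ 2 := fun m =>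
          Measurable.lintegral_prod_right' (hf.pow_const 2)
        rw [lintegral_const_mul _ ((Finset.measurable_fun_sum _ fun m _ => hm2 m).const_mul _),
          lintegral_const_mul _ (Finset.measurable_fun_sum _ fun m _ => hm2 m),
          lintegral_finsetSum _ fun m _ => hm2 m]
        simp_rw [l2_prod_sq hf]
    _ = l2 volume β ^ 2 * eI T g ^ 2 * ((box d 1).card *
          ∑ m ∈ box d 1, (w * l2 ((timeMeasure T).prod (volume.restrict (cube l (k + m))))
            (Function.uncurry f)) ^ 2) := by
        simp_rw [mul_pow, ← Finset.mul_sum]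
        ring
    _ ≤ l2 volume β ^ 2 * eI T g ^ 2 * ((box d 1).card * ((box d 1).card * eX T f ^ 2)) := by
        gcongr
        rw [← nsmul_eq_mul]
        refine Finset.sum_le_card_nsmul _ _ _ fun m _ => ?_
        gcongr
        exact le_eX _ _ _ _
    _ = _ := by ring

theorem eN_conv_mul_le (T : ℝ) (j : ℕ) {β : Space d → ℝ≥0∞} {f g : ℝ → Space d → ℝ≥0∞}
    (hβ : Measurable β) (hf : Measurable (Function.uncurry f))
    (hg : Measurable (Function.uncurry g)) (hs : ∀ y, β y ≠ 0 → ‖y‖ ≤ 1) :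
    eN T j (fun t => conv β (fun x => f t x * g t x)) ≤
      (box d 1).card * l2 volume β * eN T j f * eI T g := by
  unfold eN
  calc _ ≤ (2 : ℝ≥0∞) ^ ((j : ℝ) / 2) * ((box d 1).card * l2 volume β * eX T f * eI T g) +
        (box d 1).card * (l2 volume β * eI T f * eI T g) := by
        gcongr
        · exact eX_conv_mul_le T hβ hf hg hs
        · exact (eI_conv_mul_le T hβ hf hg).trans (le_mul_of_one_le_left' (one_le_card_box d 1))
    _ = _ := by ring

theorem cut_conv_le {β : Space d → ℝ≥0∞} (hs : ∀ y, β y ≠ 0 → ‖y‖ ≤ 1)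
    (hβ : Measurable β) {h : ℝ → Space d → ℝ≥0∞} (hm : Measurable (Function.uncurry h)) (j : ℕ)
    (k : Fin d → ℤ) (t : ℝ) (x : Space d) :
    cut j k (fun t => conv β (h t)) t x ≤ ∑ m ∈ box d 1, conv β (cut j (k + m) h t) x := by
  by_cases hx : x ∈ cube j k
  swap
  · rw [cut_apply_of_notMem hx]; exact zero_le
  rw [cut_apply_of_mem hx]
  unfold conv
  rw [← lintegral_finsetSum]
  swap
  · intro m _
    have := measurable_slice (measurable_cut hm j (k + m)) t
    fun_prop
  refine lintegral_mono fun y => ?_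
  by_cases hy : β y = 0
  · simp [hy]
  rw [← Finset.mul_sum]
  gcongr
  have hmem := cubeIdx_sub_mem_of_norm_le (l := j) (x := x) (hs y hy)
  rw [← mem_cube_iff_eq.1 hx] at hmem
  rw [← cut_apply_of_mem (h := h) (t := t) (mem_cube_cubeIdx j (x - y))]
  refine le_trans ?_ (Finset.single_le_sum
    (f := fun m => cut j (k + m) h t (x - y)) (fun _ _ => zero_le) hmem)
  simp

theorem cut_mul (j : ℕ) (k : Fin d → ℤ) (f g : ℝ → Space d → ℝ≥0∞) :
    cut j k (fun t x => f t x * g t x) = fun t x => cut j k f t x * g t x := by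
  ext t x
  by_cases hx : x ∈ cube j k
  · simp only [cut_apply_of_mem hx]
  · simp only [cut_apply_of_notMem hx, zero_mul]

/-- The cutoff to a cube is put on `f` only: `f` carries the sum over cubes, and `g` enters just
through L^∞L². -/
theorem eY_conv_mul_le (T : ℝ) (j : ℕ) {β : Space d → ℝ≥0∞} {f g : ℝ → Space d → ℝ≥0∞}
    (hβ : Measurable β) (hf : Measurable (Function.uncurry f))
    (hg : Measurable (Function.uncurry g)) (hs : ∀ y, β y ≠ 0 → ‖y‖ ≤ 1) :
    eY T j (fun t => conv β (fun x => f t x * g t x)) ≤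
      (box d 1).card * (box d 1).card * l2 volume β * eY T j f * eI T g := by
  have hfg : Measurable (Function.uncurry fun t x => f t x * g t x) := hf.mul hg
  have h1 := (isConvNorm_eN T j).cubeSum_le_of_near (j := j) (R := 1)
    (G := fun k t => conv β (cut j k (fun t x => f t x * g t x) t))
    (fun k => measurable_uncurry_conv hβ (measurable_cut hfg j k)) (cut_conv_le hs hβ hfg j)
  refine h1.trans ?_
  simp_rw [cut_mul]
  calc _ ≤ ((box d 1).card : ℝ≥0∞) * ∑' k, (box d 1).card * l2 volume β * eN T j (cut j k f) *
        eI T g := by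
        gcongr with k
        exact eN_conv_mul_le T j hβ (measurable_cut hf j k) hg hs
    _ = _ := by
        rw [ENNReal.tsum_mul_right, ENNReal.tsum_mul_left]
        unfold eY cubeSum
        ring

/-- Bernstein's inequality L² → L^∞ in each cube, using only the L^∞L² part of the norm of X_j. -/
theorem cubeSum_eS_conv_le (T : ℝ) (j : ℕ) {β : Space d → ℝ≥0∞} {f : ℝ → Space d → ℝ≥0∞}
    (hβ : Measurable β) (hf : Measurable (Function.uncurry f)) (hs : ∀ y, β y ≠ 0 → ‖y‖ ≤ 1) :
    cubeSum (eS T) j (fun t => conv β (f t)) ≤ (box d 1).card * l2 volume β * eY T j f := by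
  have h1 := (isConvNorm_eS T).cubeSum_le_of_near (j := j) (R := 1)
    (G := fun k t => conv β (cut j k f t))
    (fun k => measurable_uncurry_conv hβ (measurable_cut hf j k)) (cut_conv_le hs hβ hf j)
  refine h1.trans ?_
  rw [mul_assoc]
  refine mul_le_mul' le_rfl ?_
  unfold eY cubeSum
  rw [← ENNReal.tsum_mul_left]
  refine ENNReal.tsum_le_tsum fun k => ?_
  refine essSup_le_of_ae_le _ ((ae_le_eI T (cut j k f)).mono fun t ht => iSup_le fun x => ?_)
  refine (conv_le_l2 hβ (measurable_slice (measurable_cut hf j k) t) x).trans ?_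
  refine mul_le_mul' le_rfl ?_
  exact ht.trans (eI_le_eN _ _ _)

theorem eN_mul_le (T : ℝ) (j : ℕ) (f : ℝ → Space d → ℝ≥0∞) {g : ℝ → Space d → ℝ≥0∞}
    (hg : Measurable (Function.uncurry g)) :
    eN T j (fun t x => f t x * g t x) ≤ eS T f * eN T j g := by
  unfold eN
  rw [mul_add, mul_left_comm]
  gcongr
  · unfold eX
    rw [ENNReal.mul_iSup]
    simp_rw [ENNReal.mul_iSup]
    refine iSup₂_mono fun l k => ?_
    rw [mul_left_comm, ← l2_const_mul _ hg]
    gcongr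
    refine l2_mono_ae ?_
    have h1 : ∀ᵐ p ∂(timeMeasure T).prod (volume.restrict (cube l k)), ∀ x, f p.1 x ≤ eS T f :=
      Measure.quasiMeasurePreserving_fst.ae (ae_le_eS T f)
    exact h1.mono fun p hp => mul_le_mul' (hp p.2) le_rfl
  · refine essSup_le_of_ae_le _ ?_
    filter_upwards [ae_le_eI T g, ae_le_eS T f] with t ht hf
    calc l2 volume (fun x => f t x * g t x) ≤ l2 volume (fun x => eS T f * g t x) :=
          l2_mono fun x => mul_le_mul' (hf x) le_rfl
      _ = eS T f * l2 volume (g t) := l2_const_mul _ (measurable_slice hg t)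
      _ ≤ _ := by gcongr

/-- Hölder with the sum over cubes charged to the factor in the supremum norm. -/
theorem eY_mul_le (T : ℝ) (j : ℕ) (f : ℝ → Space d → ℝ≥0∞) {g : ℝ → Space d → ℝ≥0∞}
    (hg : Measurable (Function.uncurry g)) :
    eY T j (fun t x => f t x * g t x) ≤ cubeSum (eS T) j f * eN T j g := by
  unfold eY cubeSum
  rw [← ENNReal.tsum_mul_right]
  refine ENNReal.tsum_le_tsum fun k => ?_
  rw [cut_mul]
  exact eN_mul_le T j _ hg

end

section

variable {d : ℕ}

/-! ### The model kernels -/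

theorem lintegral_comp_smul_of_pos {c : ℝ} (hc : 0 < c) {f : Space d → ℝ≥0∞} (hf : Measurable f) :
    ∫⁻ x, f (c • x) = ENNReal.ofReal ((c ^ d)⁻¹) * ∫⁻ x, f x := by
  have h1 : Measurable fun x : Space d => c • x := measurable_const_smul c
  rw [← lintegral_map hf h1, Measure.map_addHaar_smul _ hc.ne', lintegral_smul_measure]
  simp only [finrank_euclideanSpace, Fintype.card_fin]
  rw [abs_of_pos (by positivity)]
  rfl

/-- The model kernel `2^{kd} (1 + 2^k |x|)^{-(d+1)}`. -/
def wt (k : ℕ) (x : Space d) : ℝ≥0∞ :=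
  ENNReal.ofReal (((2 : ℝ) ^ k) ^ d * ((1 + ‖(2 : ℝ) ^ k • x‖) ^ (d + 1))⁻¹)

theorem measurable_wt (k : ℕ) : Measurable (wt k : Space d → ℝ≥0∞) := by
  unfold wt
  fun_prop

theorem lintegral_scaled (k : ℕ) {f : Space d → ℝ≥0∞} (hf : Measurable f) :
    ∫⁻ x, ENNReal.ofReal (((2 : ℝ) ^ k) ^ d) * f ((2 : ℝ) ^ k • x) = ∫⁻ x, f x := by
  have h2 : (0 : ℝ) < 2 ^ k := by positivity
  rw [lintegral_const_mul _ (show Measurable fun x => f ((2 : ℝ) ^ k • x) from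
      hf.comp (measurable_const_smul _)), lintegral_comp_smul_of_pos h2 hf,
    ← mul_assoc, ← ENNReal.ofReal_mul (by positivity), mul_inv_cancel₀ (by positivity)]
  simp

theorem wt_eq (k : ℕ) (x : Space d) :
    wt k x = ENNReal.ofReal (((2 : ℝ) ^ k) ^ d) * wt 0 ((2 : ℝ) ^ k • x) := by
  unfold wt
  rw [← ENNReal.ofReal_mul (by positivity)]
  simp

theorem lintegral_wt (k : ℕ) : ∫⁻ x : Space d, wt k x = ∫⁻ x : Space d, wt 0 x := by
  simp_rw [wt_eq k]
  exact lintegral_scaled k (measurable_wt 0)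

theorem lintegral_wt_ne_top (k : ℕ) : ∫⁻ x : Space d, wt k x ≠ ⊤ := by
  rw [lintegral_wt]
  have h := integrable_one_add_norm (E := Space d) (μ := volume) (r := (d + 1 : ℝ)) (by simp)
  have e : ∀ x : Space d, wt 0 x = ENNReal.ofReal ((1 + ‖x‖) ^ (-(d + 1 : ℝ))) := fun x => by
    unfold wt
    rw [Real.rpow_neg (by positivity)]
    have : (1 + ‖x‖) ^ (d + 1 : ℝ) = (1 + ‖x‖) ^ (d + 1) := by
      rw [← Real.rpow_natCast]; push_cast; rfl
    rw [this]
    simp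
  simp_rw [e]
  exact (Integrable.lintegral_lt_top h).ne

/-- The mass of the model kernels. -/
def wtMass (d : ℕ) : ℝ≥0 := (∫⁻ x : Space d, wt 0 x).toNNReal

theorem lintegral_wt_eq (k : ℕ) : ∫⁻ x : Space d, wt k x = wtMass d := by
  rw [lintegral_wt, wtMass, ENNReal.coe_toNNReal (lintegral_wt_ne_top 0)]

/-- The normalized indicator function of the ball of radius `2^{-k}`. -/
def bal (k : ℕ) (x : Space d) : ℝ≥0∞ :=
  ENNReal.ofReal (((2 : ℝ) ^ k) ^ d) *
    (Metric.closedBall (0 : Space d) 1).indicator 1 ((2 : ℝ) ^ k • x)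

theorem measurable_bal (k : ℕ) : Measurable (bal k : Space d → ℝ≥0∞) := by
  unfold bal
  exact ((measurable_one.indicator Metric.isClosed_closedBall.measurableSet).comp
    (measurable_const_smul _)).const_mul _

/-- The volume of the unit ball. -/
def unitVol (d : ℕ) : ℝ≥0 := (volume (Metric.closedBall (0 : Space d) 1)).toNNReal

theorem coe_unitVol (d : ℕ) : (unitVol d : ℝ≥0∞) = volume (Metric.closedBall (0 : Space d) 1) := by
  rw [unitVol, ENNReal.coe_toNNReal]
  exact (isCompact_closedBall _ _).measure_lt_top.ne

theorem unitVol_ne_zero (d : ℕ) : unitVol d ≠ 0 := by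
  have : (unitVol d : ℝ≥0∞) ≠ 0 := by
    rw [coe_unitVol]
    exact (Metric.measure_closedBall_pos _ _ one_pos).ne'
  exact_mod_cast this

theorem bal_eq_of_ne_zero {k : ℕ} {x : Space d} (h : bal k x ≠ 0) : ‖(2 : ℝ) ^ k • x‖ ≤ 1 := by
  by_contra H
  apply h
  unfold bal
  rw [Set.indicator_of_notMem (by simpa using H), mul_zero]

theorem norm_le_of_bal_ne_zero {k : ℕ} {x : Space d} (h : bal k x ≠ 0) : ‖x‖ ≤ 1 := by
  have h1 := bal_eq_of_ne_zero h
  rw [norm_smul, Real.norm_of_nonneg (by positivity)] at h1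
  refine le_trans ?_ h1
  exact le_mul_of_one_le_left (norm_nonneg _) (one_le_pow₀ (by norm_num))

theorem lintegral_bal (k : ℕ) : ∫⁻ x : Space d, bal k x = unitVol d := by
  unfold bal
  rw [lintegral_scaled k (measurable_one.indicator Metric.isClosed_closedBall.measurableSet),
    lintegral_indicator_one Metric.isClosed_closedBall.measurableSet, coe_unitVol]

theorem l2_bal (k : ℕ) : l2 volume (bal k : Space d → ℝ≥0∞) =
    (2 : ℝ≥0∞) ^ ((k : ℝ) * d / 2) * (unitVol d : ℝ≥0∞) ^ (1 / 2 : ℝ) := by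
  have h : ∫⁻ x : Space d, bal k x ^ 2 = (2 : ℝ≥0∞) ^ ((k : ℝ) * d) * unitVol d := by
    have e2 : ENNReal.ofReal (((2 : ℝ) ^ k) ^ d) = (2 : ℝ≥0∞) ^ ((k : ℝ) * d) := by
      rw [← pow_mul, ENNReal.ofReal_pow (by norm_num), ← Nat.cast_mul, ENNReal.rpow_natCast]
      norm_num
    have e : ∀ x : Space d, bal k x ^ 2 = (2 : ℝ≥0∞) ^ ((k : ℝ) * d) * bal k x := fun x => by
      by_cases hx : bal k x = 0
      · simp [hx]
      · have := bal_eq_of_ne_zero hx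
        unfold bal
        rw [Set.indicator_of_mem (by simpa using this), e2]
        simp [sq]
    simp_rw [e]
    rw [lintegral_const_mul _ (measurable_bal k), lintegral_bal]
  rw [l2, h, ENNReal.mul_rpow_of_nonneg _ _ (by norm_num), ← ENNReal.rpow_mul]
  congr 2
  ring

/-- The weight is essentially constant at scale 2^(-k): moving by |y| ≤ 2^(-k) at most doubles 1 +
2^k|x|. Hence the kernel with tails is dominated by its convolution with a ball, and the estimates
for kernels supported in the unit ball apply. -/
theorem wt_mul_unitVol_le (k : ℕ) (x : Space d) :
    wt k x * unitVol d ≤ 2 ^ (d + 1) * conv (wt k) (bal k) x := by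
  rw [conv_comm, ← lintegral_bal k, ← lintegral_const_mul _ (measurable_bal k)]
  unfold conv
  rw [← lintegral_const_mul' _ _ (by simp)]
  refine lintegral_mono fun y => ?_
  by_cases hy : bal k y = 0
  · simp [hy]
  rw [mul_left_comm, mul_comm (wt k x)]
  gcongr
  have h1 := bal_eq_of_ne_zero hy
  have e : (2 : ℝ≥0∞) ^ (d + 1) = ENNReal.ofReal ((2 : ℝ) ^ (d + 1)) := by
    rw [ENNReal.ofReal_pow (by norm_num)]; norm_num
  unfold wt
  rw [e, ← ENNReal.ofReal_mul (by positivity)]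
  apply ENNReal.ofReal_le_ofReal
  rw [mul_left_comm]
  gcongr
  rw [inv_le_iff_one_le_mul₀ (by positivity), mul_assoc, ← div_eq_inv_mul, mul_div,
    le_div_iff₀ (by positivity), one_mul, ← mul_pow]
  gcongr
  have := norm_sub_le ((2 : ℝ) ^ k • x) ((2 : ℝ) ^ k • y)
  rw [smul_sub]
  linarith [norm_nonneg ((2 : ℝ) ^ k • x)]

theorem conv_wt_le (k : ℕ) {F : Space d → ℝ≥0∞} (hF : Measurable F) (x : Space d) :
    conv (wt k) F x ≤
      (2 ^ (d + 1) * (unitVol d)⁻¹ : ℝ≥0) * conv (wt k) (conv (bal k) F) x := by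
  have hv := unitVol_ne_zero d
  rw [← conv_assoc (measurable_wt k) (measurable_bal k) hF, ← const_mul_conv _ ENNReal.coe_ne_top]
  refine conv_mono (fun y => ?_) (fun _ => le_rfl) x
  have h := wt_mul_unitVol_le k y
  rw [ENNReal.coe_mul, ENNReal.coe_inv hv, mul_right_comm, ← div_eq_mul_inv,
    ENNReal.le_div_iff_mul_le (by simp [hv]) (by simp)]
  exact_mod_cast h

/-- The tails are removed by `conv_wt_le` and `eY_conv_le` without loss; the factor 2^(kd/2) is the
L² norm of the normalized ball. -/
theorem eY_conv_wt_mul_le (d : ℕ) : ∃ C : ℝ≥0, ∀ (T : ℝ) (k : ℕ) (f g : ℝ → Space d → ℝ≥0∞),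
    Measurable (Function.uncurry f) → Measurable (Function.uncurry g) →
      eY T k (fun t => conv (wt k) (fun x => f t x * g t x)) ≤
        C * (2 : ℝ≥0∞) ^ ((k : ℝ) * d / 2) * eY T k f * eI T g := by
  set K : ℝ≥0 := Nat.cast (box d 1).card
  have hK : ((box d 1).card : ℝ≥0∞) = K := by simp [K]
  refine ⟨2 ^ (d + 1) * (unitVol d)⁻¹ * (K * K * wtMass d * (K * K * (unitVol d) ^ (1 / 2 : ℝ))),
    fun T k f g hf hg => ?_⟩
  have hfg : Measurable (Function.uncurry fun t x => f t x * g t x) := hf.mul hg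
  have hb := measurable_uncurry_conv (measurable_bal k) hfg
  set A : ℝ≥0 := 2 ^ (d + 1) * (unitVol d)⁻¹
  calc _ ≤ eY T k (fun t x => conv (wt k)
        (fun z => (A : ℝ≥0∞) * conv (bal k) (fun x => f t x * g t x) z) x) := by
        refine eY_mono T k fun t x => ?_
        rw [conv_const_mul _ (by simp)]
        exact conv_wt_le k (measurable_slice hfg t) x
    _ ≤ K * K * wtMass d * eY T k (fun t z => (A : ℝ≥0∞) *
          conv (bal k) (fun x => f t x * g t x) z) := by
        have := eY_conv_le T k (measurable_wt k) (h := fun t z => (A : ℝ≥0∞) *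
          conv (bal k) (fun x => f t x * g t x) z) (hb.const_mul (A : ℝ≥0∞))
        rw [lintegral_wt_eq, hK] at this
        exact this
    _ = K * K * wtMass d * eY T k (fun t => conv (fun z => (A : ℝ≥0∞) * bal k z)
          (fun x => f t x * g t x)) := by
        congr 2
        ext t z
        rw [const_mul_conv _ (by simp)]
    _ ≤ K * K * wtMass d * (K * K * l2 volume (fun z : Space d => (A : ℝ≥0∞) * bal k z) *
          eY T k f * eI T g) := by
        gcongr
        rw [← hK]
        refine eY_conv_mul_le T k ((measurable_bal k).const_mul _) hf hg fun y hy => ?_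
        exact norm_le_of_bal_ne_zero (right_ne_zero_of_mul hy)
    _ = _ := by
        rw [l2_const_mul _ (measurable_bal k), l2_bal]
        push_cast
        rw [ENNReal.coe_rpow_of_nonneg _ (by norm_num)]
        ring

/-- The low factor is bounded in L^∞ at its own level, where Bernstein costs 2^(id/2). Its cubes are
then merged to those of level `k`, which is free because no weight is attached to the supremum norm.
-/
theorem eY_conv_wt_mul_le_of_le (d : ℕ) : ∃ C : ℝ≥0, ∀ (T : ℝ) (i k : ℕ)
    (f g : ℝ → Space d → ℝ≥0∞), i ≤ k →
    Measurable (Function.uncurry f) → Measurable (Function.uncurry g) →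
      eY T k (fun t x => conv (wt i) (f t) x * g t x) ≤
        C * (2 : ℝ≥0∞) ^ ((i : ℝ) * d / 2) * eY T i f * eN T k g := by
  set K : ℝ≥0 := Nat.cast (box d 1).card
  have hK : ((box d 1).card : ℝ≥0∞) = K := by simp [K]
  refine ⟨2 ^ (d + 1) * (unitVol d)⁻¹ * (K * K * wtMass d * (K * (unitVol d) ^ (1 / 2 : ℝ))),
    fun T i k f g hik hf hg => ?_⟩
  have hb := measurable_uncurry_conv (measurable_bal i) hf
  set A : ℝ≥0 := 2 ^ (d + 1) * (unitVol d)⁻¹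
  have hS := isConvNorm_eS (d := d) T
  have hmain : cubeSum (eS T) k (fun t => conv (wt i) (f t)) ≤
      K * K * wtMass d * (K * l2 volume (fun z : Space d => (A : ℝ≥0∞) * bal i z) * eY T i f) := by
    calc cubeSum (eS T) k (fun t => conv (wt i) (f t))
        ≤ cubeSum (eS T) i (fun t => conv (wt i) (f t)) := by
          obtain ⟨m, rfl⟩ := Nat.exists_eq_add_of_le hik
          exact hS.cubeSum_add_le (measurable_uncurry_conv (measurable_wt i) hf) i m
      _ ≤ cubeSum (eS T) i (fun t x => conv (wt i)
            (fun z => (A : ℝ≥0∞) * conv (bal i) (f t) z) x) := by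
          refine hS.cubeSum_mono (fun t x => ?_) i
          rw [conv_const_mul _ (by simp)]
          exact conv_wt_le i (measurable_slice hf t) x
      _ ≤ K * K * wtMass d * cubeSum (eS T) i (fun t z => (A : ℝ≥0∞) * conv (bal i) (f t) z) := by
          have := hS.cubeSum_conv_le (measurable_wt i) (h := fun t z => (A : ℝ≥0∞) *
            conv (bal i) (f t) z) (hb.const_mul (A : ℝ≥0∞)) i
          rw [lintegral_wt_eq, hK] at this
          exact this
      _ = K * K * wtMass d * cubeSum (eS T) i
            (fun t => conv (fun z => (A : ℝ≥0∞) * bal i z) (f t)) := by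
          congr 2
          ext t z
          rw [const_mul_conv _ (by simp)]
      _ ≤ _ := by
          gcongr
          rw [← hK]
          refine cubeSum_eS_conv_le T i ((measurable_bal i).const_mul _) hf fun y hy => ?_
          exact norm_le_of_bal_ne_zero (right_ne_zero_of_mul hy)
  refine (eY_mul_le T k _ hg).trans ((mul_le_mul' hmain le_rfl).trans_eq ?_)
  rw [l2_const_mul _ (measurable_bal i), l2_bal]
  push_cast
  rw [ENNReal.coe_rpow_of_nonneg _ (by norm_num)]
  ring

end

section

variable {d : ℕ} {E : Type*} [NormedAddCommGroup E]

/-! ### Comparison of smooth and sharp cutoffs -/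

theorem normX_eq (T : ℝ) (f : ℝ → Space d → E) : normX T f = eX T fun t x => ‖f t x‖ₑ := by
  unfold normX eX
  simp_rw [eLpNorm_two_eq]
  rfl

theorem normXj_eq (T : ℝ) (j : ℕ) (f : ℝ → Space d → E) :
    normXj T j f = eN T j fun t x => ‖f t x‖ₑ := by
  unfold normXj eN normLinftyL2 eI
  rw [normX_eq]
  simp_rw [eLpNorm_two_eq]

namespace CubeCutoff

variable (χ : CubeCutoff d)

theorem exists_support_bound : ∃ R : ℕ, ∀ x, χ.toFun x ≠ 0 → ∀ i, |x i| ≤ R := by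
  obtain ⟨r, hr⟩ := χ.hasCompactSupport.isCompact.isBounded.subset_closedBall 0
  refine ⟨⌈r⌉₊, fun x hx i => ?_⟩
  have h1 : x ∈ Metric.closedBall (0 : Space d) r := hr (subset_tsupport _ hx)
  rw [mem_closedBall_zero_iff] at h1
  exact ((PiLp.norm_apply_le x i).trans h1).trans (Nat.le_ceil r)

theorem sub_mem_box_of_bump_ne_zero {R : ℕ} (hR : ∀ x, χ.toFun x ≠ 0 → ∀ i, |x i| ≤ R)
    {j : ℕ} {k : Fin d → ℤ} {x : Space d} (h : χ.bump j k x ≠ 0) :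
    cubeIdx j x - k ∈ box d (R + 1) := by
  rw [mem_box]
  intro i
  have h1 := hR _ h i
  simp only [PiLp.sub_apply, PiLp.smul_apply, smul_eq_mul] at h1
  rw [inv_mul_eq_div, abs_le] at h1
  have a1 := Int.floor_le (x i / 2 ^ j)
  have a2 := Int.lt_floor_add_one (x i / 2 ^ j)
  simp only [cubeIdx, Pi.sub_apply]
  have b1 : (⌊x i / 2 ^ j⌋ : ℝ) ≤ k i + R := by linarith [h1.2]
  have b2 : (k i : ℝ) < ⌊x i / 2 ^ j⌋ + 1 + R := by linarith [h1.1]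
  have b1' : ⌊x i / 2 ^ j⌋ ≤ k i + R := by exact_mod_cast b1
  have b2' : k i < ⌊x i / 2 ^ j⌋ + 1 + R := by exact_mod_cast b2
  rw [abs_le]
  push_cast
  constructor <;> linarith

/-- Only boundedly many bumps of the partition meet a given cube, so the partition of unity is a
finite sum there, with a range of offsets independent of the level. -/
theorem sum_bump {R : ℕ} (hR : ∀ x, χ.toFun x ≠ 0 → ∀ i, |x i| ≤ R) {j : ℕ} {k : Fin d → ℤ}
    {x : Space d} (hx : x ∈ cube j k) : ∑ m ∈ box d (R + 1), χ.bump j (k + m) x = 1 := by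
  rw [mem_cube_iff_eq] at hx
  subst hx
  have h1 := χ.sum_eq_one (((2 : ℝ) ^ j)⁻¹ • x)
  have h2 : ∑' k, χ.bump j k x = 1 := h1
  rw [← (Equiv.addLeft (cubeIdx j x)).tsum_eq, tsum_eq_sum (s := box d (R + 1))] at h2
  · exact h2
  · intro m hm
    by_contra H
    apply hm
    have := χ.sub_mem_box_of_bump_ne_zero hR H
    rw [mem_box] at this ⊢
    intro i
    have := this i
    simpa using this

theorem bump_nonneg (j : ℕ) (k : Fin d → ℤ) (x : Space d) : 0 ≤ χ.bump j k x := χ.nonneg _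

theorem bump_le_one (j : ℕ) (k : Fin d → ℤ) (x : Space d) : χ.bump j k x ≤ 1 := by
  obtain ⟨R, hR⟩ := χ.exists_support_bound
  by_cases h : χ.bump j k x = 0
  · rw [h]; exact zero_le_one
  have hm := χ.sub_mem_box_of_bump_ne_zero hR h
  rw [← χ.sum_bump hR (mem_cube_cubeIdx j x)]
  have hm' : k - cubeIdx j x ∈ box d (R + 1) := by
    rw [mem_box] at hm ⊢
    intro i
    rw [← neg_sub, Pi.neg_apply, abs_neg]
    exact hm i
  refine le_trans ?_ (Finset.single_le_sum (f := fun m => χ.bump j (cubeIdx j x + m) x)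
    (fun _ _ => χ.bump_nonneg _ _ _) hm')
  simp

theorem measurable_bump (j : ℕ) (k : Fin d → ℤ) : Measurable (χ.bump j k) := by
  have := χ.smooth.continuous
  unfold bump
  exact this.measurable.comp (by fun_prop)

end CubeCutoff

theorem normL1Xj_eq [NormedSpace ℝ E] (χ : CubeCutoff d) (T : ℝ) (j : ℕ) (f : ℝ → Space d → E) :
    normL1Xj χ T j f =
      ∑' k, eN T j fun t x => ENNReal.ofReal (χ.bump j k x) * ‖f t x‖ₑ := by
  unfold normL1Xj
  simp_rw [normXj_eq, enorm_smul, Real.enorm_of_nonneg (χ.bump_nonneg _ _ _)]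

/-- A bump meets boundedly many cubes of its level, and a cube is covered by boundedly many bumps
which sum to one on it. The overlap is invariant under dyadic scaling, so the constant does not
depend on `j`. -/
theorem exists_normL1Xj_comparison (χ : CubeCutoff d) : ∃ C : ℝ≥0, ∀ (T : ℝ) (j : ℕ)
    (h : ℝ → Space d → ℝ≥0∞), Measurable (Function.uncurry h) →
      (∑' k, eN T j fun t x => ENNReal.ofReal (χ.bump j k x) * h t x) ≤ C * eY T j h ∧
      eY T j h ≤ C * ∑' k, eN T j fun t x => ENNReal.ofReal (χ.bump j k x) * h t x := by
  obtain ⟨R, hR⟩ := χ.exists_support_bound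
  refine ⟨Nat.cast (box d (R + 1)).card, fun T j h hm => ⟨?_, ?_⟩⟩
  · have key : ∀ k t x, ENNReal.ofReal (χ.bump j k x) * h t x ≤
        ∑ m ∈ box d (R + 1), cut j (k + 0 + m) h t x := by
      intro k t x
      by_cases hb : χ.bump j k x = 0
      · simp [hb]
      have hmem := χ.sub_mem_box_of_bump_ne_zero hR hb
      calc ENNReal.ofReal (χ.bump j k x) * h t x ≤ 1 * h t x := by
            gcongr
            exact ENNReal.ofReal_le_one.2 (χ.bump_le_one j k x)
        _ ≤ _ := by
            rw [one_mul]
            refine le_trans ?_ (Finset.single_le_sum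
              (f := fun m => cut j (k + 0 + m) h t x) (fun _ _ => zero_le) hmem)
            rw [cut_apply_of_mem]
            simpa using mem_cube_cubeIdx j x
    calc _ ≤ ∑' k, ∑ m ∈ box d (R + 1), eN T j (cut j (k + 0 + m) h) :=
          ENNReal.tsum_le_tsum fun k => le_trans ((isConvNorm_eN T j).mono (key k))
            ((isConvNorm_eN T j).sum_le _ fun m => measurable_cut hm _ _)
      _ = _ := by
          rw [tsum_sum_shift _ (fun k => eN T j (cut j k h))]
          simp [eY, cubeSum]
  · have := (isConvNorm_eN T j).cubeSum_le_of_near (j := j) (R := R + 1) (H := h)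
      (G := fun k t x => ENNReal.ofReal (χ.bump j k x) * h t x) (fun k => ?_) (fun k t x => ?_)
    · simpa [eY] using this
    · exact ((χ.measurable_bump j k).comp measurable_snd).ennreal_ofReal.mul hm
    · by_cases hx : x ∈ cube j k
      · rw [cut_apply_of_mem hx, ← Finset.sum_mul, ← ENNReal.ofReal_sum_of_nonneg
          (fun _ _ => χ.bump_nonneg _ _ _), χ.sum_bump hR hx]
        simp
      · rw [cut_apply_of_notMem hx]; exact zero_le

theorem eN_congr_ae (T : ℝ) (j : ℕ) {h h' : ℝ → Space d → ℝ≥0∞}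
    (H : ∀ᵐ t ∂timeMeasure T, ∀ x, h t x = h' t x) : eN T j h = eN T j h' := by
  have hX : eX T h = eX T h' := by
    refine iSup_congr fun l => iSup_congr fun k => ?_
    rw [l2_congr_ae]
    have h1 : ∀ᵐ p ∂(timeMeasure T).prod (volume.restrict (cube l k)), ∀ x, h p.1 x = h' p.1 x :=
      Measure.quasiMeasurePreserving_fst.ae H
    exact h1.mono fun p hp => hp p.2
  have hI : eI T h = eI T h' :=
    essSup_congr_ae (H.mono fun t ht => by simp only [funext ht])
  rw [eN, eN, hX, hI]

end

/-! ### Smoothing, pairing and frequency localization of tempered distributions -/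

section

variable {d : ℕ}

/-! ### Smoothness of parametric integrals -/

/-- The integrals of the derivatives form a Taylor series of the integral: dominated differentiation
gives each step from order n to n + 1. -/
theorem integral_smooth_family {α V H : Type*} {mα : MeasurableSpace α} {μ : Measure α}
    [NormedAddCommGroup V] [NormedSpace ℝ V] [NormedAddCommGroup H] [NormedSpace ℝ H]
    [CompleteSpace H] {F : α → V → H} (hF : ∀ x, ContDiff ℝ ∞ (F x))
    (hm : ∀ (n : ℕ) z, AEStronglyMeasurable (fun x => iteratedFDeriv ℝ n (F x) z) μ)
    (hb : ∀ (n : ℕ) (z₀ : V), ∃ b : α → ℝ, Integrable b μ ∧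
      ∀ᵐ x ∂μ, ∀ z ∈ Metric.ball z₀ 1, ‖iteratedFDeriv ℝ n (F x) z‖ ≤ b x) :
    ContDiff ℝ ∞ (fun z => ∫ x, F x z ∂μ) ∧
      ∀ (n : ℕ) (z : V), iteratedFDeriv ℝ n (fun z => ∫ x, F x z ∂μ) z =
        ∫ x, iteratedFDeriv ℝ n (F x) z ∂μ := by
  set p : V → FormalMultilinearSeries ℝ V H := fun z n => ∫ x, iteratedFDeriv ℝ n (F x) z ∂μ
  have hint : ∀ (n : ℕ) z, Integrable (fun x => iteratedFDeriv ℝ n (F x) z) μ := fun n z => by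
    obtain ⟨b, hbi, hbb⟩ := hb n z
    exact hbi.mono' (hm n z) (hbb.mono fun x hx => hx z (Metric.mem_ball_self one_pos))
  have hder : ∀ (n : ℕ) z, HasFDerivAt (fun z => p z n) (p z (n + 1)).curryLeft z := by
    intro n z
    obtain ⟨b, hbi, hbb⟩ := hb (n + 1) z
    have e : (p z (n + 1)).curryLeft =
        ∫ x, fderiv ℝ (iteratedFDeriv ℝ n (F x)) z ∂μ := by
      -- Currying is a continuous linear equivalence and therefore commutes with the integral.
      let e : (V [×(n + 1)]→L[ℝ] H) ≃L[ℝ] (V →L[ℝ] V [×n]→L[ℝ] H) :=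
        (continuousMultilinearCurryLeftEquiv ℝ (fun _ : Fin (n + 1) => V) H).toContinuousLinearEquiv
      have h1 := ContinuousLinearEquiv.integral_comp_comm (𝕜 := ℝ) (E := V [×(n + 1)]→L[ℝ] H)
        (F := V →L[ℝ] V [×n]→L[ℝ] H) e (μ := μ) (fun x => iteratedFDeriv ℝ (n + 1) (F x) z)
      refine h1.symm.trans (integral_congr_ae (Eventually.of_forall fun x => ?_))
      simp only [iteratedFDeriv_succ_eq_comp_left, Function.comp]
      exact (continuousMultilinearCurryLeftEquiv ℝ (fun _ : Fin (n + 1) => V) H).apply_symm_apply _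
    rw [e]
    refine hasFDerivAt_integral_of_dominated_of_fderiv_le
      (F' := fun z x => fderiv ℝ (iteratedFDeriv ℝ n (F x)) z) (Metric.ball_mem_nhds z one_pos)
      (Eventually.of_forall fun y => hm n y) (hint n z) ?_ ?_ hbi ?_
    · have h1 := (continuousMultilinearCurryLeftEquiv ℝ (fun _ : Fin (n + 1) => V) H
        ).continuous.comp_aestronglyMeasurable (hm (n + 1) z)
      refine h1.congr (Eventually.of_forall fun x => ?_)
      simp only [iteratedFDeriv_succ_eq_comp_left, Function.comp]
      exact (continuousMultilinearCurryLeftEquiv ℝ (fun _ : Fin (n + 1) => V) H).apply_symm_apply _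
    · refine hbb.mono fun x hx y hy => ?_
      rw [norm_fderiv_iteratedFDeriv]
      exact hx y hy
    · refine Eventually.of_forall fun x y _ => ?_
      have := (hF x).differentiable_iteratedFDeriv (m := n) (by exact_mod_cast WithTop.coe_lt_top n)
      exact (this y).hasFDerivAt
  have hT : HasFTaylorSeriesUpTo ∞ (fun z => ∫ x, F x z ∂μ) p := by
    refine ⟨fun z => ?_, fun n _ z => hder n z, fun n _ => ?_⟩
    · have h1 := (continuousMultilinearCurryFin0 ℝ V H
        ).toContinuousLinearEquiv.integral_comp_comm (μ := μ)
          (fun x => iteratedFDeriv ℝ 0 (F x) z)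
      refine h1.symm.trans (integral_congr_ae (Eventually.of_forall fun x => ?_))
      simp
    · exact continuous_iff_continuousAt.2 fun z => (hder n z).continuousAt
  refine ⟨hT.contDiff, fun n z => ?_⟩
  exact (hT.eq_iteratedFDeriv (by exact_mod_cast le_top) z).symm

/-! ### Translations of Schwartz functions -/

theorem SchwartzMap.one_add_norm_pow_mul_le {V H : Type*} [NormedAddCommGroup V] [NormedSpace ℝ V]
    [NormedAddCommGroup H] [NormedSpace ℝ H] (κ : 𝓢(V, H)) (k n : ℕ) :
    ∃ M : ℝ, 0 ≤ M ∧ ∀ z, (1 + ‖z‖) ^ k * ‖iteratedFDeriv ℝ n κ z‖ ≤ M := by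
  refine ⟨_, ?_, fun z => SchwartzMap.one_add_le_sup_seminorm_apply (𝕜 := ℝ) (m := (k, n)) le_rfl
    le_rfl κ z⟩
  positivity

theorem SchwartzMap.iteratedFDeriv_translate (κ : 𝓢(Space d, ℂ)) (n : ℕ) (y x : Space d) :
    iteratedFDeriv ℝ n (κ.compSubConstCLM ℂ y) x = iteratedFDeriv ℝ n κ (x - y) := by
  have : ⇑(κ.compSubConstCLM ℂ y) = fun x => κ (x - y) := by ext x; simp
  rw [this, iteratedFDeriv_comp_sub]

theorem SchwartzMap.seminorm_translate_le (κ : 𝓢(Space d, ℂ)) (k n : ℕ) :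
    ∃ M : ℝ, 0 ≤ M ∧ ∀ y, SchwartzMap.seminorm ℂ k n (κ.compSubConstCLM ℂ y) ≤
      M * (1 + ‖y‖) ^ k := by
  obtain ⟨M, hM, h⟩ := SchwartzMap.one_add_norm_pow_mul_le κ k n
  refine ⟨M, hM, fun y => SchwartzMap.seminorm_le_bound _ _ _ _ (by positivity) fun x => ?_⟩
  rw [SchwartzMap.iteratedFDeriv_translate]
  have h1 : ‖x‖ ≤ (1 + ‖x - y‖) * (1 + ‖y‖) := by
    have := norm_add_le (x - y) y
    rw [sub_add_cancel] at this
    nlinarith [norm_nonneg (x - y), norm_nonneg y]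
  calc ‖x‖ ^ k * ‖iteratedFDeriv ℝ n κ (x - y)‖
      ≤ ((1 + ‖x - y‖) * (1 + ‖y‖)) ^ k * ‖iteratedFDeriv ℝ n κ (x - y)‖ := by gcongr
    _ = ((1 + ‖x - y‖) ^ k * ‖iteratedFDeriv ℝ n κ (x - y)‖) * (1 + ‖y‖) ^ k := by
        rw [mul_pow]; ring
    _ ≤ _ := by gcongr; exact h _

/-- Mean value inequality on the unit ball about x, where the weight 1 + |z| is comparable with 1 +
|x|. -/
theorem SchwartzMap.seminorm_translate_sub_le (κ : 𝓢(Space d, ℂ)) (k n : ℕ) :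
    ∃ M : ℝ, 0 ≤ M ∧ ∀ y, ‖y‖ ≤ 1 →
      SchwartzMap.seminorm ℂ k n (κ.compSubConstCLM ℂ y - κ) ≤ M * ‖y‖ := by
  obtain ⟨M, hM, h⟩ := SchwartzMap.one_add_norm_pow_mul_le κ k (n + 1)
  refine ⟨2 ^ k * M, by positivity, fun y hy =>
    SchwartzMap.seminorm_le_bound _ _ _ _ (by positivity) fun x => ?_⟩
  have e : iteratedFDeriv ℝ n (κ.compSubConstCLM ℂ y - κ) x =
      iteratedFDeriv ℝ n κ (x - y) - iteratedFDeriv ℝ n κ x := by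
    have h1 : ⇑(κ.compSubConstCLM ℂ y - κ) = ⇑(κ.compSubConstCLM ℂ y) - ⇑κ := by ext; simp
    rw [h1, iteratedFDeriv_sub_apply ((SchwartzMap.smooth _ n).contDiffAt)
      ((SchwartzMap.smooth _ n).contDiffAt), SchwartzMap.iteratedFDeriv_translate]
  have hbd : ∀ z ∈ Metric.closedBall x 1,
      ‖fderiv ℝ (iteratedFDeriv ℝ n κ) z‖ ≤ 2 ^ k * M / (1 + ‖x‖) ^ k := by
    intro z hz
    rw [norm_fderiv_iteratedFDeriv, le_div_iff₀ (by positivity)]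
    rw [mem_closedBall_iff_norm'] at hz
    have h1 : 1 + ‖x‖ ≤ 2 * (1 + ‖z‖) := by
      have := norm_add_le (x - z) z
      rw [sub_add_cancel] at this
      linarith [norm_nonneg z]
    calc ‖iteratedFDeriv ℝ (n + 1) κ z‖ * (1 + ‖x‖) ^ k
        ≤ ‖iteratedFDeriv ℝ (n + 1) κ z‖ * (2 * (1 + ‖z‖)) ^ k := by gcongr
      _ = 2 ^ k * ((1 + ‖z‖) ^ k * ‖iteratedFDeriv ℝ (n + 1) κ z‖) := by rw [mul_pow]; ring
      _ ≤ _ := by gcongr; exact h z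
  have hdiff : Differentiable ℝ (iteratedFDeriv ℝ n κ) :=
    (SchwartzMap.smooth κ ⊤).differentiable_iteratedFDeriv
      (by exact_mod_cast WithTop.coe_lt_top n)
  have hmv := (convex_closedBall x 1).norm_image_sub_le_of_norm_fderiv_le
    (fun z _ => hdiff z) hbd (Metric.mem_closedBall_self zero_le_one)
    (y := x - y) (by simpa using hy)
  rw [e]
  calc ‖x‖ ^ k * ‖iteratedFDeriv ℝ n κ (x - y) - iteratedFDeriv ℝ n κ x‖
      ≤ (1 + ‖x‖) ^ k * (2 ^ k * M / (1 + ‖x‖) ^ k * ‖x - y - x‖) := by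
        gcongr
        linarith
    _ = _ := by
        rw [sub_sub_cancel_left, norm_neg]
        field_simp

/-- Translations form a group of continuous maps, so continuity at 0 suffices. -/
theorem SchwartzMap.continuous_translate (κ : 𝓢(Space d, ℂ)) :
    Continuous fun y : Space d => κ.compSubConstCLM ℂ y := by
  have h0 : Tendsto (fun y : Space d => κ.compSubConstCLM ℂ y) (𝓝 0) (𝓝 κ) := by
    rw [(schwartz_withSeminorms ℂ (Space d) ℂ).tendsto_nhds]
    intro i ε hε
    obtain ⟨M, hM, h⟩ := SchwartzMap.seminorm_translate_sub_le κ i.1 i.2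
    have h1 : ∀ᶠ y : Space d in 𝓝 0, ‖y‖ < min 1 (ε / (M + 1)) := by
      have := Metric.ball_mem_nhds (0 : Space d) (ε := min 1 (ε / (M + 1))) (by positivity)
      filter_upwards [this] with y hy using by simpa using hy
    filter_upwards [h1] with y hy
    refine (h y (hy.le.trans (min_le_left _ _))).trans_lt ?_
    have h2 : ‖y‖ < ε / (M + 1) := hy.trans_le (min_le_right _ _)
    rw [lt_div_iff₀ (by positivity)] at h2
    nlinarith [norm_nonneg y]
  rw [continuous_iff_continuousAt]
  intro y₀
  have e : (fun y : Space d => κ.compSubConstCLM ℂ y) =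
      fun y => (SchwartzMap.compSubConstCLM ℂ y₀ (κ.compSubConstCLM ℂ (y - y₀))) := by
    ext y x
    simp
  rw [e, ContinuousAt, sub_self]
  have h2 : SchwartzMap.compSubConstCLM ℂ (0 : Space d) κ = κ := by ext; simp
  rw [h2]
  refine ((SchwartzMap.compSubConstCLM ℂ y₀).continuous.tendsto κ).comp (h0.comp ?_)
  have : Tendsto (fun y : Space d => y - y₀) (𝓝 y₀) (𝓝 (y₀ - y₀)) :=
    (continuous_id.sub continuous_const).tendsto y₀
  rwa [sub_self] at this

end

section

variable {d : ℕ}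

/-! ### Convolution of a Schwartz function with a function of polynomial growth -/

/-- Measurable functions which are integrable against a negative power of `1 + |x|`. -/
def PolyIntegrable {E : Type*} [NormedAddCommGroup E] (K : ℕ) (f : Space d → E) : Prop :=
  AEStronglyMeasurable f ∧ Integrable fun x => ((1 + ‖x‖) ^ K)⁻¹ * ‖f x‖

set_option linter.unusedSectionVars false

section Smooth

variable {E : Type*} [NormedAddCommGroup E] [NormedSpace ℂ E]

theorem Integrable.polyIntegrable {f : Space d → E} (hf : Integrable f) : PolyIntegrable 0 f :=
  ⟨hf.1, by simpa using hf.norm⟩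

/-- The map `e ↦ (c ↦ c • e)`. -/
def smulConst : E →L[ℝ] ℂ →L[ℝ] E := (ContinuousLinearMap.lsmul ℝ ℂ).flip

@[simp] theorem smulConst_apply (e : E) (c : ℂ) : smulConst e c = c • e := rfl

theorem iteratedFDeriv_smul_const_translate (κ : 𝓢(Space d, ℂ)) (e : E) (x : Space d) (n : ℕ)
    (z : Space d) :
    iteratedFDeriv ℝ n (fun z => κ (z - x) • e) z =
      (smulConst e).compContinuousMultilinearMap
        (iteratedFDeriv ℝ n κ (z - x)) := by
  have h1 : (fun z => κ (z - x) • e) =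
      (smulConst e) ∘ fun z => κ (z - x) := by
    ext z; simp
  have h2 : ContDiff ℝ n fun z => κ (z - x) :=
    (κ.smooth n).comp (contDiff_id.sub contDiff_const)
  rw [h1, ContinuousLinearMap.iteratedFDeriv_comp_left _ h2.contDiffAt le_rfl,
    iteratedFDeriv_comp_sub]

theorem norm_iteratedFDeriv_smul_const_translate (κ : 𝓢(Space d, ℂ)) (e : E) (x : Space d) (n : ℕ)
    (z : Space d) :
    ‖iteratedFDeriv ℝ n (fun z => κ (z - x) • e) z‖ ≤ ‖iteratedFDeriv ℝ n κ (z - x)‖ * ‖e‖ := by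
  rw [iteratedFDeriv_smul_const_translate]
  refine (ContinuousLinearMap.norm_compContinuousMultilinearMap_le _ _).trans ?_
  rw [mul_comm]
  gcongr
  refine ContinuousLinearMap.opNorm_le_bound _ (norm_nonneg _) fun c => ?_
  simp [norm_smul, mul_comm]

theorem PolyIntegrable.exists_bound {K : ℕ} {f : Space d → E} (hf : PolyIntegrable K f)
    (κ : 𝓢(Space d, ℂ)) (n : ℕ) (z₀ : Space d) : ∃ b : Space d → ℝ, Integrable b ∧
      ∀ x, ∀ z ∈ Metric.ball z₀ 1, ‖iteratedFDeriv ℝ n κ (z - x)‖ * ‖f x‖ ≤ b x := by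
  obtain ⟨M, hM, h⟩ := SchwartzMap.one_add_norm_pow_mul_le κ K n
  refine ⟨_, hf.2.const_mul (M * (2 + ‖z₀‖) ^ K), fun x z hz => ?_⟩
  have h1 : 1 + ‖x‖ ≤ (2 + ‖z₀‖) * (1 + ‖z - x‖) := by
    rw [mem_ball_iff_norm] at hz
    have h2 := norm_sub_le (z - z₀) (z - x)
    have h3 := norm_add_le (z - z₀ - (z - x)) z₀
    have h4 : z - z₀ - (z - x) + z₀ = x := by abel
    rw [h4] at h3
    nlinarith [norm_nonneg z₀, norm_nonneg (z - x)]
  rw [← mul_assoc]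
  gcongr
  rw [← div_eq_mul_inv, le_div_iff₀ (by positivity)]
  calc ‖iteratedFDeriv ℝ n κ (z - x)‖ * (1 + ‖x‖) ^ K
      ≤ ‖iteratedFDeriv ℝ n κ (z - x)‖ * ((2 + ‖z₀‖) * (1 + ‖z - x‖)) ^ K := by gcongr
    _ = (2 + ‖z₀‖) ^ K * ((1 + ‖z - x‖) ^ K * ‖iteratedFDeriv ℝ n κ (z - x)‖) := by
        rw [mul_pow]; ring
    _ ≤ (2 + ‖z₀‖) ^ K * M := by gcongr; exact h _
    _ = _ := mul_comm _ _

theorem isBoundedBilinearMap_compContinuousMultilinearMap (n : ℕ) :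
    IsBoundedBilinearMap ℝ fun p : (ℂ →L[ℝ] E) × (Space d [×n]→L[ℝ] ℂ) =>
        p.1.compContinuousMultilinearMap p.2 :=
      { add_left := fun _ _ _ => by ext; simp
        smul_left := fun _ _ _ => by ext; rfl
        add_right := fun _ _ _ => by ext; simp
        smul_right := fun c A B => by ext v; exact A.map_smul c (B v)
        bound := ⟨1, one_pos, fun A B => by
          rw [one_mul]; exact ContinuousLinearMap.norm_compContinuousMultilinearMap_le A B⟩ }

theorem continuous_smulConst_comp (n : ℕ) : Continuous fun p : (Space d [×n]→L[ℝ] ℂ) × E =>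
    (smulConst p.2).compContinuousMultilinearMap p.1 := by
  have h3 : Continuous fun p : (Space d [×n]→L[ℝ] ℂ) × E => (smulConst p.2, p.1) :=
    (smulConst.continuous.comp continuous_snd).prodMk continuous_fst
  exact (isBoundedBilinearMap_compContinuousMultilinearMap n).continuous.comp h3

theorem stronglyMeasurable_smulConst_comp {n : ℕ} {g : Space d → (Space d [×n]→L[ℝ] ℂ) × E}
    (hg : StronglyMeasurable g) :
    StronglyMeasurable fun x => (smulConst (g x).2).compContinuousMultilinearMap (g x).1 := by
  have := (continuous_smulConst_comp (d := d) (E := E) n).comp_stronglyMeasurable hg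
  exact this

theorem PolyIntegrable.aestronglyMeasurable_iteratedFDeriv {K : ℕ} {f : Space d → E}
    (hf : PolyIntegrable K f) (κ : 𝓢(Space d, ℂ)) (n : ℕ) (z : Space d) :
    AEStronglyMeasurable (fun x => iteratedFDeriv ℝ n (fun z => κ (z - x) • f x) z) := by
  rw [funext fun x => iteratedFDeriv_smul_const_translate κ (f x) x n z]
  have h4 : Continuous fun x => iteratedFDeriv ℝ n κ (z - x) :=
    ((κ.smooth n).continuous_iteratedFDeriv (m := n) le_rfl).comp (by fun_prop)
  have h5 : AEStronglyMeasurable (fun x => (iteratedFDeriv ℝ n κ (z - x), f x)) volume :=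
    AEStronglyMeasurable.prodMk h4.aestronglyMeasurable hf.1
  obtain ⟨g, hg, hae⟩ := h5
  refine ⟨fun x => (smulConst (g x).2).compContinuousMultilinearMap (g x).1,
    stronglyMeasurable_smulConst_comp hg, ?_⟩
  filter_upwards [hae] with x hx
  rw [← hx]

theorem PolyIntegrable.smooth_conv [CompleteSpace E] {K : ℕ} {f : Space d → E}
    (hf : PolyIntegrable K f) (κ : 𝓢(Space d, ℂ)) :
    ContDiff ℝ ∞ (fun z => ∫ x, κ (z - x) • f x) ∧
      ∀ (n : ℕ) (z : Space d), iteratedFDeriv ℝ n (fun z => ∫ x, κ (z - x) • f x) z =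
        ∫ x, iteratedFDeriv ℝ n (fun z => κ (z - x) • f x) z := by
  refine integral_smooth_family (fun x => ?_)
    (fun n z => hf.aestronglyMeasurable_iteratedFDeriv κ n z) fun n z₀ => ?_
  · exact ((κ.smooth ⊤).comp (contDiff_id.sub contDiff_const)).smul contDiff_const
  · obtain ⟨b, hb, h⟩ := hf.exists_bound κ n z₀
    exact ⟨b, hb, Eventually.of_forall fun x z hz =>
      (norm_iteratedFDeriv_smul_const_translate _ _ _ _ _).trans (h x z hz)⟩

theorem PolyIntegrable.enorm_iteratedFDeriv_le [CompleteSpace E] {K : ℕ} {f : Space d → E}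
    (hf : PolyIntegrable K f) (κ : 𝓢(Space d, ℂ)) (n : ℕ) (z : Space d) :
    ‖iteratedFDeriv ℝ n (fun z => ∫ x, κ (z - x) • f x) z‖ₑ ≤
      conv (fun y => ‖iteratedFDeriv ℝ n κ y‖ₑ) (fun x => ‖f x‖ₑ) z := by
  rw [(hf.smooth_conv κ).2 n z, conv_comm]
  refine (enorm_integral_le_lintegral_enorm _).trans (lintegral_mono fun x => ?_)
  beta_reduce
  rw [mul_comm, ← enorm_norm (iteratedFDeriv ℝ n κ _), ← enorm_norm (f x), ← enorm_mul,
    ← enorm_norm (iteratedFDeriv ℝ n _ z)]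
  refine enorm_le_iff_norm_le.2 ?_
  simpa using norm_iteratedFDeriv_smul_const_translate κ (f x) x n z

end Smooth

/-! ### Pairing a distribution with translates -/

/-- The Schwartz function `x ↦ ∫ θ(y) κ(x - y) dy`. -/
def sconv (θ κ : 𝓢(Space d, ℂ)) : 𝓢(Space d, ℂ) :=
  SchwartzMap.convolution (ContinuousLinearMap.lsmul ℂ ℂ) θ κ

theorem sconv_apply (θ κ : 𝓢(Space d, ℂ)) (z : Space d) :
    sconv θ κ z = ∫ x, κ (z - x) • θ x := by
  rw [sconv, SchwartzMap.convolution_apply]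
  refine integral_congr_ae (Eventually.of_forall fun x => ?_)
  simp [mul_comm]

theorem fourier_sconv (θ κ : 𝓢(Space d, ℂ)) (ξ : Space d) :
    𝓕 (sconv θ κ) ξ = 𝓕 θ ξ * 𝓕 κ ξ := by
  rw [sconv, SchwartzMap.fourier_convolution]
  rfl

theorem TemperedDistribution.exists_bound {E : Type*} [NormedAddCommGroup E] [NormedSpace ℂ E]
    (U : 𝓢'(Space d, E)) :
    ∃ (s : Finset (ℕ × ℕ)) (C : ℝ≥0), ∀ ψ, ‖U ψ‖ ≤ C * (s.sup (schwartzSeminormFamily ℂ (Space d) ℂ)) ψ := by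
  have hc : Continuous fun ψ : 𝓢(Space d, ℂ) => U ψ := map_continuous U
  set q : Seminorm ℂ 𝓢(Space d, ℂ) := (normSeminorm ℂ E).comp
    ({ toFun := U, map_add' := map_add U, map_smul' := map_smul U } : 𝓢(Space d, ℂ) →ₗ[ℂ] E)
  have hq : Continuous q := hc.norm
  obtain ⟨s, C, -, h⟩ := Seminorm.bound_of_continuous (schwartz_withSeminorms ℂ (Space d) ℂ) q hq
  exact ⟨s, C, fun ψ => h ψ⟩

end

section

variable {d : ℕ}

/-! ### Integrals of test functions inside a tempered distribution -/

/-- If a linear map is dominated by another one with values in a Banach space, it commutes with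
the integrals which the latter commutes with. -/
theorem eq_integral_of_norm_le {α X B E : Type*} {mα : MeasurableSpace α} {μ : Measure α}
    [AddCommGroup X] [Module ℂ X] [NormedAddCommGroup B] [NormedSpace ℂ B] [CompleteSpace B]
    [NormedAddCommGroup E] [NormedSpace ℂ E] [CompleteSpace E]
    (J : X →ₗ[ℂ] B) (U : X →ₗ[ℂ] E) (C : ℝ) (hU : ∀ ψ, ‖U ψ‖ ≤ C * ‖J ψ‖) (γ : α → X)
    (hγ : Integrable (fun a => J (γ a)) μ) (ψ : X) (hψ : J ψ = ∫ a, J (γ a) ∂μ) :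
    Integrable (fun a => U (γ a)) μ ∧ U ψ = ∫ a, U (γ a) ∂μ := by
  set R : Submodule ℂ B := (LinearMap.range J).topologicalClosure
  have hR : IsClosed (R : Set B) := Submodule.isClosed_topologicalClosure _
  have : CompleteSpace R := hR.completeSpace_coe
  have hmem : ∀ ψ, J ψ ∈ R := fun ψ =>
    Submodule.le_topologicalClosure _ (LinearMap.mem_range_self J ψ)
  let Jr : X →ₗ[ℂ] R := J.codRestrict R hmem
  have hd : DenseRange Jr := by
    intro x
    rw [closure_subtype]
    have h1 : (x : B) ∈ closure (LinearMap.range J : Set B) := x.2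
    refine closure_mono ?_ h1
    rintro _ ⟨y, rfl⟩
    exact ⟨Jr y, ⟨y, rfl⟩, rfl⟩
  have hb : ∃ C, ∀ ψ, ‖U ψ‖ ≤ C * ‖Jr ψ‖ := ⟨C, hU⟩
  have hint : Integrable (fun a => Jr (γ a)) μ := by
    refine ⟨?_, ?_⟩
    · exact (Topology.IsEmbedding.subtypeVal.aestronglyMeasurable_comp_iff).1 hγ.1
    · have := hγ.2
      simpa [HasFiniteIntegral] using! this
  have he : Jr ψ = ∫ a, Jr (γ a) ∂μ := by
    apply Subtype.ext
    have h2 := R.subtypeL.integral_comp_comm hint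
    exact hψ.trans h2
  -- By the bound, `U` factors through `J` and extends to a bounded operator on the closure of the
  -- range, and bounded operators commute with Bochner integrals.
  have hV : ∀ ψ, U.extendOfNorm Jr (Jr ψ) = U ψ := LinearMap.extendOfNorm_eq hd hb
  have h3 := (U.extendOfNorm Jr).integrable_comp hint
  have h4 := (U.extendOfNorm Jr).integral_comp_comm hint
  simp only [hV] at h3 h4
  refine ⟨h3, ?_⟩
  rw [h4, ← he, hV]

/-- Indices of the weighted derivatives `‖x‖ ^ k * D^n ψ(x)(v)` with `(k, n) ∈ s`. -/
structure JetIndex (d : ℕ) (s : Finset (ℕ × ℕ)) where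
  order : s
  pt : Space d
  dir : Fin order.1.2 → Space d
  dir_le : ∀ i, ‖dir i‖ ≤ 1

/-- With the discrete topology the bounded continuous functions are all bounded functions, so that
`jets` takes values in an ℓ^∞ space. -/
instance (s : Finset (ℕ × ℕ)) : TopologicalSpace (JetIndex d s) := ⊥

instance (s : Finset (ℕ × ℕ)) : DiscreteTopology (JetIndex d s) := ⟨rfl⟩

/-- A weighted derivative. -/
def jetEval {s : Finset (ℕ × ℕ)} (a : JetIndex d s) (ψ : 𝓢(Space d, ℂ)) : ℂ :=
  ((‖a.pt‖ ^ a.order.1.1 : ℝ) : ℂ) * iteratedFDeriv ℝ a.order.1.2 ψ a.pt a.dir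

theorem jetEval_add {s : Finset (ℕ × ℕ)} (a : JetIndex d s) (ψ₁ ψ₂ : 𝓢(Space d, ℂ)) :
    jetEval a (ψ₁ + ψ₂) = jetEval a ψ₁ + jetEval a ψ₂ := by
  have : ⇑(ψ₁ + ψ₂) = ⇑ψ₁ + ⇑ψ₂ := rfl
  rw [jetEval, this, iteratedFDeriv_add_apply (ψ₁.smooth _).contDiffAt (ψ₂.smooth _).contDiffAt]
  exact mul_add _ _ _

theorem jetEval_smul {s : Finset (ℕ × ℕ)} (a : JetIndex d s) (c : ℂ) (ψ : 𝓢(Space d, ℂ)) :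
    jetEval a (c • ψ) = c * jetEval a ψ := by
  have : ⇑(c • ψ) = c • ⇑ψ := rfl
  rw [jetEval, this, iteratedFDeriv_const_smul_apply (ψ.smooth _).contDiffAt,
    smul_apply, smul_eq_mul, mul_left_comm]
  rfl

theorem norm_jetEval_le {s : Finset (ℕ × ℕ)} (a : JetIndex d s) (ψ : 𝓢(Space d, ℂ)) :
    ‖jetEval a ψ‖ ≤ (s.sup (schwartzSeminormFamily ℂ (Space d) ℂ)) ψ := by
  have h1 : ‖jetEval a ψ‖ ≤ SchwartzMap.seminorm ℂ a.order.1.1 a.order.1.2 ψ := by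
    refine le_trans ?_ (SchwartzMap.le_seminorm ℂ _ _ ψ a.pt)
    rw [jetEval, norm_mul, Complex.norm_real, norm_pow, norm_norm]
    gcongr
    refine (ContinuousMultilinearMap.le_opNorm _ _).trans ?_
    exact mul_le_of_le_one_right (norm_nonneg _)
      (Finset.prod_le_one (fun _ _ => norm_nonneg _) fun i _ => a.dir_le i)
  exact h1.trans (Seminorm.le_def.1 (Finset.le_sup (f := schwartzSeminormFamily ℂ (Space d) ℂ)
    a.order.2) ψ)

/-- All the weighted derivatives with indices in a finite set, as a bounded function. -/
def jets (s : Finset (ℕ × ℕ)) :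
    𝓢(Space d, ℂ) →ₗ[ℂ] BoundedContinuousFunction (JetIndex d s) ℂ where
  toFun ψ := BoundedContinuousFunction.ofNormedAddCommGroupDiscrete (fun a => jetEval a ψ) _
    fun a => norm_jetEval_le a ψ
  map_add' ψ₁ ψ₂ := by
    ext a
    exact jetEval_add a ψ₁ ψ₂
  map_smul' c ψ := by
    ext a
    exact jetEval_smul a c ψ

theorem jets_apply {s : Finset (ℕ × ℕ)} (ψ : 𝓢(Space d, ℂ)) (a : JetIndex d s) :
    jets s ψ a = jetEval a ψ := rfl

theorem norm_jets_le (s : Finset (ℕ × ℕ)) (ψ : 𝓢(Space d, ℂ)) :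
    ‖jets s ψ‖ ≤ (s.sup (schwartzSeminormFamily ℂ (Space d) ℂ)) ψ :=
  (BoundedContinuousFunction.norm_le (apply_nonneg _ _)).2 fun a => norm_jetEval_le a ψ

/-- The norm of a multilinear map is recovered from unit directions. With `norm_jets_le`, the
Schwartz seminorm becomes the norm of a Banach space, in which Bochner integrals of families of test
functions make sense. -/
theorem sup_seminorm_le_norm_jets (s : Finset (ℕ × ℕ)) (ψ : 𝓢(Space d, ℂ)) :
    (s.sup (schwartzSeminormFamily ℂ (Space d) ℂ)) ψ ≤ ‖jets s ψ‖ := by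
  refine Seminorm.finset_sup_apply_le (norm_nonneg _) fun p hp => ?_
  refine SchwartzMap.seminorm_le_bound ℂ p.1 p.2 ψ (norm_nonneg (jets s ψ)) fun x => ?_
  have h1 : ∀ v : Fin p.2 → Space d, (∀ i, ‖v i‖ ≤ 1) →
      ‖x‖ ^ p.1 * ‖iteratedFDeriv ℝ p.2 ψ x v‖ ≤ ‖jets s ψ‖ := fun v hv => by
    have := (jets s ψ).norm_coe_le_norm ⟨⟨p, hp⟩, x, v, hv⟩
    rwa [jets_apply, jetEval, norm_mul, Complex.norm_real, norm_pow, norm_norm] at this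
  rcases (pow_nonneg (norm_nonneg x) p.1).eq_or_lt with h0 | h0
  · rw [← h0, zero_mul]; exact norm_nonneg _
  rw [mul_comm, ← le_div_iff₀ h0]
  refine ContinuousMultilinearMap.opNorm_le_bound (by positivity) fun v => ?_
  by_cases hv : ∃ i, v i = 0
  · obtain ⟨i, hi⟩ := hv
    rw [ContinuousMultilinearMap.map_coord_zero _ i hi, norm_zero]
    positivity
  push Not at hv
  have h2 := h1 (fun i => ‖v i‖⁻¹ • v i) fun i => by
    rw [norm_smul, norm_inv, norm_norm, inv_mul_cancel₀ (norm_ne_zero_iff.2 (hv i))]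
  have h3 : 0 < ∏ i, ‖v i‖ := Finset.prod_pos fun i _ => norm_pos_iff.2 (hv i)
  rw [ContinuousMultilinearMap.map_smul_univ, norm_smul, norm_prod] at h2
  simp only [norm_inv, norm_norm, Finset.prod_inv_distrib] at h2
  rw [div_mul_eq_mul_div, le_div_iff₀ h0]
  calc _ = (‖x‖ ^ p.1 * ((∏ i, ‖v i‖)⁻¹ * ‖iteratedFDeriv ℝ p.2 ψ x v‖)) * ∏ i, ‖v i‖ := by
        field_simp
    _ ≤ _ := by gcongr

theorem continuous_jets (s : Finset (ℕ × ℕ)) : Continuous (jets (d := d) s) := by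
  refine continuous_of_continuousAt_zero (jets (d := d) s) ?_
  rw [ContinuousAt, map_zero, tendsto_zero_iff_norm_tendsto_zero]
  refine squeeze_zero (fun _ => norm_nonneg _) (norm_jets_le s) ?_
  refine squeeze_zero (fun _ => apply_nonneg _ _)
    (fun ψ => Seminorm.finset_sup_apply_le (Finset.sum_nonneg fun i _ => apply_nonneg _ _)
      fun i hi => Finset.single_le_sum (f := fun i => schwartzSeminormFamily ℂ (Space d) ℂ i ψ)
        (fun i _ => apply_nonneg _ _) hi) ?_
  have h1 : Continuous fun ψ : 𝓢(Space d, ℂ) =>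
      ∑ i ∈ s, schwartzSeminormFamily ℂ (Space d) ℂ i ψ :=
    continuous_finsetSum _ fun i _ =>
      (schwartz_withSeminorms ℂ (Space d) ℂ).continuous_seminorm i
  simpa using h1.tendsto 0

theorem sup_seminorm_translate_le (s : Finset (ℕ × ℕ)) (κ : 𝓢(Space d, ℂ)) :
    ∃ (M : ℝ) (K : ℕ), 0 ≤ M ∧ ∀ y,
      (s.sup (schwartzSeminormFamily ℂ (Space d) ℂ)) (κ.compSubConstCLM ℂ y) ≤
        M * (1 + ‖y‖) ^ K := by
  choose M hM h using fun p : ℕ × ℕ => SchwartzMap.seminorm_translate_le κ p.1 p.2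
  refine ⟨∑ p ∈ s, M p, ∑ p ∈ s, p.1, Finset.sum_nonneg fun p _ => hM p, fun y =>
    Seminorm.finset_sup_apply_le (mul_nonneg (Finset.sum_nonneg fun p _ => hM p)
      (by positivity)) fun p hp => ?_⟩
  refine (h p y).trans ?_
  gcongr
  · exact Finset.sum_nonneg fun p _ => hM p
  · exact Finset.single_le_sum (fun p _ => hM p) hp
  · linarith [norm_nonneg y]
  · exact Finset.single_le_sum (f := fun p : ℕ × ℕ => p.1) (fun p _ => Nat.zero_le _) hp

theorem SchwartzMap.integrable_one_add_norm_pow_mul (θ : 𝓢(Space d, ℂ)) (K : ℕ) :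
    Integrable fun x => (1 + ‖x‖) ^ K * ‖θ x‖ := by
  have h : (fun x => (1 + ‖x‖) ^ K * ‖θ x‖) =
      fun x => ∑ m ∈ Finset.range (K + 1), (K.choose m : ℝ) * (‖x‖ ^ m * ‖θ x‖) := by
    ext x
    rw [add_comm, add_pow, Finset.sum_mul]
    refine Finset.sum_congr rfl fun m _ => ?_
    ring
  rw [h]
  exact integrable_finsetSum _ fun m _ => (θ.integrable_pow_mul volume m).const_mul _

theorem integrable_jets_translate (s : Finset (ℕ × ℕ)) (θ κ : 𝓢(Space d, ℂ)) :
    Integrable fun x => jets s (θ x • κ.compSubConstCLM ℂ x) := by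
  obtain ⟨M, K, hM, h⟩ := sup_seminorm_translate_le s κ
  refine ((SchwartzMap.integrable_one_add_norm_pow_mul θ K).const_mul M).mono' ?_
    (Eventually.of_forall fun x => ?_)
  · refine Continuous.aestronglyMeasurable ?_
    exact (continuous_jets s).comp (θ.continuous.smul (SchwartzMap.continuous_translate κ))
  · rw [map_smul, norm_smul]
    have := (norm_jets_le s _).trans (h x)
    nlinarith [norm_nonneg (θ x)]

/-- The pairing of a distribution with a convolution. -/
theorem distribution_sconv {E : Type*} [NormedAddCommGroup E] [NormedSpace ℂ E] [CompleteSpace E]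
    (U : 𝓢'(Space d, E)) (θ κ : 𝓢(Space d, ℂ)) :
    Integrable (fun x => θ x • U (κ.compSubConstCLM ℂ x)) ∧
      U (sconv θ κ) = ∫ x, θ x • U (κ.compSubConstCLM ℂ x) := by
  obtain ⟨s, C, h⟩ := TemperedDistribution.exists_bound U
  let UL : 𝓢(Space d, ℂ) →ₗ[ℂ] E := { toFun := U, map_add' := map_add U, map_smul' := map_smul U }
  have h1 : ∀ ψ, ‖UL ψ‖ ≤ C * ‖jets s ψ‖ := fun ψ => by
    refine (h ψ).trans ?_
    gcongr
    exact sup_seminorm_le_norm_jets s ψ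
  have hi := integrable_jets_translate s θ κ
  -- An identity in ℓ^∞, checked in each coordinate by differentiating the convolution under the
  -- integral.
  have hj : jets s (sconv θ κ) = ∫ x, jets s (θ x • κ.compSubConstCLM ℂ x) := by
    ext a
    have h2 := (BoundedContinuousFunction.evalCLM ℂ (β := ℂ) a).integral_comp_comm hi
    simp only [BoundedContinuousFunction.evalCLM_apply] at h2
    rw [← h2, jets_apply, jetEval]
    have h3 : (⇑(sconv θ κ) : Space d → ℂ) = fun z => ∫ x, κ (z - x) • θ x :=
      funext fun z => sconv_apply θ κ z
    have hp := Integrable.polyIntegrable θ.integrable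
    rw [h3, (hp.smooth_conv κ).2]
    have hint : Integrable fun x => iteratedFDeriv ℝ a.order.1.2 (fun z => κ (z - x) • θ x) a.pt := by
      obtain ⟨b, hb, hb'⟩ := hp.exists_bound κ a.order.1.2 a.pt
      exact hb.mono' (hp.aestronglyMeasurable_iteratedFDeriv κ _ _) (Eventually.of_forall fun x =>
        (norm_iteratedFDeriv_smul_const_translate _ _ _ _ _).trans
          (hb' x _ (Metric.mem_ball_self one_pos)))
    rw [ContinuousMultilinearMap.integral_apply hint, ← integral_const_mul]
    refine integral_congr_ae (Eventually.of_forall fun x => ?_)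
    beta_reduce
    rw [map_smul]
    change _ = θ x • jetEval a (κ.compSubConstCLM ℂ x)
    rw [jetEval, SchwartzMap.iteratedFDeriv_translate, iteratedFDeriv_smul_const_translate]
    simp only [ContinuousLinearMap.compContinuousMultilinearMap_coe, Function.comp_apply,
      smulConst_apply, smul_eq_mul]
    ring
  have := eq_integral_of_norm_le (μ := volume) (jets s) UL C h1
    (fun x => θ x • κ.compSubConstCLM ℂ x) hi (sconv θ κ) hj
  simp only [map_smul] at this
  exact this

end

section

variable {d : ℕ}

/-! ### Frequency localization of tempered distributions -/

/-- The product of two Schwartz functions. -/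
def pmul (a b : 𝓢(Space d, ℂ)) : 𝓢(Space d, ℂ) :=
  SchwartzMap.pairing (ContinuousLinearMap.mul ℂ ℂ) a b

@[simp] theorem pmul_apply (a b : 𝓢(Space d, ℂ)) (x : Space d) : pmul a b x = a x * b x := rfl

theorem fourier_fourier_apply (f : 𝓢(Space d, ℂ)) (ξ : Space d) : 𝓕 (𝓕 f) ξ = f (-ξ) := by
  have h : 𝓕⁻ (𝓕 f) = f := FourierPair.fourierInv_fourier_eq f
  conv_rhs => rw [← h, SchwartzMap.fourierInv_apply_eq]
  simp

theorem fourier_injective : Function.Injective (fun f : 𝓢(Space d, ℂ) => 𝓕 f) :=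
  Function.LeftInverse.injective (g := fun f => 𝓕⁻ f) FourierPair.fourierInv_fourier_eq

theorem sconv_fourier (a b : 𝓢(Space d, ℂ)) : sconv (𝓕 a) (𝓕 b) = 𝓕 (pmul a b) := by
  apply fourier_injective
  ext ξ
  simp only [fourier_sconv, fourier_fourier_apply, pmul_apply]

/-- The modulation of a symbol which translates its Fourier transform. -/
def modul (x : Space d) (σ : 𝓢(Space d, ℂ)) : 𝓢(Space d, ℂ) :=
  𝓕⁻ ((𝓕 σ).compSubConstCLM ℂ x)

theorem fourier_modul (x : Space d) (σ : 𝓢(Space d, ℂ)) :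
    𝓕 (modul x σ) = (𝓕 σ).compSubConstCLM ℂ x :=
  FourierInvPair.fourier_fourierInv_eq _

theorem modul_apply (x : Space d) (σ : 𝓢(Space d, ℂ)) (ξ : Space d) :
    modul x σ ξ = Complex.exp (↑(2 * Real.pi * inner ℝ x ξ) * Complex.I) * σ ξ := by
  have h : 𝓕⁻ (𝓕 σ) = σ := FourierPair.fourierInv_fourier_eq σ
  conv_rhs => rw [← h]
  rw [modul, SchwartzMap.fourierInv_coe, SchwartzMap.fourierInv_coe, Real.fourierInv_eq',
    Real.fourierInv_eq', ← integral_const_mul,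
    ← integral_add_right_eq_self _ x]
  refine integral_congr_ae (Eventually.of_forall fun y => ?_)
  simp only [SchwartzMap.compSubConstCLM_apply, add_sub_cancel_right, smul_eq_mul, ← mul_assoc,
    ← Complex.exp_add, inner_add_left]
  congr 2
  push_cast
  ring

theorem modul_eq_zero {x : Space d} {σ : 𝓢(Space d, ℂ)} {ξ : Space d} (h : σ ξ = 0) :
    modul x σ ξ = 0 := by
  rw [modul_apply, h, mul_zero]

theorem pmul_modul (x : Space d) (σ η : 𝓢(Space d, ℂ)) :
    pmul (modul x η) σ = modul x (pmul σ η) := by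
  ext ξ
  simp only [pmul_apply, modul_apply]
  ring

variable {E : Type*} [NormedAddCommGroup E] [NormedSpace ℂ E]

/-- The Fourier multiplier with symbol `σ` applied to a distribution. -/
def band (σ : 𝓢(Space d, ℂ)) (U : 𝓢'(Space d, E)) (x : Space d) : E :=
  U ((𝓕 σ).compSubConstCLM ℂ x)

theorem piece_eq_band (φ : LPCutoff d) (j : ℕ) (U : 𝓢'(Space d, E)) :
    φ.piece j U = band (φ.symbol j) U := rfl

theorem continuous_band (σ : 𝓢(Space d, ℂ)) (U : 𝓢'(Space d, E)) : Continuous (band σ U) := by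
  have hU : Continuous fun ψ : 𝓢(Space d, ℂ) => U ψ := map_continuous U
  exact hU.comp (SchwartzMap.continuous_translate (𝓕 σ))

theorem band_sum {ι : Type*} (s : Finset ι) (σ : ι → 𝓢(Space d, ℂ)) (U : 𝓢'(Space d, E))
    (x : Space d) : band (∑ i ∈ s, σ i) U x = ∑ i ∈ s, band (σ i) U x := by
  have h : 𝓕 (∑ i ∈ s, σ i) = ∑ i ∈ s, 𝓕 (σ i) :=
    map_sum (SchwartzMap.fourierTransformCLM ℂ) σ s
  simp only [band, h, map_sum]

theorem band_pairing [CompleteSpace E] (σ ψ : 𝓢(Space d, ℂ)) (U : 𝓢'(Space d, E)) :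
    Integrable (fun x => 𝓕 ψ x • band σ U x) ∧
      ∫ x, 𝓕 ψ x • band σ U x = U (𝓕 (pmul ψ σ)) := by
  have := distribution_sconv U (𝓕 ψ) (𝓕 σ)
  rw [sconv_fourier] at this
  exact ⟨this.1, this.2.symm⟩

/-- A multiplier acts by convolution on the frequency localized pieces. -/
theorem band_pmul [CompleteSpace E] (σ η : 𝓢(Space d, ℂ)) (U : 𝓢'(Space d, E)) (x : Space d) :
    Integrable (fun y => 𝓕 η (y - x) • band σ U y) ∧
      band (pmul σ η) U x = ∫ y, 𝓕 η (y - x) • band σ U y := by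
  have h := band_pairing σ (modul x η) U
  rw [pmul_modul, fourier_modul, fourier_modul] at h
  simp only [SchwartzMap.compSubConstCLM_apply] at h
  exact ⟨h.1, h.2.symm⟩

/-- The reproducing formula: a multiplier equal to one on the support of `σ` changes nothing. -/
theorem band_eq_integral [CompleteSpace E] {σ η : 𝓢(Space d, ℂ)}
    (h : ∀ ξ, σ ξ ≠ 0 → η ξ = 1) (U : 𝓢'(Space d, E)) (x : Space d) :
    band σ U x = ∫ y, 𝓕⁻ η (x - y) • band σ U y := by
  have h1 : pmul σ η = σ := by
    ext ξ
    by_cases hξ : σ ξ = 0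
    · simp [hξ]
    · simp [h ξ hξ]
  have h2 := (band_pmul σ η U x).2
  rw [h1] at h2
  rw [h2]
  refine integral_congr_ae (Eventually.of_forall fun y => ?_)
  simp [SchwartzMap.fourierInv_apply_eq]

/-! ### Polynomial growth of the frequency localized pieces -/

theorem norm_band_le (σ : 𝓢(Space d, ℂ)) (U : 𝓢'(Space d, E)) :
    ∃ (M : ℝ) (K : ℕ), 0 ≤ M ∧ ∀ x, ‖band σ U x‖ ≤ M * (1 + ‖x‖) ^ K := by
  obtain ⟨s, C, h⟩ := TemperedDistribution.exists_bound U
  obtain ⟨M, K, hM, h'⟩ := sup_seminorm_translate_le s (𝓕 σ)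
  refine ⟨C * M, K, by positivity, fun x => (h _).trans ?_⟩
  rw [mul_assoc]
  gcongr
  exact h' x

theorem PolyIntegrable.of_norm_le {E : Type*} [NormedAddCommGroup E] {f : Space d → E} (hf : AEStronglyMeasurable f) {M : ℝ} {K : ℕ}
    (h : ∀ x, ‖f x‖ ≤ M * (1 + ‖x‖) ^ K) : PolyIntegrable (K + (d + 1)) f := by
  refine ⟨hf, ?_⟩
  have h1 := integrable_one_add_norm (E := Space d) (μ := volume) (r := (d + 1 : ℝ)) (by simp)
  refine (h1.const_mul M).mono' ?_ (Eventually.of_forall fun x => ?_)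
  · exact (Continuous.aestronglyMeasurable (by fun_prop (disch := intro x; positivity))).mul hf.norm
  · have h0 : 0 < 1 + ‖x‖ := by positivity
    rw [norm_mul, norm_norm, norm_inv, Real.norm_of_nonneg (by positivity),
      Real.rpow_neg h0.le, pow_add]
    have e : (1 + ‖x‖) ^ ((d : ℝ) + 1) = (1 + ‖x‖) ^ (d + 1) := by
      rw [← Real.rpow_natCast]; push_cast; rfl
    rw [e, mul_inv, mul_assoc, inv_mul_le_iff₀ (by positivity)]
    calc _ ≤ ((1 + ‖x‖) ^ (d + 1))⁻¹ * (M * (1 + ‖x‖) ^ K) := by gcongr; exact h x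
      _ = _ := by ring

theorem polyIntegrable_band (σ : 𝓢(Space d, ℂ)) (U : 𝓢'(Space d, E)) :
    ∃ K, PolyIntegrable K (band σ U) := by
  obtain ⟨M, K, -, h⟩ := norm_band_le σ U
  exact ⟨_, PolyIntegrable.of_norm_le (continuous_band σ U).aestronglyMeasurable h⟩

theorem hasTemperateGrowth_conv [CompleteSpace E] {f : Space d → E} (hf : AEStronglyMeasurable f)
    {M : ℝ} {K : ℕ} (hM : 0 ≤ M) (h : ∀ x, ‖f x‖ ≤ M * (1 + ‖x‖) ^ K) (κ : 𝓢(Space d, ℂ)) :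
    Function.HasTemperateGrowth fun z => ∫ x, κ (z - x) • f x := by
  have hp := PolyIntegrable.of_norm_le hf h
  refine ⟨(hp.smooth_conv κ).1, fun n => ?_⟩
  obtain ⟨b, hb, hb'⟩ : ∃ b : ℝ, 0 ≤ b ∧ ∫ x : Space d, ‖iteratedFDeriv ℝ n κ x‖ * (1 + ‖x‖) ^ K ≤ b :=
    ⟨|∫ x : Space d, ‖iteratedFDeriv ℝ n κ x‖ * (1 + ‖x‖) ^ K|, abs_nonneg _, le_abs_self _⟩
  have hint : Integrable fun x => ‖iteratedFDeriv ℝ n κ x‖ * (1 + ‖x‖) ^ K := by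
    have e : (fun x => ‖iteratedFDeriv ℝ n κ x‖ * (1 + ‖x‖) ^ K) =
      fun x => ∑ m ∈ Finset.range (K + 1), (K.choose m : ℝ) * (‖x‖ ^ m * ‖iteratedFDeriv ℝ n κ x‖) := by
      ext x
      rw [add_comm, add_pow, Finset.mul_sum]
      refine Finset.sum_congr rfl fun m _ => ?_
      ring
    rw [e]
    exact integrable_finsetSum _ fun m _ => (κ.integrable_pow_mul_iteratedFDeriv volume m n).const_mul _
  refine ⟨K, M * b, fun z => ?_⟩
  rw [(hp.smooth_conv κ).2 n z]
  have h1 : ∀ x, ‖iteratedFDeriv ℝ n (fun z => κ (z - x) • f x) z‖ ≤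
      M * (1 + ‖z‖) ^ K * (‖iteratedFDeriv ℝ n κ (z - x)‖ * (1 + ‖z - x‖) ^ K) := fun x => by
    refine (norm_iteratedFDeriv_smul_const_translate _ _ _ _ _).trans ?_
    have h2 : 1 + ‖x‖ ≤ (1 + ‖z‖) * (1 + ‖z - x‖) := by
      have := norm_sub_le z (z - x)
      rw [sub_sub_cancel] at this
      nlinarith [norm_nonneg z, norm_nonneg (z - x)]
    calc _ ≤ ‖iteratedFDeriv ℝ n κ (z - x)‖ * (M * ((1 + ‖z‖) * (1 + ‖z - x‖)) ^ K) := by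
          gcongr
          exact (h x).trans (by gcongr)
      _ = _ := by rw [mul_pow]; ring
  refine (norm_integral_le_of_norm_le ((hint.comp_sub_left z).const_mul _)
    (Eventually.of_forall h1)).trans ?_
  rw [integral_const_mul, integral_sub_left_eq_self (fun x => ‖iteratedFDeriv ℝ n κ x‖ * (1 + ‖x‖) ^ K)]
  nlinarith [mul_le_mul_of_nonneg_left hb' (show 0 ≤ M * (1 + ‖z‖) ^ K by positivity)]

theorem hasTemperateGrowth_band [CompleteSpace E] {σ η : 𝓢(Space d, ℂ)}
    (h : ∀ ξ, σ ξ ≠ 0 → η ξ = 1) (U : 𝓢'(Space d, E)) :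
    Function.HasTemperateGrowth (band σ U) := by
  obtain ⟨M, K, hM, h'⟩ := norm_band_le σ U
  have := hasTemperateGrowth_conv (continuous_band σ U).aestronglyMeasurable hM h' (𝓕⁻ η)
  rwa [← funext (band_eq_integral h U)] at this

/-! ### Orthogonality of products of frequency localized pieces -/

/-- If the symbol of a test function has no frequency in the sum of the frequency supports, its
pairing with the product of the pieces vanishes. -/
theorem integral_fourier_mul_band_mul_band_eq_zero {σ ρ η ψ : 𝓢(Space d, ℂ)}
    (hη : ∀ ξ, ρ ξ ≠ 0 → η ξ = 1) (h : ∀ ξ ζ, σ ξ ≠ 0 → ρ ζ ≠ 0 → ψ (ξ + ζ) = 0)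
    (U V : 𝓢'(Space d, ℂ)) : ∫ x, 𝓕 ψ x * (band σ U x * band ρ V x) = 0 := by
  have hg := hasTemperateGrowth_band hη V
  -- The smooth factor of moderate growth is absorbed into the test function; it remains to see that
  -- the frequencies `θ` of the new test function miss the support of `σ`.
  set θ : 𝓢(Space d, ℂ) := 𝓕⁻ (SchwartzMap.smulLeftCLM ℂ (band ρ V) (𝓕 ψ))
  have hθ : 𝓕 θ = SchwartzMap.smulLeftCLM ℂ (band ρ V) (𝓕 ψ) :=
    FourierInvPair.fourier_fourierInv_eq _
  have h1 := (band_pairing σ θ U).2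
  rw [hθ] at h1
  simp only [SchwartzMap.smulLeftCLM_apply_apply hg, smul_eq_mul] at h1
  have h2 : pmul θ σ = 0 := by
    ext ξ
    by_cases hξ : σ ξ = 0
    · simp [hξ]
    have h3 : θ ξ = 0 := by
      -- The value θ(ξ) is the pairing of `V` with the Fourier transform of ψ(· + ξ)ρ, and this
      -- function vanishes by hypothesis when σ(ξ) ≠ 0.
      have h4 : pmul (ψ.compSubConstCLM ℂ (-ξ)) ρ = 0 := by
        ext ζ
        by_cases hζ : ρ ζ = 0
        · simp [hζ]
        · simp [add_comm ζ ξ, h ξ ζ hξ hζ]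
      have h5 := (band_pairing ρ (ψ.compSubConstCLM ℂ (-ξ)) V).2
      have e0 : V (𝓕 (0 : 𝓢(Space d, ℂ))) = 0 := by
        have : 𝓕 (0 : 𝓢(Space d, ℂ)) = 0 := map_zero (SchwartzMap.fourierTransformCLM ℂ)
        rw [this]; exact map_zero V
      rw [h4, e0] at h5
      rw [← h5]
      simp only [θ]
      rw [SchwartzMap.fourierInv_coe, Real.fourierInv_eq']
      refine integral_congr_ae (Eventually.of_forall fun x => ?_)
      simp only [SchwartzMap.smulLeftCLM_apply_apply hg, smul_eq_mul]
      have h6 : 𝓕 (ψ.compSubConstCLM ℂ (-ξ)) x =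
          Complex.exp (↑(2 * Real.pi * inner ℝ x ξ) * Complex.I) * 𝓕 ψ x := by
        rw [SchwartzMap.fourier_coe, SchwartzMap.fourier_coe, Real.fourier_eq', Real.fourier_eq',
          ← integral_const_mul, ← integral_sub_right_eq_self _ ξ]
        refine integral_congr_ae (Eventually.of_forall fun y => ?_)
        simp only [SchwartzMap.compSubConstCLM_apply, sub_neg_eq_add, sub_add_cancel, smul_eq_mul,
          ← mul_assoc, ← Complex.exp_add, inner_sub_left, real_inner_comm x ξ]
        congr 2
        push_cast
        ring
      rw [h6]
      ring
    simp [h3]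
  rw [h2] at h1
  have e0 : U (𝓕 (0 : 𝓢(Space d, ℂ))) = 0 := by
    have : 𝓕 (0 : 𝓢(Space d, ℂ)) = 0 := map_zero (SchwartzMap.fourierTransformCLM ℂ)
    rw [this]; exact map_zero U
  rw [e0] at h1
  rw [← h1]
  refine integral_congr_ae (Eventually.of_forall fun x => ?_)
  ring

end

/-! ### Dyadic symbols, bounds for the pieces, and the norm in terms of pieces -/

section

variable {d : ℕ}

/-! ### The dyadic symbols -/

namespace LPCutoff

variable (φ : LPCutoff d)

theorem lowSymbol_apply (j : ℕ) (ξ : Space d) :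
    φ.lowSymbol j ξ = ((φ.toFun (((2 : ℝ) ^ j)⁻¹ • ξ) : ℝ) : ℂ) := rfl

theorem lowSymbol_eq_one {j : ℕ} {ξ : Space d} (h : ‖ξ‖ ≤ 2 ^ j) : φ.lowSymbol j ξ = 1 := by
  rw [lowSymbol_apply, φ.eq_one, Complex.ofReal_one]
  rw [norm_smul, norm_inv, norm_pow, Real.norm_ofNat, inv_mul_le_iff₀ (by positivity), mul_one]
  exact h

theorem lowSymbol_eq_zero {j : ℕ} {ξ : Space d} (h : 2 ^ (j + 1) ≤ ‖ξ‖) :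
    φ.lowSymbol j ξ = 0 := by
  rw [lowSymbol_apply, φ.eq_zero, Complex.ofReal_zero]
  rw [norm_smul, norm_inv, norm_pow, Real.norm_ofNat, le_inv_mul_iff₀ (by positivity), ← pow_succ]
  exact h

theorem symbol_zero : φ.symbol 0 = φ.lowSymbol 0 := rfl

theorem symbol_succ (j : ℕ) : φ.symbol (j + 1) = φ.lowSymbol (j + 1) - φ.lowSymbol j := rfl

theorem norm_lt_of_symbol_ne_zero {j : ℕ} {ξ : Space d} (h : φ.symbol j ξ ≠ 0) :
    ‖ξ‖ < 2 ^ (j + 1) := by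
  by_contra! h1
  apply h
  cases j with
  | zero => exact φ.lowSymbol_eq_zero h1
  | succ j =>
    have h2 : (2 : ℝ) ^ (j + 1) ≤ ‖ξ‖ := le_trans (by gcongr <;> norm_num) h1
    rw [symbol_succ, sub_apply, φ.lowSymbol_eq_zero h1, φ.lowSymbol_eq_zero h2,
      sub_zero]

theorem lt_norm_of_symbol_ne_zero {j : ℕ} {ξ : Space d} (h : φ.symbol (j + 1) ξ ≠ 0) :
    2 ^ j < ‖ξ‖ := by
  by_contra! h1
  apply h
  have h2 : ‖ξ‖ ≤ 2 ^ (j + 1) := le_trans h1 (by gcongr <;> norm_num)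
  rw [symbol_succ, sub_apply, φ.lowSymbol_eq_one h1, φ.lowSymbol_eq_one h2, sub_self]

theorem sum_symbol (N : ℕ) : ∑ j ∈ Finset.range (N + 1), φ.symbol j = φ.lowSymbol N := by
  induction N with
  | zero => simp [symbol_zero]
  | succ N ih => rw [Finset.sum_range_succ, ih, symbol_succ, add_sub_cancel]

theorem lowSymbol_succ_eq_one_of_symbol_ne_zero {j : ℕ} {ξ : Space d} (h : φ.symbol j ξ ≠ 0) :
    φ.lowSymbol (j + 1) ξ = 1 :=
  φ.lowSymbol_eq_one (φ.norm_lt_of_symbol_ne_zero h).le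

/-- A gap of three levels is enough: 2^(i+1) + 2^(j+1) ≤ 2^(k-1), the inner radius of the annulus of
level `k`. -/
theorem symbol_add_eq_zero_of_lt {i j k : ℕ} (hi : i + 3 ≤ k) (hj : j + 3 ≤ k) {ξ ζ : Space d}
    (h1 : φ.symbol i ξ ≠ 0) (h2 : φ.symbol j ζ ≠ 0) : φ.symbol k (ξ + ζ) = 0 := by
  by_contra h
  obtain ⟨k, rfl⟩ : ∃ k', k = k' + 1 := ⟨k - 1, by omega⟩
  have h3 := φ.lt_norm_of_symbol_ne_zero h
  have h4 := norm_add_le ξ ζ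
  have h5 : (2 : ℝ) ^ (i + 1) * 2 ≤ 2 ^ k := by
    rw [← pow_succ]; exact pow_le_pow_right₀ (by norm_num) (by omega)
  have h6 : (2 : ℝ) ^ (j + 1) * 2 ≤ 2 ^ k := by
    rw [← pow_succ]; exact pow_le_pow_right₀ (by norm_num) (by omega)
  have h7 := φ.norm_lt_of_symbol_ne_zero h1
  have h8 := φ.norm_lt_of_symbol_ne_zero h2
  linarith

/-- By the gap, |ξ + ζ| ≥ 2^(j-1) - 2^(i+1) ≥ 2^(j-2). -/
theorem pow_le_norm_add {i j l : ℕ} (hi : i + 3 ≤ j) (hl : l + 3 ≤ j) {ξ ζ : Space d}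
    (h1 : φ.symbol i ξ ≠ 0) (h2 : φ.symbol j ζ ≠ 0) : 2 ^ (l + 1) ≤ ‖ξ + ζ‖ := by
  obtain ⟨j, rfl⟩ : ∃ j', j = j' + 1 := ⟨j - 1, by omega⟩
  have h3 := φ.lt_norm_of_symbol_ne_zero h2
  have h4 := norm_sub_le (ξ + ζ) ξ
  rw [add_sub_cancel_left] at h4
  have h5 : (2 : ℝ) ^ (i + 1) * 2 ≤ 2 ^ j := by
    rw [← pow_succ]; exact pow_le_pow_right₀ (by norm_num) (by omega)
  have h6 : (2 : ℝ) ^ (l + 1) * 2 ≤ 2 ^ j := by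
    rw [← pow_succ]; exact pow_le_pow_right₀ (by norm_num) (by omega)
  have h7 := φ.norm_lt_of_symbol_ne_zero h1
  linarith

end LPCutoff

theorem lowPiece_eq_band {E : Type*} [NormedAddCommGroup E] [NormedSpace ℂ E] (φ : LPCutoff d)
    (N : ℕ) (U : 𝓢'(Space d, E)) : φ.lowPiece N U = band (φ.lowSymbol N) U := by
  ext x
  rw [← φ.sum_symbol, band_sum]
  rfl

/-! ### Dyadic dilations of a symbol -/

/-- The dilated symbol `ξ ↦ σ(2^{-k} ξ)`. -/
def dil (k : ℕ) (σ : 𝓢(Space d, ℂ)) : 𝓢(Space d, ℂ) :=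
  SchwartzMap.compCLMOfContinuousLinearEquiv ℂ
    (ContinuousLinearEquiv.smulLeft (Units.mk0 (((2 : ℝ) ^ k)⁻¹) (by positivity))) σ

theorem dil_apply (k : ℕ) (σ : 𝓢(Space d, ℂ)) (ξ : Space d) :
    dil k σ ξ = σ (((2 : ℝ) ^ k)⁻¹ • ξ) := rfl

theorem LPCutoff.lowSymbol_add (φ : LPCutoff d) (k l : ℕ) :
    φ.lowSymbol (k + l) = dil k (φ.lowSymbol l) := by
  ext ξ
  rw [dil_apply, φ.lowSymbol_apply, φ.lowSymbol_apply, smul_smul, pow_add, mul_inv_rev]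

/-- All symbols of positive level are dilates of one annular symbol; uniform kernel bounds then
reduce to two fixed Schwartz functions. -/
theorem LPCutoff.symbol_succ_eq_dil (φ : LPCutoff d) (k : ℕ) :
    φ.symbol (k + 1) = dil k (φ.symbol 1) := by
  ext ξ
  rw [dil_apply, φ.symbol_succ, φ.symbol_succ 0, sub_apply, sub_apply,
    φ.lowSymbol_add k 1, dil_apply]
  congr 1
  have := φ.lowSymbol_add k 0
  rw [add_zero] at this
  rw [this, dil_apply]

theorem fourier_dil (k : ℕ) (σ : 𝓢(Space d, ℂ)) (x : Space d) :
    𝓕 (dil k σ) x = ((((2 : ℝ) ^ k) ^ d : ℝ) : ℂ) * 𝓕 σ ((2 : ℝ) ^ k • x) := by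
  rw [SchwartzMap.fourier_coe, SchwartzMap.fourier_coe, Real.fourier_eq', Real.fourier_eq']
  have h := Measure.integral_comp_smul (volume : Measure (Space d)) (fun ξ : Space d =>
    Complex.exp (↑(-2 * Real.pi * inner ℝ ξ ((2 : ℝ) ^ k • x)) * Complex.I) • σ ξ) (((2 : ℝ) ^ k)⁻¹)
  simp only [finrank_euclideanSpace, Fintype.card_fin] at h
  rw [abs_of_pos (by positivity), inv_pow, inv_inv, Complex.real_smul] at h
  rw [← h]
  refine integral_congr_ae (Eventually.of_forall fun ξ => ?_)
  beta_reduce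
  rw [dil_apply, inner_smul_left, inner_smul_right]
  simp only [conj_trivial]
  rw [inv_mul_cancel_left₀ (by positivity)]

theorem fourierInv_dil (k : ℕ) (σ : 𝓢(Space d, ℂ)) (x : Space d) :
    𝓕⁻ (dil k σ) x = ((((2 : ℝ) ^ k) ^ d : ℝ) : ℂ) * 𝓕⁻ σ ((2 : ℝ) ^ k • x) := by
  have h : ∀ (f : 𝓢(Space d, ℂ)) y, 𝓕⁻ f y = 𝓕 f (-y) := fun f y => by
    simp [SchwartzMap.fourierInv_apply_eq]
  rw [h, h, fourier_dil, smul_neg]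

theorem exists_enorm_iteratedFDeriv_le_wt (κ : 𝓢(Space d, ℂ)) (n : ℕ) :
    ∃ C : ℝ≥0, ∀ x, ‖iteratedFDeriv ℝ n κ x‖ₑ ≤ C * wt 0 x := by
  obtain ⟨M, hM, h⟩ := SchwartzMap.one_add_norm_pow_mul_le κ (d + 1) n
  refine ⟨M.toNNReal, fun x => ?_⟩
  rw [wt, ← ofReal_norm]
  change _ ≤ ENNReal.ofReal M * _
  rw [← ENNReal.ofReal_mul (by positivity)]
  apply ENNReal.ofReal_le_ofReal
  simp only [pow_zero, one_pow, one_mul, one_smul]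
  rw [← div_eq_mul_inv, le_div_iff₀ (by positivity), mul_comm]
  exact h x

theorem exists_enorm_iteratedFDeriv_dil_le (κ : 𝓢(Space d, ℂ)) (n : ℕ) :
    ∃ C : ℝ≥0, ∀ (k : ℕ) (κ' : Space d → ℂ),
      (∀ x, κ' x = ((((2 : ℝ) ^ k) ^ d : ℝ) : ℂ) * κ ((2 : ℝ) ^ k • x)) →
      ∀ x, ‖iteratedFDeriv ℝ n κ' x‖ₑ ≤ C * 2 ^ (k * n) * wt k x := by
  obtain ⟨C, hC⟩ := exists_enorm_iteratedFDeriv_le_wt κ n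
  refine ⟨C, fun k κ' h x => ?_⟩
  have h1 : κ' = fun x => (((2 : ℝ) ^ k) ^ d) • κ ((2 : ℝ) ^ k • x) := by
    ext x; rw [h, Complex.real_smul]
  have h2 : ContDiff ℝ n fun x => κ ((2 : ℝ) ^ k • x) :=
    (κ.smooth n).comp (contDiff_const_smul _)
  rw [h1, iteratedFDeriv_const_smul_apply' h2.contDiffAt,
    iteratedFDeriv_comp_const_smul _ (κ.smooth n)]
  rw [smul_smul, enorm_smul, wt_eq, enorm_mul]
  have e1 : ‖((2 : ℝ) ^ k) ^ d‖ₑ = ENNReal.ofReal (((2 : ℝ) ^ k) ^ d) := by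
    rw [Real.enorm_eq_ofReal (by positivity)]
  have e2 : ‖((2 : ℝ) ^ k) ^ n‖ₑ = 2 ^ (k * n) := by
    rw [Real.enorm_eq_ofReal (by positivity), ← pow_mul, ENNReal.ofReal_pow (by norm_num)]
    simp
  rw [e1, e2]
  calc _ ≤ ENNReal.ofReal (((2 : ℝ) ^ k) ^ d) * 2 ^ (k * n) * (C * wt 0 ((2 : ℝ) ^ k • x)) := by
        gcongr; exact hC _
    _ = _ := by ring

theorem exists_enorm_fourier_dil_le (σ : 𝓢(Space d, ℂ)) (n : ℕ) :
    ∃ C : ℝ≥0, ∀ (k : ℕ) x,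
      ‖iteratedFDeriv ℝ n (𝓕 (dil k σ) : 𝓢(Space d, ℂ)) x‖ₑ ≤ C * 2 ^ (k * n) * wt k x ∧
      ‖iteratedFDeriv ℝ n (𝓕⁻ (dil k σ) : 𝓢(Space d, ℂ)) x‖ₑ ≤ C * 2 ^ (k * n) * wt k x := by
  obtain ⟨C₁, h₁⟩ := exists_enorm_iteratedFDeriv_dil_le (𝓕 σ) n
  obtain ⟨C₂, h₂⟩ := exists_enorm_iteratedFDeriv_dil_le (𝓕⁻ σ) n
  refine ⟨C₁ + C₂, fun k x => ⟨(h₁ k _ (fourier_dil k σ) x).trans ?_,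
    (h₂ k _ (fourierInv_dil k σ) x).trans ?_⟩⟩
  · gcongr; exact le_self_add
  · gcongr; exact le_add_self

/-- Compensates the shift of index in `symbol_succ_eq_dil`, where the symbol of level k + 1 is a
dilate by 2^k. -/
theorem wt_le_succ (k : ℕ) (x : Space d) : wt k x ≤ 2 * wt (k + 1) x := by
  have h2 : (2 : ℝ≥0∞) = ENNReal.ofReal 2 := by simp
  refine le_trans ?_ (mul_le_mul' h2.ge le_rfl)
  rw [wt, wt, ← ENNReal.ofReal_mul (by positivity)]
  apply ENNReal.ofReal_le_ofReal
  rw [norm_smul, norm_smul]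
  simp only [norm_pow, Real.norm_ofNat]
  set a : ℝ := 2 ^ k * ‖x‖
  have ha : 0 ≤ a := by positivity
  have e : (2 : ℝ) ^ (k + 1) * ‖x‖ = 2 * a := by simp only [a]; ring
  have h3 : (1 + 2 * a) ^ (d + 1) ≤ 2 ^ (d + 1) * (1 + a) ^ (d + 1) := by
    rw [← mul_pow]; gcongr; linarith
  rw [e, pow_succ 2 k, mul_pow, ← div_eq_mul_inv, ← div_eq_mul_inv, ← mul_div_assoc,
    div_le_div_iff₀ (by positivity) (by positivity)]
  calc ((2 : ℝ) ^ k) ^ d * (1 + 2 * a) ^ (d + 1)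
      ≤ ((2 : ℝ) ^ k) ^ d * (2 ^ (d + 1) * (1 + a) ^ (d + 1)) := by gcongr
    _ = _ := by ring

theorem exists_enorm_symbol_le (φ : LPCutoff d) (n : ℕ) :
    ∃ C : ℝ≥0, ∀ (k : ℕ) x,
      ‖iteratedFDeriv ℝ n (𝓕 (φ.symbol k) : 𝓢(Space d, ℂ)) x‖ₑ ≤ C * 2 ^ (k * n) * wt k x ∧
      ‖iteratedFDeriv ℝ n (𝓕⁻ (φ.symbol k) : 𝓢(Space d, ℂ)) x‖ₑ ≤ C * 2 ^ (k * n) * wt k x := by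
  obtain ⟨C₁, h₁⟩ := exists_enorm_fourier_dil_le (φ.symbol 0) n
  obtain ⟨C₂, h₂⟩ := exists_enorm_fourier_dil_le (φ.symbol 1) n
  have h0 : dil 0 (φ.symbol 0) = φ.symbol 0 := by ext ξ; simp [dil_apply]
  refine ⟨C₁ + 2 * C₂, fun k x => ?_⟩
  cases k with
  | zero =>
    have := h₁ 0 x
    rw [h0] at this
    refine ⟨this.1.trans ?_, this.2.trans ?_⟩ <;> · gcongr; exact le_self_add
  | succ k =>
    have h3 : (C₂ : ℝ≥0∞) * 2 ^ (k * n) * wt k x ≤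
        (C₁ + 2 * C₂ : ℝ≥0) * 2 ^ ((k + 1) * n) * wt (k + 1) x := by
      calc (C₂ : ℝ≥0∞) * 2 ^ (k * n) * wt k x
          ≤ C₂ * 2 ^ ((k + 1) * n) * (2 * wt (k + 1) x) := by
            gcongr
            · norm_num
            · omega
            · exact wt_le_succ k x
        _ = 2 * C₂ * 2 ^ ((k + 1) * n) * wt (k + 1) x := by ring
        _ ≤ _ := by gcongr; push_cast; exact le_add_self
    rw [φ.symbol_succ_eq_dil]
    exact ⟨(h₂ k x).1.trans h3, (h₂ k x).2.trans h3⟩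

end

section

variable {d : ℕ} {E : Type*} [NormedAddCommGroup E] [NormedSpace ℂ E]

/-! ### Pointwise bounds for the pieces -/

theorem wt_neg (k : ℕ) (x : Space d) : wt k (-x) = wt k x := by
  unfold wt
  rw [smul_neg, norm_neg]

theorem enorm_band_pmul_le [CompleteSpace E] (σ η : 𝓢(Space d, ℂ)) {B : ℝ≥0} {k : ℕ}
    (hη : ∀ x, ‖𝓕 η x‖ₑ ≤ B * wt k x) (U : 𝓢'(Space d, E)) (x : Space d) :
    ‖band (pmul σ η) U x‖ₑ ≤ B * conv (wt k) (fun y => ‖band σ U y‖ₑ) x := by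
  rw [(band_pmul σ η U x).2, conv_comm, conv, ← lintegral_const_mul' _ _ (by simp)]
  refine (enorm_integral_le_lintegral_enorm _).trans (lintegral_mono fun y => ?_)
  rw [enorm_smul, mul_left_comm, mul_comm]
  gcongr
  rw [← wt_neg, neg_sub]
  exact hη _

theorem contDiff_piece [CompleteSpace E] (φ : LPCutoff d) (j : ℕ) (U : 𝓢'(Space d, E)) :
    ContDiff ℝ ∞ (φ.piece j U) :=
  (hasTemperateGrowth_band (fun _ h => φ.lowSymbol_succ_eq_one_of_symbol_ne_zero h) U).1

/-- In the reproducing formula with the wider symbol `lowSymbol (j + 1)` the derivatives fall on the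
kernel, a dilate by 2^j of a fixed function; each costs 2^j. -/
theorem exists_enorm_iteratedFDeriv_piece_le [CompleteSpace E] (φ : LPCutoff d) (n : ℕ) :
    ∃ C : ℝ≥0, ∀ (j : ℕ) (U : 𝓢'(Space d, E)) z,
      ‖iteratedFDeriv ℝ n (φ.piece j U) z‖ₑ ≤
        C * 2 ^ (j * n) * conv (wt j) (fun y => ‖φ.piece j U y‖ₑ) z := by
  obtain ⟨C, hC⟩ := exists_enorm_fourier_dil_le (φ.lowSymbol 1) n
  refine ⟨C, fun j U z => ?_⟩
  have h1 := band_eq_integral (fun _ h => φ.lowSymbol_succ_eq_one_of_symbol_ne_zero (j := j) h) U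
  rw [← piece_eq_band, φ.lowSymbol_add j 1] at h1
  obtain ⟨K, hK⟩ := polyIntegrable_band (φ.symbol j) U
  rw [← piece_eq_band] at hK
  conv_lhs => rw [funext h1]
  refine (hK.enorm_iteratedFDeriv_le _ n z).trans ?_
  rw [← const_mul_conv _ (by finiteness)]
  exact conv_mono (fun x => (hC j x).2) (fun _ => le_rfl) z

theorem exists_enorm_piece_le [CompleteSpace E] (φ : LPCutoff d) :
    ∃ C : ℝ≥0, ∀ (j : ℕ) (U : 𝓢'(Space d, E)) z,
      ‖φ.piece j U z‖ₑ ≤ C * conv (wt j) (fun y => ‖φ.piece j U y‖ₑ) z := by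
  obtain ⟨C, hC⟩ := exists_enorm_iteratedFDeriv_piece_le (E := E) φ 0
  refine ⟨C, fun j U z => ?_⟩
  have h := hC j U z
  have e : ‖iteratedFDeriv ℝ 0 (φ.piece j U) z‖ₑ = ‖φ.piece j U z‖ₑ := by
    rw [← ofReal_norm, norm_iteratedFDeriv_zero, ofReal_norm]
  simpa [e] using h

/-! ### Measurable representatives -/

/-- Weak measurability for countably many test functions, namely those attached to a dense sequence
of points, suffices: the family is set to zero on one measurable null set of times, and continuity
in space gives joint measurability. -/
theorem exists_stronglyMeasurable_band {μ : Measure ℝ} {U : ℝ → 𝓢'(Space d, E)}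
    (hU : ∀ θ : 𝓢(Space d, ℂ), AEStronglyMeasurable (fun t => U t θ) μ) (σ : ℕ → 𝓢(Space d, ℂ)) :
    ∃ U' : ℝ → 𝓢'(Space d, E), (∀ᵐ t ∂μ, U' t = U t) ∧
      ∀ j, StronglyMeasurable (Function.uncurry fun t x => band (σ j) (U' t) x) := by
  classical
  set xs := TopologicalSpace.denseSeq (Space d)
  set θ : ℕ → ℕ → 𝓢(Space d, ℂ) := fun j n => (𝓕 (σ j)).compSubConstCLM ℂ (xs n)
  have h1 : ∀ᵐ t ∂μ, ∀ j n, U t (θ j n) = (hU (θ j n)).mk _ t :=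
    ae_all_iff.2 fun j => ae_all_iff.2 fun n => (hU (θ j n)).ae_eq_mk
  obtain ⟨N, hN, hNm, hN0⟩ := exists_measurable_superset_of_null h1
  set U' : ℝ → 𝓢'(Space d, E) := fun t => if t ∈ N then 0 else U t
  have hU' : ∀ t ∉ N, U' t = U t := fun t ht => if_neg ht
  refine ⟨U', ?_, fun j => ?_⟩
  · filter_upwards [measure_eq_zero_iff_ae_notMem.1 hN0] with t ht using hU' t ht
  · have h2 : ∀ n, StronglyMeasurable fun t => band (σ j) (U' t) (xs n) := by
      intro n
      have e : (fun t => band (σ j) (U' t) (xs n)) = Nᶜ.indicator ((hU (θ j n)).mk _) := by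
        ext t
        by_cases ht : t ∈ N
        · simp only [Set.indicator, Set.mem_compl_iff, ht, not_true_eq_false, if_false]
          simp only [band, U', ht, if_true]
          rfl
        · simp only [Set.indicator, Set.mem_compl_iff, ht, not_false_eq_true, if_true]
          rw [band, hU' t ht]
          have : t ∈ {t | ∀ j n, U t (θ j n) = (hU (θ j n)).mk _ t} := by
            by_contra h
            exact ht (hN h)
          exact this j n
      rw [e]
      exact (hU (θ j n)).stronglyMeasurable_mk.indicator hNm.compl
    have h3 : ∀ x, StronglyMeasurable fun t => band (σ j) (U' t) x := by
      intro x
      obtain ⟨y, hy, hyx⟩ := mem_closure_iff_seq_limit.1 (TopologicalSpace.denseRange_denseSeq (Space d) x)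
      refine stronglyMeasurable_of_tendsto (f := fun n t => band (σ j) (U' t) (y n)) atTop
        (fun n => ?_) (tendsto_pi_nhds.2 fun t => ?_)
      · obtain ⟨m, hm⟩ := hy n
        rw [← hm]
        exact h2 m
      · exact ((continuous_band (σ j) (U' t)).tendsto x).comp hyx
    exact (stronglyMeasurable_uncurry_of_continuous_of_stronglyMeasurable
      (u := fun x t => band (σ j) (U' t) x) (fun t => continuous_band _ _) h3).comp_measurable
        measurable_swap

/-! ### The norm of `l¹ X^s` with sharp cutoffs -/

/-- Joint measurability of the Littlewood-Paley pieces. -/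
def PieceMeas (φ : LPCutoff d) (U : ℝ → 𝓢'(Space d, E)) : Prop :=
  ∀ j, StronglyMeasurable (Function.uncurry fun t x => φ.piece j (U t) x)

theorem PieceMeas.measurable {φ : LPCutoff d} {U : ℝ → 𝓢'(Space d, E)} (h : PieceMeas φ U) (j : ℕ) :
    Measurable (Function.uncurry fun t x => ‖φ.piece j (U t) x‖ₑ) :=
  (h j).enorm

theorem exists_pieceMeas (φ : LPCutoff d) {μ : Measure ℝ} {U : ℝ → 𝓢'(Space d, E)}
    (hU : ∀ θ : 𝓢(Space d, ℂ), AEStronglyMeasurable (fun t => U t θ) μ) :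
    ∃ U' : ℝ → 𝓢'(Space d, E), (∀ᵐ t ∂μ, U' t = U t) ∧ PieceMeas φ U' :=
  exists_stronglyMeasurable_band hU φ.symbol

/-- The norm of a Littlewood-Paley piece. -/
def pieceNorm (φ : LPCutoff d) (T : ℝ) (j : ℕ) (U : ℝ → 𝓢'(Space d, E)) : ℝ≥0∞ :=
  eY T j fun t x => ‖φ.piece j (U t) x‖ₑ

/-- The weighted `ℓ²` norm of a sequence. -/
def wl2 (s : ℝ) (a : ℕ → ℝ≥0∞) : ℝ≥0∞ :=
  l2 Measure.count fun j : ℕ => (2 : ℝ≥0∞) ^ ((j : ℝ) * s) * a j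

theorem wl2_eq (s : ℝ) (a : ℕ → ℝ≥0∞) :
    wl2 s a = (∑' j : ℕ, (2 : ℝ≥0∞) ^ (2 * (j : ℝ) * s) * a j ^ 2) ^ (1 / 2 : ℝ) := by
  rw [wl2, l2, lintegral_count]
  congr 1
  refine tsum_congr fun j => ?_
  rw [mul_pow, ← ENNReal.rpow_natCast, ← ENNReal.rpow_mul]
  congr 2
  push_cast
  ring

theorem wl2_mono (s : ℝ) {a b : ℕ → ℝ≥0∞} (h : ∀ j, a j ≤ b j) : wl2 s a ≤ wl2 s b :=
  l2_mono fun j => mul_le_mul' le_rfl (h j)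

theorem wl2_const_mul (s : ℝ) (c : ℝ≥0∞) (a : ℕ → ℝ≥0∞) :
    wl2 s (fun j => c * a j) = c * wl2 s a := by
  rw [wl2, wl2, ← l2_const_mul c (by fun_prop)]
  congr 1
  ext j
  ring

theorem exists_normL1X_comparison (φ : LPCutoff d) (χ : CubeCutoff d) :
    ∃ C : ℝ≥0, ∀ (T s : ℝ) (U : ℝ → 𝓢'(Space d, E)), PieceMeas φ U →
      normL1X φ χ T s U ≤ C * wl2 s (fun j => pieceNorm φ T j U) ∧
      wl2 s (fun j => pieceNorm φ T j U) ≤ C * normL1X φ χ T s U := by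
  obtain ⟨C, hC⟩ := exists_normL1Xj_comparison χ
  refine ⟨C, fun T s U hU => ?_⟩
  have e : normL1X φ χ T s U = wl2 s fun j => normL1Xj χ T j fun t x => φ.piece j (U t) x := by
    rw [wl2_eq]; rfl
  have h1 : ∀ j, normL1Xj χ T j (fun t x => φ.piece j (U t) x) ≤ C * pieceNorm φ T j U := fun j => by
    rw [normL1Xj_eq]; exact (hC T j _ (hU.measurable j)).1
  have h2 : ∀ j, pieceNorm φ T j U ≤ C * normL1Xj χ T j (fun t x => φ.piece j (U t) x) := fun j => by
    rw [normL1Xj_eq]; exact (hC T j _ (hU.measurable j)).2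
  rw [e, ← wl2_const_mul, ← wl2_const_mul]
  exact ⟨wl2_mono s h1, wl2_mono s h2⟩

theorem normL1X_congr_ae (φ : LPCutoff d) (χ : CubeCutoff d) (T s : ℝ) {U U' : ℝ → 𝓢'(Space d, E)}
    (h : ∀ᵐ t ∂timeMeasure T, U' t = U t) : normL1X φ χ T s U' = normL1X φ χ T s U := by
  unfold normL1X
  congr 1
  refine tsum_congr fun j => ?_
  rw [normL1Xj_eq, normL1Xj_eq]
  congr 2
  refine tsum_congr fun k => eN_congr_ae T j ?_
  filter_upwards [h] with t ht x
  rw [ht]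

end

/-! ### Summation of frequency interactions, existence of products and the bilinear estimates -/

section

/-! ### Sequences -/

theorem two_rpow_add (a b : ℝ) : (2 : ℝ≥0∞) ^ (a + b) = 2 ^ a * 2 ^ b :=
  ENNReal.rpow_add _ _ (by norm_num) (by norm_num)

theorem two_rpow_le {a b : ℝ} (h : a ≤ b) : (2 : ℝ≥0∞) ^ a ≤ 2 ^ b :=
  ENNReal.rpow_le_rpow_of_exponent_le (by norm_num) h

theorem two_rpow_natCast (n : ℕ) : (2 : ℝ≥0∞) ^ (n : ℝ) = 2 ^ n := ENNReal.rpow_natCast _ _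

theorem two_rpow_ne_top (a : ℝ) : (2 : ℝ≥0∞) ^ a ≠ ⊤ :=
  ENNReal.rpow_ne_top_of_ne_zero (by norm_num) (by norm_num)

theorem two_rpow_mul_neg (a : ℝ) : (2 : ℝ≥0∞) ^ a * 2 ^ (-a) = 1 := by
  rw [← two_rpow_add, add_neg_cancel, ENNReal.rpow_zero]

theorem exists_two_rpow (a : ℝ) : ∃ C : ℝ≥0, (2 : ℝ≥0∞) ^ a = C :=
  ⟨_, (ENNReal.coe_toNNReal (two_rpow_ne_top a)).symm⟩

theorem exists_tsum_two_rpow_le {δ : ℝ} (hδ : 0 < δ) :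
    ∃ G : ℝ≥0, ∑' j : ℕ, (2 : ℝ≥0∞) ^ (-(δ * j)) ≤ G := by
  have h1 : (2 : ℝ≥0∞) ^ (-δ) < 1 :=
    ENNReal.rpow_lt_one_of_one_lt_of_neg (by norm_num) (by linarith)
  have h2 : ∑' j : ℕ, (2 : ℝ≥0∞) ^ (-(δ * j)) = (1 - (2 : ℝ≥0∞) ^ (-δ))⁻¹ := by
    rw [← ENNReal.tsum_geometric]
    refine tsum_congr fun j => ?_
    rw [← ENNReal.rpow_natCast, ← ENNReal.rpow_mul]
    ring_nf
  refine ⟨((1 - (2 : ℝ≥0∞) ^ (-δ))⁻¹).toNNReal, ?_⟩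
  rw [h2, ENNReal.coe_toNNReal]
  exact ENNReal.inv_ne_top.2 (tsub_pos_of_lt h1).ne'

/-- The `ℓ²` norm of a sequence. -/
def sl2 (a : ℕ → ℝ≥0∞) : ℝ≥0∞ := l2 Measure.count a

theorem wl2_eq_sl2 (s : ℝ) (a : ℕ → ℝ≥0∞) :
    wl2 s a = sl2 fun j : ℕ => (2 : ℝ≥0∞) ^ ((j : ℝ) * s) * a j := rfl

theorem sl2_mono {a b : ℕ → ℝ≥0∞} (h : ∀ j, a j ≤ b j) : sl2 a ≤ sl2 b := l2_mono h

theorem sl2_const_mul (c : ℝ≥0∞) (a : ℕ → ℝ≥0∞) : sl2 (fun j => c * a j) = c * sl2 a :=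
  l2_const_mul c (by fun_prop)

theorem sl2_mul_const (c : ℝ≥0∞) (a : ℕ → ℝ≥0∞) : sl2 (fun j => a j * c) = sl2 a * c := by
  simp_rw [mul_comm _ c]
  exact sl2_const_mul c a

theorem sl2_tsum_le {ι : Type*} [Countable ι] (a : ι → ℕ → ℝ≥0∞) :
    sl2 (fun j => ∑' i, a i j) ≤ ∑' i, sl2 (a i) := l2_tsum_le fun i => by fun_prop

theorem sl2_add_le (a b : ℕ → ℝ≥0∞) : sl2 (fun j => a j + b j) ≤ sl2 a + sl2 b := by
  have := sl2_tsum_le fun (i : Bool) j => if i then a j else b j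
  simpa [tsum_bool, add_comm] using this

theorem le_sl2 (a : ℕ → ℝ≥0∞) (j : ℕ) : a j ≤ sl2 a := by
  rw [← pow_two_le_pow_two_iff, sl2, l2_sq, lintegral_count]
  exact ENNReal.le_tsum (f := fun j => a j ^ 2) j

theorem tsum_mul_le_sl2 (a b : ℕ → ℝ≥0∞) : ∑' j, a j * b j ≤ sl2 a * sl2 b := by
  rw [← lintegral_count]
  exact lintegral_mul_le_l2 (by fun_prop) (by fun_prop)

theorem sl2_le_tsum (a : ℕ → ℝ≥0∞) : sl2 a ≤ ∑' j, a j := by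
  rw [← pow_two_le_pow_two_iff, sl2, l2_sq, lintegral_count, sq, ← ENNReal.tsum_mul_left]
  refine ENNReal.tsum_le_tsum fun j => ?_
  rw [sq]
  gcongr
  exact ENNReal.le_tsum j

theorem exists_tsum_two_rpow_mul_le {δ : ℝ} (hδ : 0 < δ) :
    ∃ G : ℝ≥0, ∀ a : ℕ → ℝ≥0∞, ∑' j : ℕ, (2 : ℝ≥0∞) ^ (-(δ * j)) * a j ≤ G * sl2 a := by
  obtain ⟨G, hG⟩ := exists_tsum_two_rpow_le hδ
  refine ⟨G, fun a => (ENNReal.tsum_le_tsum fun j => mul_le_mul' le_rfl (le_sl2 a j)).trans ?_⟩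
  rw [ENNReal.tsum_mul_right]
  gcongr

/-- The exponentially decaying kernel `2 ^ (-δ |i - j|)`. -/
def geo (δ : ℝ) (i j : ℕ) : ℝ≥0∞ := 2 ^ (-(δ * |(i : ℝ) - j|))

theorem geo_comm (δ : ℝ) (i j : ℕ) : geo δ i j = geo δ j i := by
  rw [geo, geo, abs_sub_comm]

/-- For each distance m at most two indices `j` satisfy |i - j| = m, which leaves a geometric
series. -/
theorem exists_tsum_geo_le {δ : ℝ} (hδ : 0 < δ) :
    ∃ G : ℝ≥0, ∀ i, ∑' j, geo δ i j ≤ G := by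
  obtain ⟨G, hG⟩ := exists_tsum_two_rpow_le hδ
  refine ⟨G * 2, fun i => ?_⟩
  have h1 : ∀ j, geo δ i j ≤ ∑' m : ℕ, (2 : ℝ≥0∞) ^ (-(δ * m)) *
      ((if j = i + m then 1 else 0) + (if j + m = i then 1 else 0)) := by
    intro j
    rcases le_total i j with h | h
    · refine le_trans ?_ (ENNReal.le_tsum (j - i))
      rw [if_pos (by omega), geo, Nat.cast_sub h, abs_sub_comm,
        abs_of_nonneg (sub_nonneg.2 (Nat.cast_le.2 h))]
      exact le_mul_of_one_le_right' le_self_add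
    · refine le_trans ?_ (ENNReal.le_tsum (i - j))
      rw [if_pos (show j + (i - j) = i by omega), geo, Nat.cast_sub h,
        abs_of_nonneg (sub_nonneg.2 (Nat.cast_le.2 h))]
      exact le_mul_of_one_le_right' le_add_self
  refine (ENNReal.tsum_le_tsum h1).trans ?_
  rw [ENNReal.tsum_comm]
  have h2 : ∀ m : ℕ, ∑' j : ℕ, (2 : ℝ≥0∞) ^ (-(δ * m)) *
      ((if j = i + m then 1 else 0) + (if j + m = i then 1 else 0)) ≤ 2 ^ (-(δ * m)) * 2 := by
    intro m
    rw [ENNReal.tsum_mul_left, ENNReal.tsum_add]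
    gcongr
    rw [← one_add_one_eq_two]
    gcongr
    · rw [tsum_ite_eq]
    · refine le_trans (ENNReal.tsum_le_tsum fun j => ?_) (tsum_ite_eq (i - m) (fun _ => (1 : ℝ≥0∞))).le
      split_ifs <;> first | exact le_rfl | exact zero_le | omega
  refine (ENNReal.tsum_le_tsum h2).trans ?_
  rw [ENNReal.tsum_mul_right]
  push_cast
  gcongr

/-- Schur's test for the exponentially decaying kernel. -/
theorem exists_sl2_geo_le {δ : ℝ} (hδ : 0 < δ) :
    ∃ G : ℝ≥0, ∀ b : ℕ → ℝ≥0∞, sl2 (fun i => ∑' j, geo δ i j * b j) ≤ G * sl2 b := by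
  obtain ⟨G, hG⟩ := exists_tsum_geo_le hδ
  refine ⟨G, fun b => ?_⟩
  have h1 : ∀ i, (∑' j, geo δ i j * b j) ^ 2 ≤ G * ∑' j, geo δ i j * b j ^ 2 := by
    intro i
    have e : ∀ a : ℝ≥0∞, a ^ (1 / 2 : ℝ) * a ^ (1 / 2 : ℝ) = a := fun a => by
      rw [← ENNReal.rpow_add_of_nonneg _ _ (by norm_num) (by norm_num)]; norm_num
    have e2 : ∀ a : ℝ≥0∞, (a ^ (1 / 2 : ℝ)) ^ 2 = a := fun a => by rw [sq, e]
    have h2 : ∑' j, geo δ i j * b j =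
        ∑' j, geo δ i j ^ (1 / 2 : ℝ) * (geo δ i j ^ (1 / 2 : ℝ) * b j) :=
      tsum_congr fun j => by rw [← mul_assoc, e]
    rw [h2]
    refine (pow_le_pow_left' (tsum_mul_le_sl2 _ _) 2).trans ?_
    rw [mul_pow, sl2, sl2, l2_sq, l2_sq, lintegral_count, lintegral_count]
    simp_rw [mul_pow, e2]
    gcongr
    exact hG i
  rw [← pow_two_le_pow_two_iff, mul_pow, sl2, sl2, l2_sq, l2_sq, lintegral_count, lintegral_count]
  calc ∑' i, (∑' j, geo δ i j * b j) ^ 2 ≤ ∑' i, G * ∑' j, geo δ i j * b j ^ 2 :=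
        ENNReal.tsum_le_tsum h1
    _ = G * ∑' j, ∑' i, geo δ i j * b j ^ 2 := by
        rw [ENNReal.tsum_mul_left, ENNReal.tsum_comm]
    _ ≤ G * ∑' j, G * b j ^ 2 := by
        gcongr with j
        rw [ENNReal.tsum_mul_right]
        gcongr
        simp_rw [geo_comm δ _ j]
        exact hG j
    _ = _ := by rw [ENNReal.tsum_mul_left]; ring

end

section

variable {d : ℕ}

/-! ### Products of two distributions at a fixed time -/

/-- The pairing of a product of two pieces with a Schwartz function. -/
def pairTerm (φ : LPCutoff d) (U V : 𝓢'(Space d, ℂ)) (p : ℕ × ℕ) (θ : 𝓢(Space d, ℂ)) : ℂ :=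
  ∫ x, θ x * (φ.piece p.1 U x * φ.piece p.2 V x)

/-- The spatial `L²` norm of a piece. -/
def pieceL2 {E : Type*} [NormedAddCommGroup E] [NormedSpace ℂ E] (φ : LPCutoff d)
    (U : 𝓢'(Space d, E)) (j : ℕ) : ℝ≥0∞ :=
  l2 volume fun x => ‖φ.piece j U x‖ₑ

/-- A weighted `L¹` norm of the Fourier transform of a test function. -/
def wienerNorm (M : ℕ) (ψ : 𝓢(Space d, ℂ)) : ℝ≥0∞ :=
  ∫⁻ ξ, ENNReal.ofReal ((1 + ‖ξ‖) ^ M) * ‖ψ ξ‖ₑ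

theorem enorm_fourier_le (ψ : 𝓢(Space d, ℂ)) (x : Space d) : ‖𝓕 ψ x‖ₑ ≤ ∫⁻ ξ, ‖ψ ξ‖ₑ := by
  rw [SchwartzMap.fourier_coe, Real.fourier_eq']
  refine (enorm_integral_le_lintegral_enorm _).trans (lintegral_mono fun ξ => ?_)
  rw [enorm_smul]
  refine mul_le_of_le_one_left zero_le ?_
  rw [← ofReal_norm, Complex.norm_exp_ofReal_mul_I]
  simp

theorem lintegral_enorm_le_wienerNorm (M : ℕ) (ψ : 𝓢(Space d, ℂ)) :
    ∫⁻ ξ, ‖ψ ξ‖ₑ ≤ wienerNorm M ψ := by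
  refine lintegral_mono fun ξ => le_mul_of_one_le_left zero_le ?_
  rw [ENNReal.one_le_ofReal]
  exact one_le_pow₀ (by linarith [norm_nonneg ξ])

theorem wienerNorm_lt_top (M : ℕ) (ψ : 𝓢(Space d, ℂ)) : wienerNorm M ψ < ⊤ := by
  have h := (SchwartzMap.integrable_one_add_norm_pow_mul ψ M).2
  refine lt_of_le_of_lt (le_of_eq ?_) h
  refine lintegral_congr fun ξ => ?_
  rw [enorm_mul, enorm_norm, Real.enorm_of_nonneg (by positivity)]

/-- Needed for the continuity of the product as a functional on test functions; d + 1 extra powers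
of 1 + |ξ| make the weight integrable. -/
theorem exists_wienerNorm_le (M : ℕ) : ∃ (s : Finset (ℕ × ℕ)) (C : ℝ), 0 ≤ C ∧
    ∀ ψ : 𝓢(Space d, ℂ), (wienerNorm M ψ).toReal ≤
      C * (s.sup (schwartzSeminormFamily ℂ (Space d) ℂ)) ψ := by
  have hi := integrable_one_add_norm (E := Space d) (μ := volume) (r := (d + 1 : ℝ)) (by simp)
  refine ⟨Finset.Iic (M + (d + 1), 0), 2 ^ (M + (d + 1)) * ∫ ξ : Space d, (1 + ‖ξ‖) ^ (-(d + 1 : ℝ)),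
    by positivity, fun ψ => ?_⟩
  have h1 : ∀ ξ, (1 + ‖ξ‖) ^ M * ‖ψ ξ‖ ≤ 2 ^ (M + (d + 1)) *
      (((Finset.Iic (M + (d + 1), 0)).sup (schwartzSeminormFamily ℂ (Space d) ℂ)) ψ) *
      (1 + ‖ξ‖) ^ (-(d + 1 : ℝ)) := fun ξ => by
    have h2 := SchwartzMap.one_add_le_sup_seminorm_apply (𝕜 := ℂ) (m := (M + (d + 1), 0)) le_rfl
      le_rfl ψ ξ
    rw [norm_iteratedFDeriv_zero] at h2
    have h0 : 0 < 1 + ‖ξ‖ := by positivity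
    have e : (1 + ‖ξ‖) ^ (-(d + 1 : ℝ)) = ((1 + ‖ξ‖) ^ (d + 1))⁻¹ := by
      rw [Real.rpow_neg h0.le, ← Real.rpow_natCast]; push_cast; rfl
    rw [e, ← div_eq_mul_inv, le_div_iff₀ (by positivity)]
    calc _ = (1 + ‖ξ‖) ^ (M + (d + 1)) * ‖ψ ξ‖ := by rw [pow_add]; ring
      _ ≤ _ := h2
  have h3 : (wienerNorm M ψ).toReal = ∫ ξ, (1 + ‖ξ‖) ^ M * ‖ψ ξ‖ := by
    rw [integral_eq_lintegral_of_nonneg_ae (Eventually.of_forall fun ξ => by positivity)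
      (SchwartzMap.integrable_one_add_norm_pow_mul ψ M).1]
    congr 1
    refine lintegral_congr fun ξ => ?_
    rw [ENNReal.ofReal_mul (by positivity), ofReal_norm]
  rw [h3]
  refine (integral_mono (SchwartzMap.integrable_one_add_norm_pow_mul ψ M) (hi.const_mul _) h1).trans ?_
  rw [integral_const_mul]
  exact le_of_eq (by ring)

section PairTerm

variable (φ : LPCutoff d) (U V : 𝓢'(Space d, ℂ))

theorem lintegral_enorm_pair_le {θ : Space d → ℂ} {S : ℝ≥0∞} (hθ : ∀ x, ‖θ x‖ₑ ≤ S) (p : ℕ × ℕ) :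
    ∫⁻ x, ‖θ x * (φ.piece p.1 U x * φ.piece p.2 V x)‖ₑ ≤
      S * (pieceL2 φ U p.1 * pieceL2 φ V p.2) := by
  have hm : ∀ (j : ℕ) (U : 𝓢'(Space d, ℂ)), Measurable fun x => ‖φ.piece j U x‖ₑ :=
    fun j U => (continuous_band (φ.symbol j) U).measurable.enorm
  have h : Measurable fun x => ‖φ.piece p.1 U x‖ₑ * ‖φ.piece p.2 V x‖ₑ := (hm _ _).mul (hm _ _)
  calc _ ≤ ∫⁻ x, S * (‖φ.piece p.1 U x‖ₑ * ‖φ.piece p.2 V x‖ₑ) := by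
        refine lintegral_mono fun x => ?_
        rw [enorm_mul, enorm_mul]
        gcongr
        exact hθ x
    _ = S * ∫⁻ x, ‖φ.piece p.1 U x‖ₑ * ‖φ.piece p.2 V x‖ₑ := lintegral_const_mul _ h
    _ ≤ _ := by
        gcongr
        exact lintegral_mul_le_l2 (hm _ _).aemeasurable (hm _ _).aemeasurable

theorem integrable_pair {p : ℕ × ℕ} (hU : pieceL2 φ U p.1 ≠ ⊤) (hV : pieceL2 φ V p.2 ≠ ⊤)
    (ψ : 𝓢(Space d, ℂ)) : Integrable fun x => 𝓕 ψ x * (φ.piece p.1 U x * φ.piece p.2 V x) := by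
  refine ⟨Continuous.aestronglyMeasurable ?_, ?_⟩
  · exact (SchwartzMap.continuous _).mul
      ((continuous_band (φ.symbol p.1) U).mul (continuous_band (φ.symbol p.2) V))
  · refine (lintegral_enorm_pair_le φ U V (enorm_fourier_le ψ) p).trans_lt ?_
    have := (lintegral_enorm_le_wienerNorm 0 ψ).trans_lt (wienerNorm_lt_top 0 ψ)
    exact ENNReal.mul_lt_top this (ENNReal.mul_lt_top hU.lt_top hV.lt_top)

theorem enorm_pairTerm_le (p : ℕ × ℕ) (ψ : 𝓢(Space d, ℂ)) :
    ‖pairTerm φ U V p (𝓕 ψ)‖ₑ ≤ (∫⁻ ξ, ‖ψ ξ‖ₑ) * (pieceL2 φ U p.1 * pieceL2 φ V p.2) :=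
  (enorm_integral_le_lintegral_enorm _).trans
    (lintegral_enorm_pair_le φ U V (enorm_fourier_le ψ) p)

theorem pairTerm_comm (i j : ℕ) (θ : 𝓢(Space d, ℂ)) :
    pairTerm φ U V (i, j) θ = pairTerm φ V U (j, i) θ := by
  unfold pairTerm
  simp_rw [mul_comm (φ.piece i U _)]

theorem pairTerm_fourier_sub {p : ℕ × ℕ} (hU : pieceL2 φ U p.1 ≠ ⊤) (hV : pieceL2 φ V p.2 ≠ ⊤)
    (ψ ψ' : 𝓢(Space d, ℂ)) : pairTerm φ U V p (𝓕 (ψ - ψ')) =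
      pairTerm φ U V p (𝓕 ψ) - pairTerm φ U V p (𝓕 ψ') := by
  have e : 𝓕 (ψ - ψ') = 𝓕 ψ - 𝓕 ψ' := map_sub (SchwartzMap.fourierTransformCLM ℂ) ψ ψ'
  rw [pairTerm, pairTerm, pairTerm, e,
    ← integral_sub (integrable_pair φ U V hU hV ψ) (integrable_pair φ U V hU hV ψ')]
  refine integral_congr_ae (Eventually.of_forall fun x => ?_)
  simp only [sub_apply, sub_mul]

/-- When the frequencies of the two factors are far apart, only the high frequencies of the test
function matter. -/
theorem pairTerm_eq_of_add_three_le {i j : ℕ} (hij : i + 3 ≤ j) (hU : pieceL2 φ U i ≠ ⊤)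
    (hV : pieceL2 φ V j ≠ ⊤) (ψ : 𝓢(Space d, ℂ)) :
    pairTerm φ U V (i, j) (𝓕 ψ) =
      pairTerm φ U V (i, j) (𝓕 (ψ - pmul ψ (φ.lowSymbol (j - 3)))) := by
  rw [pairTerm_fourier_sub φ U V (p := (i, j)) hU hV]
  have h : pairTerm φ U V (i, j) (𝓕 (pmul ψ (φ.lowSymbol (j - 3)))) = 0 := by
    have h0 : ∀ ξ ζ, φ.symbol i ξ ≠ 0 → φ.symbol j ζ ≠ 0 →
        pmul ψ (φ.lowSymbol (j - 3)) (ξ + ζ) = 0 := fun ξ ζ h1 h2 => by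
      rw [pmul_apply, φ.lowSymbol_eq_zero (φ.pow_le_norm_add hij (by omega) h1 h2), mul_zero]
    exact integral_fourier_mul_band_mul_band_eq_zero (σ := φ.symbol i) (ρ := φ.symbol j)
      (η := φ.lowSymbol (j + 1)) (fun ξ => φ.lowSymbol_succ_eq_one_of_symbol_ne_zero) h0 U V
  rw [h, sub_zero]

end PairTerm

/-- The factor 1 - `lowSymbol l` vanishes for |ξ| ≤ 2^l, and beyond this radius (1 + |ξ|)^M is at
least 2^(lM). -/
theorem exists_lintegral_sub_lowSymbol_le (φ : LPCutoff d) (M : ℕ) : ∃ C : ℝ≥0,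
    ∀ (l : ℕ) (ψ : 𝓢(Space d, ℂ)), ∫⁻ ξ, ‖(ψ - pmul ψ (φ.lowSymbol l)) ξ‖ₑ ≤
      C * 2 ^ (-((l : ℝ) * M)) * wienerNorm M ψ := by
  obtain ⟨B, hB⟩ : ∃ B : ℝ≥0, ∀ ξ, ‖φ.lowSymbol 0 ξ‖ ≤ B :=
    ⟨(SchwartzMap.seminorm ℝ 0 0 (φ.lowSymbol 0)).toNNReal, fun ξ =>
      (SchwartzMap.norm_le_seminorm ℝ _ ξ).trans (Real.le_coe_toNNReal _)⟩
  refine ⟨1 + B, fun l ψ => ?_⟩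
  rw [wienerNorm, ← lintegral_const_mul' _ _ (ENNReal.mul_ne_top (by simp) (two_rpow_ne_top _))]
  refine lintegral_mono fun ξ => ?_
  have e : (ψ - pmul ψ (φ.lowSymbol l)) ξ = ψ ξ * (1 - φ.lowSymbol l ξ) := by
    rw [sub_apply, pmul_apply]; ring
  rw [e]
  rcases le_or_gt ‖ξ‖ (2 ^ l) with h | h
  · rw [φ.lowSymbol_eq_one h]; simp
  · have h1 : ‖1 - φ.lowSymbol l ξ‖ₑ ≤ (1 + B : ℝ≥0) := by
      have h0 : φ.lowSymbol l ξ = φ.lowSymbol 0 (((2 : ℝ) ^ l)⁻¹ • ξ) := by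
        have := φ.lowSymbol_add l 0
        rw [add_zero] at this
        rw [this, dil_apply]
      rw [enorm_le_coe, ← NNReal.coe_le_coe, coe_nnnorm]
      refine (norm_sub_le _ _).trans ?_
      rw [h0, norm_one]
      push_cast
      gcongr
      exact hB _
    have h2 : (1 : ℝ≥0∞) ≤ 2 ^ (-((l : ℝ) * M)) * ENNReal.ofReal ((1 + ‖ξ‖) ^ M) := by
      have h3 : (2 : ℝ≥0∞) ^ ((l : ℝ) * M) ≤ ENNReal.ofReal ((1 + ‖ξ‖) ^ M) := by
        have h4 : (2 : ℝ≥0∞) ^ ((l : ℝ) * M) = ENNReal.ofReal (((2 : ℝ) ^ l) ^ M) := by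
          rw [ENNReal.rpow_mul, ENNReal.rpow_natCast, ENNReal.rpow_natCast,
            ENNReal.ofReal_pow (by positivity), ENNReal.ofReal_pow (by positivity)]
          simp
        rw [h4]
        apply ENNReal.ofReal_le_ofReal
        gcongr
        linarith
      calc (1 : ℝ≥0∞) = 2 ^ (-((l : ℝ) * M)) * 2 ^ ((l : ℝ) * M) := by
            rw [mul_comm, two_rpow_mul_neg]
        _ ≤ _ := by gcongr
    rw [enorm_mul, mul_comm]
    calc _ ≤ ((1 + B : ℝ≥0) : ℝ≥0∞) * (1 * ‖ψ ξ‖ₑ) := by rw [one_mul]; gcongr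
      _ ≤ ((1 + B : ℝ≥0) : ℝ≥0∞) * (2 ^ (-((l : ℝ) * M)) * ENNReal.ofReal ((1 + ‖ξ‖) ^ M) * ‖ψ ξ‖ₑ) := by
          gcongr
      _ = _ := by ring

end

section

variable {d : ℕ}

/-- The off-diagonal decay of the pairings. -/
def pairWeight (M : ℕ) (p : ℕ × ℕ) : ℝ≥0∞ :=
  if p.1 + 3 ≤ p.2 ∨ p.2 + 3 ≤ p.1 then 2 ^ (-(max (p.1 : ℝ) p.2 * M)) else 1

/-- Far from the diagonal only frequencies of the test function comparable with the larger one are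
seen, and they are rapidly small; near the diagonal the trivial bound L^∞ · L² · L² is used. -/
theorem exists_enorm_pairTerm_le (φ : LPCutoff d) (M : ℕ) : ∃ C : ℝ≥0, ∀ (U V : 𝓢'(Space d, ℂ))
    (p : ℕ × ℕ) (ψ : 𝓢(Space d, ℂ)), pieceL2 φ U p.1 ≠ ⊤ → pieceL2 φ V p.2 ≠ ⊤ →
      ‖pairTerm φ U V p (𝓕 ψ)‖ₑ ≤
        C * wienerNorm M ψ * (pairWeight M p * (pieceL2 φ U p.1 * pieceL2 φ V p.2)) := by
  obtain ⟨C, hC⟩ := exists_lintegral_sub_lowSymbol_le φ M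
  have key : ∀ (U V : 𝓢'(Space d, ℂ)) (i j : ℕ) (ψ : 𝓢(Space d, ℂ)), i + 3 ≤ j →
      pieceL2 φ U i ≠ ⊤ → pieceL2 φ V j ≠ ⊤ →
      ‖pairTerm φ U V (i, j) (𝓕 ψ)‖ₑ ≤ C * 2 ^ (3 * M) * wienerNorm M ψ *
        (2 ^ (-((j : ℝ) * M)) * (pieceL2 φ U i * pieceL2 φ V j)) := by
    intro U V i j ψ hij hU hV
    rw [pairTerm_eq_of_add_three_le φ U V hij hU hV]
    refine (enorm_pairTerm_le φ U V (i, j) _).trans ?_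
    refine (mul_le_mul' (hC (j - 3) ψ) le_rfl).trans (le_of_eq ?_)
    have e : (2 : ℝ≥0∞) ^ (-(((j - 3 : ℕ) : ℝ) * M)) = 2 ^ (3 * M) * 2 ^ (-((j : ℝ) * M)) := by
      rw [← two_rpow_natCast, ← two_rpow_add, Nat.cast_sub (by omega)]
      congr 1
      push_cast
      ring
    rw [e]
    simp only
    ring
  -- The factor 2^(3M) comes from cutting the test function at level j - 3, the 1 from the diagonal.
  refine ⟨max 1 (C * 2 ^ (3 * M)), fun U V p ψ hU hV => ?_⟩
  have hle : (C * 2 ^ (3 * M) : ℝ≥0∞) ≤ (max 1 (C * 2 ^ (3 * M)) : ℝ≥0) := by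
    have : C * 2 ^ (3 * M) ≤ max 1 (C * 2 ^ (3 * M)) := le_max_right _ _
    exact_mod_cast this
  have hle1 : (1 : ℝ≥0∞) ≤ (max 1 (C * 2 ^ (3 * M)) : ℝ≥0) := by
    have : (1 : ℝ≥0) ≤ max 1 (C * 2 ^ (3 * M)) := le_max_left _ _
    exact_mod_cast this
  obtain ⟨i, j⟩ := p
  unfold pairWeight
  split_ifs with h
  · rcases h with h | h
    · refine (key U V i j ψ h hU hV).trans ?_
      have : max (i : ℝ) j = j := max_eq_right (by exact_mod_cast (by omega : i ≤ j))
      simp only [this]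
      gcongr
    · rw [pairTerm_comm]
      refine (key V U j i ψ h hV hU).trans ?_
      have : max (i : ℝ) j = i := max_eq_left (by exact_mod_cast (by omega : j ≤ i))
      simp only [this]
      rw [mul_comm (pieceL2 φ V j)]
      gcongr
  · refine (enorm_pairTerm_le φ U V (i, j) ψ).trans ?_
    rw [one_mul]
    gcongr
    refine (lintegral_enorm_le_wienerNorm M ψ).trans ?_
    exact le_mul_of_one_le_left zero_le hle1

/-- Off the diagonal a large power M absorbs any weights; on the diagonal the weights are almost
2^(i(σ+s)) ≥ 1. What remains is a bilinear form with exponentially decaying kernel. -/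
theorem exists_tsum_pairWeight_le {σ s : ℝ} (h : 0 ≤ σ + s) : ∃ (M : ℕ) (C : ℝ≥0),
    ∀ a b : ℕ → ℝ≥0∞, ∑' p : ℕ × ℕ, pairWeight M p * (a p.1 * b p.2) ≤ C * (wl2 σ a * wl2 s b) := by
  -- The extra 1 leaves the decay `geo 1`.
  obtain ⟨M, hM⟩ := exists_nat_ge (|σ| + |s| + 1)
  obtain ⟨B, hB⟩ := exists_two_rpow (2 * |s| + 2)
  obtain ⟨G, hG⟩ := exists_sl2_geo_le one_pos
  refine ⟨M, B * G, fun a b => ?_⟩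
  have key : ∀ i j : ℕ, pairWeight M (i, j) ≤
      B * (2 ^ ((i : ℝ) * σ) * 2 ^ ((j : ℝ) * s) * geo 1 i j) := by
    intro i j
    have hi : (0 : ℝ) ≤ i := Nat.cast_nonneg i
    have hj : (0 : ℝ) ≤ j := Nat.cast_nonneg j
    rw [← hB, geo, ← two_rpow_add, ← two_rpow_add, ← two_rpow_add, pairWeight]
    have h1 := mul_le_mul_of_nonneg_left (neg_abs_le σ) hi
    have h2 := mul_le_mul_of_nonneg_left (neg_abs_le s) hj
    split_ifs with hij
    · refine two_rpow_le ?_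
      simp only
      have hmi : (i : ℝ) ≤ max (i : ℝ) j := le_max_left _ _
      have hmj : (j : ℝ) ≤ max (i : ℝ) j := le_max_right _ _
      set m := max (i : ℝ) j
      have h3 : |(i : ℝ) - j| ≤ m := abs_sub_le_iff.2 ⟨by linarith, by linarith⟩
      have h4 := mul_le_mul_of_nonneg_left hM (hi.trans hmi)
      have h5 := mul_le_mul_of_nonneg_right hmi (abs_nonneg σ)
      have h6 := mul_le_mul_of_nonneg_right hmj (abs_nonneg s)
      nlinarith [abs_nonneg s]
    · rw [← ENNReal.rpow_zero (x := 2)]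
      refine two_rpow_le ?_
      push Not at hij
      have h7 : |(i : ℝ) - j| ≤ 2 := abs_sub_le_iff.2
        ⟨by have : (i : ℝ) ≤ j + 2 := by exact_mod_cast (by omega : i ≤ j + 2)
            linarith,
         by have : (j : ℝ) ≤ i + 2 := by exact_mod_cast (by omega : j ≤ i + 2)
            linarith⟩
      have h8 : -(2 * |s|) ≤ ((j : ℝ) - i) * s := by
        have := neg_abs_le (((j : ℝ) - i) * s)
        rw [abs_mul, abs_sub_comm] at this
        nlinarith [mul_le_mul_of_nonneg_right h7 (abs_nonneg s)]
      nlinarith [mul_nonneg hi h]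
  calc ∑' p : ℕ × ℕ, pairWeight M p * (a p.1 * b p.2)
      = ∑' i, ∑' j, pairWeight M (i, j) * (a i * b j) :=
        ENNReal.tsum_prod (f := fun i j => pairWeight M (i, j) * (a i * b j))
    _ ≤ ∑' i : ℕ, B * ((2 ^ ((i : ℝ) * σ) * a i) *
          ∑' j : ℕ, geo 1 i j * (2 ^ ((j : ℝ) * s) * b j)) := by
        refine ENNReal.tsum_le_tsum fun i => ?_
        rw [← ENNReal.tsum_mul_left, ← ENNReal.tsum_mul_left]
        refine ENNReal.tsum_le_tsum fun j => ?_
        calc _ ≤ (B * (2 ^ ((i : ℝ) * σ) * 2 ^ ((j : ℝ) * s) * geo 1 i j)) * (a i * b j) := by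
              gcongr; exact key i j
          _ = _ := by ring
    _ ≤ B * (wl2 σ a * (G * wl2 s b)) := by
        rw [ENNReal.tsum_mul_left]
        gcongr
        refine (tsum_mul_le_sl2 _ _).trans ?_
        gcongr
        · exact le_rfl
        · exact hG _
    _ = _ := by push_cast; ring

/-- A continuous linear map on Schwartz functions as a tempered distribution. -/
def ofCLM {E : Type*} [NormedAddCommGroup E] [NormedSpace ℂ E] (L : 𝓢(Space d, ℂ) →L[ℂ] E) :
    𝓢'(Space d, E) := ContinuousLinearMap.toPointwiseConvergenceCLM _ _ _ _ L

@[simp] theorem ofCLM_apply {E : Type*} [NormedAddCommGroup E] [NormedSpace ℂ E]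
    (L : 𝓢(Space d, ℂ) →L[ℂ] E) (θ : 𝓢(Space d, ℂ)) : ofCLM L θ = L θ := rfl

theorem norm_tsum_le_of_enorm {ι E : Type*} [NormedAddCommGroup E] [CompleteSpace E] {f : ι → E}
    {c : ℝ≥0∞} (hc : c ≠ ⊤) (h : ∑' i, ‖f i‖ₑ ≤ c) : Summable f ∧ ‖∑' i, f i‖ ≤ c.toReal := by
  have h1 : ∑' i, ‖f i‖ₑ ≠ ⊤ := (h.trans_lt hc.lt_top).ne
  have h2 : Summable fun i => ‖f i‖ := by
    have := ENNReal.tsum_coe_ne_top_iff_summable.1 h1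
    exact (NNReal.summable_coe.2 this).congr fun i => by simp
  refine ⟨h2.of_norm, (norm_tsum_le_tsum_norm h2).trans ?_⟩
  have h3 : ∑' i, ‖f i‖ = (∑' i, ‖f i‖ₑ).toReal := by
    rw [ENNReal.tsum_toReal_eq fun i => by simp]
    simp
  rw [h3]
  exact ENNReal.toReal_mono hc h

/-- The pairings are absolutely summable with a bound by a Wiener norm of ψ = 𝓕⁻θ, which is
continuous on Schwartz functions. The functional is built in the variable ψ and composed with the
inverse Fourier transform. -/
theorem exists_product_at (φ : LPCutoff d) {σ s : ℝ} (h : 0 ≤ σ + s) (U V : 𝓢'(Space d, ℂ))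
    (hU : wl2 σ (pieceL2 φ U) ≠ ⊤) (hV : wl2 s (pieceL2 φ V) ≠ ⊤) :
    ∃ W : 𝓢'(Space d, ℂ), ∀ θ, HasSum (fun p => pairTerm φ U V p θ) (W θ) := by
  obtain ⟨M, C, hC⟩ := exists_tsum_pairWeight_le h
  obtain ⟨C', hC'⟩ := exists_enorm_pairTerm_le φ M
  have hfin : ∀ {s : ℝ} {a : ℕ → ℝ≥0∞}, wl2 s a ≠ ⊤ → ∀ j, a j ≠ ⊤ := by
    intro s a ha j hj
    have h1 := (le_sl2 (fun j : ℕ => (2 : ℝ≥0∞) ^ ((j : ℝ) * s) * a j) j).trans_lt (lt_top_iff_ne_top.2 ha)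
    simp only [hj] at h1
    rw [ENNReal.mul_top (by simp [ENNReal.rpow_eq_zero_iff])] at h1
    exact absurd h1 (lt_irrefl _)
  set D : ℝ≥0∞ := C' * (C * (wl2 σ (pieceL2 φ U) * wl2 s (pieceL2 φ V)))
  have hD : D ≠ ⊤ := by
    have : wl2 σ (pieceL2 φ U) * wl2 s (pieceL2 φ V) ≠ ⊤ := ENNReal.mul_ne_top hU hV
    finiteness
  have hsum : ∀ ψ, ∑' p, ‖pairTerm φ U V p (𝓕 ψ)‖ₑ ≤ D * wienerNorm M ψ := by
    intro ψ
    calc _ ≤ ∑' p : ℕ × ℕ, C' * wienerNorm M ψ * (pairWeight M p * (pieceL2 φ U p.1 * pieceL2 φ V p.2)) :=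
          ENNReal.tsum_le_tsum fun p => hC' U V p ψ (hfin hU _) (hfin hV _)
      _ = C' * wienerNorm M ψ * ∑' p : ℕ × ℕ, pairWeight M p * (pieceL2 φ U p.1 * pieceL2 φ V p.2) :=
          ENNReal.tsum_mul_left
      _ ≤ C' * wienerNorm M ψ * (C * (wl2 σ (pieceL2 φ U) * wl2 s (pieceL2 φ V))) := by
          gcongr; exact hC _ _
      _ = _ := by simp only [D]; ring
  have hb : ∀ ψ, Summable (fun p => pairTerm φ U V p (𝓕 ψ)) ∧
      ‖∑' p, pairTerm φ U V p (𝓕 ψ)‖ ≤ D.toReal * (wienerNorm M ψ).toReal := fun ψ => by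
    rw [← ENNReal.toReal_mul]
    exact norm_tsum_le_of_enorm (ENNReal.mul_ne_top hD (wienerNorm_lt_top M ψ).ne) (hsum ψ)
  have hadd : ∀ (ψ₁ ψ₂ : 𝓢(Space d, ℂ)) p, pairTerm φ U V p (𝓕 (ψ₁ + ψ₂)) =
      pairTerm φ U V p (𝓕 ψ₁) + pairTerm φ U V p (𝓕 ψ₂) := by
    intro ψ₁ ψ₂ p
    have e : 𝓕 (ψ₁ + ψ₂) = 𝓕 ψ₁ + 𝓕 ψ₂ := map_add (SchwartzMap.fourierTransformCLM ℂ) ψ₁ ψ₂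
    rw [pairTerm, pairTerm, pairTerm, e,
      ← integral_add (integrable_pair φ U V (hfin hU _) (hfin hV _) ψ₁)
        (integrable_pair φ U V (hfin hU _) (hfin hV _) ψ₂)]
    refine integral_congr_ae (Eventually.of_forall fun x => ?_)
    simp only [add_apply, add_mul]
  have hsmul : ∀ (c : ℂ) (ψ : 𝓢(Space d, ℂ)) p, pairTerm φ U V p (𝓕 (c • ψ)) = c • pairTerm φ U V p (𝓕 ψ) := by
    intro c ψ p
    have e : 𝓕 (c • ψ) = c • 𝓕 ψ := map_smul (SchwartzMap.fourierTransformCLM ℂ) c ψ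
    rw [pairTerm, pairTerm, e, ← integral_smul]
    refine integral_congr_ae (Eventually.of_forall fun x => ?_)
    simp only [smul_apply, smul_eq_mul, mul_assoc]
  obtain ⟨S, c, hc, hS⟩ := exists_wienerNorm_le (d := d) M
  let L : 𝓢(Space d, ℂ) →L[ℂ] ℂ := SchwartzMap.mkCLMtoNormedSpace
    (fun ψ => ∑' p, pairTerm φ U V p (𝓕 ψ))
    (fun ψ₁ ψ₂ => by simp only [hadd]; exact (hb ψ₁).1.tsum_add (hb ψ₂).1)
    (fun c ψ => by simp only [hsmul]; exact (hb ψ).1.tsum_const_smul c)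
    ⟨S, D.toReal * c, by positivity, fun ψ => (hb ψ).2.trans (by
      rw [mul_assoc]; exact mul_le_mul_of_nonneg_left (hS ψ) ENNReal.toReal_nonneg)⟩
  let I : 𝓢(Space d, ℂ) →L[ℂ] 𝓢(Space d, ℂ) := FourierTransform.fourierInvCLM ℂ 𝓢(Space d, ℂ)
  refine ⟨ofCLM (L.comp I), fun θ => ?_⟩
  have h1 : 𝓕 (𝓕⁻ θ) = θ := FourierInvPair.fourier_fourierInv_eq θ
  have h2 := (hb (𝓕⁻ θ)).1.hasSum
  rw [h1] at h2
  have h3 : ofCLM (L.comp I) θ = ∑' p, pairTerm φ U V p (𝓕 (𝓕⁻ θ)) := rfl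
  rw [h3, h1]
  exact h2

end

section

variable {d : ℕ}

/-! ### Estimates for the products of pieces -/

theorem cut_congr_ae {T : ℝ} {h h' : ℝ → Space d → ℝ≥0∞}
    (H : ∀ᵐ t ∂timeMeasure T, ∀ x, h t x = h' t x) (j : ℕ) (k : Fin d → ℤ) :
    ∀ᵐ t ∂timeMeasure T, ∀ x, cut j k h t x = cut j k h' t x := by
  filter_upwards [H] with t ht x
  by_cases hx : x ∈ cube j k
  · rw [cut_apply_of_mem hx, cut_apply_of_mem hx, ht]
  · rw [cut_apply_of_notMem hx, cut_apply_of_notMem hx]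

theorem eY_congr_ae (T : ℝ) (j : ℕ) {h h' : ℝ → Space d → ℝ≥0∞}
    (H : ∀ᵐ t ∂timeMeasure T, ∀ x, h t x = h' t x) : eY T j h = eY T j h' :=
  tsum_congr fun k => eN_congr_ae T j (cut_congr_ae H j k)

theorem eY_mono_ae (T : ℝ) (j : ℕ) {h h' : ℝ → Space d → ℝ≥0∞}
    (H : ∀ᵐ t ∂timeMeasure T, ∀ x, h t x ≤ h' t x) : eY T j h ≤ eY T j h' := by
  -- At almost all times `h` equals its minimum with `h'`, and this minimum is below `h'` at every
  -- time.
  have h1 : eY T j h = eY T j fun t x => min (h t x) (h' t x) :=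
    eY_congr_ae T j (H.mono fun t ht x => (min_eq_left (ht x)).symm)
  rw [h1]
  exact eY_mono T j fun t x => min_le_right _ _

theorem eY_const_mul_le (T : ℝ) (j : ℕ) (c : ℕ) {h : ℝ → Space d → ℝ≥0∞}
    (hm : Measurable (Function.uncurry h)) : eY T j (fun t x => c * h t x) ≤ c * eY T j h := by
  have := eY_tsum_le T j (ι := Fin c) (h := fun _ => h) fun _ => hm
  simpa [tsum_fintype] using this

theorem eY_level_le (T : ℝ) {h : ℝ → Space d → ℝ≥0∞} (hm : Measurable (Function.uncurry h))
    {j k m : ℕ} (h1 : k ≤ j + m) (h2 : j ≤ k + m) :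
    eY T k h ≤ 2 ^ (m * d + m) * eY T j h := by
  rcases le_total k j with hkj | hkj
  · obtain ⟨n, rfl⟩ := Nat.exists_eq_add_of_le hkj
    refine (eY_le_add T h k n).trans ?_
    gcongr
    · norm_num
    · nlinarith
  · obtain ⟨n, rfl⟩ := Nat.exists_eq_add_of_le hkj
    refine (eY_add_le T hm j n).trans ?_
    gcongr
    rw [← two_rpow_natCast]
    refine two_rpow_le ?_
    have h3 : (n : ℝ) ≤ m := by exact_mod_cast (by omega : n ≤ m)
    push_cast
    nlinarith [show (0 : ℝ) ≤ m * d by positivity, show (0 : ℝ) ≤ n by positivity]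

/-- When `k` exceeds `i` the factor 2^((i-k)d) is below one; the constant 2^(md+m) compensates for
it and for the change of weight. -/
theorem eY_lower_le (T : ℝ) {h : ℝ → Space d → ℝ≥0∞} (hm : Measurable (Function.uncurry h))
    {i k m : ℕ} (h1 : k ≤ i + m) :
    eY T k h ≤ 2 ^ (m * d + m) * ((2 : ℝ≥0∞) ^ (((i : ℝ) - k) * d) * eY T i h) := by
  have h0 : (1 : ℝ≥0∞) ≤ 2 ^ (m * d + m) := one_le_pow₀ (by norm_num)
  rcases le_total k i with hki | hki
  · obtain ⟨n, rfl⟩ := Nat.exists_eq_add_of_le hki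
    refine (eY_le_add T h k n).trans ?_
    refine le_trans ?_ (le_mul_of_one_le_left zero_le h0)
    gcongr
    rw [← two_rpow_natCast]
    refine two_rpow_le (le_of_eq ?_)
    push_cast
    ring
  · obtain ⟨n, rfl⟩ := Nat.exists_eq_add_of_le hki
    refine (eY_add_le T hm i n).trans ?_
    rw [← mul_assoc]
    gcongr
    rw [← two_rpow_natCast, ← two_rpow_add]
    refine two_rpow_le ?_
    have h3 : (n : ℝ) ≤ m := by exact_mod_cast (by omega : n ≤ m)
    push_cast
    nlinarith [mul_le_mul_of_nonneg_right h3 (show (0 : ℝ) ≤ d by positivity),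
      show (0 : ℝ) ≤ n by positivity]

/-- Functions controlled by their averages at scale `2^{-i}`. -/
def Averaged (B : ℝ≥0) (i : ℕ) (f : ℝ → Space d → ℝ≥0∞) : Prop :=
  Measurable (Function.uncurry f) ∧ ∀ t x, f t x ≤ B * conv (wt i) (f t) x

theorem exists_eY_low_high_le (d : ℕ) (B : ℝ≥0) : ∃ C : ℝ≥0, ∀ (T : ℝ) (i j : ℕ)
    (f g : ℝ → Space d → ℝ≥0∞), Averaged B i f → Measurable (Function.uncurry g) → i ≤ j →
      eY T j (fun t x => f t x * g t x) ≤
        C * (2 : ℝ≥0∞) ^ ((i : ℝ) * (d / 2)) * eY T i f * eY T j g := by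
  obtain ⟨C, hC⟩ := eY_conv_wt_mul_le_of_le d
  obtain ⟨n, hn⟩ := exists_nat_ge B
  refine ⟨n * C, fun T i j f g hf hg hij => ?_⟩
  -- A natural constant is pulled out as a sum of n equal terms, so only subadditivity is used.
  have hn' : (B : ℝ≥0∞) ≤ n := by exact_mod_cast hn
  have hm : Measurable (Function.uncurry fun t x => conv (wt i) (f t) x * g t x) :=
    (measurable_uncurry_conv (measurable_wt i) hf.1).mul hg
  calc eY T j (fun t x => f t x * g t x)
      ≤ eY T j (fun t x => n * (conv (wt i) (f t) x * g t x)) := eY_mono T j fun t x => by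
        rw [← mul_assoc]
        gcongr
        exact (hf.2 t x).trans (by gcongr)
    _ ≤ n * eY T j (fun t x => conv (wt i) (f t) x * g t x) := eY_const_mul_le T j n hm
    _ ≤ n * (C * (2 : ℝ≥0∞) ^ ((i : ℝ) * d / 2) * eY T i f * eN T j g) := by
        gcongr
        exact hC T i j f g hij hf.1 hg
    _ ≤ n * (C * (2 : ℝ≥0∞) ^ ((i : ℝ) * d / 2) * eY T i f * eY T j g) := by
        gcongr
        exact (isConvNorm_eN T j).le_cubeSum hg j
    _ = _ := by rw [mul_div_assoc]; push_cast; ring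

/-- Averaging the product of a low and a high frequency function. -/
theorem exists_eY_conv_low_high_le (d : ℕ) (B : ℝ≥0) : ∃ C : ℝ≥0, ∀ (T : ℝ) (i j k : ℕ)
    (f g : ℝ → Space d → ℝ≥0∞), Averaged B i f → Measurable (Function.uncurry g) → i ≤ j →
      k ≤ j + 2 → j ≤ k + 2 →
      eY T k (fun t => conv (wt k) fun x => f t x * g t x) ≤
        C * (2 : ℝ≥0∞) ^ ((i : ℝ) * (d / 2)) * eY T i f * eY T j g := by
  obtain ⟨C, hC⟩ := exists_eY_low_high_le d B
  refine ⟨(box d 1).card * (box d 1).card * wtMass d * 2 ^ (2 * d + 2) * C,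
    fun T i j k f g hf hg hij h1 h2 => ?_⟩
  have hm : Measurable (Function.uncurry fun t x => f t x * g t x) := hf.1.mul hg
  refine (eY_conv_le T k (measurable_wt k) hm).trans ?_
  rw [lintegral_wt_eq]
  calc _ ≤ (box d 1).card * (box d 1).card * (wtMass d : ℝ≥0∞) * (2 ^ (2 * d + 2) *
        (C * (2 : ℝ≥0∞) ^ ((i : ℝ) * (d / 2)) * eY T i f * eY T j g)) := by
        gcongr
        exact (eY_level_le T hm h1 h2).trans (by gcongr; exact hC T i j f g hf hg hij)
    _ = _ := by push_cast; ring

/-- Averaging the product of functions of comparable frequency at a lower frequency. -/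
theorem exists_eY_conv_high_high_le (d : ℕ) : ∃ C : ℝ≥0, ∀ (T : ℝ) (i j k : ℕ)
    (f g : ℝ → Space d → ℝ≥0∞), Measurable (Function.uncurry f) → Measurable (Function.uncurry g) →
      k ≤ i + 4 →
      eY T k (fun t => conv (wt k) fun x => f t x * g t x) ≤
        C * (2 : ℝ≥0∞) ^ ((i : ℝ) * d - k * (d / 2)) * eY T i f * eY T j g := by
  obtain ⟨C, hC⟩ := eY_conv_wt_mul_le d
  refine ⟨C * 2 ^ (4 * d + 4), fun T i j k f g hf hg h => ?_⟩
  -- Bernstein at the output scale, then refinement of the cubes of `f` from level `i` to level `k`: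
  -- the exponents kd/2 and (i-k)d add up to id - kd/2.
  calc _ ≤ C * (2 : ℝ≥0∞) ^ ((k : ℝ) * d / 2) * eY T k f * eI T g := hC T k f g hf hg
    _ ≤ C * (2 : ℝ≥0∞) ^ ((k : ℝ) * d / 2) *
        (2 ^ (4 * d + 4) * ((2 : ℝ≥0∞) ^ (((i : ℝ) - k) * d) * eY T i f)) * eY T j g := by
        gcongr
        · exact eY_lower_le T hf h
        · exact eI_le_eY T j hg
    _ = C * 2 ^ (4 * d + 4) * ((2 : ℝ≥0∞) ^ ((k : ℝ) * d / 2) * (2 : ℝ≥0∞) ^ (((i : ℝ) - k) * d)) *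
        eY T i f * eY T j g := by ring
    _ = _ := by
        rw [← two_rpow_add]
        push_cast
        congr 4
        ring

/-! ### The frequency interactions -/

/-- The frequencies of a product of pieces at levels `i` and `j` may reach the level `k`. -/
def Compat (k : ℕ) (p : ℕ × ℕ) : Prop :=
  ¬(p.1 + 3 ≤ k ∧ p.2 + 3 ≤ k) ∧ ¬(p.1 + 3 ≤ p.2 ∧ k + 3 ≤ p.2) ∧ ¬(p.2 + 3 ≤ p.1 ∧ k + 3 ≤ p.1)

/-- Low-high, high-low and high-high. In the last case k ≤ i + 4, since `k` exceeds the larger index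
by at most two and this index exceeds `i` by at most two. -/
theorem Compat.cases {k i j : ℕ} (h : Compat k (i, j)) :
    (i ≤ j ∧ k ≤ j + 2 ∧ j ≤ k + 2) ∨ (j ≤ i ∧ k ≤ i + 2 ∧ i ≤ k + 2) ∨
      (i ≤ j + 2 ∧ j ≤ i + 2 ∧ k ≤ i + 4) := by
  unfold Compat at h
  simp only at h
  omega

theorem pairTerm_eq_zero_of_not_compat (φ : LPCutoff d) (U V : 𝓢'(Space d, ℂ)) {k : ℕ} {p : ℕ × ℕ}
    (h : ¬Compat k p) (x : Space d) : pairTerm φ U V p (φ.kernelAt k x) = 0 := by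
  obtain ⟨i, j⟩ := p
  have e : φ.kernelAt k x = 𝓕 (modul x (φ.symbol k)) := (fourier_modul x _).symm
  have h0 : ∀ ξ ζ, φ.symbol i ξ ≠ 0 → φ.symbol j ζ ≠ 0 → modul x (φ.symbol k) (ξ + ζ) = 0 := by
    intro ξ ζ h1 h2
    apply modul_eq_zero
    have h' : (i + 3 ≤ k ∧ j + 3 ≤ k) ∨ (i + 3 ≤ j ∧ k + 3 ≤ j) ∨ (j + 3 ≤ i ∧ k + 3 ≤ i) := by
      unfold Compat at h
      simp only at h
      omega
    rcases h' with ⟨h3, h4⟩ | ⟨h3, h4⟩ | ⟨h3, h4⟩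
    · exact φ.symbol_add_eq_zero_of_lt h3 h4 h1 h2
    · by_contra h5
      exact absurd (φ.norm_lt_of_symbol_ne_zero h5) (not_lt.2 (φ.pow_le_norm_add h3 h4 h1 h2))
    · by_contra h5
      rw [add_comm] at h5
      exact absurd (φ.norm_lt_of_symbol_ne_zero h5) (not_lt.2 (φ.pow_le_norm_add h3 h4 h2 h1))
  rw [e]
  exact integral_fourier_mul_band_mul_band_eq_zero (σ := φ.symbol i) (ρ := φ.symbol j)
    (η := φ.lowSymbol (j + 1)) (fun ξ => φ.lowSymbol_succ_eq_one_of_symbol_ne_zero) h0 U V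

theorem exists_enorm_kernel_le (φ : LPCutoff d) :
    ∃ C : ℝ≥0, ∀ (k : ℕ) x, ‖(𝓕 (φ.symbol k) : 𝓢(Space d, ℂ)) x‖ₑ ≤ C * wt k x := by
  obtain ⟨C, hC⟩ := exists_enorm_symbol_le φ 0
  refine ⟨C, fun k x => ?_⟩
  have h := (hC k x).1
  have e : ∀ f : Space d → ℂ, ‖iteratedFDeriv ℝ 0 f x‖ₑ = ‖f x‖ₑ := fun f => by
    rw [← ofReal_norm, norm_iteratedFDeriv_zero, ofReal_norm]
  simpa [e] using h

/-- The test function is the kernel of S_k translated to x. Incompatible pairs contribute nothing by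
orthogonality, so the series may be restricted before absolute values are taken. -/
theorem exists_enorm_piece_product_le (φ : LPCutoff d) : ∃ C : ℝ≥0, ∀ (U V W : 𝓢'(Space d, ℂ)),
    (∀ θ, HasSum (fun p => pairTerm φ U V p θ) (W θ)) → ∀ (k : ℕ) (x : Space d),
      ‖φ.piece k W x‖ₑ ≤ ∑' p : {p // Compat k p}, C * conv (wt k)
        (fun y => ‖φ.piece p.1.1 U y‖ₑ * ‖φ.piece p.1.2 V y‖ₑ) x := by
  obtain ⟨C, hC⟩ := exists_enorm_kernel_le φ
  refine ⟨C, fun U V W hW k x => ?_⟩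
  have h1 : ∀ p, ‖pairTerm φ U V p (φ.kernelAt k x)‖ₑ ≤
      C * conv (wt k) (fun y => ‖φ.piece p.1 U y‖ₑ * ‖φ.piece p.2 V y‖ₑ) x := by
    intro p
    rw [conv_comm, conv, ← lintegral_const_mul' _ _ (by simp)]
    refine (enorm_integral_le_lintegral_enorm _).trans (lintegral_mono fun y => ?_)
    rw [enorm_mul, enorm_mul]
    have h0 : ‖φ.kernelAt k x y‖ₑ ≤ C * wt k (x - y) := by
      rw [← wt_neg, neg_sub]
      exact hC k _
    refine (mul_le_mul' h0 le_rfl).trans (le_of_eq ?_)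
    ring
  have h2 : φ.piece k W x = ∑' p, pairTerm φ U V p (φ.kernelAt k x) := (hW _).tsum_eq.symm
  have h3 : ∑' p : {p // Compat k p}, ‖pairTerm φ U V p.1 (φ.kernelAt k x)‖ₑ =
      ∑' p, ‖pairTerm φ U V p (φ.kernelAt k x)‖ₑ := by
    refine tsum_subtype_eq_of_support_subset (s := Compat k)
      (f := fun p => ‖pairTerm φ U V p (φ.kernelAt k x)‖ₑ) fun p hp => ?_
    by_contra h
    exact hp (by simp [pairTerm_eq_zero_of_not_compat φ U V h x])
  rw [h2]
  refine (enorm_tsum_le_tsum_enorm).trans ?_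
  rw [← h3]
  exact ENNReal.tsum_le_tsum fun p => h1 p.1

end

section

variable {d : ℕ}

/-! ### Summation over the frequencies -/

theorem tsum_prod_mul (f g : ℕ → ℝ≥0∞) : ∑' p : ℕ × ℕ, f p.1 * g p.2 = (∑' i, f i) * ∑' j, g j := by
  rw [ENNReal.tsum_prod (f := fun i j => f i * g j), ← ENNReal.tsum_mul_right]
  simp_rw [ENNReal.tsum_mul_left]

/-- The sum factors. The low index is summed by its own decay, the high index by Schur's test. -/
theorem exists_sl2_low_high_le {δ : ℝ} (hδ : 0 < δ) : ∃ G : ℝ≥0, ∀ a b : ℕ → ℝ≥0∞,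
    sl2 (fun k => ∑' p : ℕ × ℕ, 2 ^ (-(δ * p.1)) * a p.1 * (geo δ k p.2 * b p.2)) ≤
      G * (sl2 a * sl2 b) := by
  obtain ⟨G, hG⟩ := exists_tsum_two_rpow_mul_le hδ
  obtain ⟨G', hG'⟩ := exists_sl2_geo_le hδ
  refine ⟨G * G', fun a b => ?_⟩
  have e : ∀ k, ∑' p : ℕ × ℕ, 2 ^ (-(δ * p.1)) * a p.1 * (geo δ k p.2 * b p.2) =
      (∑' i : ℕ, 2 ^ (-(δ * i)) * a i) * ∑' j, geo δ k j * b j := fun k =>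
    tsum_prod_mul (fun i : ℕ => 2 ^ (-(δ * i)) * a i) fun j => geo δ k j * b j
  simp_rw [e]
  rw [sl2_const_mul]
  refine (mul_le_mul' (hG a) (hG' b)).trans (le_of_eq ?_)
  push_cast
  ring

/-- The output index appears only in the summable factor 2^(-δk); the double sum over the inputs is
a Schur form bounded by Cauchy–Schwarz. -/
theorem exists_sl2_high_high_le {δ : ℝ} (hδ : 0 < δ) : ∃ G : ℝ≥0, ∀ a b : ℕ → ℝ≥0∞,
    sl2 (fun k => ∑' p : ℕ × ℕ, 2 ^ (-(δ * k)) * (a p.1 * (geo δ p.1 p.2 * b p.2))) ≤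
      G * (sl2 a * sl2 b) := by
  obtain ⟨G, hG⟩ := exists_tsum_two_rpow_le hδ
  obtain ⟨G', hG'⟩ := exists_sl2_geo_le hδ
  refine ⟨G * G', fun a b => ?_⟩
  have e : ∑' p : ℕ × ℕ, a p.1 * (geo δ p.1 p.2 * b p.2) =
      ∑' i, a i * ∑' j, geo δ i j * b j := by
    rw [ENNReal.tsum_prod (f := fun i j => a i * (geo δ i j * b j))]
    simp_rw [ENNReal.tsum_mul_left]
  simp_rw [ENNReal.tsum_mul_left]
  rw [sl2_mul_const, e]
  refine (mul_le_mul' ((sl2_le_tsum _).trans hG) ((tsum_mul_le_sl2 _ _).trans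
    (mul_le_mul' le_rfl (hG' b)))).trans (le_of_eq ?_)
  push_cast
  ring

theorem averaged_piece (φ : LPCutoff d) : ∃ B : ℝ≥0, ∀ U : ℝ → 𝓢'(Space d, ℂ), PieceMeas φ U →
    ∀ i, Averaged B i fun t x => ‖φ.piece i (U t) x‖ₑ := by
  obtain ⟨B, hB⟩ := exists_enorm_piece_le (E := ℂ) φ
  exact ⟨B, fun U hU i => ⟨hU.measurable i, fun t x => hB i (U t) x⟩⟩

theorem two_rpow_abs_le {x y c : ℝ} (hxy : |x - y| ≤ 2) : (2 : ℝ≥0∞) ^ (x * c) ≤ 2 ^ (2 * |c|) * 2 ^ (y * c) := by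
  rw [← two_rpow_add]
  apply two_rpow_le
  have h1 := le_abs_self ((x - y) * c)
  rw [abs_mul] at h1
  nlinarith [mul_le_mul_of_nonneg_right hxy (abs_nonneg c)]

theorem abs_sub_le_two {i j : ℕ} (h1 : i ≤ j + 2) (h2 : j ≤ i + 2) : |(i : ℝ) - j| ≤ 2 := by
  have h1' : (i : ℝ) ≤ j + 2 := by exact_mod_cast h1
  have h2' : (j : ℝ) ≤ i + 2 := by exact_mod_cast h2
  exact abs_sub_le_iff.2 ⟨by linarith, by linarith⟩

/-- The space-time estimate of the frequency interactions. -/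
theorem exists_interaction_le (d : ℕ) (B : ℝ≥0) {s σ ρ τ : ℝ} (hs : (d : ℝ) / 2 < s) (hσ : (d : ℝ) - s ≤ σ)
    (hρτ : ∀ i j : ℕ, i ≤ j → (j : ℝ) * σ + i * (d / 2) ≤ j * τ + i * ρ - (s - d / 2) * i) :
    ∃ C : ℝ≥0, ∀ (T : ℝ) (k i j : ℕ) (f g : ℝ → Space d → ℝ≥0∞), Averaged B i f → Averaged B j g →
      Compat k (i, j) →
      2 ^ ((k : ℝ) * σ) * eY T k (fun t => conv (wt k) fun x => f t x * g t x) ≤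
        C * (2 ^ (-((s - d / 2) * i)) * (2 ^ ((i : ℝ) * ρ) * eY T i f) *
            (geo (s - d / 2) k j * (2 ^ ((j : ℝ) * τ) * eY T j g)) +
          2 ^ (-((s - d / 2) * j)) * (2 ^ ((j : ℝ) * s) * eY T j g) *
            (geo (s - d / 2) k i * (2 ^ ((i : ℝ) * σ) * eY T i f)) +
          2 ^ (-((s - d / 2) * k)) * ((2 ^ ((i : ℝ) * σ) * eY T i f) *
            (geo (s - d / 2) i j * (2 ^ ((j : ℝ) * s) * eY T j g)))) := by
  obtain ⟨C₁, hC₁⟩ := exists_eY_conv_low_high_le d B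
  obtain ⟨C₂, hC₂⟩ := exists_eY_conv_high_high_le d
  set δ := s - d / 2 with hδ
  have hδ0 : 0 < δ := by linarith
  obtain ⟨D, hD⟩ := exists_two_rpow (2 * |σ| + 2 * δ)
  obtain ⟨D', hD'⟩ := exists_two_rpow (4 * (σ + s - d) + 2 * s + 2 * δ)
  -- `D` pays for replacing `k` by an index at distance at most two, `D'` for k ≤ i + 4 and |i - j|
  -- ≤ 2.
  refine ⟨C₁ * D + C₂ * D', fun T k i j f g hf hg hp => ?_⟩
  have hs0 : 0 < s := lt_of_le_of_lt (by positivity) hs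
  rcases hp.cases with ⟨h1, h2, h3⟩ | ⟨h1, h2, h3⟩ | ⟨h1, h2, h3⟩
  -- Low-high. The hypothesis on `ρ` and `τ` is used only here; it leaves open which of the two
  -- factors is measured with the exponent s.
  · have hk := abs_sub_le_two h2 h3
    have hexp : (2 : ℝ≥0∞) ^ ((k : ℝ) * σ + i * (d / 2)) ≤
        D * 2 ^ (-(δ * i) + i * ρ + (-(δ * |(k : ℝ) - j|) + j * τ)) := by
      rw [← hD, ← two_rpow_add]
      apply two_rpow_le
      have h4 := le_abs_self (((k : ℝ) - j) * σ)
      rw [abs_mul] at h4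
      nlinarith [mul_le_mul_of_nonneg_right hk (abs_nonneg σ), hρτ i j h1]
    calc _ ≤ 2 ^ ((k : ℝ) * σ) * (C₁ * (2 : ℝ≥0∞) ^ ((i : ℝ) * (d / 2)) * eY T i f * eY T j g) := by
          gcongr
          exact hC₁ T i j k f g hf hg.1 h1 h2 h3
      _ = C₁ * (2 : ℝ≥0∞) ^ ((k : ℝ) * σ + i * (d / 2)) * (eY T i f * eY T j g) := by
          rw [two_rpow_add]; ring
      _ ≤ C₁ * (D * 2 ^ (-(δ * i) + i * ρ + (-(δ * |(k : ℝ) - j|) + j * τ))) * (eY T i f * eY T j g) := by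
          gcongr
      _ = C₁ * D * (2 ^ (-(δ * i)) * (2 ^ ((i : ℝ) * ρ) * eY T i f) *
            (geo δ k j * (2 ^ ((j : ℝ) * τ) * eY T j g))) := by
          rw [two_rpow_add, two_rpow_add, two_rpow_add, geo]; ring
      _ ≤ _ := by
          push_cast
          refine mul_le_mul' le_self_add ?_
          rw [add_assoc]
          exact le_self_add
  -- High-low. Here `g` is the low factor, measured with s, and s = δ + d/2 balances the exponents
  -- exactly.
  · have hk := abs_sub_le_two h2 h3
    have hexp : (2 : ℝ≥0∞) ^ ((k : ℝ) * σ + j * (d / 2)) ≤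
        D * 2 ^ (-(δ * j) + j * s + (-(δ * |(k : ℝ) - i|) + i * σ)) := by
      rw [← hD, ← two_rpow_add]
      apply two_rpow_le
      have h4 := le_abs_self (((k : ℝ) - i) * σ)
      rw [abs_mul] at h4
      have h5 : -(δ * j) + j * s = (j : ℝ) * (d / 2) := by rw [hδ]; ring
      nlinarith [mul_le_mul_of_nonneg_right hk (abs_nonneg σ)]
    calc _ ≤ 2 ^ ((k : ℝ) * σ) * (C₁ * (2 : ℝ≥0∞) ^ ((j : ℝ) * (d / 2)) * eY T j g * eY T i f) := by
          gcongr
          simp_rw [mul_comm (f _ _)]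
          exact hC₁ T j i k g f hg hf.1 h1 h2 h3
      _ = C₁ * (2 : ℝ≥0∞) ^ ((k : ℝ) * σ + j * (d / 2)) * (eY T i f * eY T j g) := by
          rw [two_rpow_add]; ring
      _ ≤ C₁ * (D * 2 ^ (-(δ * j) + j * s + (-(δ * |(k : ℝ) - i|) + i * σ))) * (eY T i f * eY T j g) := by
          gcongr
      _ = C₁ * D * (2 ^ (-(δ * j)) * (2 ^ ((j : ℝ) * s) * eY T j g) *
            (geo δ k i * (2 ^ ((i : ℝ) * σ) * eY T i f))) := by
          rw [two_rpow_add, two_rpow_add, two_rpow_add, geo]; ring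
      _ ≤ _ := by
          push_cast
          refine mul_le_mul' le_self_add ?_
          rw [add_right_comm]
          exact le_add_self
  -- High-high. The condition σ + s - d ≥ 0 allows k(σ + s - d) to be replaced by (i + 4)(σ + s -
  -- d); the rest of the weight at `k` is the decay 2^(-δk).
  · have hk := abs_sub_le_two h1 h2
    have hexp : (2 : ℝ≥0∞) ^ ((k : ℝ) * σ + (i * d - k * (d / 2))) ≤
        D' * 2 ^ (-(δ * k) + i * σ + (-(δ * |(i : ℝ) - j|) + j * s)) := by
      rw [← hD', ← two_rpow_add]
      apply two_rpow_le
      have h4 : (k : ℝ) ≤ i + 4 := by exact_mod_cast h3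
      have h5 : (i : ℝ) ≤ j + 2 := by exact_mod_cast h1
      have h6 := mul_le_mul_of_nonneg_right h4 (show 0 ≤ σ + s - d by linarith)
      have h7 := mul_le_mul_of_nonneg_right h5 hs0.le
      have h8 : δ * k = k * s - k * (d / 2) := by rw [hδ]; ring
      nlinarith
    calc _ ≤ 2 ^ ((k : ℝ) * σ) *
          (C₂ * (2 : ℝ≥0∞) ^ ((i : ℝ) * d - k * (d / 2)) * eY T i f * eY T j g) := by
          gcongr
          exact hC₂ T i j k f g hf.1 hg.1 h3
      _ = C₂ * (2 : ℝ≥0∞) ^ ((k : ℝ) * σ + (i * d - k * (d / 2))) * (eY T i f * eY T j g) := by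
          rw [two_rpow_add _ ((i : ℝ) * d - _)]; ring
      _ ≤ C₂ * (D' * 2 ^ (-(δ * k) + i * σ + (-(δ * |(i : ℝ) - j|) + j * s))) * (eY T i f * eY T j g) := by
          gcongr
      _ = C₂ * D' * (2 ^ (-(δ * k)) * ((2 ^ ((i : ℝ) * σ) * eY T i f) *
            (geo δ i j * (2 ^ ((j : ℝ) * s) * eY T j g)))) := by
          rw [two_rpow_add, two_rpow_add, two_rpow_add, geo]; ring
      _ ≤ _ := by
          push_cast
          exact mul_le_mul' le_add_self le_add_self

/-- The bilinear estimate. -/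
theorem exists_wl2_product_le (φ : LPCutoff d) {s σ ρ τ : ℝ} (hs : (d : ℝ) / 2 < s)
    (hσ : (d : ℝ) - s ≤ σ)
    (hρτ : ∀ i j : ℕ, i ≤ j → (j : ℝ) * σ + i * (d / 2) ≤ j * τ + i * ρ - (s - d / 2) * i) :
    ∃ C : ℝ≥0, ∀ (T : ℝ) (U V W : ℝ → 𝓢'(Space d, ℂ)), PieceMeas φ U → PieceMeas φ V →
      (∀ᵐ t ∂timeMeasure T, ∀ θ, HasSum (fun p => pairTerm φ (U t) (V t) p θ) (W t θ)) →
      wl2 σ (fun j => pieceNorm φ T j W) ≤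
        C * (wl2 σ (fun j => pieceNorm φ T j U) * wl2 s (fun j => pieceNorm φ T j V) +
          wl2 ρ (fun j => pieceNorm φ T j U) * wl2 τ (fun j => pieceNorm φ T j V)) := by
  obtain ⟨A, hA⟩ := exists_enorm_piece_product_le φ
  obtain ⟨n, hn⟩ := exists_nat_ge A
  obtain ⟨B, hB⟩ := averaged_piece φ
  obtain ⟨C, hC⟩ := exists_interaction_le d B hs hσ hρτ
  have hδ : 0 < s - d / 2 := by linarith
  set δ := s - d / 2
  obtain ⟨G, hG⟩ := exists_sl2_low_high_le hδ
  obtain ⟨G', hG'⟩ := exists_sl2_high_high_le hδ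
  refine ⟨n * C * (2 * G + G'), fun T U V W hU hV hW => ?_⟩
  have hn' : (A : ℝ≥0∞) ≤ n := by exact_mod_cast hn
  let X : ℕ → ℕ × ℕ → ℝ → Space d → ℝ≥0∞ := fun k p t =>
    conv (wt k) fun y => ‖φ.piece p.1 (U t) y‖ₑ * ‖φ.piece p.2 (V t) y‖ₑ
  have hX : ∀ k p, Measurable (Function.uncurry (X k p)) := fun k p =>
    measurable_uncurry_conv (measurable_wt k) ((hU.measurable p.1).mul (hV.measurable p.2))
  have h1 : ∀ k, pieceNorm φ T k W ≤ ∑' p : {p // Compat k p}, n * eY T k (X k p.1) := by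
    intro k
    calc pieceNorm φ T k W ≤ eY T k (fun t x => ∑' p : {p // Compat k p}, n * X k p.1 t x) := by
          refine eY_mono_ae T k (hW.mono fun t ht x => (hA _ _ _ ht k x).trans ?_)
          exact ENNReal.tsum_le_tsum fun p => mul_le_mul' hn' le_rfl
      _ ≤ ∑' p : {p // Compat k p}, eY T k (fun t x => n * X k p.1 t x) :=
          eY_tsum_le T k fun p => (hX k p.1).const_mul _
      _ ≤ _ := ENNReal.tsum_le_tsum fun p => eY_const_mul_le T k n (hX k p.1)
  let a : ℝ → ℕ → ℝ≥0∞ := fun r j => 2 ^ ((j : ℝ) * r) * pieceNorm φ T j U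
  let b : ℝ → ℕ → ℝ≥0∞ := fun r j => 2 ^ ((j : ℝ) * r) * pieceNorm φ T j V
  have h2 : ∀ k : ℕ, 2 ^ ((k : ℝ) * σ) * pieceNorm φ T k W ≤ n * C *
      ((∑' p : ℕ × ℕ, 2 ^ (-(δ * p.1)) * a ρ p.1 * (geo δ k p.2 * b τ p.2)) +
        (∑' p : ℕ × ℕ, 2 ^ (-(δ * p.1)) * b s p.1 * (geo δ k p.2 * a σ p.2)) +
        (∑' p : ℕ × ℕ, 2 ^ (-(δ * k)) * (a σ p.1 * (geo δ p.1 p.2 * b s p.2)))) := by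
    intro k
    -- In the high-low sum the roles of the indices are exchanged, so that the low one comes first.
    rw [← (Equiv.prodComm ℕ ℕ).tsum_eq
      (fun p : ℕ × ℕ => 2 ^ (-(δ * p.1)) * b s p.1 * (geo δ k p.2 * a σ p.2)),
      ← ENNReal.tsum_add, ← ENNReal.tsum_add, ← ENNReal.tsum_mul_left]
    refine (mul_le_mul' le_rfl (h1 k)).trans ?_
    rw [← ENNReal.tsum_mul_left]
    refine le_trans (ENNReal.tsum_le_tsum fun p => ?_) (ENNReal.tsum_comp_le_tsum_of_injective
      (Subtype.val_injective (p := Compat k)) _)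
    rw [mul_left_comm, mul_assoc]
    refine mul_le_mul' le_rfl ?_
    exact hC T k p.1.1 p.1.2 _ _ (hB U hU _) (hB V hV _) p.2
  rw [wl2_eq_sl2]
  refine (sl2_mono h2).trans ?_
  rw [sl2_const_mul]
  refine (mul_le_mul' le_rfl ((sl2_add_le _ _).trans (add_le_add ((sl2_add_le _ _).trans
    (add_le_add (hG (a ρ) (b τ)) (hG (b s) (a σ)))) (hG' (a σ) (b s))))).trans ?_
  have e1 : sl2 (a σ) = wl2 σ (fun j => pieceNorm φ T j U) := rfl
  have e2 : sl2 (a ρ) = wl2 ρ (fun j => pieceNorm φ T j U) := rfl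
  have e3 : sl2 (b s) = wl2 s (fun j => pieceNorm φ T j V) := rfl
  have e4 : sl2 (b τ) = wl2 τ (fun j => pieceNorm φ T j V) := rfl
  rw [← e1, ← e2, ← e3, ← e4]
  push_cast
  rw [mul_assoc (_ * _)]
  gcongr
  rw [mul_comm (sl2 (b s))]
  generalize sl2 (a σ) * sl2 (b s) = x
  generalize sl2 (a ρ) * sl2 (b τ) = y
  calc G * y + G * x + G' * x ≤ (G * y + G * x + G' * x) + (G * x + (G * y + G' * y)) := le_self_add
    _ = _ := by ring

end

section

variable {d : ℕ}

/-! ### Convergence of the low frequency truncations -/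

section HighPass

variable (φ : LPCutoff d)

/-- The symbol of `1 - S_{≤ N}`. -/
def highSymbol (N : ℕ) (ξ : Space d) : ℂ := 1 - φ.lowSymbol N ξ

theorem contDiff_highSymbol (N : ℕ) : ContDiff ℝ ∞ (highSymbol φ N) :=
  contDiff_const.sub ((φ.lowSymbol N).smooth _)

/-- The symbol vanishes for |ξ| < 2^N, and outside this ball 2^(-N)|ξ| ≥ 1 may be inserted freely.
One power of |ξ|, harmless for Schwartz functions, thus buys the decay 2^(-N). -/
theorem exists_iteratedFDeriv_highSymbol_le (m : ℕ) : ∃ B : ℝ, 0 ≤ B ∧ ∀ (N : ℕ) (ξ : Space d),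
    ‖iteratedFDeriv ℝ m (highSymbol φ N) ξ‖ ≤ B * ((2 ^ N)⁻¹ * ‖ξ‖) := by
  have h0 : ∃ B : ℝ, 0 ≤ B ∧ ∀ ξ, ‖iteratedFDeriv ℝ m (highSymbol φ 0) ξ‖ ≤ B := by
    refine ⟨1 + SchwartzMap.seminorm ℝ 0 m (φ.lowSymbol 0), by positivity, fun ξ => ?_⟩
    have e : highSymbol φ 0 = (fun _ => (1 : ℂ)) - (φ.lowSymbol 0 : Space d → ℂ) := rfl
    rw [e, iteratedFDeriv_sub_apply contDiff_const.contDiffAt ((φ.lowSymbol 0).smooth m).contDiffAt]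
    refine (norm_sub_le _ _).trans (add_le_add ?_
      (SchwartzMap.norm_iteratedFDeriv_le_seminorm ℝ _ m ξ))
    rcases Nat.eq_zero_or_pos m with rfl | hm
    · simp
    · rw [iteratedFDeriv_const_of_ne hm.ne']
      simp
  obtain ⟨B, hB, h⟩ := h0
  refine ⟨B, hB, fun N ξ => ?_⟩
  rcases lt_or_ge ‖ξ‖ (2 ^ N) with hξ | hξ
  · have h1 : highSymbol φ N =ᶠ[𝓝 ξ] fun _ => (0 : ℂ) := by
      filter_upwards [(isOpen_lt continuous_norm continuous_const).mem_nhds hξ] with ζ hζ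
      rw [highSymbol, φ.lowSymbol_eq_one (le_of_lt hζ), sub_self]
    rw [(h1.iteratedFDeriv ℝ m).eq_of_nhds]
    have : iteratedFDeriv ℝ m (fun _ : Space d => (0 : ℂ)) ξ = 0 := by
      simp [iteratedFDeriv_fun_zero]
    rw [this, norm_zero]
    positivity
  · have e : highSymbol φ N = fun ζ => highSymbol φ 0 (((2 : ℝ) ^ N)⁻¹ • ζ) := by
      ext ζ
      have := φ.lowSymbol_add N 0
      rw [add_zero] at this
      rw [highSymbol, highSymbol, this, dil_apply]
    rw [e, iteratedFDeriv_comp_const_smul _ ((contDiff_highSymbol φ 0).of_le (by exact_mod_cast le_top))]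
    rw [norm_smul, mul_comm]
    have h2 : (1 : ℝ) ≤ (2 ^ N)⁻¹ * ‖ξ‖ := by
      rw [inv_mul_eq_div, one_le_div (by positivity)]; exact hξ
    refine mul_le_mul (h _) (le_trans ?_ h2) (norm_nonneg _) hB
    rw [norm_pow, norm_inv, norm_pow]
    simp only [Real.norm_ofNat]
    exact pow_le_one₀ (by positivity) (inv_le_one_of_one_le₀ (one_le_pow₀ (by norm_num)))

theorem tendsto_pmul_lowSymbol (ψ : 𝓢(Space d, ℂ)) :
    Tendsto (fun N => pmul ψ (φ.lowSymbol N)) atTop (𝓝 ψ) := by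
  choose B hB h using exists_iteratedFDeriv_highSymbol_le φ
  rw [(schwartz_withSeminorms ℝ (Space d) ℂ).tendsto_nhds]
  rintro ⟨k, n⟩ ε hε
  set M : ℝ := ∑ i ∈ Finset.range (n + 1), (n.choose i : ℝ) *
    SchwartzMap.seminorm ℝ (k + 1) i ψ * B (n - i)
  have hM : ∀ N, SchwartzMap.seminorm ℝ k n (pmul ψ (φ.lowSymbol N) - ψ) ≤ M * (2⁻¹) ^ N := by
    intro N
    have hM0 : 0 ≤ M := Finset.sum_nonneg fun i _ => by have := hB (n - i); positivity
    rw [map_sub_rev]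
    refine SchwartzMap.seminorm_le_bound ℝ k n _ (by positivity) fun ξ => ?_
    have e : ((ψ - pmul ψ (φ.lowSymbol N) : 𝓢(Space d, ℂ)) : Space d → ℂ) =
        fun ξ => ψ ξ * highSymbol φ N ξ := by
      ext ξ
      rw [sub_apply, pmul_apply, highSymbol]; ring
    rw [e]
    have h1 := norm_iteratedFDeriv_mul_le (ψ.smooth n)
      ((contDiff_highSymbol φ N).of_le (by exact_mod_cast le_top)) ξ (n := n) le_rfl
    refine (mul_le_mul_of_nonneg_left h1 (by positivity)).trans ?_
    rw [Finset.mul_sum, Finset.sum_mul]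
    refine Finset.sum_le_sum fun i _ => ?_
    have h2 := h (n - i) N ξ
    have h3 := SchwartzMap.le_seminorm ℝ (k + 1) i ψ ξ
    calc ‖ξ‖ ^ k * (n.choose i * ‖iteratedFDeriv ℝ i ψ ξ‖ *
          ‖iteratedFDeriv ℝ (n - i) (highSymbol φ N) ξ‖)
        ≤ ‖ξ‖ ^ k * (n.choose i * ‖iteratedFDeriv ℝ i ψ ξ‖ * (B (n - i) * ((2 ^ N)⁻¹ * ‖ξ‖))) := by
          gcongr
      _ = n.choose i * (‖ξ‖ ^ (k + 1) * ‖iteratedFDeriv ℝ i ψ ξ‖) * B (n - i) * 2⁻¹ ^ N := by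
          rw [inv_pow]; ring
      _ ≤ _ := by
          have := hB (n - i)
          gcongr
  have ht : Tendsto (fun N : ℕ => M * (2⁻¹ : ℝ) ^ N) atTop (𝓝 0) := by
    simpa using (tendsto_pow_atTop_nhds_zero_of_lt_one (r := (2⁻¹ : ℝ)) (by norm_num)
      (by norm_num)).const_mul M
  filter_upwards [ht.eventually (gt_mem_nhds hε)] with N hN
  exact (hM N).trans_lt hN

theorem tendsto_lowSymbol_pairing {E : Type*} [NormedAddCommGroup E] [NormedSpace ℂ E]
    (U : 𝓢'(Space d, E)) (ψ : 𝓢(Space d, ℂ)) :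
    Tendsto (fun N => U (𝓕 (pmul ψ (φ.lowSymbol N)))) atTop (𝓝 (U (𝓕 ψ))) := by
  have h1 : Continuous fun ψ : 𝓢(Space d, ℂ) => U (𝓕 ψ) :=
    (map_continuous U).comp (SchwartzMap.fourierTransformCLM ℂ).continuous
  exact (h1.tendsto ψ).comp (tendsto_pmul_lowSymbol φ ψ)

end HighPass

theorem fourierInv_fourier_pmul (g b : 𝓢(Space d, ℂ)) (x : Space d) :
    ∫ y, 𝓕⁻ b (x - y) * g y = 𝓕⁻ (pmul (𝓕 g) b) x := by
  have h : sconv g (𝓕⁻ b) = 𝓕⁻ (pmul (𝓕 g) b) := by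
    apply fourier_injective
    ext ξ
    have h1 : 𝓕 (𝓕⁻ b) = b := FourierInvPair.fourier_fourierInv_eq b
    have h2 : 𝓕 (𝓕⁻ (pmul (𝓕 g) b)) = pmul (𝓕 g) b := FourierInvPair.fourier_fourierInv_eq _
    simp only
    rw [fourier_sconv, h1, h2, pmul_apply]
  rw [← h, sconv_apply]
  rfl

theorem l2_add_le {f g : Space d → ℝ≥0∞} (hf : Measurable f) (hg : Measurable g) :
    l2 volume (fun x => f x + g x) ≤ l2 volume f + l2 volume g := by
  have := l2_tsum_le (μ := (volume : Measure (Space d))) (h := fun b : Bool => if b then f else g)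
    (fun b => by cases b <;> simpa)
  simpa [tsum_bool, add_comm] using this

theorem exists_enorm_lowSymbol_le (φ : LPCutoff d) : ∃ C : ℝ≥0, ∀ (N : ℕ) x,
    ‖(𝓕⁻ (φ.lowSymbol N) : 𝓢(Space d, ℂ)) x‖ₑ ≤ C * wt N x ∧
      ‖(𝓕 (φ.lowSymbol N) : 𝓢(Space d, ℂ)) x‖ₑ ≤ C * wt N x := by
  obtain ⟨C, hC⟩ := exists_enorm_fourier_dil_le (φ.lowSymbol 0) 0
  have e : ∀ (f : Space d → ℂ) x, ‖iteratedFDeriv ℝ 0 f x‖ₑ = ‖f x‖ₑ := fun f x => by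
    rw [← ofReal_norm, norm_iteratedFDeriv_zero, ofReal_norm]
  refine ⟨C, fun N x => ?_⟩
  have h1 := φ.lowSymbol_add N 0
  rw [add_zero] at h1
  have := hC N x
  rw [← h1, e, e] at this
  simpa using this.symm

/-- The truncations are bounded on L² uniformly in N, because their kernels are dominated by `wt N`
of fixed mass, and they converge on Schwartz functions; density concludes. -/
theorem tendsto_l2_lowPiece_sub (φ : LPCutoff d) {f : Space d → ℂ} (hf : MemLp f 2)
    (U : 𝓢'(Space d, ℂ)) (hU : ∀ θ, U θ = ∫ x, θ x • f x) :
    Tendsto (fun N => l2 volume fun x => ‖φ.lowPiece N U x - f x‖ₑ) atTop (𝓝 0) := by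
  obtain ⟨C, hC⟩ := exists_enorm_lowSymbol_le φ
  obtain ⟨f', hf'm, hf'⟩ := hf.1
  have hmem : MemLp f' 2 := (memLp_congr_ae hf').1 hf
  let A : ℕ → (Space d → ℂ) → Space d → ℂ := fun N h x => ∫ y, 𝓕⁻ (φ.lowSymbol N) (x - y) * h y
  have hA : ∀ N x, φ.lowPiece N U x = A N f' x := by
    intro N x
    rw [lowPiece_eq_band, band, hU]
    refine integral_congr_ae ?_
    filter_upwards [hf'] with y hy
    rw [← hy]
    simp [SchwartzMap.fourier_coe, SchwartzMap.fourierInv_coe, Real.fourierInv_eq_fourier_neg]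
  have hkey : ∀ g : 𝓢(Space d, ℂ), ∀ N, (l2 volume fun x => ‖φ.lowPiece N U x - f x‖ₑ) ≤
      (C * wtMass d + 1) * l2 volume (fun x => ‖f' x - g x‖ₑ) +
        l2 volume fun x => ‖(𝓕⁻ (pmul (𝓕 g) (φ.lowSymbol N)) : 𝓢(Space d, ℂ)) x - g x‖ₑ := by
    intro g N
    have hgm : Measurable fun x => ‖f' x - g x‖ₑ :=
      (hf'm.measurable.sub g.continuous.measurable).enorm
    have hKi : ∀ (h : Space d → ℂ), MemLp h 2 → ∀ x,
        Integrable fun y => 𝓕⁻ (φ.lowSymbol N) (x - y) * h y := by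
      intro h hh x
      have h2 : MemLp (fun y => (𝓕⁻ (φ.lowSymbol N) : 𝓢(Space d, ℂ)) (x - y)) 2 :=
        (SchwartzMap.memLp (𝓕⁻ (φ.lowSymbol N)) 2).comp_measurePreserving
          (Measure.measurePreserving_sub_left volume x)
      exact h2.integrable_mul hh
    have h1 : ∀ x, ‖A N f' x - A N g x‖ₑ ≤ C * conv (wt N) (fun y => ‖f' y - g y‖ₑ) x := by
      intro x
      have e : A N f' x - A N g x = ∫ y, 𝓕⁻ (φ.lowSymbol N) (x - y) * (f' y - g y) := by
        simp only [A]
        rw [← integral_sub (hKi f' hmem x) (hKi g (SchwartzMap.memLp g 2) x)]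
        simp_rw [mul_sub]
      rw [e, conv_comm, conv, ← lintegral_const_mul' _ _ (by simp)]
      refine (enorm_integral_le_lintegral_enorm _).trans (lintegral_mono fun y => ?_)
      rw [enorm_mul]
      refine (mul_le_mul' (hC N _).1 le_rfl).trans (le_of_eq (by ring))
    have hm1 : Measurable fun x => C * conv (wt N) (fun y => ‖f' y - g y‖ₑ) x :=
      (measurable_conv (measurable_wt N) hgm).const_mul _
    have hm2 : Measurable fun x => ‖(𝓕⁻ (pmul (𝓕 g) (φ.lowSymbol N)) : 𝓢(Space d, ℂ)) x - g x‖ₑ :=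
      ((SchwartzMap.continuous _).sub g.continuous).measurable.enorm
    calc (l2 volume fun x => ‖φ.lowPiece N U x - f x‖ₑ)
        ≤ l2 volume fun x => (C * conv (wt N) (fun y => ‖f' y - g y‖ₑ) x + ‖f' x - g x‖ₑ) +
            ‖(𝓕⁻ (pmul (𝓕 g) (φ.lowSymbol N)) : 𝓢(Space d, ℂ)) x - g x‖ₑ := by
          refine l2_mono_ae ?_
          filter_upwards [hf'] with x hx
          have e : φ.lowPiece N U x - f x = (A N f' x - A N g x) +
              (A N g x - g x) - (f' x - g x) := by rw [hA, hx]; ring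
          have e2 : A N g x = (𝓕⁻ (pmul (𝓕 g) (φ.lowSymbol N)) : 𝓢(Space d, ℂ)) x :=
            fourierInv_fourier_pmul g _ x
          rw [e, ← e2, add_right_comm]
          refine (enorm_sub_le).trans ?_
          gcongr
          refine (enorm_add_le _ _).trans ?_
          gcongr
          exact h1 x
      _ ≤ (C * (wtMass d * l2 volume (fun x => ‖f' x - g x‖ₑ)) + l2 volume (fun x => ‖f' x - g x‖ₑ)) +
          l2 volume fun x => ‖(𝓕⁻ (pmul (𝓕 g) (φ.lowSymbol N)) : 𝓢(Space d, ℂ)) x - g x‖ₑ := by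
          refine (l2_add_le (hm1.add hgm) hm2).trans ?_
          gcongr
          refine (l2_add_le hm1 hgm).trans ?_
          gcongr
          rw [l2_const_mul _ (measurable_conv (measurable_wt N) hgm)]
          gcongr
          refine (l2_conv_le (measurable_wt N) hgm).trans ?_
          rw [lintegral_wt_eq]
      _ = _ := by ring
  have hg0 : ∀ g : 𝓢(Space d, ℂ), Tendsto (fun N => l2 volume fun x =>
      ‖(𝓕⁻ (pmul (𝓕 g) (φ.lowSymbol N)) : 𝓢(Space d, ℂ)) x - g x‖ₑ) atTop (𝓝 0) := by
    intro g
    have h1 : Tendsto (fun N => (𝓕⁻ (pmul (𝓕 g) (φ.lowSymbol N)) : 𝓢(Space d, ℂ)) - g) atTop (𝓝 0) := by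
      have h2 : Continuous fun ψ : 𝓢(Space d, ℂ) => (𝓕⁻ ψ : 𝓢(Space d, ℂ)) - g :=
        ((FourierTransform.fourierInvCLM ℂ 𝓢(Space d, ℂ)).continuous).sub continuous_const
      have h3 := (h2.tendsto (𝓕 g)).comp (tendsto_pmul_lowSymbol φ (𝓕 g))
      have h4 : 𝓕⁻ (𝓕 g) = g := FourierPair.fourierInv_fourier_eq g
      rw [h4, sub_self] at h3
      exact h3
    have h5 := ((SchwartzMap.continuous_toLp (F := ℂ) (p := 2)
      (μ := (volume : Measure (Space d)))).tendsto 0).comp h1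
    have h6 := ENNReal.tendsto_ofReal (tendsto_norm.comp h5)
    simp only [Function.comp_def] at h6
    have h7 : ‖(0 : 𝓢(Space d, ℂ)).toLp 2 volume‖ = 0 := by
      have := map_zero (SchwartzMap.toLpCLM ℝ ℂ 2 (volume : Measure (Space d)))
      rw [SchwartzMap.toLpCLM_apply] at this
      rw [this, norm_zero]
    rw [h7, ENNReal.ofReal_zero] at h6
    refine h6.congr fun N => ?_
    rw [SchwartzMap.norm_toLp, ENNReal.ofReal_toReal (SchwartzMap.memLp _ 2 volume).2.ne, eLpNorm_two_eq]
    rfl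
  rw [ENNReal.tendsto_nhds_zero]
  intro ε hε
  set K : ℝ≥0∞ := C * wtMass d + 1
  have hK : K ≠ ⊤ := by finiteness
  have hK0 : K ≠ 0 := by simp [K]
  obtain ⟨g, hg⟩ : ∃ g : 𝓢(Space d, ℂ), K * l2 volume (fun x => ‖f' x - g x‖ₑ) ≤ ε / 2 := by
    have h1 := (SchwartzMap.denseRange_toLpCLM (F := ℂ) (p := 2) (by norm_num)
      (μ := (volume : Measure (Space d))))
    have h2 : 0 < ε / 2 / K := ENNReal.div_pos (ENNReal.div_pos hε.ne' (by norm_num)).ne' hK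
    obtain ⟨g, hg⟩ := h1.exists_mem_open Metric.isOpen_eball
      ⟨hmem.toLp f', Metric.mem_eball_self h2⟩
    refine ⟨g, ?_⟩
    rw [Metric.mem_eball, edist_comm, SchwartzMap.toLpCLM_apply, SchwartzMap.toLp,
      Lp.edist_toLp_toLp, eLpNorm_two_eq] at hg
    calc _ ≤ K * (ε / 2 / K) := by gcongr; exact hg.le
      _ = ε / 2 := ENNReal.mul_div_cancel hK0 hK
  filter_upwards [ENNReal.tendsto_nhds_zero.1 (hg0 g) (ε / 2) (ENNReal.div_pos hε.ne' (by norm_num))]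
    with N hN
  calc _ ≤ ε / 2 + ε / 2 := (hkey g N).trans (add_le_add hg hN)
    _ = ε := ENNReal.add_halves ε

end

section

variable {d : ℕ}

/-! ### The product -/

theorem tendsto_integral_mul_of_tendsto_l2 {a b : ℕ → Space d → ℂ} {u v θ : Space d → ℂ} {M : ℝ≥0}
    (hθ : AEStronglyMeasurable θ) (hM : ∀ x, ‖θ x‖ₑ ≤ M) (ha : ∀ N, AEStronglyMeasurable (a N))
    (hb : ∀ N, AEStronglyMeasurable (b N)) (hu : MemLp u 2) (hv : MemLp v 2)
    (hau : Tendsto (fun N => l2 volume fun x => ‖a N x - u x‖ₑ) atTop (𝓝 0))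
    (hbv : Tendsto (fun N => l2 volume fun x => ‖b N x - v x‖ₑ) atTop (𝓝 0)) :
    Tendsto (fun N => ∫ x, θ x * (a N x * b N x)) atTop (𝓝 (∫ x, θ x * (u x * v x))) := by
  have hu' : l2 volume (fun x => ‖u x‖ₑ) ≠ ⊤ := by rw [← eLpNorm_two_eq]; exact hu.2.ne
  have hv' : l2 volume (fun x => ‖v x‖ₑ) ≠ ⊤ := by rw [← eLpNorm_two_eq]; exact hv.2.ne
  refine tendsto_integral_of_L1' _ (hθ.mul (hu.1.mul hv.1)) ?_ ?_
  · have h1 : ∀ᶠ N in atTop, l2 volume (fun x => ‖a N x - u x‖ₑ) < ⊤ :=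
      hau.eventually (gt_mem_nhds ENNReal.coe_lt_top)
    have h2 : ∀ᶠ N in atTop, l2 volume (fun x => ‖b N x - v x‖ₑ) < ⊤ :=
      hbv.eventually (gt_mem_nhds ENNReal.coe_lt_top)
    filter_upwards [h1, h2] with N h1 h2
    have e1 : MemLp (a N) 2 := by
      have : MemLp (fun x => a N x - u x) 2 := ⟨(ha N).sub hu.1, by rwa [eLpNorm_two_eq]⟩
      exact (this.add hu).ae_eq (Eventually.of_forall fun x => by simp)
    have e2 : MemLp (b N) 2 := by
      have : MemLp (fun x => b N x - v x) 2 := ⟨(hb N).sub hv.1, by rwa [eLpNorm_two_eq]⟩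
      exact (this.add hv).ae_eq (Eventually.of_forall fun x => by simp)
    refine (e1.integrable_mul e2).bdd_mul (c := M) hθ (Eventually.of_forall fun x => ?_)
    have := hM x
    rwa [enorm_le_coe, ← NNReal.coe_le_coe, coe_nnnorm] at this
  · rw [tendsto_congr fun N => eLpNorm_one_eq_lintegral_enorm]
    set α := fun N => l2 volume fun x => ‖a N x - u x‖ₑ
    set β := fun N => l2 volume fun x => ‖b N x - v x‖ₑ
    have hle : ∀ N, ∫⁻ x, ‖θ x * (a N x * b N x) - θ x * (u x * v x)‖ₑ ≤
        M * (α N * β N + α N * l2 volume (fun x => ‖v x‖ₑ) + l2 volume (fun x => ‖u x‖ₑ) * β N) := by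
      intro N
      have ma : AEMeasurable fun x => ‖a N x - u x‖ₑ := ((ha N).sub hu.1).enorm
      have mb : AEMeasurable fun x => ‖b N x - v x‖ₑ := ((hb N).sub hv.1).enorm
      have mu : AEMeasurable fun x => ‖u x‖ₑ := hu.1.enorm
      have mv : AEMeasurable fun x => ‖v x‖ₑ := hv.1.enorm
      calc _ ≤ ∫⁻ x, M * (‖a N x - u x‖ₑ * ‖b N x - v x‖ₑ + ‖a N x - u x‖ₑ * ‖v x‖ₑ +
              ‖u x‖ₑ * ‖b N x - v x‖ₑ) := by
            refine lintegral_mono fun x => ?_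
            have e : θ x * (a N x * b N x) - θ x * (u x * v x) =
              θ x * ((a N x - u x) * (b N x - v x) + (a N x - u x) * v x + u x * (b N x - v x)) := by
              ring
            rw [e, enorm_mul]
            refine mul_le_mul' (hM x) ((enorm_add_le _ _).trans
              (add_le_add ((enorm_add_le _ _).trans (add_le_add ?_ ?_)) ?_)) <;>
            exact (enorm_mul _ _).le
        _ = M * ((∫⁻ x, ‖a N x - u x‖ₑ * ‖b N x - v x‖ₑ) + (∫⁻ x, ‖a N x - u x‖ₑ * ‖v x‖ₑ) +
              ∫⁻ x, ‖u x‖ₑ * ‖b N x - v x‖ₑ) := by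
            have mub : AEMeasurable fun x => ‖u x‖ₑ * ‖b N x - v x‖ₑ := mu.mul mb
            have mav : AEMeasurable fun x => ‖a N x - u x‖ₑ * ‖v x‖ₑ := ma.mul mv
            rw [lintegral_const_mul' _ _ (by simp), lintegral_add_right' _ mub,
              lintegral_add_right' _ mav]
        _ ≤ _ := by
            gcongr
            · exact lintegral_mul_le_l2 ma mb
            · exact lintegral_mul_le_l2 ma mv
            · exact lintegral_mul_le_l2 mu mb
    refine tendsto_of_tendsto_of_tendsto_of_le_of_le tendsto_const_nhds ?_ (fun _ => zero_le) hle
    have h1 := ENNReal.Tendsto.mul hau (Or.inr ENNReal.zero_ne_top) hbv (Or.inr ENNReal.zero_ne_top)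
    have h2 := ENNReal.Tendsto.mul_const (b := l2 volume fun x => ‖v x‖ₑ) hau (Or.inr hv')
    have h3 := ENNReal.Tendsto.const_mul (a := l2 volume fun x => ‖u x‖ₑ) hbv (Or.inr hu')
    have h4 := ENNReal.Tendsto.const_mul (a := (M : ℝ≥0∞)) ((h1.add h2).add h3) (Or.inr (by simp))
    simpa using h4

theorem exists_enorm_schwartz_le (θ : 𝓢(Space d, ℂ)) : ∃ M : ℝ≥0, ∀ x, ‖θ x‖ₑ ≤ M := by
  refine ⟨(SchwartzMap.seminorm ℝ 0 0 θ).toNNReal, fun x => ?_⟩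
  rw [enorm_le_coe, ← NNReal.coe_le_coe, coe_nnnorm]
  exact (SchwartzMap.norm_le_seminorm ℝ θ x).trans (Real.le_coe_toNNReal _)

/-- Both truncations converge in L², so their product converges in L¹ to the pointwise product;
limits against test functions are unique. -/
theorem isGivenBy_mul (φ : LPCutoff d) {T : ℝ} {U V W : ℝ → 𝓢'(Space d, ℂ)}
    (h : ∀ᵐ t ∂(timeMeasure T), ∀ θ : 𝓢(Space d, ℂ),
      Tendsto (fun N : ℕ => ∫ x, θ x * (φ.lowPiece N (U t) x * φ.lowPiece N (V t) x))
        atTop (𝓝 (W t θ)))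
    {u v : ℝ → Space d → ℂ} (hU : IsGivenBy T U u) (hV : IsGivenBy T V v)
    (hu : ∀ᵐ t ∂(timeMeasure T), MemLp (u t) 2 volume)
    (hv : ∀ᵐ t ∂(timeMeasure T), MemLp (v t) 2 volume) :
    IsGivenBy T W (fun t x => u t x * v t x) := by
  refine ⟨hU.measurable.mul hV.measurable, ?_⟩
  filter_upwards [h, hU.eq_integral, hV.eq_integral, hu, hv] with t h hU hV hu hv θ
  obtain ⟨M, hM⟩ := exists_enorm_schwartz_le θ
  have hθ : AEStronglyMeasurable (θ : Space d → ℂ) := θ.continuous.aestronglyMeasurable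
  have hlow : ∀ (U : 𝓢'(Space d, ℂ)) N, AEStronglyMeasurable (φ.lowPiece N U) := fun U N => by
    rw [lowPiece_eq_band]
    exact (continuous_band _ _).aestronglyMeasurable
  refine ⟨?_, ?_⟩
  · refine (hu.integrable_mul hv).bdd_mul (c := M) hθ (Eventually.of_forall fun x => ?_)
    have := hM x
    rwa [enorm_le_coe, ← NNReal.coe_le_coe, coe_nnnorm] at this
  · exact tendsto_nhds_unique (h θ) (tendsto_integral_mul_of_tendsto_l2 hθ hM (hlow _) (hlow _) hu hv
      (tendsto_l2_lowPiece_sub φ hu (U t) fun θ => (hU θ).2)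
      (tendsto_l2_lowPiece_sub φ hv (V t) fun θ => (hV θ).2))

theorem wl2_ne_top_apply {s : ℝ} {a : ℕ → ℝ≥0∞} (ha : wl2 s a ≠ ⊤) (j : ℕ) : a j ≠ ⊤ := by
  intro hj
  have h1 := (le_sl2 (fun j : ℕ => (2 : ℝ≥0∞) ^ ((j : ℝ) * s) * a j) j).trans_lt (lt_top_iff_ne_top.2 ha)
  simp only [hj] at h1
  rw [ENNReal.mul_top (by simp [ENNReal.rpow_eq_zero_iff])] at h1
  exact absurd h1 (lt_irrefl _)

theorem ae_wl2_pieceL2_le {E : Type*} [NormedAddCommGroup E] [NormedSpace ℂ E] (φ : LPCutoff d)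
    (T s : ℝ) {U : ℝ → 𝓢'(Space d, E)} (hU : PieceMeas φ U) :
    ∀ᵐ t ∂timeMeasure T, wl2 s (pieceL2 φ (U t)) ≤ wl2 s (fun j => pieceNorm φ T j U) := by
  have h : ∀ j, ∀ᵐ t ∂timeMeasure T, pieceL2 φ (U t) j ≤ pieceNorm φ T j U := fun j =>
    (ae_le_eI T _).mono fun t ht => ht.trans (eI_le_eY T j (hU.measurable j))
  filter_upwards [ae_all_iff.2 h] with t ht
  exact wl2_mono s ht

/-- The product of two truncations is the partial sum of the double series over a square of indices;
unconditional convergence therefore gives the limit in the definition of the product. -/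
theorem tendsto_square_atTop :
    Tendsto (fun N : ℕ => Finset.range (N + 1) ×ˢ Finset.range (N + 1)) atTop atTop := by
  refine tendsto_atTop_finset_of_monotone (fun M N h => ?_) fun p => ⟨p.1 + p.2, ?_⟩
  · have : Finset.range (M + 1) ⊆ Finset.range (N + 1) := Finset.range_mono (by omega)
    exact Finset.product_subset_product this this
  · simp only [Finset.mem_product, Finset.mem_range]
    omega

theorem integral_lowPiece_mul (φ : LPCutoff d) {U V : 𝓢'(Space d, ℂ)} (hU : ∀ j, pieceL2 φ U j ≠ ⊤)
    (hV : ∀ j, pieceL2 φ V j ≠ ⊤) (N : ℕ) (θ : 𝓢(Space d, ℂ)) :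
    ∫ x, θ x * (φ.lowPiece N U x * φ.lowPiece N V x) =
      ∑ p ∈ Finset.range (N + 1) ×ˢ Finset.range (N + 1), pairTerm φ U V p θ := by
  have hθ : 𝓕 (𝓕⁻ θ) = θ := FourierInvPair.fourier_fourierInv_eq θ
  have hi : ∀ p : ℕ × ℕ, Integrable fun x => θ x * (φ.piece p.1 U x * φ.piece p.2 V x) := fun p => by
    have := integrable_pair φ U V (p := p) (hU _) (hV _) (𝓕⁻ θ)
    rwa [hθ] at this
  simp only [pairTerm]
  rw [← integral_finsetSum _ fun p _ => hi p]
  refine integral_congr_ae (Eventually.of_forall fun x => ?_)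
  simp only [LPCutoff.lowPiece]
  rw [Finset.sum_mul_sum, ← Finset.sum_product', Finset.mul_sum]

/-- Existence and estimate of the product. -/
theorem exists_product (φ : LPCutoff d) (χ : CubeCutoff d) {s σ ρ τ : ℝ} (hs : (d : ℝ) / 2 < s)
    (hσ : (d : ℝ) - s ≤ σ)
    (hρτ : ∀ i j : ℕ, i ≤ j → (j : ℝ) * σ + i * (d / 2) ≤ j * τ + i * ρ - (s - d / 2) * i) :
    ∃ C : ℝ≥0, ∀ (T : ℝ) (U V : ℝ → 𝓢'(Space d, ℂ)), MemL1X φ χ T σ U → MemL1X φ χ T s V →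
      ∃ W, IsProduct φ T U V W ∧
        (∀ θ : 𝓢(Space d, ℂ), AEStronglyMeasurable (fun t => W t θ) (timeMeasure T)) ∧
        normL1X φ χ T σ W ≤ C * (normL1X φ χ T σ U * normL1X φ χ T s V +
          normL1X φ χ T ρ U * normL1X φ χ T τ V) := by
  classical
  obtain ⟨A, hA⟩ := exists_wl2_product_le φ hs hσ hρτ
  obtain ⟨B, hB⟩ := exists_normL1X_comparison (E := ℂ) φ χ
  refine ⟨B * A * B * B, fun T U V hU hV => ?_⟩
  obtain ⟨U', hU', hUm⟩ := exists_pieceMeas φ hU.measurable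
  obtain ⟨V', hV', hVm⟩ := exists_pieceMeas φ hV.measurable
  have fin : ∀ {r : ℝ} {U U' : ℝ → 𝓢'(Space d, ℂ)}, MemL1X φ χ T r U → PieceMeas φ U' →
      (∀ᵐ t ∂timeMeasure T, U' t = U t) → ∀ᵐ t ∂timeMeasure T, wl2 r (pieceL2 φ (U' t)) ≠ ⊤ := by
    intro r U U' hU hm he
    filter_upwards [ae_wl2_pieceL2_le φ T r hm] with t ht
    refine (ht.trans_lt ((hB T r U' hm).2.trans_lt ?_)).ne
    rw [normL1X_congr_ae φ χ T r he]
    exact ENNReal.mul_lt_top (by simp) hU.norm_lt_top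
  have finU := fin hU hUm hU'
  have finV := fin hV hVm hV'
  -- A pointwise choice, zero at the exceptional times. Weak measurability follows later because the
  -- pairings are limits of measurable partial sums.
  let W₀ : ℝ → 𝓢'(Space d, ℂ) := fun t =>
    if h : ∃ W : 𝓢'(Space d, ℂ), ∀ θ, HasSum (fun p => pairTerm φ (U' t) (V' t) p θ) (W θ)
    then h.choose else 0
  have hd0 : (0 : ℝ) ≤ d := Nat.cast_nonneg d
  have hW₀ : ∀ᵐ t ∂timeMeasure T, ∀ θ, HasSum (fun p => pairTerm φ (U' t) (V' t) p θ) (W₀ t θ) := by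
    filter_upwards [finU, finV] with t h1 h2
    -- The requirement 0 ≤ σ + s follows from d ≤ σ + s.
    have h := exists_product_at φ (by linarith) (U' t) (V' t) h1 h2
    simp only [W₀, dif_pos h]
    exact h.choose_spec
  have hterm : ∀ p (θ : 𝓢(Space d, ℂ)),
      StronglyMeasurable fun t => pairTerm φ (U' t) (V' t) p θ := by
    intro p θ
    have h1 : StronglyMeasurable (Function.uncurry fun (_ : ℝ) (x : Space d) => θ x) :=
      (θ.continuous.comp continuous_snd).stronglyMeasurable
    exact (h1.mul ((hUm p.1).mul (hVm p.2))).integral_prod_right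
  have hW₀m : ∀ θ : 𝓢(Space d, ℂ), AEStronglyMeasurable (fun t => W₀ t θ) (timeMeasure T) := by
    intro θ
    refine aestronglyMeasurable_of_tendsto_ae atTop
      (f := fun (N : ℕ) t => ∑ p ∈ Finset.range (N + 1) ×ˢ Finset.range (N + 1),
        pairTerm φ (U' t) (V' t) p θ) (fun N => ?_) ?_
    · exact (Finset.stronglyMeasurable_fun_sum _ fun p _ => hterm p θ).aestronglyMeasurable
    · filter_upwards [hW₀] with t ht
      exact (ht θ).comp tendsto_square_atTop
  obtain ⟨W, hW, hWm⟩ := exists_pieceMeas φ hW₀m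
  have hsum : ∀ᵐ t ∂timeMeasure T, ∀ θ, HasSum (fun p => pairTerm φ (U' t) (V' t) p θ) (W t θ) := by
    filter_upwards [hW₀, hW] with t h1 h2
    rwa [h2]
  have htend : ∀ᵐ t ∂(timeMeasure T), ∀ θ : 𝓢(Space d, ℂ),
      Tendsto (fun N : ℕ => ∫ x, θ x * (φ.lowPiece N (U t) x * φ.lowPiece N (V t) x))
        atTop (𝓝 (W t θ)) := by
    filter_upwards [hsum, hU', hV', finU, finV] with t h1 h2 h3 h4 h5 θ
    rw [← h2, ← h3]
    exact ((h1 θ).comp tendsto_square_atTop).congr fun N =>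
      (integral_lowPiece_mul φ (wl2_ne_top_apply h4) (wl2_ne_top_apply h5) N θ).symm
  refine ⟨W, ⟨htend, fun u v => isGivenBy_mul φ htend⟩, fun θ => ?_, ?_⟩
  · refine (hW₀m θ).congr ?_
    filter_upwards [hW] with t ht
    rw [ht]
  · have eU : ∀ r, wl2 r (fun j => pieceNorm φ T j U') ≤ B * normL1X φ χ T r U := fun r => by
      rw [← normL1X_congr_ae φ χ T r hU']; exact (hB T r U' hUm).2
    have eV : ∀ r, wl2 r (fun j => pieceNorm φ T j V') ≤ B * normL1X φ χ T r V := fun r => by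
      rw [← normL1X_congr_ae φ χ T r hV']; exact (hB T r V' hVm).2
    calc normL1X φ χ T σ W ≤ B * (A * ((B * normL1X φ χ T σ U) * (B * normL1X φ χ T s V) +
          (B * normL1X φ χ T ρ U) * (B * normL1X φ χ T τ V))) := by
          refine (hB T σ W hWm).1.trans ?_
          gcongr
          refine (hA T U' V' W hUm hVm hsum).trans ?_
          exact mul_le_mul' le_rfl (add_le_add (mul_le_mul' (eU σ) (eV s)) (mul_le_mul' (eU ρ) (eV τ)))
      _ = _ := by push_cast; ring

/-- With ρ = s and τ = σ the condition on the exponents is an equality: the low factor always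
carries s. -/
theorem bilinear_estimate (φ : LPCutoff d) (χ : CubeCutoff d) {s σ : ℝ} (hs : (d : ℝ) / 2 < s)
    (hσ : (d : ℝ) - s ≤ σ) : ∃ C : ℝ≥0, ∀ (T : ℝ) (U V : ℝ → 𝓢'(Space d, ℂ)),
      MemL1X φ χ T s U → MemL1X φ χ T σ U → MemL1X φ χ T s V → MemL1X φ χ T σ V →
      ∃ W, IsProduct φ T U V W ∧ MemL1X φ χ T σ W ∧
        normL1X φ χ T σ W ≤ C * (normL1X φ χ T σ U * normL1X φ χ T s V +
          normL1X φ χ T s U * normL1X φ χ T σ V) := by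
  obtain ⟨C, hC⟩ := exists_product φ χ (ρ := s) (τ := σ) hs hσ fun i j _ => by
    apply le_of_eq; ring
  refine ⟨C, fun T U V hU hU' hV hV' => ?_⟩
  obtain ⟨W, hW, hm, h⟩ := hC T U V hU' hV
  refine ⟨W, hW, ⟨hm, h.trans_lt ?_⟩, h⟩
  exact ENNReal.mul_lt_top (by simp) (ENNReal.add_lt_top.2
    ⟨ENNReal.mul_lt_top hU'.2 hV.2, ENNReal.mul_lt_top hU.2 hV'.2⟩)

/-- With ρ = σ and τ = s the condition on the exponents reads (j - i)(s - σ) ≥ 0, which is where σ ≤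
s enters. -/
theorem one_sided_bilinear_estimate (φ : LPCutoff d) (χ : CubeCutoff d) {s σ : ℝ}
    (hs : (d : ℝ) / 2 < s) (hσ : (d : ℝ) - s ≤ σ) (hσs : σ ≤ s) :
    ∃ C : ℝ≥0, ∀ (T : ℝ) (U V : ℝ → 𝓢'(Space d, ℂ)), MemL1X φ χ T σ U → MemL1X φ χ T s V →
      ∃ W, IsProduct φ T U V W ∧ MemL1X φ χ T σ W ∧
        normL1X φ χ T σ W ≤ C * (normL1X φ χ T σ U * normL1X φ χ T s V) := by
  obtain ⟨C, hC⟩ := exists_product φ χ (ρ := σ) (τ := s) hs hσ fun i j hij => by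
    have : (i : ℝ) ≤ j := by exact_mod_cast hij
    nlinarith
  refine ⟨C * 2, fun T U V hU hV => ?_⟩
  obtain ⟨W, hW, hm, h⟩ := hC T U V hU hV
  have h' : normL1X φ χ T σ W ≤ (C * 2 : ℝ≥0) * (normL1X φ χ T σ U * normL1X φ χ T s V) := by
    refine h.trans (le_of_eq ?_)
    push_cast
    ring
  exact ⟨W, hW, ⟨hm, h'.trans_lt (ENNReal.mul_lt_top ENNReal.coe_lt_top (ENNReal.mul_lt_top hU.2 hV.2))⟩, h'⟩

end

/-! ### Smooth functions of a distribution: telescoping and decay of high frequencies -/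

section

variable {d : ℕ} {E : Type*} [NormedAddCommGroup E] [NormedSpace ℂ E]

/-! ### High frequencies of smooth functions -/

/-- Smooth functions all of whose derivatives are bounded. -/
def BddSmooth (g : Space d → E) : Prop :=
  ContDiff ℝ ∞ g ∧ ∀ n : ℕ, ∃ M : ℝ, ∀ x, ‖iteratedFDeriv ℝ n g x‖ ≤ M

theorem BddSmooth.norm_iteratedFDeriv_lineDeriv_le {g : Space d → E} (hg : BddSmooth g) (v : Space d)
    (n : ℕ) (x : Space d) :
    ‖iteratedFDeriv ℝ n (fun y => fderiv ℝ g y v) x‖ ≤ ‖v‖ * ‖iteratedFDeriv ℝ (n + 1) g x‖ := by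
  have h := norm_iteratedFDeriv_clm_apply_const (c := v) (n := n) (N := ∞)
    (hg.1.fderiv_right (m := ∞) (by simp)).contDiffAt (x := x) (by exact_mod_cast le_top)
  rwa [norm_iteratedFDeriv_fderiv] at h

theorem BddSmooth.lineDeriv {g : Space d → E} (hg : BddSmooth g) (v : Space d) :
    BddSmooth fun y => fderiv ℝ g y v := by
  refine ⟨(hg.1.fderiv_right (m := ∞) (by simp)).clm_apply contDiff_const, fun n => ?_⟩
  obtain ⟨M, hM⟩ := hg.2 (n + 1)
  refine ⟨‖v‖ * M, fun x => (hg.norm_iteratedFDeriv_lineDeriv_le v n x).trans ?_⟩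
  gcongr
  exact hM x

theorem BddSmooth.integrable_smul {g : Space d → E} (hg : BddSmooth g) (θ : 𝓢(Space d, ℂ))
    (x : Space d) : Integrable fun y => θ (y - x) • g y := by
  obtain ⟨M, hM⟩ := hg.2 0
  refine Integrable.smul_bdd (θ.integrable.comp_sub_right x) M hg.1.continuous.aestronglyMeasurable
    (Eventually.of_forall fun y => ?_)
  simpa using hM y

section Division

variable (m : 𝓢(Space d, ℂ))

/-- The components of `ξ m(ξ) / |ξ|²`, normalized for integration by parts. -/
def divSymbolFun (l : Fin d) (ξ : Space d) : ℂ :=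
  (-(2 * Real.pi * Complex.I))⁻¹ * ((ξ l / ‖ξ‖ ^ 2 : ℝ) : ℂ) * m ξ

variable {m}

theorem contDiff_divSymbolFun (h : ∀ ξ, ‖ξ‖ ≤ 1 → m ξ = 0) (l : Fin d) :
    ContDiff ℝ ∞ (divSymbolFun m l) := by
  rw [contDiff_iff_contDiffAt]
  intro ξ
  rcases lt_or_ge ‖ξ‖ 1 with hξ | hξ
  · have h1 : divSymbolFun m l =ᶠ[𝓝 ξ] fun _ => (0 : ℂ) := by
      filter_upwards [(isOpen_lt continuous_norm continuous_const).mem_nhds hξ] with ζ hζ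
      rw [divSymbolFun, h ζ (le_of_lt hζ), mul_zero]
    exact contDiffAt_const.congr_of_eventuallyEq h1
  · have h0 : ‖ξ‖ ^ 2 ≠ 0 := by positivity
    have h2 : ContDiffAt ℝ ∞ (fun ζ : Space d => ζ l / ‖ζ‖ ^ 2) ξ :=
      (ContDiff.contDiffAt (by fun_prop)).div (contDiff_norm_sq ℝ).contDiffAt h0
    exact (contDiffAt_const.mul (Complex.ofRealCLM.contDiff.contDiffAt.comp ξ h2)).mul
      (m.smooth _).contDiffAt

/-- `divSymbolFun` as a Schwartz function. -/
def divSymbol (h : ∀ ξ, ‖ξ‖ ≤ 1 → m ξ = 0) (hc : HasCompactSupport m) (l : Fin d) : 𝓢(Space d, ℂ) :=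
  HasCompactSupport.toSchwartzMap (f := divSymbolFun m l) hc.mul_left (contDiff_divSymbolFun h l)

theorem divSymbol_apply (h : ∀ ξ, ‖ξ‖ ≤ 1 → m ξ = 0) (hc : HasCompactSupport m) (l : Fin d)
    (ξ : Space d) : divSymbol h hc l ξ =
      (-(2 * Real.pi * Complex.I))⁻¹ * ((ξ l / ‖ξ‖ ^ 2 : ℝ) : ℂ) * m ξ := rfl

/-- Since Σ ξ_l · ξ_l/|ξ|² = 1 away from 0, a symbol vanishing near the origin is a sum of ξ_l times
symbols of the same kind. On the kernel side this is a divergence with a gain 2^(-k). -/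
theorem fourier_dil_eq_sum (h : ∀ ξ, ‖ξ‖ ≤ 1 → m ξ = 0) (hc : HasCompactSupport m) (k : ℕ)
    (y : Space d) : 𝓕 (dil k m) y = ((2 : ℂ) ^ k)⁻¹ * ∑ l,
      fderiv ℝ (𝓕 (dil k (divSymbol h hc l)) : 𝓢(Space d, ℂ)) y (EuclideanSpace.single l 1) := by
  have ht : ∀ l : Fin d, (fun ξ : Space d => inner ℝ ξ (EuclideanSpace.single l (1 : ℝ))).HasTemperateGrowth :=
    fun l => ((innerSL ℝ).flip (EuclideanSpace.single l (1 : ℝ))).hasTemperateGrowth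
  have e : dil k m = ((2 : ℂ) ^ k)⁻¹ • ∑ l, -(2 * Real.pi * Complex.I) •
      SchwartzMap.smulLeftCLM ℂ (fun ξ : Space d => inner ℝ ξ (EuclideanSpace.single l (1 : ℝ)))
        (dil k (divSymbol h hc l)) := by
    ext ξ
    rw [smul_apply, sum_apply, dil_apply]
    have h1 : ∀ l : Fin d, (-(2 * Real.pi * Complex.I) •
        SchwartzMap.smulLeftCLM ℂ (fun ξ : Space d => inner ℝ ξ (EuclideanSpace.single l (1 : ℝ)))
        (dil k (divSymbol h hc l))) ξ =
          ((ξ l * ((((2 : ℝ) ^ k)⁻¹ * ξ l) / ‖((2 : ℝ) ^ k)⁻¹ • ξ‖ ^ 2) : ℝ) : ℂ) *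
            m (((2 : ℝ) ^ k)⁻¹ • ξ) := by
      intro l
      rw [smul_apply, SchwartzMap.smulLeftCLM_apply_apply (ht l), dil_apply, divSymbol_apply]
      have h3 : (2 * Real.pi * Complex.I : ℂ) ≠ 0 := by
        simp [Real.pi_ne_zero, Complex.I_ne_zero]
      have h4 : inner ℝ ξ (EuclideanSpace.single l (1 : ℝ)) = ξ l := by
        simp [EuclideanSpace.inner_single_right]
      rw [h4, smul_eq_mul, Complex.real_smul, PiLp.smul_apply, smul_eq_mul]
      push_cast
      field_simp
    simp_rw [h1]
    rw [← Finset.sum_mul, ← Complex.ofReal_sum]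
    by_cases hξ : ξ = 0
    · subst hξ
      simp [h 0 (by simp)]
    · have h5 : ∑ l, ξ l * ((((2 : ℝ) ^ k)⁻¹ * ξ l) / ‖((2 : ℝ) ^ k)⁻¹ • ξ‖ ^ 2) = 2 ^ k := by
        have h6 : ∀ l, ξ l * ((((2 : ℝ) ^ k)⁻¹ * ξ l) / ‖((2 : ℝ) ^ k)⁻¹ • ξ‖ ^ 2) =
            ξ l ^ 2 * (2 ^ k / ‖ξ‖ ^ 2) := by
          intro l
          have : ‖ξ‖ ≠ 0 := norm_ne_zero_iff.2 hξ
          rw [norm_smul, norm_inv, norm_pow, Real.norm_ofNat]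
          field_simp
        simp_rw [h6]
        rw [← Finset.sum_mul, ← EuclideanSpace.real_norm_sq_eq]
        have : ‖ξ‖ ≠ 0 := norm_ne_zero_iff.2 hξ
        field_simp
      rw [h5, smul_eq_mul]
      push_cast
      rw [← mul_assoc, inv_mul_cancel₀ (pow_ne_zero _ two_ne_zero), one_mul]
  have e2 : 𝓕 (dil k m) = ((2 : ℂ) ^ k)⁻¹ • ∑ l : Fin d,
      LineDeriv.lineDerivOp (EuclideanSpace.single l (1 : ℝ)) (𝓕 (dil k (divSymbol h hc l))) := by
    simp_rw [SchwartzMap.lineDerivOp_fourier_eq]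
    conv_lhs => rw [e]
    have h1 := map_smul (SchwartzMap.fourierTransformCLM ℂ) (((2 : ℂ) ^ k)⁻¹)
      (∑ l : Fin d, -(2 * Real.pi * Complex.I) •
      SchwartzMap.smulLeftCLM ℂ (fun ξ : Space d => inner ℝ ξ (EuclideanSpace.single l (1 : ℝ)))
        (dil k (divSymbol h hc l)))
    rw [map_sum] at h1
    exact h1
  rw [e2, smul_apply, sum_apply]
  rfl

theorem divSymbol_eq_zero (h : ∀ ξ, ‖ξ‖ ≤ 1 → m ξ = 0) (hc : HasCompactSupport m) (l : Fin d)
    (ξ : Space d) (hξ : ‖ξ‖ ≤ 1) : divSymbol h hc l ξ = 0 := by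
  rw [divSymbol_apply, h ξ hξ, mul_zero]

theorem hasCompactSupport_divSymbol (h : ∀ ξ, ‖ξ‖ ≤ 1 → m ξ = 0) (hc : HasCompactSupport m)
    (l : Fin d) : HasCompactSupport (divSymbol h hc l) :=
  HasCompactSupport.mul_left (f := fun ξ : Space d =>
    (-(2 * Real.pi * Complex.I))⁻¹ * ((ξ l / ‖ξ‖ ^ 2 : ℝ) : ℂ)) (f' := m) hc

/-- Integration by parts in the divergence form of the kernel: one derivative of `g` is exchanged
for 2^(-k). -/
theorem integral_fourier_dil_smul (h : ∀ ξ, ‖ξ‖ ≤ 1 → m ξ = 0) (hc : HasCompactSupport m) (k : ℕ)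
    {g : Space d → E} (hg : BddSmooth g) (x : Space d) :
    ∫ y, 𝓕 (dil k m) (y - x) • g y = -(((2 : ℂ) ^ k)⁻¹ • ∑ l,
      ∫ y, 𝓕 (dil k (divSymbol h hc l)) (y - x) • fderiv ℝ g y (EuclideanSpace.single l 1)) := by
  have key : ∀ l : Fin d, Integrable (fun y =>
        fderiv ℝ (𝓕 (dil k (divSymbol h hc l)) : 𝓢(Space d, ℂ)) (y - x) (EuclideanSpace.single l 1) • g y) ∧
      ∫ y, 𝓕 (dil k (divSymbol h hc l)) (y - x) • fderiv ℝ g y (EuclideanSpace.single l 1) =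
      -∫ y, fderiv ℝ (𝓕 (dil k (divSymbol h hc l)) : 𝓢(Space d, ℂ)) (y - x)
        (EuclideanSpace.single l 1) • g y := by
    intro l
    set K : 𝓢(Space d, ℂ) := 𝓕 (dil k (divSymbol h hc l))
    have hK : ∀ y, fderiv ℝ (fun y => K (y - x)) y = fderiv ℝ K (y - x) := fun y => by
      rw [fderiv_comp_sub]
    have hi : Integrable (fun y => fderiv ℝ K (y - x) (EuclideanSpace.single l 1) • g y) :=
      hg.integrable_smul (LineDeriv.lineDerivOp (EuclideanSpace.single l (1 : ℝ)) K) x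
    refine ⟨hi, ?_⟩
    have := integral_smul_fderiv_eq_neg_fderiv_smul_of_integrable (μ := volume)
      (f := fun y => K (y - x)) (g := g) (v := EuclideanSpace.single l (1 : ℝ)) (by simpa only [hK] using hi)
      ((hg.lineDeriv _).integrable_smul K x) (hg.integrable_smul K x)
      (fun y _ => (K.differentiable.comp (differentiable_id.sub_const x)).differentiableAt)
      (fun y _ => (hg.1.differentiable (by simp)).differentiableAt)
    simpa only [hK] using this
  simp_rw [fun l => (key l).2, fourier_dil_eq_sum h hc]
  rw [Finset.sum_neg_distrib, smul_neg, neg_neg, ← integral_finsetSum _ fun l _ => (key l).1,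
    ← integral_smul]
  refine integral_congr_ae (Eventually.of_forall fun y => ?_)
  simp only [mul_smul, Finset.sum_smul]

end Division

/-- Smooth functions have rapidly decaying high frequencies. -/
theorem exists_enorm_integral_fourier_dil_le (N : ℕ) : ∀ m : 𝓢(Space d, ℂ),
    (∀ ξ, ‖ξ‖ ≤ 1 → m ξ = 0) → HasCompactSupport m → ∃ C : ℝ≥0, ∀ (k : ℕ) (g : Space d → E),
      BddSmooth g → ∀ x, (2 : ℝ≥0∞) ^ (k * N) * ‖∫ y, 𝓕 (dil k m) (y - x) • g y‖ₑ ≤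
        C * conv (wt k) (fun y => ‖iteratedFDeriv ℝ N g y‖ₑ) x := by
  induction N with
  | zero =>
    intro m _ _
    obtain ⟨C, hC⟩ := exists_enorm_fourier_dil_le m 0
    refine ⟨C, fun k g _ x => ?_⟩
    have e : ∀ {F : Type _} [NormedAddCommGroup F] [NormedSpace ℝ F] (f : Space d → F) x,
        ‖iteratedFDeriv ℝ 0 f x‖ₑ = ‖f x‖ₑ := fun f x => by
      rw [← ofReal_norm, norm_iteratedFDeriv_zero, ofReal_norm]
    rw [mul_zero, pow_zero, one_mul, conv_comm, conv, ← lintegral_const_mul' _ _ (by simp)]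
    refine (enorm_integral_le_lintegral_enorm _).trans (lintegral_mono fun y => ?_)
    have h := (hC k (y - x)).1
    rw [e, mul_zero, pow_zero, mul_one, ← wt_neg, neg_sub] at h
    beta_reduce
    rw [enorm_smul, ← ofReal_norm (iteratedFDeriv ℝ 0 g y), norm_iteratedFDeriv_zero, ofReal_norm]
    refine (mul_le_mul' h le_rfl).trans (le_of_eq (by ring))
  | succ N ih =>
    intro m h hc
    choose C hC using fun l => ih (divSymbol h hc l) (divSymbol_eq_zero h hc l)
      (hasCompactSupport_divSymbol h hc l)
    -- The divided symbols vanish on the unit ball and have compact support again, so the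
    -- integration by parts can be repeated.
    refine ⟨∑ l, C l, fun k g hg x => ?_⟩
    rw [integral_fourier_dil_smul h hc k hg, enorm_neg, enorm_smul]
    have e1 : (2 : ℝ≥0∞) ^ (k * (N + 1)) * ‖((2 : ℂ) ^ k)⁻¹‖ₑ = 2 ^ (k * N) := by
      have : ‖((2 : ℂ) ^ k)⁻¹‖ₑ = ((2 : ℝ≥0∞) ^ k)⁻¹ := by
        rw [enorm_inv (pow_ne_zero _ two_ne_zero), enorm_pow]
        congr 2
        rw [← ofReal_norm]
        simp
      rw [this, mul_add, pow_add, mul_one, mul_assoc, ENNReal.mul_inv_cancel (by simp) (by simp), mul_one]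
    rw [← mul_assoc, e1]
    push_cast
    rw [Finset.sum_mul]
    refine (mul_le_mul' le_rfl (enorm_sum_le _ _)).trans ?_
    rw [Finset.mul_sum]
    refine Finset.sum_le_sum fun l _ => (hC l k _ (hg.lineDeriv _) x).trans ?_
    gcongr
    refine conv_mono (fun _ => le_rfl) (fun y => ?_) x
    have := hg.norm_iteratedFDeriv_lineDeriv_le (EuclideanSpace.single l 1) N y
    rw [PiLp.norm_single, norm_one, one_mul] at this
    exact enorm_le_iff_norm_le.2 this

/-- Littlewood-Paley pieces of smooth functions. -/
theorem exists_enorm_integral_kernelAt_le (φ : LPCutoff d) (N : ℕ) : ∃ C : ℝ≥0, ∀ (k : ℕ)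
    (g : Space d → E), BddSmooth g → ∀ x, ‖∫ y, φ.kernelAt (k + 1) x y • g y‖ₑ ≤
        C * 2 ^ (-((k : ℝ) * N)) * conv (wt (k + 1)) (fun y => ‖iteratedFDeriv ℝ N g y‖ₑ) x := by
  have h1 : ∀ ξ : Space d, ‖ξ‖ ≤ 1 → φ.symbol 1 ξ = 0 := by
    intro ξ hξ
    by_contra h
    have := φ.lt_norm_of_symbol_ne_zero (j := 0) h
    rw [pow_zero] at this
    linarith
  have h2 : HasCompactSupport (φ.symbol 1) := by
    refine HasCompactSupport.of_support_subset_isCompact (isCompact_closedBall (0 : Space d) 4) ?_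
    intro ξ hξ
    have := φ.norm_lt_of_symbol_ne_zero hξ
    rw [mem_closedBall_zero_iff]
    norm_num at this
    exact this.le
  obtain ⟨C, hC⟩ := exists_enorm_integral_fourier_dil_le (E := E) N (φ.symbol 1) h1 h2
  -- The 2 is the price of passing from `wt k` to `wt (k + 1)`.
  refine ⟨C * 2, fun k g hg x => ?_⟩
  have h3 := hC k g hg x
  rw [← φ.symbol_succ_eq_dil] at h3
  have e : ∀ y, φ.kernelAt (k + 1) x y = 𝓕 (φ.symbol (k + 1)) (y - x) := fun y => rfl
  simp_rw [e]
  have e2 : (2 : ℝ≥0∞) ^ (-((k : ℝ) * N)) * 2 ^ (k * N) = 1 := by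
    rw [← two_rpow_natCast, mul_comm, Nat.cast_mul, two_rpow_mul_neg]
  calc ‖∫ y, 𝓕 (φ.symbol (k + 1)) (y - x) • g y‖ₑ = (2 : ℝ≥0∞) ^ (-((k : ℝ) * N)) *
        (2 ^ (k * N) * ‖∫ y, 𝓕 (φ.symbol (k + 1)) (y - x) • g y‖ₑ) := by
        rw [← mul_assoc, e2, one_mul]
    _ ≤ (2 : ℝ≥0∞) ^ (-((k : ℝ) * N)) * (C * (2 * conv (wt (k + 1)) (fun y => ‖iteratedFDeriv ℝ N g y‖ₑ) x)) := by
        refine mul_le_mul' le_rfl (h3.trans (mul_le_mul' le_rfl ?_))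
        rw [← const_mul_conv _ (by norm_num)]
        exact conv_mono (fun y => wt_le_succ k y) (fun _ => le_rfl) x
    _ = _ := by push_cast; ring

end

section

/-! ### Hadamard's lemma -/

section Hadamard

variable {V H : Type*} [NormedAddCommGroup V] [NormedSpace ℝ V]
  [NormedAddCommGroup H] [NormedSpace ℝ H] [CompleteSpace H]

/-- On the compact set of r in [0, 1] and z near z₀ all derivatives are bounded, which provides the
domination. -/
theorem contDiff_integral_unit_interval [FiniteDimensional ℝ V] {Ψ : ℝ × V → H} (hΨ : ContDiff ℝ ∞ Ψ) :
    ContDiff ℝ ∞ fun z => ∫ r in Set.Icc (0 : ℝ) 1, Ψ (r, z) := by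
  have hder : ∀ (n : ℕ) r z, iteratedFDeriv ℝ n (fun z => Ψ (r, z)) z =
      (iteratedFDeriv ℝ n Ψ (r, z)).compContinuousLinearMap
        fun _ => ContinuousLinearMap.inr ℝ ℝ V := by
    intro n r z
    have e : (fun z => Ψ (r, z)) = (fun p => Ψ (p + (r, 0))) ∘ ContinuousLinearMap.inr ℝ ℝ V := by
      ext z; simp
    have h1 : ContDiff ℝ n fun p => Ψ (p + (r, 0)) :=
      (hΨ.of_le (by exact_mod_cast le_top)).comp (contDiff_id.add contDiff_const)
    rw [e, (ContinuousLinearMap.inr ℝ ℝ V).iteratedFDeriv_comp_right h1 z le_rfl,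
      iteratedFDeriv_comp_add_right]
    simp
  have hc : ∀ n : ℕ, Continuous fun p : ℝ × V => iteratedFDeriv ℝ n (fun z => Ψ (p.1, z)) p.2 := by
    intro n
    simp_rw [hder]
    have h1 : Continuous fun p : ℝ × V => iteratedFDeriv ℝ n Ψ p :=
      (hΨ.of_le (by exact_mod_cast le_top)).continuous_iteratedFDeriv (m := n) le_rfl
    exact (ContinuousMultilinearMap.compContinuousLinearMapL (F := H)
      (fun _ : Fin n => ContinuousLinearMap.inr ℝ ℝ V)).continuous.comp h1
  refine (integral_smooth_family (F := fun r z => Ψ (r, z)) (fun r => ?_) (fun n z => ?_)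
    fun n z₀ => ?_).1
  · exact hΨ.comp (contDiff_const.prodMk contDiff_id)
  · exact ((hc n).comp (continuous_id.prodMk continuous_const)).aestronglyMeasurable
  · have hK : IsCompact (Set.Icc (0 : ℝ) 1 ×ˢ Metric.closedBall z₀ 1) :=
      isCompact_Icc.prod (isCompact_closedBall z₀ 1)
    obtain ⟨M, hM⟩ := hK.exists_bound_of_continuousOn (hc n).continuousOn
    refine ⟨fun _ => M, integrable_const _, ?_⟩
    rw [ae_restrict_iff' measurableSet_Icc]
    refine Eventually.of_forall fun r hr z hz => hM (r, z) ⟨hr, Metric.ball_subset_closedBall hz⟩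

variable {V' H' : Type*} [NormedAddCommGroup V'] [NormedSpace ℝ V']
  [NormedAddCommGroup H'] [NormedSpace ℝ H'] [CompleteSpace H']

/-- The mean of the derivative of `G` over the segment from `A p` to `A p + B p`. -/
def meanDeriv (G : V' → H') (A B : V →L[ℝ] V') (p : V) : V' →L[ℝ] H' :=
  ∫ r in Set.Icc (0 : ℝ) 1, fderiv ℝ G (A p + r • B p)

theorem contDiff_meanDeriv [FiniteDimensional ℝ V] {G : V' → H'} (hG : ContDiff ℝ ∞ G) (A B : V →L[ℝ] V') :
    ContDiff ℝ ∞ (meanDeriv G A B) := by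
  refine contDiff_integral_unit_interval (Ψ := fun q : ℝ × V => fderiv ℝ G (A q.2 + q.1 • B q.2)) ?_
  exact (hG.fderiv_right (m := ∞) (by simp)).comp
    ((A.contDiff.comp contDiff_snd).add (contDiff_fst.smul (B.contDiff.comp contDiff_snd)))

theorem meanDeriv_apply {G : V' → H'} (hG : ContDiff ℝ ∞ G) (A B : V →L[ℝ] V') (p : V) :
    meanDeriv G A B p (B p) = G (A p + B p) - G (A p) := by
  have hc : Continuous fun r : ℝ => fderiv ℝ G (A p + r • B p) :=
    (hG.continuous_fderiv (by simp)).comp (by fun_prop)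
  have h1 : meanDeriv G A B p (B p) = ∫ r in (0 : ℝ)..1, fderiv ℝ G (A p + r • B p) (B p) := by
    rw [intervalIntegral.integral_of_le zero_le_one, ← integral_Icc_eq_integral_Ioc, meanDeriv]
    exact (ContinuousLinearMap.integral_apply (hc.continuousOn.integrableOn_compact isCompact_Icc) _)
  rw [h1, intervalIntegral.integral_eq_sub_of_hasDerivAt (f := fun r : ℝ => G (A p + r • B p))]
  · simp
  · intro r _
    have h2 : HasDerivAt (fun r : ℝ => A p + r • B p) (B p) r := by
      simpa using ((hasDerivAt_id r).smul_const (B p)).const_add (A p)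
    exact ((hG.differentiable (by simp)).differentiableAt.hasFDerivAt).comp_hasDerivAt r h2
  · exact (hc.clm_apply continuous_const).intervalIntegrable _ _

theorem meanDeriv_zero (G : V' → H') (A B : V →L[ℝ] V') :
    meanDeriv G A B 0 = fderiv ℝ G 0 := by
  simp [meanDeriv]

/-- A quadratic representation of the increments of a function with vanishing derivative at `0`. -/
theorem exists_quadratic_increment [FiniteDimensional ℝ V'] {G : V' → H'} (hG : ContDiff ℝ ∞ G) (h : fderiv ℝ G 0 = 0) :
    ∃ K : V' × V' → (V' × V' →L[ℝ] V' →L[ℝ] H'), ContDiff ℝ ∞ K ∧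
      ∀ a b, G (a + b) - G a = K (a, b) (a, b) b := by
  set L := meanDeriv G (ContinuousLinearMap.fst ℝ V' V') (ContinuousLinearMap.snd ℝ V' V')
  have hL : ContDiff ℝ ∞ L := contDiff_meanDeriv hG _ _
  refine ⟨meanDeriv L 0 (ContinuousLinearMap.id ℝ (V' × V')), contDiff_meanDeriv hL _ _, fun a b => ?_⟩
  have h1 := meanDeriv_apply hG (ContinuousLinearMap.fst ℝ V' V') (ContinuousLinearMap.snd ℝ V' V') (a, b)
  have h2 := meanDeriv_apply hL 0 (ContinuousLinearMap.id ℝ (V' × V')) (a, b)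
  -- The mean derivative vanishes at the origin because G'(0) = 0, so Hadamard's lemma applies to it
  -- once more.
  have h3 : L 0 = 0 := by rw [← h]; exact meanDeriv_zero G _ _
  simp only [ContinuousLinearMap.id_apply, zero_apply, zero_add, h3, sub_zero] at h2
  rw [h2]
  exact h1.symm

end Hadamard

/-! ### Scaled bounds for derivatives -/

section ScaledBound

variable {D V H W : Type*} [NormedAddCommGroup D] [NormedSpace ℝ D] [NormedAddCommGroup V]
  [NormedSpace ℝ V] [NormedAddCommGroup H] [NormedSpace ℝ H] [NormedAddCommGroup W] [NormedSpace ℝ W]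

/-- The derivatives of order `i ≤ n` of `f` at `x` are bounded by `M λ ^ i`. -/
def ScaledBound (n : ℕ) (r M : ℝ) (f : D → V) (x : D) : Prop :=
  ∀ i ≤ n, ‖iteratedFDeriv ℝ i f x‖ ≤ M * r ^ i

/-- Leibniz' rule: the powers of `r` add up to r^i and the binomial coefficients to 2^i. -/
theorem ScaledBound.bilinear {n : ℕ} {r M M' : ℝ} {f : D → V} {g : D → H} {x : D}
    (hf : ScaledBound n r M f x) (hg : ScaledBound n r M' g x) (hfc : ContDiff ℝ ∞ f)
    (hgc : ContDiff ℝ ∞ g) (hr : 0 ≤ r) (B : V →L[ℝ] H →L[ℝ] W) :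
    ScaledBound n r (‖B‖ * 2 ^ n * (M * M')) (fun y => B (f y) (g y)) x := by
  have hM : 0 ≤ M := by simpa using (norm_nonneg _).trans (hf 0 (Nat.zero_le n))
  have hM' : 0 ≤ M' := by simpa using (norm_nonneg _).trans (hg 0 (Nat.zero_le n))
  intro i hi
  refine (B.norm_iteratedFDeriv_le_of_bilinear (N := ∞) hfc hgc x (n := i) (by exact_mod_cast le_top)).trans ?_
  calc ‖B‖ * ∑ l ∈ Finset.range (i + 1), (i.choose l : ℝ) * ‖iteratedFDeriv ℝ l f x‖ *
        ‖iteratedFDeriv ℝ (i - l) g x‖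
      ≤ ‖B‖ * ∑ l ∈ Finset.range (i + 1), (i.choose l : ℝ) * (M * M' * r ^ i) := by
        refine mul_le_mul_of_nonneg_left (Finset.sum_le_sum fun l hl => ?_) (norm_nonneg B)
        have hl' : l ≤ i := Nat.lt_succ_iff.1 (Finset.mem_range.1 hl)
        rw [mul_assoc]
        refine mul_le_mul_of_nonneg_left ?_ (Nat.cast_nonneg _)
        calc _ ≤ (M * r ^ l) * (M' * r ^ (i - l)) :=
              mul_le_mul (hf l (hl'.trans hi)) (hg (i - l) ((Nat.sub_le i l).trans hi))
                (norm_nonneg _) (by positivity)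
          _ = M * M' * (r ^ l * r ^ (i - l)) := by ring
          _ = _ := by rw [← pow_add, Nat.add_sub_cancel' hl']
    _ = ‖B‖ * 2 ^ i * (M * M') * r ^ i := by
        rw [← Finset.sum_mul, ← Nat.cast_sum, Nat.sum_range_choose]; push_cast; ring
    _ ≤ _ := by
        gcongr
        norm_num

/-- Faà di Bruno. Replacing M by max 1 M gives M ≤ (max 1 M)^l for l ≥ 1, the form in which a scaled
bound is stable under composition. -/
theorem ScaledBound.comp {n : ℕ} {r M C : ℝ} {p : D → V} {K : V → W} {x : D}
    (hp : ScaledBound n r M p x) (hpc : ContDiff ℝ ∞ p) (hK : ContDiff ℝ ∞ K) (hr : 0 ≤ r)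
    (hC : ∀ i ≤ n, ‖iteratedFDeriv ℝ i K (p x)‖ ≤ C) :
    ScaledBound n r (n.factorial * C * max 1 M ^ n) (fun y => K (p y)) x := by
  have hC0 : 0 ≤ C := (norm_nonneg _).trans (hC 0 (Nat.zero_le n))
  intro i hi
  have h1 := norm_iteratedFDeriv_comp_le (N := ∞) (n := i) (C := C) (D := max 1 M * r) hK hpc
    (by exact_mod_cast le_top) x (fun l hl => hC l (hl.trans hi)) fun l hl hl' => by
      refine (hp l (hl'.trans hi)).trans ?_
      rw [mul_pow]
      gcongr
      exact (le_max_right 1 M).trans (le_self_pow₀ (le_max_left _ _) (by omega))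
  refine h1.trans ?_
  rw [mul_pow, ← mul_assoc]
  have h2 : (1 : ℝ) ≤ max 1 M := le_max_left _ _
  gcongr

theorem ScaledBound.mono {n : ℕ} {r M M' : ℝ} {f : D → V} {x : D} (hf : ScaledBound n r M f x)
    (hr : 0 ≤ r) (h : M ≤ M') : ScaledBound n r M' f x := fun i hi =>
  (hf i hi).trans (by gcongr)

end ScaledBound

end

section

variable {d : ℕ} {E : Type*} [NormedAddCommGroup E] [NormedSpace ℂ E]

/-! ### Functions with summable Littlewood-Paley pieces -/

/-- The pointwise bound 2^(kd) times the mass, which does not depend on `k`. -/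
theorem exists_l2_wt_le (d : ℕ) : ∃ C : ℝ≥0, ∀ k : ℕ,
    l2 volume (wt k : Space d → ℝ≥0∞) ≤ C * 2 ^ ((k : ℝ) * (d / 2)) := by
  have hw : ∀ (k : ℕ) (x : Space d), wt k x ≤ 2 ^ ((k : ℝ) * d) := by
    intro k x
    have e : (2 : ℝ≥0∞) ^ ((k : ℝ) * d) = ENNReal.ofReal (((2 : ℝ) ^ k) ^ d) := by
      rw [ENNReal.rpow_mul, ENNReal.rpow_natCast, ENNReal.rpow_natCast,
        ENNReal.ofReal_pow (by positivity), ENNReal.ofReal_pow (by positivity)]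
      simp
    rw [e, wt]
    apply ENNReal.ofReal_le_ofReal
    refine mul_le_of_le_one_right (by positivity) (inv_le_one_of_one_le₀ (one_le_pow₀ ?_))
    linarith [norm_nonneg ((2 : ℝ) ^ k • x)]
  refine ⟨1 + wtMass d, fun k => ?_⟩
  rw [l2_le_iff]
  calc ∫⁻ x : Space d, wt k x ^ 2 ≤ ∫⁻ x : Space d, 2 ^ ((k : ℝ) * d) * wt k x :=
        lintegral_mono fun x => by rw [sq]; gcongr; exact hw k x
    _ = 2 ^ ((k : ℝ) * d) * wtMass d := by
        rw [lintegral_const_mul _ (measurable_wt k), lintegral_wt_eq]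
    _ ≤ 2 ^ ((k : ℝ) * d) * (1 + wtMass d) ^ 2 := by
        gcongr
        rw [sq]
        refine le_trans (le_add_self) (le_mul_of_one_le_left zero_le le_self_add)
    _ = _ := by
        rw [mul_pow, ← ENNReal.rpow_natCast (2 ^ ((k : ℝ) * (d / 2))), ← ENNReal.rpow_mul]
        push_cast
        rw [mul_comm]
        congr 2
        ring

theorem measurable_enorm_piece (φ : LPCutoff d) (j : ℕ) (U : 𝓢'(Space d, E)) :
    Measurable fun x => ‖φ.piece j U x‖ₑ :=
  (continuous_band (φ.symbol j) U).enorm.measurable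

theorem exists_conv_piece_le (φ : LPCutoff d) : ∃ C : ℝ≥0, ∀ (j : ℕ) (U : 𝓢'(Space d, E)) x,
    conv (wt j) (fun y => ‖φ.piece j U y‖ₑ) x ≤ C * (2 ^ ((j : ℝ) * (d / 2)) * pieceL2 φ U j) := by
  obtain ⟨C, hC⟩ := exists_l2_wt_le d
  refine ⟨C, fun j U x => (conv_le_l2 (measurable_wt j) (measurable_enorm_piece φ j U) x).trans ?_⟩
  rw [← mul_assoc]
  gcongr
  · exact hC j
  · exact le_rfl

theorem exists_tsum_half_le {s : ℝ} (hs : (d : ℝ) / 2 < s) : ∃ G : ℝ≥0, ∀ a : ℕ → ℝ≥0∞,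
    ∑' j : ℕ, (2 : ℝ≥0∞) ^ ((j : ℝ) * (d / 2)) * a j ≤ G * wl2 s a := by
  obtain ⟨G, hG⟩ := exists_tsum_two_rpow_mul_le (δ := s - d / 2) (by linarith)
  refine ⟨G, fun a => le_trans (le_of_eq (tsum_congr fun j => ?_)) (hG fun j => 2 ^ ((j : ℝ) * s) * a j)⟩
  rw [← mul_assoc, ← two_rpow_add]
  congr 2
  ring

/-- The sum of the Littlewood-Paley pieces, as a function. -/
def full (φ : LPCutoff d) (U : 𝓢'(Space d, E)) (x : Space d) : E := ∑' j, φ.piece j U x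

/-- The Littlewood-Paley pieces are absolutely summable, uniformly in space. -/
def SummablePieces (φ : LPCutoff d) (U : 𝓢'(Space d, E)) : Prop :=
  ∑' j : ℕ, (2 : ℝ≥0∞) ^ ((j : ℝ) * (d / 2)) * pieceL2 φ U j ≠ ⊤

section

variable [CompleteSpace E] {φ : LPCutoff d}

theorem exists_enorm_piece_le_pieceL2 (φ : LPCutoff d) : ∃ C : ℝ≥0, ∀ (j : ℕ) (U : 𝓢'(Space d, E)) x,
    ‖φ.piece j U x‖ₑ ≤ C * (2 ^ ((j : ℝ) * (d / 2)) * pieceL2 φ U j) := by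
  obtain ⟨C, hC⟩ := exists_enorm_piece_le (E := E) φ
  obtain ⟨C', hC'⟩ := exists_conv_piece_le (E := E) φ
  refine ⟨C * C', fun j U x => (hC j U x).trans ?_⟩
  push_cast
  rw [mul_assoc]
  gcongr
  exact hC' j U x

theorem SummablePieces.exists_summable_bound {U : 𝓢'(Space d, E)} (hU : SummablePieces φ U) :
    ∃ b : ℕ → ℝ, Summable b ∧ ∀ j x, ‖φ.piece j U x‖ ≤ b j := by
  obtain ⟨C, hC⟩ := exists_enorm_piece_le_pieceL2 (E := E) φ
  have h1 : ∑' j : ℕ, C * ((2 : ℝ≥0∞) ^ ((j : ℝ) * (d / 2)) * pieceL2 φ U j) ≠ ⊤ := by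
    rw [ENNReal.tsum_mul_left]
    exact ENNReal.mul_ne_top (by simp) hU
  refine ⟨_, ENNReal.summable_toReal h1, fun j x => ?_⟩
  have h2 := hC j U x
  rw [← ofReal_norm] at h2
  exact (ENNReal.ofReal_le_iff_le_toReal (ENNReal.ne_top_of_tsum_ne_top h1 j)).1 h2

theorem SummablePieces.tendsto_lowPiece {U : 𝓢'(Space d, E)} (hU : SummablePieces φ U) (x : Space d) :
    Tendsto (fun N => φ.lowPiece N U x) atTop (𝓝 (full φ U x)) := by
  obtain ⟨b, hb, h⟩ := hU.exists_summable_bound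
  exact (hb.of_norm_bounded fun j => h j x).hasSum.tendsto_sum_nat.comp (tendsto_add_atTop_nat 1)

theorem SummablePieces.continuous_full {U : 𝓢'(Space d, E)} (hU : SummablePieces φ U) :
    Continuous (full φ U) := by
  obtain ⟨b, hb, h⟩ := hU.exists_summable_bound
  exact continuous_tsum (fun j => continuous_band _ _) hb h

theorem SummablePieces.exists_norm_lowPiece_le {U : 𝓢'(Space d, E)} (hU : SummablePieces φ U) :
    ∃ M : ℝ, (∀ N x, ‖φ.lowPiece N U x‖ ≤ M) ∧ ∀ x, ‖full φ U x‖ ≤ M := by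
  obtain ⟨b, hb, h⟩ := hU.exists_summable_bound
  have h1 : ∀ N x, ‖φ.lowPiece N U x‖ ≤ ∑' j, b j := fun N x =>
    (norm_sum_le_of_le _ fun j _ => h j x).trans
      (hb.sum_le_tsum _ fun j _ => (norm_nonneg _).trans (h j x))
  exact ⟨_, h1, fun x => le_of_tendsto (hU.tendsto_lowPiece x).norm (Eventually.of_forall fun N => h1 N x)⟩

theorem integrable_schwartz_smul {E : Type*} [NormedAddCommGroup E] [NormedSpace ℂ E]
    {v : Space d → E} (hv : Continuous v) {M : ℝ} (h : ∀ x, ‖v x‖ ≤ M)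
    (θ : 𝓢(Space d, ℂ)) : Integrable fun x => θ x • v x :=
  Integrable.smul_bdd θ.integrable M hv.aestronglyMeasurable (Eventually.of_forall h)

/-- The truncations converge to the sum of the pieces, uniformly bounded, and to `U` as
distributions. -/
theorem SummablePieces.integral_full {U : 𝓢'(Space d, E)} (hU : SummablePieces φ U)
    (θ : 𝓢(Space d, ℂ)) : Integrable (fun x => θ x • full φ U x) ∧ U θ = ∫ x, θ x • full φ U x := by
  obtain ⟨M, hM, hM'⟩ := hU.exists_norm_lowPiece_le
  have hθ : 𝓕 (𝓕⁻ θ) = θ := FourierInvPair.fourier_fourierInv_eq θ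
  refine ⟨integrable_schwartz_smul hU.continuous_full hM' θ, ?_⟩
  have h1 : Tendsto (fun N => ∫ x, θ x • φ.lowPiece N U x) atTop (𝓝 (∫ x, θ x • full φ U x)) := by
    refine tendsto_integral_of_dominated_convergence (fun x => ‖θ x‖ * M) (fun N => ?_)
      (θ.integrable.norm.mul_const M) (fun N => Eventually.of_forall fun x => ?_)
      (Eventually.of_forall fun x => (hU.tendsto_lowPiece x).const_smul _)
    · rw [lowPiece_eq_band]
      exact (θ.continuous.smul (continuous_band _ _)).aestronglyMeasurable
    · rw [norm_smul]
      gcongr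
      exact hM N x
  have h2 : ∀ N, ∫ x, θ x • φ.lowPiece N U x = U (𝓕 (pmul (𝓕⁻ θ) (φ.lowSymbol N))) := fun N => by
    have := (band_pairing (φ.lowSymbol N) (𝓕⁻ θ) U).2
    rw [hθ] at this
    rw [← this, lowPiece_eq_band]
  have h3 := tendsto_lowSymbol_pairing φ U (𝓕⁻ θ)
  rw [hθ] at h3
  simp_rw [h2] at h1
  exact tendsto_nhds_unique h3 h1

theorem locallyIntegrable_of_schwartz_smul (φ : LPCutoff d) {E : Type*} [NormedAddCommGroup E] [NormedSpace ℂ E]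
    {u : Space d → E}
    (hu : ∀ θ : 𝓢(Space d, ℂ), Integrable fun x => θ x • u x) : LocallyIntegrable u := by
  intro x
  obtain ⟨N, hN⟩ := pow_unbounded_of_one_lt ‖x‖ (one_lt_two : (1 : ℝ) < 2)
  refine ⟨Metric.ball 0 (2 ^ N), Metric.isOpen_ball.mem_nhds (by simpa using hN), ?_⟩
  have h1 : IntegrableOn (fun x => φ.lowSymbol N x • u x) (Metric.ball 0 (2 ^ N)) :=
    (hu (φ.lowSymbol N)).integrableOn
  refine h1.congr_fun (fun y hy => ?_) measurableSet_ball
  beta_reduce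
  rw [φ.lowSymbol_eq_one (by simpa using (mem_ball_zero_iff.1 hy).le), one_smul]

/-- Compactly supported smooth functions are Schwartz, so the fundamental lemma of the calculus of
variations applies. -/
theorem ae_eq_of_integral_schwartz_smul_eq (φ : LPCutoff d) {u v : Space d → E}
    (hu : ∀ θ : 𝓢(Space d, ℂ), Integrable fun x => θ x • u x)
    (hv : ∀ θ : 𝓢(Space d, ℂ), Integrable fun x => θ x • v x)
    (h : ∀ θ : 𝓢(Space d, ℂ), ∫ x, θ x • u x = ∫ x, θ x • v x) : u =ᵐ[volume] v := by
  refine ae_eq_of_integral_contDiff_smul_eq (locallyIntegrable_of_schwartz_smul φ hu)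
    (locallyIntegrable_of_schwartz_smul φ hv) fun g hg hgc => ?_
  have hg' : ContDiff ℝ ∞ fun x => (g x : ℂ) := Complex.ofRealCLM.contDiff.comp hg
  have hgc' : HasCompactSupport fun x => (g x : ℂ) :=
    hgc.comp_left (g := fun r : ℝ => (r : ℂ)) Complex.ofReal_zero
  have := h (hgc'.toSchwartzMap hg')
  have e : ∀ x, (hgc'.toSchwartzMap hg' : 𝓢(Space d, ℂ)) x = (g x : ℂ) := fun _ => rfl
  simpa only [e, Complex.coe_smul] using this

theorem SummablePieces.ae_eq_full {U : 𝓢'(Space d, E)} (hU : SummablePieces φ U) {u : Space d → E}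
    (hu : ∀ θ : 𝓢(Space d, ℂ), Integrable (fun x => θ x • u x) ∧ U θ = ∫ x, θ x • u x) :
    u =ᵐ[volume] full φ U :=
  ae_eq_of_integral_schwartz_smul_eq φ (fun θ => (hu θ).1) (fun θ => (hU.integral_full θ).1)
    fun θ => (hu θ).2.symm.trans (hU.integral_full θ).2

theorem SummablePieces.tsum_pieceL2_ne_top {E : Type*} [NormedAddCommGroup E] [NormedSpace ℂ E]
    {U : 𝓢'(Space d, E)} (hU : SummablePieces φ U) :
    ∑' j, pieceL2 φ U j ≠ ⊤ := by
  refine (lt_of_le_of_lt (ENNReal.tsum_le_tsum fun j => ?_) hU.lt_top).ne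
  refine le_mul_of_one_le_left zero_le ?_
  rw [← ENNReal.rpow_zero (x := 2)]
  exact two_rpow_le (by positivity)

theorem SummablePieces.memLp_full {U : 𝓢'(Space d, E)} (hU : SummablePieces φ U) :
    MemLp (full φ U) 2 := by
  refine ⟨hU.continuous_full.aestronglyMeasurable, ?_⟩
  rw [eLpNorm_two_eq]
  refine lt_of_le_of_lt ?_ hU.tsum_pieceL2_ne_top.lt_top
  refine le_trans (l2_mono fun x => ?_) (l2_tsum_le fun j => measurable_enorm_piece φ j U)
  exact enorm_tsum_le_tsum_enorm

end

end

section

/-! ### Smooth functions of Littlewood-Paley decompositions -/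

section ScaledBound

variable {D V H : Type*} [NormedAddCommGroup D] [NormedSpace ℝ D] [NormedAddCommGroup V]
  [NormedSpace ℝ V] [NormedAddCommGroup H] [NormedSpace ℝ H] {n : ℕ} {r M M' : ℝ} {x : D}

theorem ScaledBound.mono_ratio {r' : ℝ} {f : D → V} (hf : ScaledBound n r M f x)
    (hr : 0 ≤ r) (h : r ≤ r') : ScaledBound n r' M f x := by
  have hM : 0 ≤ M := by simpa using (norm_nonneg _).trans (hf 0 (Nat.zero_le n))
  exact fun i hi => (hf i hi).trans (by gcongr)

theorem ScaledBound.sub {f g : D → V} (hf : ScaledBound n r M f x) (hg : ScaledBound n r M' g x)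
    (hfc : ContDiff ℝ ∞ f) (hgc : ContDiff ℝ ∞ g) :
    ScaledBound n r (M + M') (fun y => f y - g y) x := fun i hi => by
  have h : iteratedFDeriv ℝ i (fun y => f y - g y) x = iteratedFDeriv ℝ i f x - iteratedFDeriv ℝ i g x :=
    iteratedFDeriv_sub_apply (hfc.of_le (by exact_mod_cast le_top)).contDiffAt
      (hgc.of_le (by exact_mod_cast le_top)).contDiffAt
  rw [h, add_mul]
  exact (norm_sub_le _ _).trans (add_le_add (hf i hi) (hg i hi))

theorem ScaledBound.sum {ι : Type*} {s : Finset ι} {M : ι → ℝ} {f : ι → D → V}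
    (hf : ∀ j ∈ s, ScaledBound n r (M j) (f j) x) (hfc : ∀ j, ContDiff ℝ ∞ (f j)) :
    ScaledBound n r (∑ j ∈ s, M j) (fun y => ∑ j ∈ s, f j y) x := fun i hi => by
  have h := congr_fun (iteratedFDeriv_sum (𝕜 := ℝ) (i := i) (f := f) (u := s)
    fun j _ => (hfc j).of_le (by exact_mod_cast le_top)) x
  rw [h, Finset.sum_mul, Finset.sum_apply]
  exact norm_sum_le_of_le _ fun j hj => hf j hj i hi

theorem ScaledBound.prodMk {f : D → V} {g : D → H} (hr : 0 ≤ r) (hf : ScaledBound n r M f x)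
    (hg : ScaledBound n r M' g x) (hfc : ContDiff ℝ ∞ f) (hgc : ContDiff ℝ ∞ g) :
    ScaledBound n r (max M M') (fun y => (f y, g y)) x := fun i hi => by
  have hN : (i : WithTop ℕ∞) ≤ (⊤ : ℕ∞) := by exact_mod_cast le_top
  rw [iteratedFDeriv_prodMk hfc.contDiffAt hgc.contDiffAt hN, ContinuousMultilinearMap.opNorm_prod]
  have h1 := hf i hi
  have h2 := hg i hi
  refine max_le (h1.trans ?_) (h2.trans ?_) <;> gcongr
  · exact le_max_left _ _
  · exact le_max_right _ _

end ScaledBound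

variable {d : ℕ} {E : Type*} [NormedAddCommGroup E] [NormedSpace ℂ E]

/-- The averages of the piece at frequency `2 ^ j` over the scale `2 ^ (-j)`. -/
def envelope (φ : LPCutoff d) (U : 𝓢'(Space d, E)) (j : ℕ) : Space d → ℝ≥0∞ :=
  conv (wt j) fun y => ‖φ.piece j U y‖ₑ

theorem measurable_envelope (φ : LPCutoff d) (U : 𝓢'(Space d, E)) (j : ℕ) :
    Measurable (envelope φ U j) :=
  measurable_conv (measurable_wt j) (measurable_enorm_piece φ j U)

theorem SummablePieces.exists_envelope_le {φ : LPCutoff d} {U : 𝓢'(Space d, E)} (hU : SummablePieces φ U) (j : ℕ) :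
    ∃ M : ℝ≥0, ∀ x, envelope φ U j x ≤ M := by
  obtain ⟨C, hC⟩ := exists_conv_piece_le (E := E) φ
  have h : C * ((2 : ℝ≥0∞) ^ ((j : ℝ) * (d / 2)) * pieceL2 φ U j) ≠ ⊤ :=
    ENNReal.mul_ne_top (by simp) (ENNReal.ne_top_of_tsum_ne_top hU j)
  refine ⟨(C * ((2 : ℝ≥0∞) ^ ((j : ℝ) * (d / 2)) * pieceL2 φ U j)).toNNReal, fun x => ?_⟩
  rw [ENNReal.coe_toNNReal h]
  exact hC j U x

/-- `∑_{i < j} S_i U`. -/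
def lowSum (φ : LPCutoff d) (U : 𝓢'(Space d, E)) (j : ℕ) (x : Space d) : E :=
  ∑ i ∈ Finset.range j, φ.piece i U x

theorem lowSum_succ (φ : LPCutoff d) (U : 𝓢'(Space d, E)) (j : ℕ) (x : Space d) :
    lowSum φ U (j + 1) x = lowSum φ U j x + φ.piece j U x := Finset.sum_range_succ _ _

section

variable [CompleteSpace E] {φ : LPCutoff d}

theorem contDiff_lowSum (φ : LPCutoff d) (U : 𝓢'(Space d, E)) (j : ℕ) : ContDiff ℝ ∞ (lowSum φ U j) :=
  ContDiff.sum fun i _ => contDiff_piece φ i U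

theorem exists_scaledBound_piece (φ : LPCutoff d) (n : ℕ) : ∃ C : ℝ≥0, ∀ (j : ℕ) (U : 𝓢'(Space d, E)) x,
    envelope φ U j x ≠ ⊤ → ScaledBound n (2 ^ j) (C * (envelope φ U j x).toReal) (φ.piece j U) x := by
  choose C hC using fun i => exists_enorm_iteratedFDeriv_piece_le (E := E) φ i
  refine ⟨∑ i ∈ Finset.range (n + 1), C i, fun j U x hx i hi => ?_⟩
  have h1 := hC i j U x
  have h2 : C i ≤ ∑ i ∈ Finset.range (n + 1), C i :=
    Finset.single_le_sum (fun _ _ => zero_le) (Finset.mem_range.2 (by omega))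
  have h3 : ‖iteratedFDeriv ℝ i (φ.piece j U) x‖ ≤ C i * 2 ^ (j * i) * (envelope φ U j x).toReal := by
    have := ENNReal.toReal_mono (ENNReal.mul_ne_top (by finiteness) hx) h1
    simpa [ENNReal.toReal_mul] using this
  refine h3.trans ?_
  rw [pow_mul, mul_right_comm]
  gcongr

theorem lowPiece_eq_integral_full {U : 𝓢'(Space d, E)} (hU : SummablePieces φ U) (N : ℕ) (z : Space d) :
    φ.lowPiece N U z = ∫ x, (𝓕⁻ (φ.lowSymbol N) : 𝓢(Space d, ℂ)) (z - x) • full φ U x := by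
  rw [lowPiece_eq_band, band, (hU.integral_full _).2]
  refine integral_congr_ae (Eventually.of_forall fun x => ?_)
  simp [SchwartzMap.fourier_coe, SchwartzMap.fourierInv_coe, Real.fourierInv_eq_fourier_neg]

/-- A truncation averages the bounded function `full φ U` against a kernel of scale 2^(-N) whose
mass is bounded uniformly in N. The bound thus involves only the supremum norm, not the sum of the
norms of the pieces. -/
theorem exists_scaledBound_lowPiece (φ : LPCutoff d) (n : ℕ) : ∃ C : ℝ≥0, ∀ (U : 𝓢'(Space d, E)) (R : ℝ≥0),
    SummablePieces φ U → (∀ x, ‖full φ U x‖ ≤ R) → ∀ (N : ℕ) x,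
      ScaledBound n (2 ^ N) (C * R) (φ.lowPiece N U) x := by
  choose C hC using fun i => exists_enorm_fourier_dil_le (φ.lowSymbol 0) i
  refine ⟨(∑ i ∈ Finset.range (n + 1), C i) * wtMass d, fun U R hU hR N x i hi => ?_⟩
  have h2 : C i ≤ ∑ i ∈ Finset.range (n + 1), C i :=
    Finset.single_le_sum (fun _ _ => zero_le) (Finset.mem_range.2 (by omega))
  have hp : PolyIntegrable (0 + (d + 1)) (full φ U) :=
    PolyIntegrable.of_norm_le hU.continuous_full.aestronglyMeasurable (M := R) fun x => by
      simpa using hR x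
  have h3 : ‖iteratedFDeriv ℝ i (φ.lowPiece N U) x‖ₑ ≤ C i * 2 ^ (N * i) * (wtMass d * R) := by
    rw [show φ.lowPiece N U = _ from funext (lowPiece_eq_integral_full hU N)]
    refine (hp.enorm_iteratedFDeriv_le _ i x).trans ?_
    have h1 := φ.lowSymbol_add N 0
    rw [add_zero] at h1
    calc _ ≤ conv (fun y => C i * 2 ^ (N * i) * wt N y) (fun _ => (R : ℝ≥0∞)) x :=
          conv_mono (fun y => by rw [h1]; exact (hC i N y).2)
            (fun y => by rw [← ofReal_norm]; exact ENNReal.ofReal_le_of_le_toReal (by simpa using hR y)) x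
      _ = _ := by
          rw [const_mul_conv _ (by finiteness), conv, lintegral_mul_const _ (measurable_wt N),
            lintegral_wt_eq]
  have h4 : ‖iteratedFDeriv ℝ i (φ.lowPiece N U) x‖ ≤ C i * 2 ^ (N * i) * (wtMass d * R) := by
    have := ENNReal.toReal_mono (by finiteness) h3
    simpa [ENNReal.toReal_mul] using this
  refine h4.trans ?_
  rw [pow_mul]
  push_cast
  have h5 : (C i : ℝ) ≤ ∑ i ∈ Finset.range (n + 1), (C i : ℝ) := by exact_mod_cast h2
  calc _ = (C i : ℝ) * (wtMass d * R * (2 ^ N) ^ i) := by ring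
    _ ≤ (∑ i ∈ Finset.range (n + 1), (C i : ℝ)) * (wtMass d * R * (2 ^ N) ^ i) := by gcongr
    _ = _ := by ring

end

end

section

/-! ### Increments along the Littlewood-Paley decomposition -/

theorem ScaledBound.clm_apply {D V H : Type*} [NormedAddCommGroup D] [NormedSpace ℝ D]
    [NormedAddCommGroup V] [NormedSpace ℝ V] [NormedAddCommGroup H] [NormedSpace ℝ H] {n : ℕ}
    {r M M' : ℝ} {f : D → V →L[ℝ] H} {g : D → V} {x : D} (hf : ScaledBound n r M f x)
    (hg : ScaledBound n r M' g x) (hfc : ContDiff ℝ ∞ f) (hgc : ContDiff ℝ ∞ g) (hr : 0 ≤ r) :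
    ScaledBound n r (2 ^ n * (M * M')) (fun y => f y (g y)) x := by
  have hM : 0 ≤ M := by simpa using (norm_nonneg _).trans (hf 0 (Nat.zero_le n))
  have hM' : 0 ≤ M' := by simpa using (norm_nonneg _).trans (hg 0 (Nat.zero_le n))
  refine (hf.bilinear hg hfc hgc hr (ContinuousLinearMap.id ℝ (V →L[ℝ] H))).mono hr ?_
  rw [mul_assoc]
  exact mul_le_of_le_one_left (by positivity) ContinuousLinearMap.norm_id_le

theorem ScaledBound.clm_apply_comp {D V W H : Type*} [NormedAddCommGroup D] [NormedSpace ℝ D]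
    [NormedAddCommGroup V] [NormedSpace ℝ V] [NormedAddCommGroup W] [NormedSpace ℝ W]
    [NormedAddCommGroup H] [NormedSpace ℝ H] {n : ℕ} {r M M' B C : ℝ} {K : W → W →L[ℝ] V →L[ℝ] H}
    {p : D → W} {b : D → V} {x : D} (hp : ScaledBound n r M p x) (hp' : ScaledBound n r M' p x)
    (hb : ScaledBound n r B b x) (hpc : ContDiff ℝ ∞ p) (hbc : ContDiff ℝ ∞ b) (hK : ContDiff ℝ ∞ K)
    (hr : 0 ≤ r) (hC : ∀ i ≤ n, ‖iteratedFDeriv ℝ i K (p x)‖ ≤ C) :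
    ScaledBound n r (2 ^ n * ((2 ^ n * (n.factorial * C * max 1 M' ^ n * M)) * B))
      (fun y => K (p y) (p y) (b y)) x :=
  ((((hp'.comp hpc hK hr hC).clm_apply hp (hK.comp hpc) hpc hr).clm_apply hb
    ((hK.comp hpc).clm_apply hpc) hbc hr))

variable {d : ℕ} {E H : Type*} [NormedAddCommGroup E] [NormedSpace ℂ E] [FiniteDimensional ℂ E]
  [NormedAddCommGroup H] [NormedSpace ℂ H]

/-- The increment of `G(U)` caused by the frequencies `2 ^ j` of `U`. -/
def increment (φ : LPCutoff d) (G : E → H) (U : 𝓢'(Space d, E)) (j : ℕ) (x : Space d) : H :=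
  G (lowSum φ U (j + 1) x) - G (lowSum φ U j x)

/-- A bound for the increments of `G(U)` when `G` vanishes to second order at `0`. -/
def incrementBound (φ : LPCutoff d) (U : 𝓢'(Space d, E)) (j : ℕ) (x : Space d) : ℝ≥0∞ :=
  (∑ i ∈ Finset.range (j + 1), envelope φ U i x) * envelope φ U j x

theorem exists_bound_iteratedFDeriv {V W : Type*} [NormedAddCommGroup V] [NormedSpace ℝ V]
    [FiniteDimensional ℝ V] [NormedAddCommGroup W] [NormedSpace ℝ W] {K : V → W} (hK : ContDiff ℝ ∞ K)
    (n : ℕ) (R : ℝ) : ∃ C : ℝ≥0, ∀ i ≤ n, ∀ p, ‖p‖ ≤ R → ‖iteratedFDeriv ℝ i K p‖ ≤ C := by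
  have : ProperSpace V := FiniteDimensional.proper ℝ V
  have h1 : ∀ i : ℕ, ∃ C : ℝ≥0, ∀ p, ‖p‖ ≤ R → ‖iteratedFDeriv ℝ i K p‖ ≤ C := fun i => by
    have hc : Continuous (iteratedFDeriv ℝ i K) :=
      (hK.of_le (by exact_mod_cast le_top)).continuous_iteratedFDeriv (m := i) le_rfl
    obtain ⟨M, hM⟩ := (isCompact_closedBall (0 : V) R).exists_bound_of_continuousOn hc.continuousOn
    exact ⟨M.toNNReal, fun p hp => (hM p (by simpa using hp)).trans (Real.le_coe_toNNReal M)⟩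
  choose C hC using h1
  refine ⟨∑ i ∈ Finset.range (n + 1), C i, fun i hi p hp => (hC i p hp).trans ?_⟩
  exact_mod_cast Finset.single_le_sum (f := C) (fun _ _ => zero_le) (Finset.mem_range.2 (by omega))

variable [CompleteSpace H] {φ : LPCutoff d}

/-- With a the low sum and b the piece, the increment is K(a,b)(a,b)b. The pair (a, b) is estimated
twice: by `R`, to control the nonlinear factor K(a,b), and by the envelopes, to make the bound
quadratic in the pieces. -/
theorem exists_enorm_iteratedFDeriv_increment_le (φ : LPCutoff d) {G : E → H} (hG : ContDiff ℝ ∞ G)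
    (h : fderiv ℝ G 0 = 0) (n : ℕ) (R : ℝ≥0) : ∃ C : ℝ≥0, ∀ U : 𝓢'(Space d, E), SummablePieces φ U →
      (∀ x, ‖full φ U x‖ ≤ R) → ∀ (j : ℕ) x,
        ‖iteratedFDeriv ℝ n (increment φ G U j) x‖ₑ ≤ C * 2 ^ (j * n) * incrementBound φ U j x := by
  have : CompleteSpace E := FiniteDimensional.complete ℂ E
  have : FiniteDimensional ℝ E := FiniteDimensional.complexToReal E
  obtain ⟨K, hK, hKG⟩ := exists_quadratic_increment hG h
  obtain ⟨C₁, h₁⟩ := exists_scaledBound_piece (E := E) φ n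
  obtain ⟨C₂, h₂⟩ := exists_scaledBound_lowPiece (E := E) φ n
  obtain ⟨C₃, h₃⟩ := exists_bound_iteratedFDeriv hK n (2 * C₂ * R)
  refine ⟨2 ^ n * ((2 ^ n * (n.factorial * C₃ * max 1 (2 * C₂ * R) ^ n * C₁)) * C₁),
    fun U hU hR j x => ?_⟩
  have hfin : ∀ i, envelope φ U i x ≠ ⊤ := fun i => by
    obtain ⟨M, hM⟩ := hU.exists_envelope_le i
    exact ne_top_of_le_ne_top (by simp) (hM x)
  have hr : (0 : ℝ) ≤ 2 ^ j := by positivity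
  have hlc := contDiff_lowSum φ U j
  have hpc := contDiff_piece φ j U
  have hb := h₁ j U x (hfin j)
  have hl : ScaledBound n (2 ^ j) (C₁ * (∑ i ∈ Finset.range (j + 1), envelope φ U i x).toReal)
      (lowSum φ U j) x := by
    rw [ENNReal.toReal_sum fun i _ => hfin i, Finset.mul_sum, Finset.sum_range_succ]
    refine ScaledBound.mono (M := ∑ i ∈ Finset.range j, C₁ * (envelope φ U i x).toReal) ?_ hr
      (le_add_of_nonneg_right (by positivity))
    refine ScaledBound.sum (fun i hi => ?_) fun i => contDiff_piece φ i U
    exact (h₁ i U x (hfin i)).mono_ratio (by positivity)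
      (pow_le_pow_right₀ one_le_two (Finset.mem_range.1 hi).le)
  -- The low sum over i < j is zero for j = 0 and a truncation otherwise.
  have hl' : ScaledBound n (2 ^ j) (C₂ * R) (lowSum φ U j) x := by
    cases j with
    | zero =>
      have e : lowSum φ U 0 = fun _ => 0 := by ext y; simp [lowSum]
      intro i _
      rw [e, iteratedFDeriv_fun_zero]
      simp only [Pi.zero_apply, norm_zero]
      positivity
    | succ N => exact (h₂ U R hU hR N x).mono_ratio (by positivity) (pow_le_pow_right₀ one_le_two (by omega))
  have hb' : ScaledBound n (2 ^ j) (2 * C₂ * R) (φ.piece j U) x := by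
    -- A piece is a difference of two truncations, each bounded by the supremum norm; this explains
    -- the constant 2 C₂ R.
    have e : φ.piece j U = fun y => φ.lowPiece j U y - lowSum φ U j y := by
      ext y
      exact eq_sub_of_add_eq' (lowSum_succ φ U j y).symm
    rw [e]
    refine ((h₂ U R hU hR j x).sub hl' ?_ hlc).mono hr (by linarith)
    exact contDiff_lowSum φ U (j + 1)
  have hp := (hl.prodMk hr hb hlc hpc).mono
    (M' := C₁ * (∑ i ∈ Finset.range (j + 1), envelope φ U i x).toReal) hr (max_le le_rfl (by
      gcongr
      · exact (ENNReal.sum_ne_top.2 fun i _ => hfin i)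
      · exact Finset.single_le_sum (f := fun i => envelope φ U i x) (fun _ _ => zero_le)
          (Finset.mem_range.2 (Nat.lt_succ_self j))))
  have hp' := (hl'.prodMk hr hb' hlc hpc).mono (M' := 2 * C₂ * R) hr
    (max_le (by nlinarith [C₂.2, R.2, mul_nonneg C₂.2 R.2]) le_rfl)
  have hppc : ContDiff ℝ ∞ fun y => (lowSum φ U j y, φ.piece j U y) := hlc.prodMk hpc
  have h4 := (hp.clm_apply_comp hp' hb hppc hpc hK hr (C := C₃) fun i hi => h₃ i hi _ (by
    simpa using hp' 0 (Nat.zero_le n))) n le_rfl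
  have e : (fun y => K (lowSum φ U j y, φ.piece j U y) (lowSum φ U j y, φ.piece j U y)
      (φ.piece j U y)) = increment φ G U j := by
    ext y
    rw [increment, lowSum_succ, hKG]
  rw [e] at h4
  rw [← ofReal_norm]
  refine (ENNReal.ofReal_le_ofReal h4).trans ?_
  refine ENNReal.ofReal_le_of_le_toReal (le_of_eq ?_)
  simp only [incrementBound, ENNReal.toReal_mul, ENNReal.toReal_pow, ENNReal.coe_toReal, pow_mul,
    ENNReal.toReal_ofNat]
  push_cast
  ring

end

section

/-! ### The Littlewood-Paley pieces of a smooth function of `U` at a fixed time -/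

variable {d : ℕ} {E H : Type*} [NormedAddCommGroup E] [NormedSpace ℂ E] [NormedAddCommGroup H]
  {φ : LPCutoff d}

theorem SummablePieces.exists_incrementBound_le {U : 𝓢'(Space d, E)} (hU : SummablePieces φ U) (j : ℕ) :
    ∃ M : ℝ≥0, ∀ x, incrementBound φ U j x ≤ M := by
  choose M hM using fun i => hU.exists_envelope_le i
  refine ⟨(∑ i ∈ Finset.range (j + 1), M i) * M j, fun x => ?_⟩
  push_cast
  exact mul_le_mul' (Finset.sum_le_sum fun i _ => hM i x) (hM j x)

theorem sum_increment (φ : LPCutoff d) {G : E → H} (h0 : G 0 = 0) (U : 𝓢'(Space d, E)) (N : ℕ) (x : Space d) :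
    ∑ j ∈ Finset.range N, increment φ G U j x = G (lowSum φ U N x) := by
  simp only [increment]
  rw [Finset.sum_range_sub (fun j => G (lowSum φ U j x))]
  simp [lowSum, h0]

variable [FiniteDimensional ℂ E] [NormedSpace ℂ H]

theorem contDiff_increment {G : E → H} (hG : ContDiff ℝ ∞ G) (U : 𝓢'(Space d, E)) (j : ℕ) :
    ContDiff ℝ ∞ (increment φ G U j) := by
  have : CompleteSpace E := FiniteDimensional.complete ℂ E
  exact (hG.comp (contDiff_lowSum φ U (j + 1))).sub (hG.comp (contDiff_lowSum φ U j))

variable [CompleteSpace H]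

theorem bddSmooth_increment {G : E → H} (hG : ContDiff ℝ ∞ G) (h : fderiv ℝ G 0 = 0)
    {U : 𝓢'(Space d, E)} (hU : SummablePieces φ U) (j : ℕ) : BddSmooth (increment φ G U j) := by
  have : CompleteSpace E := FiniteDimensional.complete ℂ E
  refine ⟨contDiff_increment hG U j, fun n => ?_⟩
  obtain ⟨R, -, hR⟩ := hU.exists_norm_lowPiece_le
  obtain ⟨C, hC⟩ := exists_enorm_iteratedFDeriv_increment_le φ hG h n R.toNNReal
  obtain ⟨M, hM⟩ := hU.exists_incrementBound_le j
  refine ⟨(C * 2 ^ (j * n) * M : ℝ≥0), fun x => ?_⟩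
  have h1 := (hC U hU (fun x => (hR x).trans (Real.le_coe_toNNReal R)) j x).trans
    (mul_le_mul' le_rfl (hM x))
  have h2 : ‖iteratedFDeriv ℝ n (increment φ G U j) x‖ₑ ≤ (C * 2 ^ (j * n) * M : ℝ≥0) := by
    push_cast; exact h1
  rw [← ofReal_norm] at h2
  have := (ENNReal.ofReal_le_iff_le_toReal ENNReal.coe_ne_top).1 h2
  rwa [ENNReal.coe_toReal] at this

/-- The decay of the frequencies of the increments. -/
theorem exists_enorm_integral_increment_le (φ : LPCutoff d) {G : E → H} (hG : ContDiff ℝ ∞ G)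
    (h : fderiv ℝ G 0 = 0) (n : ℕ) (R : ℝ≥0) : ∃ C : ℝ≥0, ∀ U : 𝓢'(Space d, E), SummablePieces φ U →
      (∀ x, ‖full φ U x‖ ≤ R) → ∀ (k j : ℕ) x, ‖∫ y, φ.kernelAt k x y • increment φ G U j y‖ₑ ≤
        C * 2 ^ (-(((k - j : ℕ) : ℝ) * n)) * conv (wt k) (incrementBound φ U j) x := by
  obtain ⟨C₀, h₀⟩ := exists_enorm_iteratedFDeriv_increment_le φ hG h 0 R
  obtain ⟨C₁, h₁⟩ := exists_enorm_iteratedFDeriv_increment_le φ hG h n R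
  obtain ⟨C₂, h₂⟩ := exists_enorm_kernel_le φ
  obtain ⟨C₃, h₃⟩ := exists_enorm_integral_kernelAt_le (E := H) φ n
  refine ⟨C₂ * C₀ + C₃ * C₁ * 2 ^ n, fun U hU hR k j x => ?_⟩
  have hmono : ∀ (C : ℝ≥0∞) (P : ℝ≥0∞), C ≤ ((C₂ * C₀ + C₃ * C₁ * 2 ^ n : ℝ≥0) : ℝ≥0∞) → C * P *
      conv (wt k) (incrementBound φ U j) x ≤ ((C₂ * C₀ + C₃ * C₁ * 2 ^ n : ℝ≥0) : ℝ≥0∞) * P *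
      conv (wt k) (incrementBound φ U j) x := fun C P hC => by gcongr
  -- For k ≤ j the truncated difference k - j is 0 and no decay is claimed: the bound of order zero
  -- suffices.
  rcases le_or_gt k j with hkj | hkj
  · refine le_trans ?_ (hmono (C₂ * C₀) _ (by push_cast; exact le_self_add))
    rw [Nat.sub_eq_zero_of_le hkj]
    simp only [Nat.cast_zero, zero_mul, neg_zero, ENNReal.rpow_zero, mul_one]
    refine (enorm_integral_le_lintegral_enorm _).trans ?_
    rw [conv_comm, conv, ← lintegral_const_mul' _ _ (by finiteness)]
    refine lintegral_mono fun y => ?_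
    have e : φ.kernelAt k x y = 𝓕 (φ.symbol k) (y - x) := rfl
    beta_reduce
    rw [enorm_smul, e]
    have h4 := h₂ k (y - x)
    rw [← wt_neg, neg_sub] at h4
    have h5 := h₀ U hU hR j y
    rw [← ofReal_norm, norm_iteratedFDeriv_zero, ofReal_norm, mul_zero, pow_zero, mul_one] at h5
    exact (mul_le_mul' h4 h5).trans (le_of_eq (by ring))
  · refine le_trans ?_ (hmono (C₃ * C₁ * 2 ^ n) _ (by push_cast; exact le_add_self))
    obtain ⟨l, rfl⟩ : ∃ l, k = l + 1 := ⟨k - 1, by omega⟩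
    -- For k = l + 1 > j, derivatives of order n cost 2^(jn) while the annular kernel gains 2^(-ln).
    have hjl : j ≤ l := by omega
    refine (h₃ l _ (bddSmooth_increment hG h hU j) x).trans ?_
    refine (mul_le_mul' le_rfl (conv_mono (fun _ => le_rfl) (h₁ U hU hR j) x)).trans (le_of_eq ?_)
    rw [conv_const_mul _ (by finiteness)]
    have e1 : (2 : ℝ≥0∞) ^ (-((l : ℝ) * n)) * 2 ^ (j * n) =
        2 ^ n * 2 ^ (-(((l + 1 - j : ℕ) : ℝ) * n)) := by
      rw [← ENNReal.rpow_natCast, ← ENNReal.rpow_natCast, ← two_rpow_add, ← two_rpow_add]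
      congr 1
      rw [Nat.cast_sub (by omega)]
      push_cast
      ring
    calc _ = C₃ * C₁ * ((2 : ℝ≥0∞) ^ (-((l : ℝ) * n)) * 2 ^ (j * n)) *
          conv (wt (l + 1)) (incrementBound φ U j) x := by ring
      _ = _ := by rw [e1]; ring

/-- The increments telescope to G of the truncations, as G(0) = 0; dominated convergence passes to
the limit, and the bound for finite sums is uniform. -/
theorem exists_enorm_integral_comp_full_le (φ : LPCutoff d) {G : E → H} (hG : ContDiff ℝ ∞ G)
    (h0 : G 0 = 0) (h : fderiv ℝ G 0 = 0) (n : ℕ) (R : ℝ≥0) : ∃ C : ℝ≥0, ∀ U : 𝓢'(Space d, E),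
      SummablePieces φ U → (∀ x, ‖full φ U x‖ ≤ R) → ∀ (k : ℕ) x,
        ‖∫ y, φ.kernelAt k x y • G (full φ U y)‖ₑ ≤
          ∑' j : ℕ, C * 2 ^ (-(((k - j : ℕ) : ℝ) * n)) * conv (wt k) (incrementBound φ U j) x := by
  have : CompleteSpace E := FiniteDimensional.complete ℂ E
  have : ProperSpace E := FiniteDimensional.proper ℂ E
  obtain ⟨C, hC⟩ := exists_enorm_integral_increment_le φ hG h n R
  refine ⟨C, fun U hU hR k x => ?_⟩
  obtain ⟨M, hM, hM'⟩ := hU.exists_norm_lowPiece_le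
  obtain ⟨B, hB⟩ := (isCompact_closedBall (0 : E) M).exists_bound_of_continuousOn
    hG.continuous.continuousOn
  have hcont : ∀ N, Continuous fun y => G (φ.lowPiece N U y) := fun N =>
    hG.continuous.comp (contDiff_lowSum φ U (N + 1)).continuous
  have h1 : Tendsto (fun N => ∫ y, φ.kernelAt k x y • G (φ.lowPiece N U y)) atTop
      (𝓝 (∫ y, φ.kernelAt k x y • G (full φ U y))) := by
    refine tendsto_integral_of_dominated_convergence (fun y => ‖φ.kernelAt k x y‖ * B) (fun N => ?_)
      ((φ.kernelAt k x).integrable.norm.mul_const B) (fun N => Eventually.of_forall fun y => ?_)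
      (Eventually.of_forall fun y =>
        ((hG.continuous.tendsto _).comp (hU.tendsto_lowPiece y)).const_smul _)
    · exact ((φ.kernelAt k x).continuous.smul (hcont N)).aestronglyMeasurable
    · rw [norm_smul]
      gcongr
      exact hB _ (by simpa using hM N y)
  refine le_of_tendsto h1.enorm (Eventually.of_forall fun N => ?_)
  have h2 : ∀ y, G (φ.lowPiece N U y) = ∑ j ∈ Finset.range (N + 1), increment φ G U j y := fun y =>
    (sum_increment φ h0 U (N + 1) y).symm
  simp_rw [h2, Finset.smul_sum]
  rw [integral_finsetSum _ fun j _ => ?_]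
  · refine (enorm_sum_le _ _).trans ?_
    exact (Finset.sum_le_sum fun j _ => hC U hU hR k j x).trans (ENNReal.sum_le_tsum _)
  · obtain ⟨M', hM'⟩ := (bddSmooth_increment hG h hU j).2 0
    refine integrable_schwartz_smul (contDiff_increment hG U j).continuous (M := M') (fun y => ?_) _
    simpa using hM' y

end

section

variable {d : ℕ}

/-! ### Space-time estimates for smooth functions of `U` -/

theorem eN_const_mul (T : ℝ) (j : ℕ) (c : ℝ≥0∞) {h : ℝ → Space d → ℝ≥0∞}
    (hm : Measurable (Function.uncurry h)) : eN T j (fun t x => c * h t x) = c * eN T j h := by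
  have h1 : eX T (fun t x => c * h t x) = c * eX T h := by
    simp only [eX, ENNReal.mul_iSup]
    refine iSup_congr fun l => iSup_congr fun k => ?_
    rw [show Function.uncurry (fun t x => c * h t x) = fun p => c * Function.uncurry h p from rfl,
      l2_const_mul c hm]
    ring
  have h2 : eI T (fun t x => c * h t x) = c * eI T h := by
    rw [eI, eI, ← ENNReal.essSup_const_mul]
    refine essSup_congr_ae (Eventually.of_forall fun t => l2_const_mul c ?_)
    exact hm.comp (measurable_const.prodMk measurable_id)
  rw [eN, eN, h1, h2]
  ring

theorem eY_const_mul (T : ℝ) (j : ℕ) (c : ℝ≥0∞) {h : ℝ → Space d → ℝ≥0∞}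
    (hm : Measurable (Function.uncurry h)) : eY T j (fun t x => c * h t x) = c * eY T j h := by
  rw [eY, cubeSum, eY, cubeSum, ← ENNReal.tsum_mul_left]
  refine tsum_congr fun k => ?_
  rw [← eN_const_mul T j c (measurable_cut hm j k)]
  congr 1
  ext t x
  by_cases hx : x ∈ cube j k <;> simp [cut, hx]

/-- For k ≤ i the output lies below both inputs and the estimate for two high factors applies,
harmless since σ ≥ s > d/2. For k ≥ i the first factor is low. If moreover k > j, the decay of order
`n` beats the weight 2^((k-j)σ), the loss 2^((k-j)/2) from raising the level in X_j, and the
required `geo`; hence the condition on `n`. -/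
theorem exists_eY_conv_envelope_mul_le (d : ℕ) {s σ : ℝ} (hs : (d : ℝ) / 2 < s) (hσ : s ≤ σ) {n : ℕ}
    (hn : σ + 1 / 2 + (s - d / 2) / 2 ≤ n) : ∃ C : ℝ≥0, ∀ (T : ℝ) (k i j : ℕ)
    (f g : ℝ → Space d → ℝ≥0∞), Measurable (Function.uncurry f) → Measurable (Function.uncurry g) →
      i ≤ j → 2 ^ ((k : ℝ) * σ) * (2 ^ (-(((k - j : ℕ) : ℝ) * n)) *
        eY T k (fun t => conv (wt k) fun x => conv (wt i) (f t) x * g t x)) ≤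
      C * (2 ^ (-((s - d / 2) / 2 * i)) * (2 ^ ((i : ℝ) * s) * eY T i f) *
        (geo ((s - d / 2) / 2) k j * (2 ^ ((j : ℝ) * σ) * eY T j g))) := by
  set δ : ℝ := (s - d / 2) / 2 with hδ
  have hδ0 : 0 < δ := by rw [hδ]; linarith
  have hd0 : (0 : ℝ) ≤ d := Nat.cast_nonneg d
  obtain ⟨C₁, h₁⟩ := exists_eY_conv_high_high_le d
  obtain ⟨C₂, h₂⟩ := eY_conv_wt_mul_le_of_le d
  set B : ℝ≥0 := (box d 1).card * (box d 1).card * wtMass d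
  have hB : ∀ T k i {f : ℝ → Space d → ℝ≥0∞}, Measurable (Function.uncurry f) →
      eY T k (fun t => conv (wt i) (f t)) ≤ B * eY T k f := fun T k i f hf => by
    refine (eY_conv_le T k (measurable_wt i) hf).trans (le_of_eq ?_)
    rw [lintegral_wt_eq]
    rfl
  have hpow : ∀ {a b c e g : ℝ} {Y Z K : ℝ≥0∞}, a + b ≤ c + e + g →
      (2 : ℝ≥0∞) ^ a * (K * 2 ^ b * Y * Z) ≤ K * (2 ^ c * (2 ^ e * Y) * (2 ^ g * Z)) := by
    intro a b c e g Y Z K h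
    have := two_rpow_le h
    rw [two_rpow_add, two_rpow_add, two_rpow_add] at this
    calc (2 : ℝ≥0∞) ^ a * (K * 2 ^ b * Y * Z) = (2 ^ a * 2 ^ b) * (K * Y * Z) := by ring
      _ ≤ (2 ^ c * 2 ^ e * 2 ^ g) * (K * Y * Z) := by gcongr
      _ = _ := by ring
  refine ⟨C₁ * B + B * C₂, fun T k i j f g hf hg hij => ?_⟩
  have hfc := measurable_uncurry_conv (measurable_wt i) hf
  have hij' : (i : ℝ) ≤ j := by exact_mod_cast hij
  rcases le_total k i with hki | hik
  · have hki' : (k : ℝ) ≤ i := by exact_mod_cast hki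
    have h3 := h₁ T i j k (fun t => conv (wt i) (f t)) g hfc hg (by omega)
    rw [Nat.sub_eq_zero_of_le (hki.trans hij), Nat.cast_zero, zero_mul, neg_zero, ENNReal.rpow_zero,
      one_mul]
    have h4 : (k : ℝ) * σ + (i * d - k * (d / 2)) ≤ -(δ * i) + i * s + (-(δ * |(k : ℝ) - j|) + j * σ) := by
      rw [abs_of_nonpos (by linarith)]
      have e1 : 0 ≤ (j - (i : ℝ)) * (σ - δ) := mul_nonneg (by linarith) (by linarith)
      have e2 : 0 ≤ ((i : ℝ) - k) * (σ - δ - d / 2) := mul_nonneg (by linarith) (by linarith)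
      have e3 : 0 ≤ (i : ℝ) * δ := by positivity
      have e4 : s = 2 * δ + d / 2 := by rw [hδ]; ring
      rw [e4]
      nlinarith
    calc _ ≤ 2 ^ ((k : ℝ) * σ) * (C₁ * 2 ^ ((i : ℝ) * d - k * (d / 2)) * (B * eY T i f) * eY T j g) := by
          refine mul_le_mul' le_rfl (h3.trans ?_)
          gcongr
          exact hB T i i hf
      _ = 2 ^ ((k : ℝ) * σ) * ((C₁ * B) * 2 ^ ((i : ℝ) * d - k * (d / 2)) * eY T i f * eY T j g) := by ring
      _ ≤ (C₁ * B) * (2 ^ (-(δ * i)) * (2 ^ ((i : ℝ) * s) * eY T i f) *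
          (2 ^ (-(δ * |(k : ℝ) - j|) + j * σ) * eY T j g)) := hpow h4
      _ = (C₁ * B) * (2 ^ (-(δ * i)) * (2 ^ ((i : ℝ) * s) * eY T i f) *
          (geo δ k j * (2 ^ ((j : ℝ) * σ) * eY T j g))) := by rw [two_rpow_add, geo]; ring
      _ ≤ _ := by gcongr; push_cast; exact le_self_add
  · have hik' : (i : ℝ) ≤ k := by exact_mod_cast hik
    have hprod : Measurable (Function.uncurry fun t x => conv (wt i) (f t) x * g t x) := hfc.mul hg
    have h3 : eY T k (fun t => conv (wt k) fun x => conv (wt i) (f t) x * g t x) ≤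
        B * (C₂ * 2 ^ ((i : ℝ) * d / 2) * eY T i f * eN T k g) := by
      refine (hB T k k hprod).trans (mul_le_mul' le_rfl ?_)
      exact h₂ T i k f g hik hf hg
    -- For k ≤ j the truncated difference makes this the monotonicity in the level.
    have h5 : eN T k g ≤ 2 ^ (((k - j : ℕ) : ℝ) / 2) * eY T j g := by
      refine ((eN_mono_level T (by omega : k ≤ j + (k - j)) g).trans (eN_add_le T j (k - j) g)).trans ?_
      gcongr
      exact (isConvNorm_eN T j).le_cubeSum hg j
    have h4 : (k : ℝ) * σ + (-(((k - j : ℕ) : ℝ) * n) + i * d / 2 + ((k - j : ℕ) : ℝ) / 2) ≤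
        -(δ * i) + i * s + (-(δ * |(k : ℝ) - j|) + j * σ) := by
      have e3 : 0 ≤ (i : ℝ) * δ := by positivity
      have e4 : s = 2 * δ + d / 2 := by rw [hδ]; ring
      rcases le_total k j with hkj | hjk
      · have hkj' : (k : ℝ) ≤ j := by exact_mod_cast hkj
        rw [Nat.sub_eq_zero_of_le hkj, abs_of_nonpos (by linarith), Nat.cast_zero, e4]
        have e1 : 0 ≤ (j - (k : ℝ)) * (σ - δ) := mul_nonneg (by linarith) (by linarith)
        nlinarith
      · have hjk' : (j : ℝ) ≤ k := by exact_mod_cast hjk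
        rw [Nat.cast_sub hjk, abs_of_nonneg (by linarith)]
        have e1 : 0 ≤ (k - (j : ℝ)) * (n - (σ + 1 / 2 + δ)) := mul_nonneg (by linarith) (by linarith)
        nth_rewrite 1 [e4]
        nlinarith
    calc _ ≤ 2 ^ ((k : ℝ) * σ) * (2 ^ (-(((k - j : ℕ) : ℝ) * n)) * (B * (C₂ * 2 ^ ((i : ℝ) * d / 2) *
          eY T i f * (2 ^ (((k - j : ℕ) : ℝ) / 2) * eY T j g)))) := by
          gcongr
          refine h3.trans ?_
          gcongr
      _ = 2 ^ ((k : ℝ) * σ) * ((B * C₂) * 2 ^ (-(((k - j : ℕ) : ℝ) * n) + i * d / 2 +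
          ((k - j : ℕ) : ℝ) / 2) * eY T i f * eY T j g) := by
          rw [two_rpow_add, two_rpow_add]; ring
      _ ≤ (B * C₂) * (2 ^ (-(δ * i)) * (2 ^ ((i : ℝ) * s) * eY T i f) *
          (2 ^ (-(δ * |(k : ℝ) - j|) + j * σ) * eY T j g)) := hpow h4
      _ = (B * C₂) * (2 ^ (-(δ * i)) * (2 ^ ((i : ℝ) * s) * eY T i f) *
          (geo δ k j * (2 ^ ((j : ℝ) * σ) * eY T j g))) := by rw [two_rpow_add, geo]; ring
      _ ≤ _ := by gcongr; push_cast; exact le_add_self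

variable {E H : Type*} [NormedAddCommGroup E] [NormedSpace ℂ E] [FiniteDimensional ℂ E]
  [NormedAddCommGroup H] [NormedSpace ℂ H] [CompleteSpace H]

theorem exists_wl2_comp_full_le (φ : LPCutoff d) {s σ : ℝ} (hs : (d : ℝ) / 2 < s) (hσ : s ≤ σ)
    {G : E → H} (hG : ContDiff ℝ ∞ G) (h0 : G 0 = 0) (h : fderiv ℝ G 0 = 0) (R : ℝ≥0) :
    ∃ C : ℝ≥0, ∀ (T : ℝ) (U : ℝ → 𝓢'(Space d, E)) (W : ℝ → 𝓢'(Space d, H)), PieceMeas φ U →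
      (∀ᵐ t ∂timeMeasure T, SummablePieces φ (U t) ∧ (∀ x, ‖full φ (U t) x‖ ≤ R) ∧
        ∀ θ : 𝓢(Space d, ℂ), W t θ = ∫ x, θ x • G (full φ (U t) x)) →
      wl2 σ (fun k => pieceNorm φ T k W) ≤
        C * (wl2 s (fun k => pieceNorm φ T k U) * wl2 σ (fun k => pieceNorm φ T k U)) := by
  obtain ⟨n, hn⟩ := exists_nat_ge (σ + 1 / 2 + (s - d / 2) / 2)
  obtain ⟨C₁, h₁⟩ := exists_enorm_integral_comp_full_le φ hG h0 h n R
  obtain ⟨C₂, h₂⟩ := exists_eY_conv_envelope_mul_le d hs hσ hn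
  obtain ⟨C₃, h₃⟩ := exists_sl2_low_high_le (δ := (s - d / 2) / 2) (by linarith)
  set B : ℝ≥0 := (box d 1).card * (box d 1).card * wtMass d
  refine ⟨C₁ * (C₂ * B) * C₃, fun T U W hU hW => ?_⟩
  set a : ℕ → ℝ≥0∞ := fun k => pieceNorm φ T k U
  set f : ℕ → ℝ → Space d → ℝ≥0∞ := fun i t x => ‖φ.piece i (U t) x‖ₑ
  have hf : ∀ i, Measurable (Function.uncurry (f i)) := hU.measurable
  have hfc : ∀ i, Measurable (Function.uncurry fun t => conv (wt i) (f i t)) := fun i =>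
    measurable_uncurry_conv (measurable_wt i) (hf i)
  set q : ℕ → ℕ × ℕ → ℝ → Space d → ℝ≥0∞ := fun k p t =>
    conv (wt k) fun x => conv (wt p.1) (f p.1 t) x * conv (wt p.2) (f p.2 t) x
  have hq : ∀ k p, Measurable (Function.uncurry (q k p)) := fun k p =>
    measurable_uncurry_conv (measurable_wt k) ((hfc p.1).mul (hfc p.2))
  -- The coefficient combines the decay in k - j with the restriction i ≤ j in the bound for the
  -- increments, so that all pairs of indices can be summed.
  set c : ℕ → ℕ × ℕ → ℝ≥0∞ := fun k p =>
    if p.1 ≤ p.2 then C₁ * 2 ^ (-(((k - p.2 : ℕ) : ℝ) * n)) else 0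
  have hpw : ∀ k, ∀ᵐ t ∂timeMeasure T, ∀ x, ‖φ.piece k (W t) x‖ₑ ≤ ∑' p, c k p * q k p t x := by
    intro k
    filter_upwards [hW] with t ht x
    rw [LPCutoff.piece, ht.2.2]
    refine (h₁ (U t) ht.1 ht.2.1 k x).trans (le_of_eq ?_)
    rw [ENNReal.tsum_prod', ENNReal.tsum_comm]
    refine tsum_congr fun j => ?_
    rw [tsum_eq_sum (s := Finset.range (j + 1)) fun i hi => ?_]
    · have e : incrementBound φ (U t) j = fun y => ∑' i : Finset.range (j + 1),
          envelope φ (U t) i y * envelope φ (U t) j y := by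
        ext y
        rw [incrementBound, Finset.sum_mul, ← Finset.sum_coe_sort (Finset.range (j + 1))
          fun i => envelope φ (U t) i y * envelope φ (U t) j y, tsum_fintype]
      rw [e, conv_tsum (h := fun (i : Finset.range (j + 1)) y => envelope φ (U t) i y * envelope φ (U t) j y)
        (measurable_wt k) (fun i => (measurable_envelope φ _ _).mul (measurable_envelope φ _ _)), tsum_fintype, Finset.mul_sum,
        ← Finset.sum_coe_sort (Finset.range (j + 1)) fun i => c k (i, j) * q k (i, j) t x]
      refine Finset.sum_congr rfl fun i _ => ?_
      have hij : (i : ℕ) ≤ j := Nat.lt_succ_iff.1 (Finset.mem_range.1 i.2)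
      simp only [c, q, f, if_pos hij]
      rfl
    · have hij : ¬ i ≤ j := fun hle => hi (Finset.mem_range.2 (Nat.lt_succ_of_le hle))
      simp only [c, if_neg hij, zero_mul]
  have hk : ∀ k : ℕ, 2 ^ ((k : ℝ) * σ) * pieceNorm φ T k W ≤ (C₁ * (C₂ * B) : ℝ≥0) *
      ∑' p : ℕ × ℕ, 2 ^ (-((s - d / 2) / 2 * p.1)) * (2 ^ ((p.1 : ℝ) * s) * a p.1) *
        (geo ((s - d / 2) / 2) k p.2 * (2 ^ ((p.2 : ℝ) * σ) * a p.2)) := by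
    intro k
    have hY : pieceNorm φ T k W ≤ ∑' p, c k p * eY T k (q k p) := by
      refine (eY_mono_ae T k (hpw k)).trans
        ((eY_tsum_le T k fun p => (hq k p).const_mul _).trans (ENNReal.tsum_le_tsum fun p => ?_))
      exact (eY_const_mul T k (c k p) (hq k p)).le
    refine (mul_le_mul' le_rfl hY).trans ?_
    rw [← ENNReal.tsum_mul_left, ← ENNReal.tsum_mul_left]
    refine ENNReal.tsum_le_tsum fun p => ?_
    obtain ⟨i, j⟩ := p
    by_cases hij : i ≤ j
    · simp only [c, if_pos hij]
      have h4 := h₂ T k i j (f i) (fun t => conv (wt j) (f j t)) (hf i) (hfc j) hij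
      have h5 : eY T j (fun t => conv (wt j) (f j t)) ≤ B * a j := by
        refine (eY_conv_le T j (measurable_wt j) (hf j)).trans (le_of_eq ?_)
        rw [lintegral_wt_eq]
        rfl
      calc _ = C₁ * (2 ^ ((k : ℝ) * σ) * (2 ^ (-(((k - j : ℕ) : ℝ) * n)) * eY T k (q k (i, j)))) := by
            ring
        _ ≤ C₁ * (C₂ * (2 ^ (-((s - d / 2) / 2 * i)) * (2 ^ ((i : ℝ) * s) * eY T i (f i)) *
            (geo ((s - d / 2) / 2) k j * (2 ^ ((j : ℝ) * σ) * (B * a j))))) := by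
            refine mul_le_mul' le_rfl (h4.trans ?_)
            gcongr
        _ = _ := by push_cast; simp only [a, pieceNorm, f]; ring
    · simp only [c, if_neg hij, zero_mul, mul_zero]
      exact zero_le
  rw [wl2_eq_sl2]
  refine (sl2_mono hk).trans ?_
  rw [sl2_const_mul]
  refine (mul_le_mul' le_rfl (h₃ (fun i => 2 ^ ((i : ℝ) * s) * a i)
    fun j => 2 ^ ((j : ℝ) * σ) * a j)).trans (le_of_eq ?_)
  rw [wl2_eq_sl2, wl2_eq_sl2]
  push_cast
  ring

end

/-! ### Distributions given by functions, and comparison of norms -/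

section

variable {d : ℕ} {E : Type*} [NormedAddCommGroup E] [NormedSpace ℂ E] {φ : LPCutoff d}
  {χ : CubeCutoff d} {T s : ℝ}

/-! ### Distributions given by functions -/

theorem MemL1X.exists_representative {U : ℝ → 𝓢'(Space d, E)} (hU : MemL1X φ χ T s U) :
    ∃ U' : ℝ → 𝓢'(Space d, E), (∀ᵐ t ∂timeMeasure T, U' t = U t) ∧ PieceMeas φ U' :=
  exists_pieceMeas φ hU.measurable

theorem exists_ae_tsum_pieceL2_le (φ : LPCutoff d) (χ : CubeCutoff d) (hs : (d : ℝ) / 2 < s) :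
    ∃ C : ℝ≥0, ∀ (T : ℝ) (U : ℝ → 𝓢'(Space d, E)), MemL1X φ χ T s U → ∀ᵐ t ∂timeMeasure T,
      ∑' j : ℕ, (2 : ℝ≥0∞) ^ ((j : ℝ) * (d / 2)) * pieceL2 φ (U t) j ≤ C * normL1X φ χ T s U := by
  obtain ⟨C₁, h₁⟩ := exists_tsum_half_le hs
  obtain ⟨C₂, h₂⟩ := exists_normL1X_comparison (E := E) φ χ
  refine ⟨C₁ * C₂, fun T U hU => ?_⟩
  obtain ⟨U', hUU, hm⟩ := hU.exists_representative
  filter_upwards [hUU, ae_wl2_pieceL2_le φ T s hm] with t ht h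
  rw [← ht, ← normL1X_congr_ae φ χ T s hUU]
  push_cast
  rw [mul_assoc]
  exact (h₁ _).trans (mul_le_mul' le_rfl (h.trans (h₂ T s U' hm).2))

theorem MemL1X.ae_summablePieces {U : ℝ → 𝓢'(Space d, E)} (hU : MemL1X φ χ T s U)
    (hs : (d : ℝ) / 2 < s) : ∀ᵐ t ∂timeMeasure T, SummablePieces φ (U t) := by
  obtain ⟨C, hC⟩ := exists_ae_tsum_pieceL2_le (E := E) φ χ hs
  filter_upwards [hC T U hU] with t ht
  exact (ht.trans_lt (ENNReal.mul_lt_top (by simp) hU.norm_lt_top)).ne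

theorem integrable_schwartz_smul_of_memLp {v : Space d → E} (hv : MemLp v ⊤) (θ : 𝓢(Space d, ℂ)) :
    Integrable fun x => θ x • v x :=
  Integrable.smul_bdd θ.integrable (eLpNorm v ⊤ volume).toReal hv.1 (by
    have h := ae_le_eLpNormEssSup (f := v) (μ := volume)
    rw [← eLpNorm_exponent_top] at h
    filter_upwards [h] with x hx
    rw [← ofReal_norm] at hx
    exact (ENNReal.ofReal_le_iff_le_toReal hv.2.ne).1 hx)

section

variable [CompleteSpace E]

open scoped Classical in
/-- The tempered distribution given by an essentially bounded function. -/
def ofBdd (v : Space d → E) : 𝓢'(Space d, E) :=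
  if h : MemLp v ⊤ then Lp.toTemperedDistribution h.toLp else 0

theorem ofBdd_apply {v : Space d → E} (hv : MemLp v ⊤) (θ : 𝓢(Space d, ℂ)) :
    ofBdd v θ = ∫ x, θ x • v x := by
  rw [ofBdd, dif_pos hv, Lp.toTemperedDistribution_apply]
  refine integral_congr_ae ?_
  filter_upwards [hv.coeFn_toLp] with x hx
  rw [hx]

theorem isGivenBy_ofBdd {u : ℝ → Space d → E}
    (hu : AEStronglyMeasurable (Function.uncurry u) ((timeMeasure T).prod volume))
    (hb : ∀ᵐ t ∂timeMeasure T, MemLp (u t) ⊤) : IsGivenBy T (fun t => ofBdd (u t)) u := by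
  refine ⟨hu, ?_⟩
  filter_upwards [hb] with t ht θ
  exact ⟨integrable_schwartz_smul_of_memLp ht θ, ofBdd_apply ht θ⟩

theorem SummablePieces.memLp_top_full {U : 𝓢'(Space d, E)} (hU : SummablePieces φ U) :
    MemLp (full φ U) ⊤ := by
  obtain ⟨M, -, hM⟩ := hU.exists_norm_lowPiece_le
  exact memLp_top_of_bound hU.continuous_full.aestronglyMeasurable M (Eventually.of_forall hM)

end

theorem IsGivenBy.aestronglyMeasurable {U : ℝ → 𝓢'(Space d, E)} {u : ℝ → Space d → E}
    (h : IsGivenBy T U u) (θ : 𝓢(Space d, ℂ)) :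
    AEStronglyMeasurable (fun t => U t θ) (timeMeasure T) := by
  have h1 : AEStronglyMeasurable (fun p : ℝ × Space d => θ p.2 • u p.1 p.2)
      ((timeMeasure T).prod volume) :=
    (θ.continuous.comp continuous_snd).aestronglyMeasurable.smul h.measurable
  refine h1.integral_prod_right'.congr ?_
  filter_upwards [h.eq_integral] with t ht
  exact (ht θ).2.symm

section

variable [CompleteSpace E] {U : ℝ → 𝓢'(Space d, E)} {u : ℝ → Space d → E}

theorem IsGivenBy.ae_eq_full (h : IsGivenBy T U u) (hU : MemL1X φ χ T s U) (hs : (d : ℝ) / 2 < s) :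
    ∀ᵐ t ∂timeMeasure T, SummablePieces φ (U t) ∧ u t =ᵐ[volume] full φ (U t) := by
  filter_upwards [h.eq_integral, hU.ae_summablePieces hs] with t ht hst
  exact ⟨hst, hst.ae_eq_full ht⟩

theorem IsGivenBy.ae_memLp_two (h : IsGivenBy T U u) (hU : MemL1X φ χ T s U) (hs : (d : ℝ) / 2 < s) :
    ∀ᵐ t ∂timeMeasure T, MemLp (u t) 2 volume :=
  (h.ae_eq_full hU hs).mono fun _ ht => ht.1.memLp_full.ae_eq ht.2.symm

theorem IsGivenBy.ae_memLp_top (h : IsGivenBy T U u) (hU : MemL1X φ χ T s U) (hs : (d : ℝ) / 2 < s) :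
    ∀ᵐ t ∂timeMeasure T, MemLp (u t) ⊤ volume :=
  (h.ae_eq_full hU hs).mono fun _ ht => ht.1.memLp_top_full.ae_eq ht.2.symm

/-- The sum of the pieces is a continuous representative, so an almost everywhere bound holds
everywhere. -/
theorem IsGivenBy.ae_norm_full_le (h : IsGivenBy T U u) (hU : MemL1X φ χ T s U) (hs : (d : ℝ) / 2 < s)
    {R : ℝ≥0} (hR : normSup T u ≤ R) : ∀ᵐ t ∂timeMeasure T, ∀ x, ‖full φ (U t) x‖ ≤ R := by
  have h1 : ∀ᵐ p ∂(timeMeasure T).prod volume, ‖Function.uncurry u p‖ₑ ≤ R := by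
    have h2 := ae_le_eLpNormEssSup (f := Function.uncurry u) (μ := (timeMeasure T).prod volume)
    rw [← eLpNorm_exponent_top] at h2
    filter_upwards [h2] with p hp
    exact hp.trans hR
  filter_upwards [h.ae_eq_full hU hs, Measure.ae_ae_of_ae_prod h1] with t ht h2 x
  have h3 : ∀ᵐ x, ‖full φ (U t) x‖ ≤ R := by
    filter_upwards [ht.2, h2] with x hx hx'
    rw [← hx]
    simpa [← ofReal_norm, ENNReal.ofReal_le_iff_le_toReal] using hx'
  have h4 : IsClosed {x | ‖full φ (U t) x‖ ≤ R} :=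
    isClosed_le ht.1.continuous_full.norm continuous_const
  have h5 := (Measure.dense_of_ae h3).closure_eq
  rw [h4.closure_eq] at h5
  exact h5.ge (Set.mem_univ x)

/-- The embedding into L^∞ for s > d/2, by summing Bernstein's inequality over the pieces. It
ensures that `toNNReal` of the supremum norm loses nothing in the final estimates. -/
theorem IsGivenBy.normSup_ne_top (h : IsGivenBy T U u) (hU : MemL1X φ χ T s U) (hs : (d : ℝ) / 2 < s) :
    normSup T u ≠ ⊤ := by
  obtain ⟨C₁, h₁⟩ := exists_ae_tsum_pieceL2_le (E := E) φ χ hs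
  obtain ⟨C₂, h₂⟩ := exists_enorm_piece_le_pieceL2 (E := E) φ
  set u' := h.measurable.mk (Function.uncurry u)
  have hu' := h.measurable.stronglyMeasurable_mk
  have hae : Function.uncurry u =ᵐ[(timeMeasure T).prod volume] u' := h.measurable.ae_eq_mk
  set M : ℝ≥0∞ := C₂ * (C₁ * normL1X φ χ T s U)
  have hM : M ≠ ⊤ := ENNReal.mul_ne_top (by simp) (ENNReal.mul_ne_top (by simp) hU.norm_lt_top.ne)
  have h3 : ∀ᵐ p ∂(timeMeasure T).prod volume, ‖u' p‖ₑ ≤ M := by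
    -- Passing from almost every slice to almost every point needs a measurable set, hence the
    -- strongly measurable representative.
    rw [Measure.ae_prod_iff_ae_ae (measurableSet_le hu'.enorm measurable_const)]
    filter_upwards [Measure.ae_ae_of_ae_prod hae, h.ae_eq_full hU hs, h₁ T U hU] with t h4 h5 h6
    filter_upwards [h4, h5.2] with x hx hx'
    have e : AEStronglyMeasurable.mk (Function.uncurry u) h.measurable (t, x) = full φ (U t) x :=
      hx.symm.trans hx'
    rw [e]
    refine (enorm_tsum_le_tsum_enorm).trans ((ENNReal.tsum_le_tsum fun j => h₂ j (U t) x).trans ?_)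
    rw [ENNReal.tsum_mul_left]
    exact mul_le_mul' le_rfl h6
  rw [normSup, eLpNorm_congr_ae hae, eLpNorm_exponent_top]
  exact ((eLpNormEssSup_le_of_ae_enorm_bound h3).trans_lt hM.lt_top).ne

end

/-! ### Comparison of norms -/

/-- The norm depends on the pieces through their absolute values only. Used for components, pairs,
differences and finite sums, with a constant independent of the number of terms. -/
theorem exists_normL1X_le_sum (φ : LPCutoff d) (χ : CubeCutoff d) (E F : Type*) [NormedAddCommGroup E]
    [NormedSpace ℂ E] [NormedAddCommGroup F] [NormedSpace ℂ F] : ∃ C : ℝ≥0, ∀ (ι : Type) [Fintype ι]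
      (T s : ℝ) (W : ℝ → 𝓢'(Space d, F)) (U : ι → ℝ → 𝓢'(Space d, E)),
      (∀ θ : 𝓢(Space d, ℂ), AEStronglyMeasurable (fun t => W t θ) (timeMeasure T)) →
      (∀ i, ∀ θ : 𝓢(Space d, ℂ), AEStronglyMeasurable (fun t => U i t θ) (timeMeasure T)) →
      (∀ᵐ t ∂timeMeasure T, ∀ k x, ‖φ.piece k (W t) x‖ₑ ≤ ∑ i, ‖φ.piece k (U i t) x‖ₑ) →
      normL1X φ χ T s W ≤ C * ∑ i, normL1X φ χ T s (U i) := by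
  obtain ⟨C₁, h₁⟩ := exists_normL1X_comparison (E := E) φ χ
  obtain ⟨C₂, h₂⟩ := exists_normL1X_comparison (E := F) φ χ
  refine ⟨C₂ * C₁, fun ι _ T s W U hW hU h => ?_⟩
  obtain ⟨W', hWW, hWm⟩ := exists_pieceMeas φ hW
  choose U' hUU hUm using fun i => exists_pieceMeas φ (hU i)
  have h3 : ∀ k, pieceNorm φ T k W' ≤ ∑' i, pieceNorm φ T k (U' i) := fun k => by
    refine le_trans (eY_mono_ae T k (h' := fun t x => ∑' i, ‖φ.piece k (U' i t) x‖ₑ) ?_)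
      (eY_tsum_le T k fun i => (hUm i).measurable k)
    filter_upwards [h, hWW, ae_all_iff.2 hUU] with t ht hw hu x
    rw [hw, tsum_fintype]
    simp_rw [hu]
    exact ht k x
  have h4 : wl2 s (fun k => pieceNorm φ T k W') ≤ ∑ i, wl2 s (fun k => pieceNorm φ T k (U' i)) := by
    refine (wl2_mono s h3).trans ?_
    simp_rw [wl2_eq_sl2, ← ENNReal.tsum_mul_left]
    refine (sl2_tsum_le _).trans (le_of_eq (tsum_fintype _))
  rw [← normL1X_congr_ae φ χ T s hWW]
  refine (h₂ T s W' hWm).1.trans ?_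
  push_cast
  rw [mul_assoc, Finset.mul_sum]
  refine mul_le_mul' le_rfl (h4.trans (Finset.sum_le_sum fun i _ => ?_))
  rw [← normL1X_congr_ae φ χ T s (hUU i)]
  exact (h₁ T s (U' i) (hUm i)).2

theorem normL1X_mono (φ : LPCutoff d) (χ : CubeCutoff d) (T : ℝ) {s σ : ℝ} (h : σ ≤ s)
    (U : ℝ → 𝓢'(Space d, E)) : normL1X φ χ T σ U ≤ normL1X φ χ T s U := by
  refine ENNReal.rpow_le_rpow (ENNReal.tsum_le_tsum fun j => ?_) (by norm_num)
  gcongr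
  · norm_num

theorem MemL1X.mono {U : ℝ → 𝓢'(Space d, E)} (hU : MemL1X φ χ T s U) {σ : ℝ} (h : σ ≤ s) :
    MemL1X φ χ T σ U :=
  ⟨hU.measurable, (normL1X_mono φ χ T h U).trans_lt hU.norm_lt_top⟩

/-- Smooth functions of elements of `l^1 X^s`. -/
theorem exists_normL1X_comp_le (φ : LPCutoff d) (χ : CubeCutoff d) {E H : Type*} [NormedAddCommGroup E]
    [NormedSpace ℂ E] [FiniteDimensional ℂ E] [NormedAddCommGroup H] [NormedSpace ℂ H] [CompleteSpace H]
    {s σ : ℝ} (hs : (d : ℝ) / 2 < s) (hσ : s ≤ σ) {G : E → H} (hG : ContDiff ℝ ∞ G) (h0 : G 0 = 0)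
    (h : fderiv ℝ G 0 = 0) (R : ℝ≥0) : ∃ C : ℝ≥0, ∀ (T : ℝ) (U : ℝ → 𝓢'(Space d, E))
      (u : ℝ → Space d → E) (W : ℝ → 𝓢'(Space d, H)), IsGivenBy T U u → MemL1X φ χ T s U →
      normSup T u ≤ R → IsGivenBy T W (fun t x => G (u t x)) →
      normL1X φ χ T σ W ≤ C * (normL1X φ χ T s U * normL1X φ χ T σ U) := by
  have : CompleteSpace E := FiniteDimensional.complete ℂ E
  obtain ⟨C₁, h₁⟩ := exists_normL1X_comparison (E := E) φ χ
  obtain ⟨C₂, h₂⟩ := exists_normL1X_comparison (E := H) φ χ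
  obtain ⟨C₃, h₃⟩ := exists_wl2_comp_full_le φ hs hσ hG h0 h R
  refine ⟨C₂ * C₃ * C₁ * C₁, fun T U u W hu hU hR hW => ?_⟩
  obtain ⟨U', hUU, hUm⟩ := hU.exists_representative
  obtain ⟨W', hWW, hWm⟩ := exists_pieceMeas φ hW.aestronglyMeasurable
  have h4 := h₃ T U' W' hUm (by
    filter_upwards [hUU, hWW, hu.ae_eq_full hU hs, hu.ae_norm_full_le hU hs hR, hW.eq_integral]
      with t ht ht' h5 h6 h7
    rw [ht, ht']
    refine ⟨h5.1, h6, fun θ => ?_⟩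
    rw [(h7 θ).2]
    refine integral_congr_ae ?_
    filter_upwards [h5.2] with x hx
    rw [hx])
  have h5 := (h₁ T s U' hUm).2
  have h6 := (h₁ T σ U' hUm).2
  rw [normL1X_congr_ae φ χ T _ hUU] at h5 h6
  rw [← normL1X_congr_ae φ χ T σ hWW]
  calc normL1X φ χ T σ W' ≤ C₂ * wl2 σ (fun k => pieceNorm φ T k W') := (h₂ T σ W' hWm).1
    _ ≤ C₂ * (C₃ * ((C₁ * normL1X φ χ T s U) * (C₁ * normL1X φ χ T σ U))) :=
        mul_le_mul' le_rfl (h4.trans (mul_le_mul' le_rfl (mul_le_mul' h5 h6)))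
    _ = _ := by push_cast; ring

end

/-! ### Complex conjugation and linear factorization of differences -/

section

variable {d : ℕ} {φ : LPCutoff d} {χ : CubeCutoff d} {T s : ℝ}

/-! ### Complex conjugation -/

/-- The reflection of the symbol of `S_k`. -/
def reflSymbol (φ : LPCutoff d) (k : ℕ) : 𝓢(Space d, ℂ) := 𝓕 (𝓕 (φ.symbol k))

theorem reflSymbol_apply (φ : LPCutoff d) (k : ℕ) (ξ : Space d) :
    reflSymbol φ k ξ = φ.symbol k (-ξ) := fourier_fourier_apply _ _

theorem fourier_reflSymbol_apply (φ : LPCutoff d) (k : ℕ) (x : Space d) :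
    𝓕 (reflSymbol φ k) x = 𝓕 (φ.symbol k) (-x) := by
  rw [reflSymbol, fourier_fourier_apply]

theorem conj_symbol (φ : LPCutoff d) (k : ℕ) (ξ : Space d) :
    starRingEnd ℂ (φ.symbol k ξ) = φ.symbol k ξ := by
  have h : ∀ k, starRingEnd ℂ (φ.lowSymbol k ξ) = φ.lowSymbol k ξ := fun k => Complex.conj_ofReal _
  cases k with
  | zero => exact h 0
  | succ k => rw [φ.symbol_succ, sub_apply, map_sub, h, h]

/-- The symbol is real, so conjugating its kernel reflects the symbol. -/
theorem conj_fourier_symbol (φ : LPCutoff d) (k : ℕ) (x : Space d) :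
    starRingEnd ℂ (𝓕 (φ.symbol k) x) = 𝓕 (reflSymbol φ k) x := by
  rw [fourier_reflSymbol_apply, SchwartzMap.fourier_coe, Real.fourier_eq, Real.fourier_eq,
    ← integral_conj]
  refine integral_congr_ae (Eventually.of_forall fun ξ => ?_)
  simp only [Circle.smul_def, smul_eq_mul, map_mul, conj_symbol, inner_neg_right, neg_neg]
  rw [← Circle.coe_inv_eq_conj, ← AddChar.map_neg_eq_inv, neg_neg]

theorem reflSymbol_mul_ne_zero {k i : ℕ} {ξ : Space d} (h1 : reflSymbol φ k ξ ≠ 0)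
    (h2 : φ.symbol i ξ ≠ 0) : i ≤ k + 1 ∧ k ≤ i + 1 := by
  rw [reflSymbol_apply] at h1
  have key : ∀ {k i : ℕ} {ξ ζ : Space d}, ‖ξ‖ = ‖ζ‖ → φ.symbol k ξ ≠ 0 → φ.symbol i ζ ≠ 0 →
      i ≤ k + 1 := by
    intro k i ξ ζ h h1 h2
    by_contra! hlt
    obtain ⟨i, rfl⟩ : ∃ i', i = i' + 1 := ⟨i - 1, by omega⟩
    have h3 := φ.norm_lt_of_symbol_ne_zero h1
    have h4 := φ.lt_norm_of_symbol_ne_zero h2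
    have h5 : (2 : ℝ) ^ (k + 1) ≤ 2 ^ i := pow_le_pow_right₀ (by norm_num) (by omega)
    linarith
  exact ⟨key (norm_neg ξ) h1 h2, key (norm_neg ξ).symm h2 h1⟩

/-- The profile is not assumed to be even, so S_k need not commute with conjugation. The reflected
symbol lives in the same annulus, which is covered by three neighbouring pieces. -/
theorem reflSymbol_eq_sum (φ : LPCutoff d) (k : ℕ) : reflSymbol φ k =
    ∑ i ∈ Finset.Icc (k - 1) (k + 1), pmul (φ.symbol i) (reflSymbol φ k) := by
  ext ξ
  rw [sum_apply]
  by_cases h : reflSymbol φ k ξ = 0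
  · simp [h]
  have h1 : ∑ i ∈ Finset.range (k + 2), φ.symbol i ξ = 1 := by
    rw [← sum_apply, φ.sum_symbol]
    have := h
    rw [reflSymbol_apply] at this
    exact φ.lowSymbol_eq_one (by simpa using (φ.norm_lt_of_symbol_ne_zero this).le)
  have h2 : ∑ i ∈ Finset.Icc (k - 1) (k + 1), φ.symbol i ξ = 1 := by
    rw [← h1]
    refine Finset.sum_subset (fun i hi => ?_) fun i _ hi => ?_
    · have := (Finset.mem_Icc.1 hi).2
      exact Finset.mem_range.2 (by omega)
    · by_contra h3
      have := reflSymbol_mul_ne_zero h h3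
      exact hi (Finset.mem_Icc.2 (by omega))
  simp only [pmul_apply]
  rw [← Finset.sum_mul, h2, one_mul]

theorem exists_enorm_band_reflSymbol_le (φ : LPCutoff d) {E : Type*} [NormedAddCommGroup E]
    [NormedSpace ℂ E] [CompleteSpace E] : ∃ C : ℝ≥0, ∀ (k : ℕ) (U : 𝓢'(Space d, E)) x,
      ‖band (reflSymbol φ k) U x‖ₑ ≤ ∑ i ∈ Finset.Icc (k - 1) (k + 1),
        C * conv (wt k) (fun y => ‖φ.piece i U y‖ₑ) x := by
  obtain ⟨C, hC⟩ := exists_enorm_kernel_le φ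
  refine ⟨C, fun k U x => ?_⟩
  rw [reflSymbol_eq_sum, band_sum]
  refine (enorm_sum_le _ _).trans (Finset.sum_le_sum fun i _ => ?_)
  refine enorm_band_pmul_le (φ.symbol i) (reflSymbol φ k) (fun y => ?_) U x
  rw [fourier_reflSymbol_apply, ← wt_neg]
  exact hC k (-y)

/-- The conjugate of a distribution given by a function. -/
theorem enorm_piece_conj {U W : 𝓢'(Space d, ℂ)} {u : Space d → ℂ}
    (hU : ∀ θ : 𝓢(Space d, ℂ), U θ = ∫ x, θ x • u x)
    (hW : ∀ θ : 𝓢(Space d, ℂ), W θ = ∫ x, θ x • starRingEnd ℂ (u x)) (k : ℕ) (x : Space d) :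
    ‖φ.piece k W x‖ₑ = ‖band (reflSymbol φ k) U x‖ₑ := by
  have h : φ.piece k W x = starRingEnd ℂ (band (reflSymbol φ k) U x) := by
    rw [LPCutoff.piece, hW, band, hU, ← integral_conj]
    refine integral_congr_ae (Eventually.of_forall fun y => ?_)
    simp only [smul_eq_mul, map_mul, SchwartzMap.compSubConstCLM_apply, ← conj_fourier_symbol,
      Complex.conj_conj]
    rfl
  rw [h, ← ofReal_norm, RCLike.norm_conj, ofReal_norm]

/-- Each piece of the conjugate is controlled by averages of three neighbouring pieces. As |k - i| ≤
1, the sum is dominated by the kernel `geo 1`, and Schur's test applies for every real σ. -/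
theorem exists_normL1X_conj_le (φ : LPCutoff d) (χ : CubeCutoff d) (σ : ℝ) : ∃ C : ℝ≥0, ∀ (T : ℝ)
    (U W : ℝ → 𝓢'(Space d, ℂ)) (u : ℝ → Space d → ℂ), IsGivenBy T U u →
      IsGivenBy T W (fun t x => starRingEnd ℂ (u t x)) →
      normL1X φ χ T σ W ≤ C * normL1X φ χ T σ U := by
  obtain ⟨C₁, h₁⟩ := exists_normL1X_comparison (E := ℂ) φ χ
  obtain ⟨C₂, h₂⟩ := exists_enorm_band_reflSymbol_le φ (E := ℂ)
  obtain ⟨C₃, h₃⟩ := exists_sl2_geo_le (δ := 1) one_pos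
  set B : ℝ≥0 := (box d 1).card * (box d 1).card * wtMass d
  obtain ⟨D, hD⟩ : ∃ D : ℝ≥0, (D : ℝ≥0∞) = 2 ^ (2 * |σ|) * 2 :=
    ⟨(2 ^ (2 * |σ|) * 2 : ℝ≥0∞).toNNReal, ENNReal.coe_toNNReal
      (ENNReal.mul_ne_top (two_rpow_ne_top _) (by norm_num))⟩
  refine ⟨C₁ * (C₂ * B * 2 ^ (1 * d + 1) * D * C₃ * C₁), fun T U W u hU hW => ?_⟩
  obtain ⟨U', hUU, hUm⟩ := exists_pieceMeas φ hU.aestronglyMeasurable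
  obtain ⟨W', hWW, hWm⟩ := exists_pieceMeas φ hW.aestronglyMeasurable
  set f : ℕ → ℝ → Space d → ℝ≥0∞ := fun i t x => ‖φ.piece i (U' t) x‖ₑ
  have hf : ∀ i, Measurable (Function.uncurry (f i)) := hUm.measurable
  have hfc : ∀ k i, Measurable (Function.uncurry fun t => conv (wt k) (f i t)) := fun k i =>
    measurable_uncurry_conv (measurable_wt k) (hf i)
  set c : ℕ → ℕ → ℝ≥0∞ := fun k i => if i ∈ Finset.Icc (k - 1) (k + 1) then C₂ else 0
  have hpw : ∀ k, ∀ᵐ t ∂timeMeasure T, ∀ x,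
      ‖φ.piece k (W' t) x‖ₑ ≤ ∑' i, c k i * conv (wt k) (f i t) x := by
    intro k
    filter_upwards [hUU, hWW, hU.eq_integral, hW.eq_integral] with t h4 h5 h6 h7 x
    rw [h5, enorm_piece_conj (fun θ => (h6 θ).2) fun θ => (h7 θ).2]
    refine (h₂ k (U t) x).trans (le_of_eq ?_)
    rw [tsum_eq_sum (s := Finset.Icc (k - 1) (k + 1)) fun i hi => by simp only [c, if_neg hi, zero_mul]]
    refine Finset.sum_congr rfl fun i hi => ?_
    simp only [c, if_pos hi, f, h4]
  have hk : ∀ k : ℕ, 2 ^ ((k : ℝ) * σ) * pieceNorm φ T k W' ≤ (C₂ * B * 2 ^ (1 * d + 1) * D : ℝ≥0) *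
      ∑' i, geo 1 k i * (2 ^ ((i : ℝ) * σ) * pieceNorm φ T i U') := by
    intro k
    refine (mul_le_mul' le_rfl ((eY_mono_ae T k (hpw k)).trans
      (eY_tsum_le T k fun i => (hfc k i).const_mul _))).trans ?_
    rw [← ENNReal.tsum_mul_left, ← ENNReal.tsum_mul_left]
    refine ENNReal.tsum_le_tsum fun i => ?_
    rw [eY_const_mul T k _ (hfc k i)]
    by_cases hi : i ∈ Finset.Icc (k - 1) (k + 1)
    · have hi' := Finset.mem_Icc.1 hi
      simp only [c, if_pos hi]
      have h4 : eY T k (fun t => conv (wt k) (f i t)) ≤ B * (2 ^ (1 * d + 1) * eY T i (f i)) := by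
        refine (eY_conv_le T k (measurable_wt k) (hf i)).trans ?_
        rw [lintegral_wt_eq]
        exact mul_le_mul' le_rfl (eY_level_le T (hf i) (by omega) (by omega))
      have h5 : (1 : ℝ≥0∞) ≤ 2 * geo 1 k i := by
        nth_rewrite 1 [← ENNReal.rpow_one 2]
        rw [geo, ← two_rpow_add, ← ENNReal.rpow_zero (x := 2)]
        apply two_rpow_le
        have h6 : (k : ℝ) ≤ i + 1 := by exact_mod_cast (by omega : k ≤ i + 1)
        have h7 : (i : ℝ) ≤ k + 1 := by exact_mod_cast hi'.2
        have := abs_sub_le_iff.2 ⟨(by linarith : (k : ℝ) - i ≤ 1), (by linarith)⟩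
        linarith
      calc _ ≤ 2 ^ (2 * |σ|) * 2 ^ ((i : ℝ) * σ) * (C₂ * (B * (2 ^ (1 * d + 1) * eY T i (f i)))) :=
            mul_le_mul' (two_rpow_abs_le (abs_sub_le_two (by omega) (by omega)))
              (mul_le_mul' le_rfl h4)
        _ ≤ 2 ^ (2 * |σ|) * 2 ^ ((i : ℝ) * σ) * (C₂ * (B * (2 ^ (1 * d + 1) * eY T i (f i)))) *
            (2 * geo 1 k i) := le_mul_of_one_le_right zero_le h5
        _ = C₂ * B * 2 ^ (1 * d + 1) * (2 ^ (2 * |σ|) * 2) *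
            (geo 1 k i * (2 ^ ((i : ℝ) * σ) * eY T i (f i))) := by ring
        _ = _ := by rw [← hD]; push_cast; rfl
    · simp only [c, if_neg hi, zero_mul, mul_zero]
      exact zero_le
  have h8 : wl2 σ (fun k => pieceNorm φ T k W') ≤ (C₂ * B * 2 ^ (1 * d + 1) * D : ℝ≥0) *
      (C₃ * wl2 σ (fun k => pieceNorm φ T k U')) := by
    rw [wl2_eq_sl2]
    refine (sl2_mono hk).trans ?_
    rw [sl2_const_mul]
    exact mul_le_mul' le_rfl (h₃ _)
  rw [← normL1X_congr_ae φ χ T σ hWW, ← normL1X_congr_ae φ χ T σ hUU]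
  calc normL1X φ χ T σ W' ≤ C₁ * wl2 σ (fun k => pieceNorm φ T k W') := (h₁ T σ W' hWm).1
    _ ≤ C₁ * ((C₂ * B * 2 ^ (1 * d + 1) * D : ℝ≥0) * (C₃ * (C₁ * normL1X φ χ T σ U'))) :=
        mul_le_mul' le_rfl (h8.trans (mul_le_mul' le_rfl (mul_le_mul' le_rfl (h₁ T σ U' hUm).2)))
    _ = _ := by push_cast; ring

end

section

/-! ### Factorization of differences -/

/-- The derivative of `G` is o(|z|) at 0, and the segment of integration stays within K|p| of the
origin; the average is therefore o(|p|). -/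
theorem hasFDerivAt_meanDeriv_zero {V V' H : Type*} [NormedAddCommGroup V] [NormedSpace ℝ V]
    [NormedAddCommGroup V'] [NormedSpace ℝ V'] [NormedAddCommGroup H] [NormedSpace ℝ H]
    [CompleteSpace H] {G : V' → H} (hG : ContDiff ℝ ∞ G) (h1 : fderiv ℝ G 0 = 0)
    (h2 : iteratedFDeriv ℝ 2 G 0 = 0) (A B : V →L[ℝ] V') :
    HasFDerivAt (meanDeriv G A B) (0 : V →L[ℝ] V' →L[ℝ] H) 0 := by
  have h3 : fderiv ℝ (fderiv ℝ G) 0 = 0 := by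
    have h : ‖fderiv ℝ (fderiv ℝ G) 0‖ = 0 := by
      rw [← norm_iteratedFDeriv_one, norm_iteratedFDeriv_fderiv, h2, norm_zero]
    exact (ContinuousLinearMap.opNorm_zero_iff _).1 h
  have h4 : HasFDerivAt (fderiv ℝ G) (0 : V' →L[ℝ] V' →L[ℝ] H) 0 := by
    rw [← h3]
    exact ((hG.fderiv_right (m := ∞) (by simp)).differentiable (by simp)).differentiableAt.hasFDerivAt
  rw [hasFDerivAt_iff_isLittleO_nhds_zero, Asymptotics.isLittleO_iff] at h4 ⊢
  intro ε hε
  set K : ℝ := ‖A‖ + ‖B‖ + 1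
  have hK : 0 < K := by positivity
  have h5 := h4 (div_pos hε hK)
  obtain ⟨δ, hδ, h6⟩ := Metric.eventually_nhds_iff.1 h5
  refine Metric.eventually_nhds_iff.2 ⟨δ / K, by positivity, fun p hp => ?_⟩
  rw [dist_zero_right] at hp
  have h7 : ∀ r ∈ Set.Icc (0 : ℝ) 1, ‖A p + r • B p‖ ≤ K * ‖p‖ := fun r hr => by
    calc ‖A p + r • B p‖ ≤ ‖A‖ * ‖p‖ + 1 * (‖B‖ * ‖p‖) := by
          refine (norm_add_le _ _).trans (add_le_add (A.le_opNorm p) ?_)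
          rw [norm_smul, Real.norm_of_nonneg hr.1]
          exact mul_le_mul hr.2 (B.le_opNorm p) (norm_nonneg _) zero_le_one
      _ ≤ K * ‖p‖ := by simp only [K]; nlinarith [norm_nonneg p]
  simp only [zero_add, zero_apply, sub_zero, meanDeriv_zero, h1] at h6 ⊢
  have h8 := norm_setIntegral_le_of_norm_le_const (μ := volume) (s := Set.Icc (0 : ℝ) 1)
    (f := fun r => fderiv ℝ G (A p + r • B p)) (C := ε * ‖p‖) (by simp) fun r hr => by
      have h9 := h7 r hr
      refine (h6 (y := A p + r • B p) ?_).trans ?_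
      · rw [dist_zero_right]
        refine h9.trans_lt ?_
        rwa [lt_div_iff₀' hK] at hp
      · rw [div_mul_eq_mul_div, div_le_iff₀ hK]
        nlinarith
  simpa [meanDeriv] using h8

/-- The identity or the complex conjugation. -/
def twist : Bool → ℂ → ℂ
  | true => id
  | false => starRingEnd ℂ

/-- The coefficients of a real linear map with respect to the coordinates and their conjugates. -/
def coeff {m n : ℕ} (L : EuclideanSpace ℂ (Fin m) →L[ℝ] EuclideanSpace ℂ (Fin n)) (i : Fin n)
    (q : Fin m × Bool) : ℂ :=
  (L (EuclideanSpace.single q.1 1) i +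
    (if q.2 then -Complex.I else Complex.I) * L (EuclideanSpace.single q.1 Complex.I) i) / 2

/-- In each coordinate a real linear map is c ↦ Re(c) x + Im(c) y, that is c (x - iy)/2 + c̄ (x +
iy)/2. The conjugates cannot be avoided because the nonlinearity is smooth only in the real sense.
-/
theorem apply_eq_sum_coeff {m n : ℕ} (L : EuclideanSpace ℂ (Fin m) →L[ℝ] EuclideanSpace ℂ (Fin n))
    (i : Fin n) (b : EuclideanSpace ℂ (Fin m)) :
    L b i = ∑ q : Fin m × Bool, twist q.2 (b q.1) * coeff L i q := by
  have h1 : b = ∑ l, ((b l).re • EuclideanSpace.single l (1 : ℂ) +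
      (b l).im • EuclideanSpace.single l Complex.I) := by
    ext l
    simp [WithLp.ofLp_sum, Finset.sum_apply, Pi.single_apply, Finset.sum_add_distrib, Complex.real_smul]
  conv_lhs => rw [h1]
  rw [map_sum, Fintype.sum_prod_type]
  simp only [map_add, map_smul, Fintype.sum_bool]
  rw [WithLp.ofLp_sum, Finset.sum_apply]
  refine Finset.sum_congr rfl fun l _ => ?_
  have key : ∀ c x y : ℂ, (c.re : ℂ) * x + c.im * y =
      c * ((x + -Complex.I * y) / 2) + starRingEnd ℂ c * ((x + Complex.I * y) / 2) := fun c x y => by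
    have h2 : starRingEnd ℂ c = c.re - c.im * Complex.I := by
      apply Complex.ext <;> simp
    rw [h2]
    nth_rewrite 3 [← Complex.re_add_im c]
    linear_combination (c.im : ℂ) * y * Complex.I_sq
  simpa [coeff, twist, Complex.real_smul] using key (b l) _ _

/-- The coefficients of the difference `F a - F b` as a linear function of `a - b`. -/
def diffCoeff {m n : ℕ} (F : EuclideanSpace ℂ (Fin m) → EuclideanSpace ℂ (Fin n)) (i : Fin n)
    (q : Fin m × Bool) (p : EuclideanSpace ℂ (Fin m) × EuclideanSpace ℂ (Fin m)) : ℂ :=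
  coeff (meanDeriv F (ContinuousLinearMap.snd ℝ _ _)
    (ContinuousLinearMap.fst ℝ _ _ - ContinuousLinearMap.snd ℝ _ _) p) i q

section

variable {m n : ℕ} {F : EuclideanSpace ℂ (Fin m) → EuclideanSpace ℂ (Fin n)}

theorem sub_apply_eq_sum_diffCoeff (hF : ContDiff ℝ ∞ F) (a b : EuclideanSpace ℂ (Fin m)) (i : Fin n) :
    (F a - F b) i = ∑ q : Fin m × Bool, twist q.2 ((a - b) q.1) * diffCoeff F i q (a, b) := by
  have h := meanDeriv_apply hF (ContinuousLinearMap.snd ℝ _ _)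
    (ContinuousLinearMap.fst ℝ (EuclideanSpace ℂ (Fin m)) (EuclideanSpace ℂ (Fin m)) -
      ContinuousLinearMap.snd ℝ _ _) (a, b)
  simp only [sub_apply, ContinuousLinearMap.coe_fst', ContinuousLinearMap.coe_snd',
    add_sub_cancel] at h
  rw [← h, apply_eq_sum_coeff]
  rfl

/-- `coeff` as a continuous linear map. -/
def coeffCLM {m n : ℕ} (i : Fin n) (q : Fin m × Bool) :
    (EuclideanSpace ℂ (Fin m) →L[ℝ] EuclideanSpace ℂ (Fin n)) →L[ℝ] ℂ :=
  LinearMap.toContinuousLinearMap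
    { toFun := fun L => coeff L i q
      map_add' := fun L L' => by simp only [coeff, add_apply, PiLp.add_apply]; ring
      map_smul' := fun r L => by
        simp only [coeff, smul_apply, PiLp.smul_apply, Complex.real_smul, RingHom.id_apply]
        ring }

theorem contDiff_diffCoeff (hF : ContDiff ℝ ∞ F) (i : Fin n) (q : Fin m × Bool) :
    ContDiff ℝ ∞ (diffCoeff F i q) :=
  (coeffCLM i q).contDiff.comp (contDiff_meanDeriv hF _ _)

theorem diffCoeff_zero (h1 : fderiv ℝ F 0 = 0) (i : Fin n) (q : Fin m × Bool) :
    diffCoeff F i q 0 = 0 := by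
  rw [diffCoeff, meanDeriv_zero, h1]
  simp [coeff]

/-- Here the vanishing of the second derivative of `F` at 0 is used: the coefficients then satisfy
the hypotheses of the composition estimate, which gains a quadratic factor. -/
theorem fderiv_diffCoeff_zero (hF : ContDiff ℝ ∞ F) (h1 : fderiv ℝ F 0 = 0)
    (h2 : iteratedFDeriv ℝ 2 F 0 = 0) (i : Fin n) (q : Fin m × Bool) :
    fderiv ℝ (diffCoeff F i q) 0 = 0 := by
  have h := (coeffCLM i q).hasFDerivAt.comp (0 : EuclideanSpace ℂ (Fin m) × EuclideanSpace ℂ (Fin m))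
    (hasFDerivAt_meanDeriv_zero hF h1 h2 (ContinuousLinearMap.snd ℝ _ _)
      (ContinuousLinearMap.fst ℝ _ _ - ContinuousLinearMap.snd ℝ _ _))
  rw [ContinuousLinearMap.comp_zero] at h
  exact h.fderiv

end

end

/-! ### Bounded functions, linear images and pairs -/

section

variable {d : ℕ} {φ : LPCutoff d} {χ : CubeCutoff d} {T s : ℝ}

section

variable {E F : Type*} [NormedAddCommGroup E] [NormedAddCommGroup F]

theorem memLp_top_comp [ProperSpace E] {G : E → F} (hG : Continuous G) {u : Space d → E}
    (hu : MemLp u ⊤) : MemLp (fun x => G (u x)) ⊤ := by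
  have h := ae_le_eLpNormEssSup (f := u) (μ := volume)
  rw [← eLpNorm_exponent_top] at h
  obtain ⟨M, hM⟩ := (isCompact_closedBall (0 : E) (eLpNorm u ⊤ volume).toReal).exists_bound_of_continuousOn
    hG.continuousOn
  refine memLp_top_of_bound (hG.comp_aestronglyMeasurable hu.1) M ?_
  filter_upwards [h] with x hx
  refine hM _ ?_
  rw [← ofReal_norm] at hx
  simpa using (ENNReal.ofReal_le_iff_le_toReal hu.2.ne).1 hx

theorem memLp_top_prodMk {u : Space d → E} {v : Space d → F} (hu : MemLp u ⊤) (hv : MemLp v ⊤) :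
    MemLp (fun x => (u x, v x)) ⊤ := by
  refine MemLp.of_le (hu.norm.add hv.norm) (hu.1.prodMk hv.1) (Eventually.of_forall fun x => ?_)
  rw [Prod.norm_def, Pi.add_apply, Real.norm_of_nonneg (by positivity)]
  exact max_le (le_add_of_nonneg_right (norm_nonneg _)) (le_add_of_nonneg_left (norm_nonneg _))

theorem normSup_pair_le {u v : ℝ → Space d → E} {R : ℝ≥0} (hu : normSup T u ≤ R) (hv : normSup T v ≤ R) :
    normSup T (fun t x => (u t x, v t x)) ≤ R := by
  have h : ∀ {w : ℝ → Space d → E}, normSup T w ≤ R →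
      ∀ᵐ p ∂(timeMeasure T).prod volume, ‖Function.uncurry w p‖ₑ ≤ R := fun {w} hw => by
    have h2 := ae_le_eLpNormEssSup (f := Function.uncurry w) (μ := (timeMeasure T).prod volume)
    rw [← eLpNorm_exponent_top] at h2
    exact h2.mono fun p hp => hp.trans hw
  rw [normSup, eLpNorm_exponent_top]
  refine eLpNormEssSup_le_of_ae_enorm_bound ?_
  filter_upwards [h hu, h hv] with p h1 h2
  exact max_le h1 h2

end

section

variable {E F : Type*} [NormedAddCommGroup E] [NormedSpace ℂ E] [NormedAddCommGroup F] [NormedSpace ℂ F]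

theorem IsGivenBy.sub {U V : ℝ → 𝓢'(Space d, E)} {u v : ℝ → Space d → E} (hU : IsGivenBy T U u)
    (hV : IsGivenBy T V v) : IsGivenBy T (U - V) fun t x => u t x - v t x := by
  refine ⟨hU.measurable.sub hV.measurable, ?_⟩
  filter_upwards [hU.eq_integral, hV.eq_integral] with t h1 h2 θ
  simp only [smul_sub]
  refine ⟨(h1 θ).1.sub (h2 θ).1, ?_⟩
  rw [integral_sub (h1 θ).1 (h2 θ).1, ← (h1 θ).2, ← (h2 θ).2]
  rfl

theorem IsGivenBy.zero : IsGivenBy T (0 : ℝ → 𝓢'(Space d, E)) fun _ _ => 0 := by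
  refine ⟨aestronglyMeasurable_const, Eventually.of_forall fun t θ => ?_⟩
  simp only [smul_zero, integral_zero]
  exact ⟨integrable_zero _ _ _, rfl⟩

theorem normL1X_zero (φ : LPCutoff d) (χ : CubeCutoff d) (T s : ℝ) :
    normL1X φ χ T s (0 : ℝ → 𝓢'(Space d, E)) = 0 := by
  obtain ⟨C, hC⟩ := exists_normL1X_le_sum φ χ E E
  have := hC Empty T s 0 (fun _ => 0) (fun _ => aestronglyMeasurable_const) (fun i => i.elim)
    (Eventually.of_forall fun t k x => by simp [LPCutoff.piece])
  simpa using this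

theorem MemL1X.zero : MemL1X φ χ T s (0 : ℝ → 𝓢'(Space d, E)) :=
  ⟨fun _ => aestronglyMeasurable_const, by rw [normL1X_zero]; exact ENNReal.zero_lt_top⟩

/-- Images under continuous linear maps. -/
theorem IsGivenBy.ae_map [CompleteSpace E] [CompleteSpace F] {U : ℝ → 𝓢'(Space d, E)}
    {W : ℝ → 𝓢'(Space d, F)} {u : ℝ → Space d → E} {w : ℝ → Space d → F} (hU : IsGivenBy T U u)
    (hW : IsGivenBy T W w) (L : E →L[ℂ] F) (h : ∀ t x, w t x = L (u t x)) :
    ∀ᵐ t ∂timeMeasure T, ∀ θ : 𝓢(Space d, ℂ), W t θ = L (U t θ) := by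
  filter_upwards [hU.eq_integral, hW.eq_integral] with t h1 h2 θ
  rw [(h1 θ).2, (h2 θ).2, ← L.integral_comp_comm (h1 θ).1]
  simp only [h, map_smul]

end

/-- Pairs of functions in `l^1 X^s`. -/
theorem exists_normL1X_pair_le (φ : LPCutoff d) (χ : CubeCutoff d) (E : Type*) [NormedAddCommGroup E]
    [NormedSpace ℂ E] [CompleteSpace E] : ∃ C : ℝ≥0, ∀ (T s : ℝ)
      (U V : ℝ → 𝓢'(Space d, E)) (P : ℝ → 𝓢'(Space d, E × E)) (u v : ℝ → Space d → E),
      IsGivenBy T U u → IsGivenBy T V v → IsGivenBy T P (fun t x => (u t x, v t x)) →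
      normL1X φ χ T s P ≤ C * (normL1X φ χ T s U + normL1X φ χ T s V) := by
  obtain ⟨C, hC⟩ := exists_normL1X_le_sum φ χ E (E × E)
  refine ⟨C, fun T s U V P u v hU hV hP => ?_⟩
  have h := hC Bool T s P (fun b => if b then U else V) hP.aestronglyMeasurable
    (fun b => by
      cases b
      · exact hV.aestronglyMeasurable
      · exact hU.aestronglyMeasurable) (by
    filter_upwards [hP.ae_map hU (ContinuousLinearMap.fst ℂ E E) fun _ _ => rfl,
      hP.ae_map hV (ContinuousLinearMap.snd ℂ E E) fun _ _ => rfl] with t h1 h2 k x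
    have h3 : ‖φ.piece k (P t) x‖ₑ = max ‖φ.piece k (U t) x‖ₑ ‖φ.piece k (V t) x‖ₑ := by
      rw [LPCutoff.piece, LPCutoff.piece, LPCutoff.piece, h1, h2]
      rfl
    rw [h3]
    simp only [Fintype.sum_bool, if_true, Bool.false_eq_true, if_false]
    exact max_le le_self_add le_add_self)
  simpa using h

end

section

variable {d : ℕ} {m n : ℕ}

/-! ### Nonlinear estimates -/

theorem continuous_twist (b : Bool) : Continuous (twist b) := by
  cases b
  · exact Complex.continuous_conj
  · exact continuous_id

theorem exists_normL1X_twist_le (φ : LPCutoff d) (χ : CubeCutoff d) (m : ℕ) (ρ : ℝ) : ∃ C : ℝ≥0, ∀ (T : ℝ)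
    (U : ℝ → 𝓢'(Space d, EuclideanSpace ℂ (Fin m))) (u : ℝ → Space d → EuclideanSpace ℂ (Fin m))
    (q : Fin m × Bool) (B : ℝ → 𝓢'(Space d, ℂ)), IsGivenBy T U u →
      (∀ᵐ t ∂timeMeasure T, MemLp (u t) ⊤) → IsGivenBy T B (fun t x => twist q.2 (u t x q.1)) →
      normL1X φ χ T ρ B ≤ C * normL1X φ χ T ρ U := by
  obtain ⟨C₁, h₁⟩ := exists_normL1X_le_sum φ χ (EuclideanSpace ℂ (Fin m)) ℂ
  obtain ⟨C₂, h₂⟩ := exists_normL1X_conj_le φ χ ρ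
  refine ⟨C₁ + C₂ * C₁, fun T U u q B hU hu hB => ?_⟩
  have key : ∀ B' : ℝ → 𝓢'(Space d, ℂ), IsGivenBy T B' (fun t x => u t x q.1) →
      normL1X φ χ T ρ B' ≤ C₁ * normL1X φ χ T ρ U := fun B' hB' => by
    have h := h₁ Unit T ρ B' (fun _ => U) hB'.aestronglyMeasurable (fun _ => hU.aestronglyMeasurable) (by
      filter_upwards [hU.ae_map hB' (EuclideanSpace.proj q.1) fun _ _ => rfl] with t ht k x
      rw [LPCutoff.piece, ht]
      simp only [Finset.univ_unique, Finset.sum_const, Finset.card_singleton, one_smul]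
      exact enorm_le_iff_norm_le.2 (PiLp.norm_apply_le _ _))
    simpa using h
  obtain ⟨l, b⟩ := q
  cases b with
  | true =>
    refine (key B hB).trans (mul_le_mul' ?_ le_rfl)
    push_cast
    exact le_self_add
  | false =>
    have hproj : Continuous fun z : EuclideanSpace ℂ (Fin m) => z l := by fun_prop
    -- The conjugation estimate compares two distributions, so the coordinate itself must first be
    -- realized as one; boundedness makes this possible.
    have hB' : IsGivenBy T (fun t => ofBdd fun x => u t x l) (fun t x => u t x l) :=
      isGivenBy_ofBdd (hproj.comp_aestronglyMeasurable hU.measurable)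
        (hu.mono fun t ht => memLp_top_comp hproj ht)
    refine (h₂ T _ B _ hB' hB).trans ((mul_le_mul' le_rfl (key _ hB')).trans ?_)
    rw [← mul_assoc]
    refine mul_le_mul' ?_ le_rfl
    push_cast
    exact le_add_self

/-- The estimate for differences, given an estimate for products. -/
theorem exists_normL1X_difference_le (φ : LPCutoff d) (χ : CubeCutoff d) {s σ : ℝ} (hs : (d : ℝ) / 2 < s)
    (e : ℝ≥0) {F : EuclideanSpace ℂ (Fin m) → EuclideanSpace ℂ (Fin n)} (hF : ContDiff ℝ ∞ F)
    (h1 : fderiv ℝ F 0 = 0) (h2 : iteratedFDeriv ℝ 2 F 0 = 0)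
    (hprod : ∃ C : ℝ≥0, ∀ (T : ℝ) (B Q : ℝ → 𝓢'(Space d, ℂ)),
      MemL1X φ χ T s B → MemL1X φ χ T σ B → MemL1X φ χ T s Q → MemL1X φ χ T σ Q →
        ∃ W, IsProduct φ T B Q W ∧ MemL1X φ χ T σ W ∧ normL1X φ χ T σ W ≤
          C * (normL1X φ χ T σ B * normL1X φ χ T s Q + e * (normL1X φ χ T s B * normL1X φ χ T σ Q)))
    (R : ℝ≥0) : ∃ C : ℝ≥0, ∀ (T : ℝ) (U V : ℝ → 𝓢'(Space d, EuclideanSpace ℂ (Fin m)))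
      (u v : ℝ → Space d → EuclideanSpace ℂ (Fin m)), IsGivenBy T U u → IsGivenBy T V v →
      MemL1X φ χ T (max σ s) U → MemL1X φ χ T (max σ s) V → normSup T u ≤ R → normSup T v ≤ R →
      ∃ W : ℝ → 𝓢'(Space d, EuclideanSpace ℂ (Fin n)),
        IsGivenBy T W (fun t x => F (u t x) - F (v t x)) ∧ MemL1X φ χ T σ W ∧
        normL1X φ χ T σ W ≤ C * (normL1X φ χ T σ (U - V) *
            (normL1X φ χ T s U + normL1X φ χ T s V) ^ 2 +
          e * (normL1X φ χ T s (U - V) * ((normL1X φ χ T s U + normL1X φ χ T s V) *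
            (normL1X φ χ T (max σ s) U + normL1X φ χ T (max σ s) V)))) := by
  -- The parameter `e` switches between the one-sided product estimate (e = 0) and the symmetric one
  -- (e = 1).
  obtain ⟨C₀, hC₀⟩ := hprod
  obtain ⟨C₁, hC₁⟩ := exists_normL1X_pair_le φ χ (EuclideanSpace ℂ (Fin m))
  choose C₂ hC₂ using fun (i : Fin n) (q : Fin m × Bool) => exists_normL1X_comp_le φ χ hs le_rfl
    (contDiff_diffCoeff hF i q) (diffCoeff_zero h1 i q) (fderiv_diffCoeff_zero hF h1 h2 i q) R
  -- The composition estimate requires an exponent at least s, so the coefficients are bounded at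
  -- regularity max σ s and then viewed at σ.
  choose C₃ hC₃ using fun (i : Fin n) (q : Fin m × Bool) => exists_normL1X_comp_le φ χ hs
    (le_max_right σ s)
    (contDiff_diffCoeff hF i q) (diffCoeff_zero h1 i q) (fderiv_diffCoeff_zero hF h1 h2 i q) R
  obtain ⟨C₄, hC₄⟩ := exists_normL1X_twist_le φ χ m s
  obtain ⟨C₅, hC₅⟩ := exists_normL1X_twist_le φ χ m σ
  obtain ⟨C₆, hC₆⟩ := exists_normL1X_le_sum φ χ ℂ (EuclideanSpace ℂ (Fin n))
  obtain ⟨C₇, hC₇⟩ := exists_normL1X_le_sum φ χ (EuclideanSpace ℂ (Fin m)) (EuclideanSpace ℂ (Fin m))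
  set K : Fin n → Fin m × Bool → ℝ≥0 := fun i q =>
    C₀ * (C₅ * (C₂ i q * (C₁ * C₁)) + C₄ * (C₃ i q * (C₁ * C₁)))
  refine ⟨C₆ * ∑ p : Fin n × (Fin m × Bool), K p.1 p.2, fun T U V u v hu hv hUτ hVτ hRu hRv => ?_⟩
  have hU := hUτ.mono (le_max_right σ s)
  have hV := hVτ.mono (le_max_right σ s)
  have hub := hu.ae_memLp_top hU hs
  have hvb := hv.ae_memLp_top hV hs
  set p : ℝ → Space d → EuclideanSpace ℂ (Fin m) × EuclideanSpace ℂ (Fin m) := fun t x => (u t x, v t x)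
  have hpm : AEStronglyMeasurable (Function.uncurry p) ((timeMeasure T).prod volume) :=
    hu.measurable.prodMk hv.measurable
  have hpb : ∀ᵐ t ∂timeMeasure T, MemLp (p t) ⊤ := by
    filter_upwards [hub, hvb] with t h h'
    exact memLp_top_prodMk h h'
  have hP := isGivenBy_ofBdd hpm hpb
  set P := fun t => ofBdd (p t)
  have hPn : ∀ ρ, normL1X φ χ T ρ P ≤ C₁ * (normL1X φ χ T ρ U + normL1X φ χ T ρ V) := fun ρ =>
    hC₁ T ρ U V P u v hu hv hP
  have hPτ : MemL1X φ χ T (max σ s) P := ⟨hP.aestronglyMeasurable, (hPn _).trans_lt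
    (ENNReal.mul_lt_top (by simp) (ENNReal.add_lt_top.2 ⟨hUτ.norm_lt_top, hVτ.norm_lt_top⟩))⟩
  have hPs := hPτ.mono (le_max_right σ s)
  have hPR : normSup T p ≤ R := normSup_pair_le hRu hRv
  have hc : ∀ i q, Continuous (diffCoeff F i q) := fun i q => (contDiff_diffCoeff hF i q).continuous
  have hQ : ∀ i q, IsGivenBy T (fun t => ofBdd fun x => diffCoeff F i q (p t x))
      (fun t x => diffCoeff F i q (p t x)) := fun i q =>
    isGivenBy_ofBdd ((hc i q).comp_aestronglyMeasurable hpm)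
      (hpb.mono fun t ht => memLp_top_comp (hc i q) ht)
  set Q : Fin n → Fin m × Bool → ℝ → 𝓢'(Space d, ℂ) := fun i q t => ofBdd fun x => diffCoeff F i q (p t x)
  have hQs : ∀ i q, normL1X φ χ T s (Q i q) ≤ C₂ i q * (normL1X φ χ T s P * normL1X φ χ T s P) :=
    fun i q => hC₂ i q T P p (Q i q) hP hPs hPR (hQ i q)
  have hQτ : ∀ i q, normL1X φ χ T (max σ s) (Q i q) ≤
      C₃ i q * (normL1X φ χ T s P * normL1X φ χ T (max σ s) P) :=
    fun i q => hC₃ i q T P p (Q i q) hP hPs hPR (hQ i q)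
  have hQm : ∀ i q, MemL1X φ χ T (max σ s) (Q i q) := fun i q =>
    ⟨(hQ i q).aestronglyMeasurable, (hQτ i q).trans_lt (ENNReal.mul_lt_top (by simp)
      (ENNReal.mul_lt_top hPs.norm_lt_top hPτ.norm_lt_top))⟩
  have hD := hu.sub hv
  have hDb : ∀ᵐ t ∂timeMeasure T, MemLp (fun x => u t x - v t x) ⊤ := by
    filter_upwards [hub, hvb] with t h h'
    exact h.sub h'
  have hDτ : MemL1X φ χ T (max σ s) (U - V) := by
    refine ⟨hD.aestronglyMeasurable, ?_⟩
    have h := hC₇ Bool T (max σ s) (U - V) (fun b => if b then U else V) hD.aestronglyMeasurable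
      (fun b => by
        cases b
        · exact hv.aestronglyMeasurable
        · exact hu.aestronglyMeasurable) (Eventually.of_forall fun t k x => by
      simp only [Fintype.sum_bool, if_true, Bool.false_eq_true, if_false]
      exact enorm_sub_le)
    refine h.trans_lt ?_
    simp only [Fintype.sum_bool, if_true, Bool.false_eq_true, if_false]
    exact ENNReal.mul_lt_top (by simp) (ENNReal.add_lt_top.2 ⟨hUτ.norm_lt_top, hVτ.norm_lt_top⟩)
  have ht : ∀ q : Fin m × Bool, Continuous fun z : EuclideanSpace ℂ (Fin m) => twist q.2 (z q.1) :=
    fun q => (continuous_twist q.2).comp (by fun_prop)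
  have hB : ∀ q : Fin m × Bool, IsGivenBy T (fun t => ofBdd fun x => twist q.2 ((u t x - v t x) q.1))
      (fun t x => twist q.2 ((u t x - v t x) q.1)) := fun q =>
    isGivenBy_ofBdd ((ht q).comp_aestronglyMeasurable hD.measurable)
      (hDb.mono fun t h => memLp_top_comp (ht q) h)
  set B : Fin m × Bool → ℝ → 𝓢'(Space d, ℂ) := fun q t =>
    ofBdd fun x => twist q.2 ((u t x - v t x) q.1)
  have hBs : ∀ q, normL1X φ χ T s (B q) ≤ C₄ * normL1X φ χ T s (U - V) := fun q =>
    hC₄ T _ _ q (B q) hD hDb (hB q)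
  have hBσ : ∀ q, normL1X φ χ T σ (B q) ≤ C₅ * normL1X φ χ T σ (U - V) := fun q =>
    hC₅ T _ _ q (B q) hD hDb (hB q)
  have hBsm : ∀ q, MemL1X φ χ T s (B q) := fun q => ⟨(hB q).aestronglyMeasurable,
    (hBs q).trans_lt (ENNReal.mul_lt_top (by simp) (hDτ.mono (le_max_right σ s)).norm_lt_top)⟩
  have hBσm : ∀ q, MemL1X φ χ T σ (B q) := fun q => ⟨(hB q).aestronglyMeasurable,
    (hBσ q).trans_lt (ENNReal.mul_lt_top (by simp) (hDτ.mono (le_max_left σ s)).norm_lt_top)⟩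
  -- The products are first distributions; both factors are in L² at almost every time because s >
  -- d/2, which identifies the products with pointwise ones.
  choose W hW hWm hWn using fun i q => hC₀ T (B q) (Q i q) (hBsm q) (hBσm q)
    ((hQm i q).mono (le_max_right σ s)) ((hQm i q).mono (le_max_left σ s))
  have hWg : ∀ i q, IsGivenBy T (W i q)
      (fun t x => twist q.2 ((u t x - v t x) q.1) * diffCoeff F i q (p t x)) := fun i q =>
    (hW i q).pointwise _ _ (hB q) (hQ i q) ((hB q).ae_memLp_two (hBsm q) hs)
      ((hQ i q).ae_memLp_two ((hQm i q).mono (le_max_right σ s)) hs)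
  have hZ : IsGivenBy T (fun t => ofBdd fun x => F (u t x) - F (v t x))
      (fun t x => F (u t x) - F (v t x)) :=
    isGivenBy_ofBdd ((hF.continuous.comp_aestronglyMeasurable hu.measurable).sub
      (hF.continuous.comp_aestronglyMeasurable hv.measurable)) (by
      filter_upwards [hub, hvb] with t h h'
      exact (memLp_top_comp hF.continuous h).sub (memLp_top_comp hF.continuous h'))
  set Z : ℝ → 𝓢'(Space d, EuclideanSpace ℂ (Fin n)) := fun t => ofBdd fun x => F (u t x) - F (v t x)
  have hZn := hC₆ (Fin n × (Fin m × Bool)) T σ Z (fun a => W a.1 a.2) hZ.aestronglyMeasurable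
    (fun a => (hWg a.1 a.2).aestronglyMeasurable) (by
      have hWall : ∀ᵐ t ∂timeMeasure T, ∀ a : Fin n × (Fin m × Bool), ∀ θ : 𝓢(Space d, ℂ),
          Integrable (fun x => θ x • (twist a.2.2 ((u t x - v t x) a.2.1) *
            diffCoeff F a.1 a.2 (p t x))) ∧ W a.1 a.2 t θ = ∫ x, θ x •
              (twist a.2.2 ((u t x - v t x) a.2.1) * diffCoeff F a.1 a.2 (p t x)) :=
        ae_all_iff.2 fun a => (hWg a.1 a.2).eq_integral
      filter_upwards [hWall, hZ.eq_integral] with t h3 h4 k x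
      -- The factorization of F(u) - F(v), tested against the kernel of S_k in each coordinate.
      have h5 : ∀ i, φ.piece k (Z t) x i = ∑ q, φ.piece k (W i q t) x := fun i => by
        rw [LPCutoff.piece, (h4 _).2]
        have h6 := (EuclideanSpace.proj (𝕜 := ℂ) i).integral_comp_comm (h4 (φ.kernelAt k x)).1
        refine h6.symm.trans ?_
        simp only [LPCutoff.piece, fun q => (h3 (i, q) (φ.kernelAt k x)).2]
        rw [← integral_finsetSum _ fun q _ => (h3 (i, q) (φ.kernelAt k x)).1]
        refine integral_congr_ae (Eventually.of_forall fun y => ?_)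
        have h8 : (EuclideanSpace.proj (𝕜 := ℂ) i) (F (u t y) - F (v t y)) = _ :=
          sub_apply_eq_sum_diffCoeff hF (u t y) (v t y) i
        simp only [map_smul, h8, Finset.smul_sum, p]
      have h6 : φ.piece k (Z t) x = ∑ i, EuclideanSpace.single i (φ.piece k (Z t) x i) := by
        ext l
        simp [WithLp.ofLp_sum, Finset.sum_apply, Pi.single_apply]
      rw [h6, Fintype.sum_prod_type]
      refine (enorm_sum_le _ _).trans (Finset.sum_le_sum fun i _ => ?_)
      have h7 : ‖EuclideanSpace.single i (φ.piece k (Z t) x i)‖ₑ = ‖φ.piece k (Z t) x i‖ₑ := by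
        rw [← ofReal_norm, PiLp.norm_single, ofReal_norm]
      rw [h7, h5]
      exact enorm_sum_le _ _)
  set D := normL1X φ χ T σ (U - V) * (normL1X φ χ T s U + normL1X φ χ T s V) ^ 2 +
          e * (normL1X φ χ T s (U - V) * ((normL1X φ χ T s U + normL1X φ χ T s V) *
            (normL1X φ χ T (max σ s) U + normL1X φ χ T (max σ s) V)))
  have hWD : ∀ a : Fin n × (Fin m × Bool), normL1X φ χ T σ (W a.1 a.2) ≤ K a.1 a.2 * D := by
    intro ⟨i, q⟩
    have h3 : normL1X φ χ T s (Q i q) ≤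
        (C₂ i q * (C₁ * C₁) : ℝ≥0) * (normL1X φ χ T s U + normL1X φ χ T s V) ^ 2 := by
      refine (hQs i q).trans ((mul_le_mul' le_rfl (mul_le_mul' (hPn s) (hPn s))).trans (le_of_eq ?_))
      push_cast
      ring
    have h4 : normL1X φ χ T σ (Q i q) ≤
        (C₃ i q * (C₁ * C₁) : ℝ≥0) * ((normL1X φ χ T s U + normL1X φ χ T s V) *
          (normL1X φ χ T (max σ s) U + normL1X φ χ T (max σ s) V)) := by
      refine (normL1X_mono φ χ T (le_max_left σ s) _).trans ((hQτ i q).trans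
        ((mul_le_mul' le_rfl (mul_le_mul' (hPn s) (hPn _))).trans (le_of_eq ?_)))
      push_cast
      ring
    have h5 := mul_le_mul' (hBσ q) h3
    have h6 := mul_le_mul' (hBs q) h4
    refine (hWn i q).trans ?_
    have h7 : ∀ a b c x y : ℝ≥0∞, c * (a * x + b * y) ≤ c * (a + b) * (x + y) := fun a b c x y => by
      rw [mul_assoc]
      refine mul_le_mul' le_rfl ?_
      rw [add_mul]
      exact add_le_add (mul_le_mul' le_rfl le_self_add) (mul_le_mul' le_rfl le_add_self)
    refine (mul_le_mul' le_rfl (add_le_add h5 (mul_le_mul' le_rfl h6))).trans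
      (le_trans (le_of_eq ?_) ((h7 ((C₅ * (C₂ i q * (C₁ * C₁)) : ℝ≥0) : ℝ≥0∞)
        ((C₄ * (C₃ i q * (C₁ * C₁)) : ℝ≥0) : ℝ≥0∞) C₀
        (normL1X φ χ T σ (U - V) * (normL1X φ χ T s U + normL1X φ χ T s V) ^ 2)
        (e * (normL1X φ χ T s (U - V) * ((normL1X φ χ T s U + normL1X φ χ T s V) *
          (normL1X φ χ T (max σ s) U + normL1X φ χ T (max σ s) V))))).trans (le_of_eq ?_)))
    · push_cast
      ring
    · simp only [K]
      push_cast
      rfl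
  have hZD : normL1X φ χ T σ Z ≤ C₆ * ((∑ a : Fin n × (Fin m × Bool), (K a.1 a.2 : ℝ≥0∞)) * D) := by
    refine hZn.trans (mul_le_mul' le_rfl ?_)
    rw [Finset.sum_mul]
    exact Finset.sum_le_sum fun a _ => hWD a
  refine ⟨Z, hZ, ⟨hZ.aestronglyMeasurable, ?_⟩, ?_⟩
  · refine hZn.trans_lt (ENNReal.mul_lt_top (by simp) (ENNReal.sum_lt_top.2 fun a _ => (hWm a.1 a.2).norm_lt_top))
  · refine hZD.trans (le_of_eq ?_)
    push_cast
    rw [mul_assoc]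

end

section

variable {d : ℕ} {m n : ℕ}

/-- A family of estimates, one for each bound, is an estimate with a monotone constant. -/
theorem exists_monotone_le (C : ℕ → ℝ≥0) : ∃ c : ℝ≥0 → ℝ≥0, Monotone c ∧ ∀ r, C ⌈r⌉₊ ≤ c r := by
  refine ⟨fun r => ∑ k ∈ Finset.range (⌈r⌉₊ + 1), C k, fun r r' h => ?_, fun r => ?_⟩
  · exact Finset.sum_le_sum_of_subset
      (Finset.range_mono (Nat.add_le_add_right (Nat.ceil_mono h) 1))
  · exact Finset.single_le_sum (f := C) (fun _ _ => zero_le) (Finset.self_mem_range_succ _)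

theorem le_ceil_toNNReal {a : ℝ≥0∞} (ha : a ≠ ⊤) {r : ℝ≥0} (h : a.toNNReal ≤ r) :
    a ≤ ((⌈r⌉₊ : ℝ≥0) : ℝ≥0∞) := by
  rw [← ENNReal.coe_toNNReal ha]
  exact ENNReal.coe_le_coe.2 (h.trans (Nat.le_ceil r))

theorem difference_estimate_of_normSup_le (φ : LPCutoff d) (χ : CubeCutoff d) {s σ : ℝ}
    (hs : (d : ℝ) / 2 < s) (hσ : (d : ℝ) - s ≤ σ) (hσs : σ ≤ s)
    {F : EuclideanSpace ℂ (Fin m) → EuclideanSpace ℂ (Fin n)} (hF : ContDiff ℝ ∞ F)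
    (h1 : fderiv ℝ F 0 = 0) (h2 : iteratedFDeriv ℝ 2 F 0 = 0) (R : ℝ≥0) :
    ∃ C : ℝ≥0, ∀ (T : ℝ) (U V : ℝ → 𝓢'(Space d, EuclideanSpace ℂ (Fin m)))
      (u v : ℝ → Space d → EuclideanSpace ℂ (Fin m)), IsGivenBy T U u → IsGivenBy T V v →
      MemL1X φ χ T s U → MemL1X φ χ T s V → normSup T u ≤ R → normSup T v ≤ R →
      ∃ W : ℝ → 𝓢'(Space d, EuclideanSpace ℂ (Fin n)),
        IsGivenBy T W (fun t x => F (u t x) - F (v t x)) ∧ MemL1X φ χ T σ W ∧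
        normL1X φ χ T σ W ≤ C * (normL1X φ χ T σ (U - V) *
            (normL1X φ χ T s U + normL1X φ χ T s V) ^ 2) := by
  obtain ⟨C, hC⟩ := one_sided_bilinear_estimate φ χ hs hσ hσs
  have h := exists_normL1X_difference_le φ χ hs 0 hF h1 h2 (σ := σ)
    ⟨C, fun T B Q _ hB hQ _ => by simpa using hC T B Q hB hQ⟩ R
  simpa [max_eq_right hσs] using h

/-- The difference estimate with v = 0, using F(0) = 0. For σ ≤ s the one-sided product estimate is
available; for σ ≥ s the symmetric one is used. -/
theorem nonlinear_estimate_of_normSup_le (φ : LPCutoff d) (χ : CubeCutoff d) {s σ : ℝ}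
    (hs : (d : ℝ) / 2 < s) (hσ : (d : ℝ) - s ≤ σ)
    {F : EuclideanSpace ℂ (Fin m) → EuclideanSpace ℂ (Fin n)} (hF : ContDiff ℝ ∞ F) (h0 : F 0 = 0)
    (h1 : fderiv ℝ F 0 = 0) (h2 : iteratedFDeriv ℝ 2 F 0 = 0) (R : ℝ≥0) :
    ∃ C : ℝ≥0, ∀ (T : ℝ) (U : ℝ → 𝓢'(Space d, EuclideanSpace ℂ (Fin m)))
      (u : ℝ → Space d → EuclideanSpace ℂ (Fin m)), IsGivenBy T U u →
      MemL1X φ χ T s U → MemL1X φ χ T σ U → normSup T u ≤ R →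
      ∃ W : ℝ → 𝓢'(Space d, EuclideanSpace ℂ (Fin n)),
        IsGivenBy T W (fun t x => F (u t x)) ∧ MemL1X φ χ T σ W ∧
        normL1X φ χ T σ W ≤ C * (normL1X φ χ T σ U * normL1X φ χ T s U ^ 2) := by
  have hz : ∀ T, normSup T (fun (_ : ℝ) (_ : Space d) => (0 : EuclideanSpace ℂ (Fin m))) ≤ R :=
    fun T => (eLpNorm_zero' (ε := EuclideanSpace ℂ (Fin m))).le.trans zero_le
  rcases le_total σ s with hσs | hσs
  · obtain ⟨C, hC⟩ := difference_estimate_of_normSup_le φ χ hs hσ hσs hF h1 h2 R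
    refine ⟨C, fun T U u hu hU _ hR => ?_⟩
    obtain ⟨W, hW, hm, h⟩ := hC T U 0 u (fun _ _ => 0) hu IsGivenBy.zero hU MemL1X.zero hR (hz T)
    refine ⟨W, by simpa only [h0, sub_zero] using hW, hm, ?_⟩
    simpa only [sub_zero, normL1X_zero, add_zero] using h
  · obtain ⟨C₀, hC₀⟩ := bilinear_estimate φ χ hs hσ
    obtain ⟨C, hC⟩ := exists_normL1X_difference_le φ χ hs 1 hF h1 h2 (σ := σ)
      ⟨C₀, fun T B Q h1 h2 h3 h4 => by simpa using hC₀ T B Q h1 h2 h3 h4⟩ R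
    -- Now max σ s = σ, so with v = 0 the two terms of the estimate coincide.
    refine ⟨C * 2, fun T U u hu _ hU hR => ?_⟩
    rw [max_eq_left hσs] at hC
    obtain ⟨W, hW, hm, h⟩ := hC T U 0 u (fun _ _ => 0) hu IsGivenBy.zero hU MemL1X.zero hR (hz T)
    refine ⟨W, by simpa only [h0, sub_zero] using hW, hm, ?_⟩
    simp only [sub_zero, normL1X_zero, add_zero] at h
    refine h.trans (le_of_eq ?_)
    push_cast
    ring

theorem nonlinear_estimate (φ : LPCutoff d) (χ : CubeCutoff d) {s σ : ℝ}
    (hs : (d : ℝ) / 2 < s) (hσ : (d : ℝ) - s ≤ σ)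
    {F : EuclideanSpace ℂ (Fin m) → EuclideanSpace ℂ (Fin n)} (hF : ContDiff ℝ ∞ F) (h0 : F 0 = 0)
    (h1 : fderiv ℝ F 0 = 0) (h2 : iteratedFDeriv ℝ 2 F 0 = 0) :
    ∃ c : ℝ≥0 → ℝ≥0, Monotone c ∧ ∀ (T : ℝ) (U : ℝ → 𝓢'(Space d, EuclideanSpace ℂ (Fin m)))
      (u : ℝ → Space d → EuclideanSpace ℂ (Fin m)), IsGivenBy T U u →
      MemL1X φ χ T s U → MemL1X φ χ T σ U →
      ∃ W : ℝ → 𝓢'(Space d, EuclideanSpace ℂ (Fin n)),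
        IsGivenBy T W (fun t x => F (u t x)) ∧ MemL1X φ χ T σ W ∧
        normL1X φ χ T σ W ≤ normL1X φ χ T σ U * normL1X φ χ T s U ^ 2 *
          c (normSup T u).toNNReal := by
  -- Integer bounds on the supremum norm suffice; partial sums of their constants form a
  -- nondecreasing function.
  choose C hC using fun k : ℕ => nonlinear_estimate_of_normSup_le φ χ hs hσ hF h0 h1 h2 (k : ℝ≥0)
  obtain ⟨c, hc, hCc⟩ := exists_monotone_le C
  refine ⟨c, hc, fun T U u hu hU hU' => ?_⟩
  obtain ⟨W, hW, hm, h⟩ := hC _ T U u hu hU hU'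
    (le_ceil_toNNReal (hu.normSup_ne_top hU hs) (le_refl (normSup T u).toNNReal))
  refine ⟨W, hW, hm, h.trans ?_⟩
  rw [mul_comm]
  exact mul_le_mul' le_rfl (ENNReal.coe_le_coe.2 (hCc _))

theorem difference_estimate (φ : LPCutoff d) (χ : CubeCutoff d) {s σ : ℝ}
    (hs : (d : ℝ) / 2 < s) (hσ : (d : ℝ) - s ≤ σ) (hσs : σ ≤ s)
    {F : EuclideanSpace ℂ (Fin m) → EuclideanSpace ℂ (Fin n)} (hF : ContDiff ℝ ∞ F)
    (h1 : fderiv ℝ F 0 = 0) (h2 : iteratedFDeriv ℝ 2 F 0 = 0) :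
    ∃ c : ℝ≥0 × ℝ≥0 → ℝ≥0, Monotone c ∧
      ∀ (T : ℝ) (U V : ℝ → 𝓢'(Space d, EuclideanSpace ℂ (Fin m)))
      (u v : ℝ → Space d → EuclideanSpace ℂ (Fin m)), IsGivenBy T U u → IsGivenBy T V v →
      MemL1X φ χ T s U → MemL1X φ χ T s V →
      ∃ W : ℝ → 𝓢'(Space d, EuclideanSpace ℂ (Fin n)),
        IsGivenBy T W (fun t x => F (u t x) - F (v t x)) ∧ MemL1X φ χ T σ W ∧
        normL1X φ χ T σ W ≤ normL1X φ χ T σ (U - V) *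
          (normL1X φ χ T s U + normL1X φ χ T s V) ^ 2 *
            c ((normSup T u).toNNReal, (normSup T v).toNNReal) := by
  choose C hC using fun k : ℕ =>
    difference_estimate_of_normSup_le φ χ hs hσ hσs hF h1 h2 (k : ℝ≥0)
  obtain ⟨c, hc, hCc⟩ := exists_monotone_le C
  -- One bound serves both functions, namely the larger of the two supremum norms.
  refine ⟨fun r => c (max r.1 r.2), fun r r' h => hc (max_le_max h.1 h.2),
    fun T U V u v hu hv hU hV => ?_⟩
  obtain ⟨W, hW, hm, h⟩ := hC _ T U V u v hu hv hU hV
    (le_ceil_toNNReal (hu.normSup_ne_top hU hs) (le_max_left _ (normSup T v).toNNReal))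
    (le_ceil_toNNReal (hv.normSup_ne_top hV hs) (le_max_right _ _))
  refine ⟨W, hW, hm, h.trans ?_⟩
  rw [mul_comm]
  exact mul_le_mul' le_rfl (ENNReal.coe_le_coe.2 (hCc _))

end

end L1X

end

/-! ### The proposition -/

theorem propositionp (d : ℕ) (hd : 0 < d) (φ : L1X.LPCutoff d) (χ : L1X.CubeCutoff d)
    (s : ℝ) (hs : (d : ℝ) / 2 < s) :
    -- the bilinear estimate for `d - s ≤ σ`
    (∀ σ : ℝ, (d : ℝ) - s ≤ σ → ∃ C : ℝ≥0, ∀ T : ℝ, 0 < T →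
      ∀ U V : ℝ → 𝓢'(L1X.Space d, ℂ),
        L1X.MemL1X φ χ T s U → L1X.MemL1X φ χ T σ U →
        L1X.MemL1X φ χ T s V → L1X.MemL1X φ χ T σ V →
        ∃ W : ℝ → 𝓢'(L1X.Space d, ℂ), L1X.IsProduct φ T U V W ∧ L1X.MemL1X φ χ T σ W ∧
          L1X.normL1X φ χ T σ W ≤
            C * (L1X.normL1X φ χ T σ U * L1X.normL1X φ χ T s V +
              L1X.normL1X φ χ T s U * L1X.normL1X φ χ T σ V)) ∧
    -- the one-sided bilinear estimate for `d - s ≤ σ ≤ s`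
    (∀ σ : ℝ, (d : ℝ) - s ≤ σ → σ ≤ s → ∃ C : ℝ≥0, ∀ T : ℝ, 0 < T →
      ∀ U V : ℝ → 𝓢'(L1X.Space d, ℂ),
        L1X.MemL1X φ χ T σ U → L1X.MemL1X φ χ T s V →
        ∃ W : ℝ → 𝓢'(L1X.Space d, ℂ), L1X.IsProduct φ T U V W ∧ L1X.MemL1X φ χ T σ W ∧
          L1X.normL1X φ χ T σ W ≤ C * (L1X.normL1X φ χ T σ U * L1X.normL1X φ χ T s V)) ∧
    -- the nonlinear estimates
    (∀ (m n : ℕ) (F : EuclideanSpace ℂ (Fin m) → EuclideanSpace ℂ (Fin n)),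
      ContDiff ℝ ∞ F → F 0 = 0 → fderiv ℝ F 0 = 0 → iteratedFDeriv ℝ 2 F 0 = 0 →
      -- the Moser estimate for `d - s ≤ σ`
      (∀ σ : ℝ, (d : ℝ) - s ≤ σ → ∃ c : ℝ≥0 → ℝ≥0, Monotone c ∧ ∀ T : ℝ, 0 < T →
        ∀ (U : ℝ → 𝓢'(L1X.Space d, EuclideanSpace ℂ (Fin m)))
          (u : ℝ → L1X.Space d → EuclideanSpace ℂ (Fin m)),
          L1X.IsGivenBy T U u → L1X.MemL1X φ χ T s U → L1X.MemL1X φ χ T σ U →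
          ∃ W : ℝ → 𝓢'(L1X.Space d, EuclideanSpace ℂ (Fin n)),
            L1X.IsGivenBy T W (fun t x => F (u t x)) ∧ L1X.MemL1X φ χ T σ W ∧
            L1X.normL1X φ χ T σ W ≤
              L1X.normL1X φ χ T σ U * L1X.normL1X φ χ T s U ^ 2 *
                c (L1X.normSup T u).toNNReal) ∧
      -- the difference estimate for `d - s ≤ σ ≤ s`
      (∀ σ : ℝ, (d : ℝ) - s ≤ σ → σ ≤ s →
        ∃ c : ℝ≥0 × ℝ≥0 → ℝ≥0, Monotone c ∧ ∀ T : ℝ, 0 < T →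
        ∀ (U V : ℝ → 𝓢'(L1X.Space d, EuclideanSpace ℂ (Fin m)))
          (u v : ℝ → L1X.Space d → EuclideanSpace ℂ (Fin m)),
          L1X.IsGivenBy T U u → L1X.IsGivenBy T V v →
          L1X.MemL1X φ χ T s U → L1X.MemL1X φ χ T s V →
          ∃ W : ℝ → 𝓢'(L1X.Space d, EuclideanSpace ℂ (Fin n)),
            L1X.IsGivenBy T W (fun t x => F (u t x) - F (v t x)) ∧ L1X.MemL1X φ χ T σ W ∧
            L1X.normL1X φ χ T σ W ≤
              L1X.normL1X φ χ T σ (U - V) *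
                (L1X.normL1X φ χ T s U + L1X.normL1X φ χ T s V) ^ 2 *
                c ((L1X.normSup T u).toNNReal, (L1X.normSup T v).toNNReal))) := by
  refine ⟨fun σ hσ => ?_, fun σ hσ hσs => ?_, fun m n F hF h0 h1 h2 =>
    ⟨fun σ hσ => ?_, fun σ hσ hσs => ?_⟩⟩
  · obtain ⟨C, hC⟩ := L1X.bilinear_estimate φ χ hs hσ
    exact ⟨C, fun T _ => hC T⟩
  · obtain ⟨C, hC⟩ := L1X.one_sided_bilinear_estimate φ χ hs hσ hσs
    exact ⟨C, fun T _ => hC T⟩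
  · obtain ⟨c, hc, h⟩ := L1X.nonlinear_estimate φ χ hs hσ hF h0 h1 h2
    exact ⟨c, hc, fun T _ => h T⟩
  · obtain ⟨c, hc, h⟩ := L1X.difference_estimate φ χ hs hσ hσs hF h1 h2
    exact ⟨c, hc, fun T _ => h T⟩
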